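/- Let $A,B\in\mathbb Z_{>0}$ with $A\neq B$ and write $\mathbf e(z)=e^{2\pi i z}$. **The surface.** $\Sigma$ is the Riemann surface of points $(z,m)$, $z\in\mathbb C\setminus(\mathbb Z-i\mathbb R_{\ge 0})$, $m\in\mathbb Z$, with the identifications $(k+0+iy,m)\sim(k-0+iy,m+B)$ for $y<0$, $k\in\mathbb Z$, and $(z,m+A)\sim(z+1,m)$. The coordinates $(z,m)$ are called $(z_+,m_+)$. The coordinates $z_-=z_+$, $m_-=m_++B\lfloor\mathrm{Re}\,z_+\rfloor$ extend over the lower half plane without cuts, and there $(z_-,m_-+A-B)\sim(z_-+1,m_-)$. So $\{\mathrm{Im}\,z>0\}$ consists of the half planes $m_+=0,\dots,A-1$, and $\{\mathrm{Im}\,z<0\}$ of the half planes $m_-=0,\dots,|A-B|-1$. With the principal branch of $\mathrm{Li}_2$ let $$V:\Sigma\to\mathbb C/\mathbb Z,\qquad V(z,m)=B\,\frac{\mathrm{Li}_2(\mathbf e(z))}{(2\pi i)^2}+\frac B{24}+\frac A2 z(z+1)+mz .$$ **Stokes rays and thimble.** Let $p_0\in\Sigma$ be a critical point of $V$ and $V_0\in\mathbb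 C$ a lift of $V(p_0)$. Let $\mathcal V\subset\mathbb C$ be the union of $\mathbb Z$ and of all lifts of critical values of $V$, and let $\mathcal S(V_0)=\bigcup_{v\in\mathcal V,\,v\ne V_0}\mathbb R_{\ge0}\frac{2\pi i}{v-V_0}$ be the union of the Stokes rays in the $\tau$-plane. Let $\vartheta\in(\frac\pi2,\frac{3\pi}2)$ be such that the direction $\tau=-e^{-i\vartheta}$ (that is, $\arg(-1/\tau)=\vartheta$) is not in $\mathcal S(V_0)$; equivalently, $V_0-ie^{i\vartheta}\mathbb R_{>0}$ contains no point of $\mathcal V$. The thimble $\mathcal C_{p_0,\vartheta}$ is the connected component of $p_0$ in $\{p\in\Sigma: V(p)\in V_0-ie^{i\vartheta}\mathbb R_{\ge0}+\mathbb Z\}$. **Relative homology.** For $\theta\in(0,2\pi)$ and $L\in\mathbb R$ let $D_{L,\theta}=D^+_{L,\theta}\cup D^-_{L,\theta}$, where $D^+_{L,\theta}$ is the set of points on the sheets $m_+\in\{0,\dots,A-1\}$ with $\max\{0,\frac\theta2-\frac\pi2\}<\arg z_+<\min\{\pi,\frac\theta2\}$ and $-\mathrm{Im}(\frac A2z_+^2e^{-i\theta})>L$,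 and $D^-_{L,\theta}$ is the set of points on the sheets $m_-\in\{0,\dots,|A-B|-1\}$ with $\max\{\pi,\frac\theta2+\frac{3\pi}4-\frac{(A-B)\pi}{4|A-B|}\}<\arg z_-<\min\{2\pi,\frac\theta2+\frac{5\pi}4-\frac{(A-B)\pi}{4|A-B|}\}$ and $-\mathrm{Im}(\frac{A-B}2z_-^2e^{-i\theta})>L$. Put $H_1(\Sigma,D_{\infty,\theta})=H_1\big(\varprojlim_L C_\bullet(\Sigma,D_{L,\theta})\big)$, where $C_\bullet(\Sigma,D)$ are the relative singular chains. A curve $\gamma:\mathbb R\to\Sigma$ both of whose ends eventually lie in every $D_{L,\theta}$ has a class $[\gamma]\in H_1(\Sigma,D_{\infty,\theta})$, that of the chain $\sum_{k\in\mathbb Z}\gamma|_{[k,k+1]}$. **State integral contours.** For $\tau\in\mathbb C\setminus\mathbb R_{\le0}$ with $\arg(-1/\tau)=\theta\in(0,2\pi)$, $\ell\in\mathbb Z$, $m\in\{0,\dots,A-1\}$ and small $\epsilon>0$ (it suffices that $A\epsilon$ and $|A-B|\epsilon$ are less than $\min\{\frac\theta2,\pi-\frac\theta2\}$), let $\tilde{\mathcal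 J}_{\ell,m,\tau}$ be the lift through $(z_+,m_+)=(\ell-\frac12,m)$ of $$\mathcal J_{\ell,\tau}=\big(\tfrac i{\sqrt\tau}e^{-iA\epsilon}\mathbb R_{\ge0}-\tfrac12+\ell\big)\cup\big(\tfrac i{\sqrt\tau}e^{-i(A-B)\epsilon}\mathbb R_{\le0}-\tfrac12+\ell\big).$$ **Mixed contours.** The tail at a point $p$ with $\mathrm{Im}\,z(p)\ne0$ is the straight ray from $p$ in the direction $e^{i\theta/2-iA\epsilon}$ if $\mathrm{Im}\,z(p)>0$ and $-e^{i\theta/2-i(A-B)\epsilon}$ if $\mathrm{Im}\,z(p)<0$. If $V(p)\in V_0-ie^{i\vartheta}\lambda+\mathbb Z$ with $\lambda>0$, then $\gamma_{p,\theta}$ is the union of the tail at $p$ and of the connected component of $p$ in $\{r\in\Sigma:V(r)\in V_0-ie^{i\vartheta}\mathbb R_{\ge\lambda}+\mathbb Z\}$. If $e\subset\Sigma$ is a segment (arc) with $V(e)\subset V_0-ie^{i\vartheta}\mathbb R_{>0}+\mathbb Z$ whose end points have $\mathrm{Im}\,z\ne0$, then $\gamma_{e,\theta}$ is the union of $e$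 and of the tails at its two end points. **Claim.** 1. $\mathcal C_{p_0,\vartheta}$ can be parametrised by $\mathbb R$ (continuously and bijectively), and for each such parametrisation there are integers $c_{\ell,m}$, only finitely many of them non-zero, such that for all $\theta\in(\vartheta-\frac\pi2,\vartheta+\frac\pi2)$, all $\tau$ with $\arg(-1/\tau)=\theta$ and all small $\epsilon$ as above, the curves $\mathcal C_{p_0,\vartheta}$ and $\tilde{\mathcal J}_{\ell,m,\tau}$ represent classes in $H_1(\Sigma,D_{\infty,\theta})$ and $$[\mathcal C_{p_0,\vartheta}]=\sum_{\ell\in\mathbb Z}\sum_{m=0}^{A-1}c_{\ell,m}\,[\tilde{\mathcal J}_{\ell,m,\tau}].$$ 2. For all $\theta\in(\vartheta-\frac\pi2,\vartheta+\frac\pi2)$, all $\tau$ with $\arg(-1/\tau)=\theta$ and all small $\epsilon$ as above, every contour $\gamma_{p,\theta}$ and every contour $\gamma_{e,\theta}$ as above can be parametrised as a curve $\mathbb R\to\Sigma$ (running in along a tail, and then along the level curve, respectively along $e$ and out along the second tail), every such curve represents a class in $H_1(\Sigma,D_{\infty,\theta})$, and this class is a finite integer combination of the classes $[\tilde{\mathcal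 J}_{\ell,m,\tau}]$, $\ell\in\mathbb Z$, $0\le m<A$. -/

import Mathlib

noncomputable section

namespace StateIntegral

open Complex MeasureTheory Set

/-! ### The dilogarithm -/

/-- The principal branch `Li₂(x) = -∫₀¹ log(1 - t x) / t dt` of the dilogarithm,
for `x ∈ ℂ ∖ [1, ∞)`. -/
def dilog (x : ℂ) : ℂ := -∫ t in (0 : ℝ)..1, Complex.log (1 - t * x) / t

/-- `e(z) = exp(2πiz)`. -/
def ex (z : ℂ) : ℂ := Complex.exp (2 * Real.pi * I * z)

theorem one_sub_mul_mem {x : ℂ} (hx : 1 - x ∈ slitPlane) {t : ℝ} (h0 : 0 ≤ t) (h1 : t ≤ 1) :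
    1 - t * x ∈ slitPlane := by
  have := (Complex.starConvex_one_slitPlane) hx (sub_nonneg.2 h1) h0 (by ring)
  convert this using 1
  simp [Complex.real_smul]; ring

theorem hasDerivAt_log_one_sub_mul {x : ℂ} (hx : 1 - x ∈ slitPlane) {t : ℝ} (h0 : 0 ≤ t)
    (h1 : t ≤ 1) : HasDerivAt (fun s : ℝ => Complex.log (1 - s * x)) (-x / (1 - t * x)) t := by
  have h : HasDerivAt (fun s : ℂ => 1 - s * x) (-x) (t : ℂ) := by
    simpa using ((hasDerivAt_id (t : ℂ)).mul_const x).const_sub 1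
  exact (h.clog (one_sub_mul_mem hx h0 h1)).comp_ofReal

theorem dilog_integrand_integrable {x : ℂ} (hx : 1 - x ∈ slitPlane) :
    IntervalIntegrable (fun t : ℝ => Complex.log (1 - t * x) / t) volume 0 1 := by
  have hc : ContinuousOn (dslope (fun s : ℝ => Complex.log (1 - s * x)) 0) (Icc 0 1) := by
    intro t ht
    have hd := hasDerivAt_log_one_sub_mul hx ht.1 ht.2
    rcases eq_or_ne t 0 with rfl | hne
    · exact (continuousAt_dslope_same.2 hd.differentiableAt).continuousWithinAt
    · exact ((continuousAt_dslope_of_ne hne).2 hd.continuousAt).continuousWithinAt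
  have hi : IntervalIntegrable (dslope (fun s : ℝ => Complex.log (1 - s * x)) 0) volume 0 1 :=
    ContinuousOn.intervalIntegrable (by simpa [uIcc_of_le] using hc)
  refine hi.congr ?_
  intro t ht
  rw [uIoc_of_le zero_le_one] at ht
  simp only
  rw [dslope_of_ne _ ht.1.ne', slope_def_module]
  simp [Complex.real_smul, div_eq_inv_mul]

theorem hasDerivAt_dilog {x : ℂ} (hx : 1 - x ∈ slitPlane) (hx0 : x ≠ 0) :
    HasDerivAt dilog (-Complex.log (1 - x) / x) x := by
  have hopen : IsOpen {y : ℂ | 1 - y ∈ slitPlane} :=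
    isOpen_slitPlane.preimage (by fun_prop)
  obtain ⟨r, hr, hball⟩ := Metric.nhds_basis_closedBall.mem_iff.1 (hopen.mem_nhds hx)
  have hK : IsCompact (Icc (0 : ℝ) 1 ×ˢ Metric.closedBall x r) :=
    isCompact_Icc.prod (isCompact_closedBall x r)
  have hcont : ContinuousOn (fun q : ℝ × ℂ => (1 - q.1 * q.2)⁻¹)
      (Icc (0 : ℝ) 1 ×ˢ Metric.closedBall x r) := by
    apply ContinuousOn.inv₀ (by fun_prop)
    rintro ⟨t, y⟩ ⟨ht, hy⟩
    exact slitPlane_ne_zero (one_sub_mul_mem (hball hy) ht.1 ht.2)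
  obtain ⟨C, hC⟩ := hK.exists_bound_of_continuousOn hcont
  have key := intervalIntegral.hasDerivAt_integral_of_dominated_loc_of_deriv_le
    (𝕜 := ℂ) (μ := volume) (a := 0) (b := 1)
    (F := fun (y : ℂ) (t : ℝ) => Complex.log (1 - t * y) / t)
    (F' := fun (y : ℂ) (t : ℝ) => -(1 - t * y)⁻¹) (x₀ := x) (bound := fun _ => C)
    (Metric.closedBall_mem_nhds x hr)
    (by
      filter_upwards [hopen.mem_nhds hx] with y hy
      have := (dilog_integrand_integrable hy).aestronglyMeasurable
      rwa [uIoc_of_le zero_le_one])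
    (dilog_integrand_integrable hx)
    (by
      rw [uIoc_of_le zero_le_one]
      refine (ContinuousOn.aestronglyMeasurable (s := Ioc (0:ℝ) 1) ?_ measurableSet_Ioc)
      refine ContinuousOn.neg (ContinuousOn.inv₀ (by fun_prop) ?_)
      intro t ht
      exact slitPlane_ne_zero (one_sub_mul_mem hx ht.1.le ht.2))
    (by
      refine Filter.Eventually.of_forall fun t ht y hy => ?_
      rw [uIoc_of_le zero_le_one] at ht
      rw [norm_neg]
      exact hC (t, y) ⟨⟨ht.1.le, ht.2⟩, hy⟩)
    (by simp)
    (by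
      refine Filter.Eventually.of_forall fun t ht y hy => ?_
      rw [uIoc_of_le zero_le_one] at ht
      have h : HasDerivAt (fun s : ℂ => 1 - t * s) (-t) y := by
        simpa using ((hasDerivAt_id y).const_mul (t : ℂ)).const_sub 1
      have hm := one_sub_mul_mem (hball hy) ht.1.le ht.2
      have h2 := (h.clog hm).div_const (t : ℂ)
      have ht0 : (t : ℂ) ≠ 0 := by exact_mod_cast ht.1.ne'
      have hm0 := slitPlane_ne_zero hm
      exact h2.congr_deriv (by field_simp))
  have hval : ∫ t in (0 : ℝ)..1, -(1 - (t : ℂ) * x)⁻¹ = Complex.log (1 - x) / x := by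
    have hftc := intervalIntegral.integral_eq_sub_of_hasDerivAt (a := 0) (b := 1)
      (f := fun s : ℝ => Complex.log (1 - s * x) / x) (f' := fun t : ℝ => -(1 - (t : ℂ) * x)⁻¹)
      (by
        intro t ht
        rw [uIcc_of_le zero_le_one] at ht
        have hm0 := slitPlane_ne_zero (one_sub_mul_mem hx ht.1 ht.2)
        exact ((hasDerivAt_log_one_sub_mul hx ht.1 ht.2).div_const x).congr_deriv
          (by field_simp)) key.1
    simpa using hftc
  have := key.2.neg
  rw [hval] at this
  exact this.congr_deriv (by ring)

theorem hasSum_of_pointwise {E : Type*} [AddCommMonoid E] [TopologicalSpace E] {f g : ℕ → E}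
    {a : E} (h : HasSum f a) (hfg : ∀ n, g n = f n) : HasSum g a := by
  rwa [show g = f from funext hfg]

theorem dilog_neg_one : dilog (-1) = -(Real.pi : ℂ) ^ 2 / 12 := by
  have hi : ∀ n : ℕ, Integrable (fun t : ℝ => ((-1 : ℂ) ^ n * t ^ n / (n + 1)))
      (volume.restrict (Ioc (0 : ℝ) 1)) := fun n => by
    refine (ContinuousOn.integrableOn_Icc (?_ : ContinuousOn _ (Icc (0:ℝ) 1))).mono_set
      Ioc_subset_Icc_self
    fun_prop (disch := norm_cast)
  have hn : ∀ n : ℕ, ∫ t : ℝ in Ioc (0 : ℝ) 1, ‖((-1 : ℂ) ^ n * t ^ n / (n + 1))‖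
      = 1 / ((n : ℝ) + 1) ^ 2 := fun n => by
    have : ∀ t ∈ Ioc (0 : ℝ) 1, ‖((-1 : ℂ) ^ n * t ^ n / (n + 1))‖ = t ^ n / (n + 1) := by
      intro t ht
      rw [norm_div, norm_mul, norm_pow, norm_pow]
      have : ‖((n : ℂ) + 1)‖ = (n : ℝ) + 1 := by
        rw [← Nat.cast_succ, Complex.norm_natCast]; push_cast; rfl
      simp [this, abs_of_pos ht.1]
    rw [setIntegral_congr_fun measurableSet_Ioc this, ← intervalIntegral.integral_of_le zero_le_one,
      intervalIntegral.integral_div, integral_pow]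
    field_simp; simp
  have hv : ∀ n : ℕ, ∫ t : ℝ in Ioc (0 : ℝ) 1, ((-1 : ℂ) ^ n * t ^ n / (n + 1))
      = (-1) ^ n / ((n : ℂ) + 1) ^ 2 := fun n => by
    rw [← intervalIntegral.integral_of_le zero_le_one, intervalIntegral.integral_div,
      intervalIntegral.integral_const_mul]
    have : ∫ t in (0:ℝ)..1, (t : ℂ) ^ n = 1 / (n + 1) := by
      have := integral_pow (a := 0) (b := 1) n
      have h2 : ((∫ t in (0:ℝ)..1, t ^ n : ℝ) : ℂ) = ∫ t in (0:ℝ)..1, (t : ℂ) ^ n := by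
        rw [← intervalIntegral.integral_ofReal]; simp
      rw [← h2, this]; simp
    rw [this]; field_simp
  have hz : HasSum (fun n : ℕ => (1 : ℝ) / ((n : ℝ) + 1) ^ 2) (Real.pi ^ 2 / 6) := by
    have := (hasSum_nat_add_iff' (f := fun n : ℕ => (1 : ℝ) / (n : ℝ) ^ 2) 1).2 hasSum_zeta_two
    simpa using this
  have hS := hasSum_integral_of_summable_integral_norm hi (by simp_rw [hn]; exact hz.summable)
  simp_rw [hv] at hS
  have hodd : HasSum (fun n : ℕ => (1 : ℝ) / ((2 * n + 1 : ℕ) + 1 : ℝ) ^ 2) (Real.pi ^ 2 / 24) := by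
    have h := hz.mul_left (1 / 4)
    rw [show 1 / 4 * (Real.pi ^ 2 / 6) = Real.pi ^ 2 / 24 by ring] at h
    refine hasSum_of_pointwise h fun n => ?_
    push_cast; field_simp; ring
  have heven : HasSum (fun n : ℕ => (1 : ℝ) / ((2 * n : ℕ) + 1 : ℝ) ^ 2) (Real.pi ^ 2 / 8) := by
    have hs : Summable (fun n : ℕ => (1 : ℝ) / ((2 * n : ℕ) + 1 : ℝ) ^ 2) :=
      hz.summable.comp_injective (i := fun n => 2 * n) (fun a b h => by simpa using h)
    obtain ⟨S, hS⟩ := hs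
    have := (HasSum.even_add_odd (f := fun n : ℕ => (1 : ℝ) / ((n : ℝ) + 1) ^ 2) hS hodd).unique hz
    have : S = Real.pi ^ 2 / 8 := by linarith
    rwa [this] at hS
  have halt : HasSum (fun n : ℕ => (-1 : ℝ) ^ n / ((n : ℝ) + 1) ^ 2) (Real.pi ^ 2 / 12) := by
    have := HasSum.even_add_odd (f := fun n : ℕ => (-1 : ℝ) ^ n / ((n : ℝ) + 1) ^ 2)
      (m := Real.pi ^ 2 / 8) (m' := -(Real.pi ^ 2 / 24))
      (hasSum_of_pointwise heven fun n => by simp)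
      (hasSum_of_pointwise hodd.neg fun n => by rw [pow_succ, pow_mul]; simp [neg_div])
    rwa [show Real.pi ^ 2 / 8 + -(Real.pi ^ 2 / 24) = Real.pi ^ 2 / 12 by ring] at this
  have haltC : HasSum (fun n : ℕ => (-1 : ℂ) ^ n / ((n : ℂ) + 1) ^ 2) ((Real.pi : ℂ) ^ 2 / 12) := by
    have := (Complex.hasSum_ofReal (f := fun n : ℕ => (-1 : ℝ) ^ n / ((n : ℝ) + 1) ^ 2)).2 halt
    push_cast at this
    exact this
  rw [dilog, neg_div, neg_inj, intervalIntegral.integral_of_le zero_le_one, ← hS.unique haltC]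
  rw [integral_Ioc_eq_integral_Ioo, integral_Ioc_eq_integral_Ioo]
  refine setIntegral_congr_fun measurableSet_Ioo fun t ht => ?_
  have h1 := Complex.hasSum_taylorSeries_neg_log (z := -(t : ℂ))
    (by rw [norm_neg, Complex.norm_real, Real.norm_eq_abs, abs_of_pos ht.1]; exact ht.2)
  have h2 := ((hasSum_nat_add_iff' (f := fun n : ℕ => (-(t : ℂ)) ^ n / n) 1).2 h1).mul_left
    (-(1 / (t : ℂ)))
  have ht0 : (t : ℂ) ≠ 0 := by exact_mod_cast ht.1.ne'
  rw [(show HasSum (fun n : ℕ => ((-1 : ℂ) ^ n * t ^ n / (n + 1)))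
    (Complex.log (1 - t * (-1)) / t) from ?_).tsum_eq]
  have hlim : -(1 / (t : ℂ)) * (-Complex.log (1 - -(t : ℂ))
      - ∑ i ∈ Finset.range 1, (-(t : ℂ)) ^ i / i) = Complex.log (1 - t * (-1)) / t := by
    simp; ring
  rw [hlim] at h2
  refine hasSum_of_pointwise h2 fun n => ?_
  have hn1 : (n : ℂ) + 1 ≠ 0 := by exact_mod_cast Nat.succ_ne_zero n
  push_cast
  rw [neg_pow (t : ℂ), pow_succ, pow_succ]
  field_simp

theorem hasDerivAt_ex (z : ℂ) : HasDerivAt ex (2 * Real.pi * I * ex z) z := by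
  have h : HasDerivAt (fun w : ℂ => 2 * Real.pi * I * w) (2 * Real.pi * I) z := by
    simpa using (hasDerivAt_id z).const_mul (2 * Real.pi * I)
  exact h.cexp.congr_deriv (mul_comm _ _)

theorem ex_ne_zero (z : ℂ) : ex z ≠ 0 := Complex.exp_ne_zero _

theorem ex_neg (z : ℂ) : ex (-z) = (ex z)⁻¹ := by
  rw [ex, ex, ← Complex.exp_neg]; congr 1; ring

theorem ex_add_int (z : ℂ) (k : ℤ) : ex (z + k) = ex z := by
  rw [ex, ex, Complex.exp_eq_exp_iff_exists_int]
  exact ⟨k, by ring⟩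

theorem one_sub_ex_mem {z : ℂ} (h0 : 0 < z.re) (h1 : z.re < 1) : 1 - ex z ∈ slitPlane := by
  rw [Complex.mem_slitPlane_iff]
  have him : (2 * Real.pi * I * z).im = 2 * Real.pi * z.re := by simp
  by_cases h : z.re = 1 / 2
  · left
    have : (ex z).re ≤ 0 := by
      rw [ex, Complex.exp_re, him, h, show 2 * Real.pi * (1 / 2) = Real.pi by ring, Real.cos_pi]
      have := Real.exp_pos (2 * Real.pi * I * z).re
      linarith
    simp only [sub_re, one_re]; linarith
  · right
    simp only [sub_im, one_im, zero_sub, neg_ne_zero]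
    rw [ex, Complex.exp_im, him]
    refine mul_ne_zero (Real.exp_pos _).ne' ?_
    intro hs
    obtain ⟨n, hn⟩ := Real.sin_eq_zero_iff.1 hs
    have : (n : ℝ) = 2 * z.re := by
      have := Real.pi_pos.ne'
      field_simp at hn; linarith
    have h3 : (0 : ℝ) < n := by linarith
    have h4 : (n : ℝ) < 2 := by linarith
    have h3' : (0 : ℤ) < n := by exact_mod_cast h3
    have h4' : n < (2 : ℤ) := by exact_mod_cast h4
    have : n = 1 := by omega
    subst this
    apply h; push_cast at *; linarith

theorem one_sub_ex_neg_mem {z : ℂ} (h0 : 0 < z.re) (h1 : z.re < 1) :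
    1 - ex (-z) ∈ slitPlane := by
  have := one_sub_ex_mem (z := -z + (1 : ℤ)) (by simpa using h1) (by simpa using h0)
  rwa [ex_add_int] at this

theorem ex_half : ex (1 / 2) = -1 := by
  rw [ex, show 2 * (Real.pi : ℂ) * I * (1 / 2) = Real.pi * I by ring, Complex.exp_pi_mul_I]

theorem strip_const {f : ℂ → ℂ} (hf : ∀ z : ℂ, 0 < z.re → z.re < 1 → HasDerivAt f 0 z)
    {z : ℂ} (h0 : 0 < z.re) (h1 : z.re < 1) : f z = f (1 / 2) := by
  have hconv : Convex ℝ {w : ℂ | 0 < w.re ∧ w.re < 1} :=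
    (convex_halfSpace_re_gt 0).inter (convex_halfSpace_re_lt 1)
  have hopen : IsOpen {w : ℂ | 0 < w.re ∧ w.re < 1} :=
    (isOpen_lt continuous_const continuous_re).inter (isOpen_lt continuous_re continuous_const)
  refine hopen.is_const_of_deriv_eq_zero hconv.isPreconnected
    (fun w hw => (hf w hw.1 hw.2).differentiableAt.differentiableWithinAt)
    (fun w hw => (hf w hw.1 hw.2).deriv) ⟨h0, h1⟩ ?_
  norm_num

theorem log_one_sub_ex {z : ℂ} (h0 : 0 < z.re) (h1 : z.re < 1) :
    Complex.log (1 - ex z) - Complex.log (1 - ex (-z)) = 2 * Real.pi * I * (z - 1 / 2) := by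
  have := strip_const (f := fun z => Complex.log (1 - ex z) - Complex.log (1 - ex (-z))
      - 2 * Real.pi * I * (z - 1 / 2)) (fun w hw0 hw1 => ?_) h0 h1
  · have hh : ex (-(1 / 2)) = -1 := by rw [ex_neg, ex_half]; norm_num
    simp only [hh, ex_half, sub_self, mul_zero] at this
    exact sub_eq_zero.1 this
  · have m1 := one_sub_ex_mem hw0 hw1
    have m2 := one_sub_ex_neg_mem hw0 hw1
    have d1 := ((hasDerivAt_ex w).const_sub 1).clog m1
    have d2 := (((hasDerivAt_ex (-w)).comp w (hasDerivAt_neg w)).const_sub 1).clog m2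
    have d3 := ((hasDerivAt_id w).sub_const (1 / 2)).const_mul (2 * Real.pi * I)
    refine ((d1.sub d2).sub d3).congr_deriv ?_
    have n1 := slitPlane_ne_zero m1
    have n2 := slitPlane_ne_zero m2
    have n0 := ex_ne_zero w
    rw [Function.comp_apply, ex_neg]
    rw [ex_neg] at n2
    have n3 : ex w - 1 ≠ 0 := by
      intro h; apply n1; rw [← neg_eq_zero]; linear_combination h
    have e : (1 - (ex w)⁻¹) = (ex w - 1) / ex w := by field_simp
    rw [e]
    field_simp
    rw [show ex w - 1 = -(1 - ex w) by ring]
    field_simp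
    ring

theorem dilog_inversion {z : ℂ} (h0 : 0 < z.re) (h1 : z.re < 1) :
    dilog (ex z) + dilog (ex (-z)) + (2 * Real.pi * I) ^ 2 / 2 * (z - 1 / 2) ^ 2
      = -(Real.pi : ℂ) ^ 2 / 6 := by
  have := strip_const (f := fun z => dilog (ex z) + dilog (ex (-z))
      + (2 * Real.pi * I) ^ 2 / 2 * (z - 1 / 2) ^ 2) (fun w hw0 hw1 => ?_) h0 h1
  · have hh : ex (-(1 / 2)) = -1 := by rw [ex_neg, ex_half]; norm_num
    simp only [hh, ex_half, dilog_neg_one] at this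
    rw [this]; ring
  · have d1 := (hasDerivAt_dilog (one_sub_ex_mem hw0 hw1) (ex_ne_zero w)).comp w (hasDerivAt_ex w)
    have d2 := (hasDerivAt_dilog (one_sub_ex_neg_mem hw0 hw1) (ex_ne_zero (-w))).comp w
      ((hasDerivAt_ex (-w)).comp w (hasDerivAt_neg w))
    have d3 := (((hasDerivAt_id w).sub_const (1 / 2)).pow 2).const_mul
      ((2 * Real.pi * I) ^ 2 / 2)
    refine ((d1.add d2).add d3).congr_deriv ?_
    have n0 := ex_ne_zero w
    have n0' := ex_ne_zero (-w)
    have hl := log_one_sub_ex hw0 hw1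
    rw [sub_eq_iff_eq_add] at hl
    rw [hl]
    simp only [id]
    field_simp
    ring

/-! ### The Riemann surface `Σ` and the function `V : Σ → ℂ/ℤ` -/

/-- The plane with the downward cuts `k - i ℝ_{≥ 0}`, `k ∈ ℤ`, removed: the domain of the
coordinate `z₊`. -/
def UPlus : Set ℂ := {z | ∀ (k : ℤ) (y : ℝ), y ≤ 0 → z ≠ k + y * I}

/-- The plane with the upward cuts `k + i ℝ_{≥ 0}`, `k ∈ ℤ`, removed: the domain of the
coordinate `z₋`. -/
def UMinus : Set ℂ := {z | ∀ (k : ℤ) (y : ℝ), 0 ≤ y → z ≠ k + y * I}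

/-- Disjoint union of the sheets `(z₊, m₊)` and `(z₋, m₋)`, with `m₊, m₋ ∈ ℤ`. -/
abbrev PreSurface : Type := (UPlus × ℤ) ⊕ (UMinus × ℤ)

/-- The identifications `(z₊, m + A) ∼ (z₊ + 1, m)`, its counterpart
`(z₋, m + A - B) ∼ (z₋ + 1, m)` in the other coordinates, and the change of coordinates
`z₋ = z₊`, `m₋ = m₊ + B ⌊Re z₊⌋`. The last one, read on both sides of the cut below `k`, is
`(k + 0 + iy, m) ∼ (k - 0 + iy, m + B)` for `y < 0` in the coordinates `(z₊, m₊)`. -/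
inductive SurfRel (A B : ℕ) : PreSurface → PreSurface → Prop
  | shift_plus (z w : UPlus) (m : ℤ) (h : (w : ℂ) = z + 1) :
      SurfRel A B (Sum.inl (z, m + A)) (Sum.inl (w, m))
  | shift_minus (z w : UMinus) (m : ℤ) (h : (w : ℂ) = z + 1) :
      SurfRel A B (Sum.inr (z, m + A - B)) (Sum.inr (w, m))
  | glue (z : UPlus) (w : UMinus) (m : ℤ) (h : (w : ℂ) = z) :
      SurfRel A B (Sum.inl (z, m)) (Sum.inr (w, m + B * ⌊(z : ℂ).re⌋))

/-- The surface `Σ`, with the quotient topology. -/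
abbrev Surf (A B : ℕ) : Type := Quot (SurfRel A B)

/-- `p` is the point with coordinates `(z₊, m₊) = (z, m)`. -/
def IsPlusPt {A B : ℕ} (p : Surf A B) (z : ℂ) (m : ℤ) : Prop :=
  ∃ h : z ∈ UPlus, p = Quot.mk _ (Sum.inl (⟨z, h⟩, m))

/-- `p` is the point with coordinates `(z₋, m₋) = (z, m)`. -/
def IsMinusPt {A B : ℕ} (p : Surf A B) (z : ℂ) (m : ℤ) : Prop :=
  ∃ h : z ∈ UMinus, p = Quot.mk _ (Sum.inr (⟨z, h⟩, m))

/-- `V(z₊, m₊)`. -/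
def VPlus (A B : ℕ) (z : ℂ) (m : ℤ) : ℂ :=
  B * dilog (ex z) / (2 * Real.pi * I) ^ 2 + B / 24 + A / 2 * (z * (z + 1)) + m * z

/-- `Λ(z₋, m₋)`, the expression of `V` in the other coordinates. -/
def VMinus (A B : ℕ) (z : ℂ) (m : ℤ) : ℂ :=
  -(B * dilog (ex (-z))) / (2 * Real.pi * I) ^ 2 + B / 12 - B / 2 * (z - 1 / 2) ^ 2
    + A / 2 * (z * (z + 1)) + m * z

/-- The group `ℂ/ℤ`. -/
abbrev CModZ : Type := ℂ ⧸ AddSubgroup.zmultiples (1 : ℂ)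

/-- The class of a complex number in `ℂ/ℤ`. -/
def modZ (w : ℂ) : CModZ := QuotientAddGroup.mk w

theorem modZ_eq_of_sub_eq_int {u v : ℂ} (n : ℤ) (h : u - v = n) : modZ u = modZ v := by
  refine (QuotientAddGroup.eq).2 (AddSubgroup.mem_zmultiples_iff.2 ⟨-n, ?_⟩)
  simp only [zsmul_eq_mul, mul_one]
  push_cast
  linear_combination h

/-- `V` on the disjoint union of the sheets. -/
def preVol (A B : ℕ) : PreSurface → CModZ
  | Sum.inl (z, m) => modZ (VPlus A B z m)
  | Sum.inr (z, m) => modZ (VMinus A B z m)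

theorem exists_half_mul_succ (k : ℤ) : ∃ n : ℤ, (n : ℂ) = k * (k + 1) / 2 := by
  obtain ⟨n, hn⟩ := Int.even_mul_succ_self k
  refine ⟨n, ?_⟩
  have : ((k * (k + 1) : ℤ) : ℂ) = ((n + n : ℤ) : ℂ) := by rw [hn]
  push_cast at this
  rw [this]; ring

theorem VPlus_sub_VMinus (A B : ℕ) {z : ℂ} (h1 : z ∈ UPlus) (h2 : z ∈ UMinus) (m : ℤ) :
    VPlus A B z m - VMinus A B z (m + B * ⌊z.re⌋) = -(B * (⌊z.re⌋ * (⌊z.re⌋ + 1) / 2)) := by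
  set k : ℤ := ⌊z.re⌋ with hk
  have hne : (k : ℝ) ≠ z.re := by
    intro h
    have hz : z = k + z.im * I := by
      apply Complex.ext <;> simp [h]
    rcases le_total z.im 0 with hy | hy
    · exact h1 k z.im hy hz
    · exact h2 k z.im hy hz
  have hlt : (k : ℝ) < z.re := lt_of_le_of_ne (Int.floor_le _) hne
  have hlt' : z.re < k + 1 := Int.lt_floor_add_one _
  have hinv := dilog_inversion (z := z - k) (by simp; linarith) (by simp; linarith)
  have e1 : ex (z - k) = ex z := by
    have := ex_add_int z (-k)
    push_cast at this
    rwa [← sub_eq_add_neg] at this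
  have e2 : ex (-(z - k)) = ex (-z) := by rw [ex_neg, e1, ex_neg]
  rw [e1, e2] at hinv
  have hpi : (Real.pi : ℂ) ≠ 0 := by exact_mod_cast Real.pi_ne_zero
  have hI : (2 * Real.pi * I : ℂ) ^ 2 = -(4 * Real.pi ^ 2) := by
    rw [mul_pow, I_sq]; ring
  rw [hI] at hinv
  have hd : dilog (ex z) = -dilog (ex (-z)) + 2 * Real.pi ^ 2 * (z - k - 1 / 2) ^ 2
      - Real.pi ^ 2 / 6 := by linear_combination hinv
  unfold VPlus VMinus
  rw [hI, hd]
  push_cast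
  field_simp
  ring

/-- The function `V : Σ → ℂ/ℤ`. -/
def vol (A B : ℕ) : Surf A B → CModZ :=
  Quot.lift (preVol A B) (by
    intro a b hab
    cases hab with
    | shift_plus z w m h =>
      refine modZ_eq_of_sub_eq_int (-(A + m)) ?_
      have e : ex (z + 1) = ex z := by simpa using ex_add_int z 1
      rw [h]; unfold VPlus; rw [e]; push_cast; ring
    | shift_minus z w m h =>
      refine modZ_eq_of_sub_eq_int (-(A + m)) ?_
      have e : ex (-((z : ℂ) + 1)) = ex (-z) := by
        have := ex_add_int (-((z : ℂ) + 1)) 1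
        rw [← this]; congr 1; push_cast; ring
      rw [h]; unfold VMinus; rw [e]; push_cast; ring
    | glue z w m h =>
      obtain ⟨n, hn⟩ := exists_half_mul_succ ⌊(z : ℂ).re⌋
      refine modZ_eq_of_sub_eq_int (-(B * n)) ?_
      have := VPlus_sub_VMinus A B z.2 (h ▸ w.2) m
      rw [h, this, ← hn]; push_cast; ring)

/-- `p` is a critical point of `V`: in a coordinate around `p` the derivative vanishes. -/
def IsCritical {A B : ℕ} (p : Surf A B) : Prop :=
  (∃ z m, IsPlusPt p z m ∧ HasDerivAt (fun w => VPlus A B w m) 0 z) ∨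
  (∃ z m, IsMinusPt p z m ∧ HasDerivAt (fun w => VMinus A B w m) 0 z)

/-- The set `𝒱 ⊆ ℂ` of (lifts of) critical values; it includes the integers, which are the
values of `V` at the branch points. -/
def critValues (A B : ℕ) : Set ℂ :=
  {v | ∃ p : Surf A B, IsCritical p ∧ vol A B p = modZ v} ∪ Set.range (fun n : ℤ => (n : ℂ))

/-- The union `𝒮(V₀)` of the Stokes rays `ℝ_{≥ 0} · 2πi / (v - V₀)`, `v ∈ 𝒱`, `v ≠ V₀`,
in the `τ`-plane. -/
def stokes (A B : ℕ) (V₀ : ℂ) : Set ℂ :=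
  {w | ∃ v ∈ critValues A B, v ≠ V₀ ∧ ∃ r : ℝ, 0 ≤ r ∧ w = r * (2 * Real.pi * I / (v - V₀))}

/-- The set of `p ∈ Σ` with `V(p) ∈ V₀ - i e^{iϑ} ℝ_{≥ lam} + ℤ`. -/
def levelSet (A B : ℕ) (V₀ : ℂ) (ϑ lam : ℝ) : Set (Surf A B) :=
  {p | ∃ s : ℝ, lam ≤ s ∧ vol A B p = modZ (V₀ - I * exp (ϑ * I) * s)}

/-- The component of `p` in `levelSet`. For `p = p₀` critical, `V₀ = V(p₀)` and `lam = 0` this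
is the thimble `𝒞_{p₀,ϑ}`; for `V(p) = V₀ - i e^{iϑ} lam` with `lam > 0` it is `Γ_{p,ϑ}`. -/
def levelComponent (A B : ℕ) (V₀ : ℂ) (ϑ lam : ℝ) (p : Surf A B) : Set (Surf A B) :=
  connectedComponentIn (levelSet A B V₀ ϑ lam) p

/-! ### Homology of the inverse limit of relative singular chain complexes -/

section Homology

/-- Singular `n`-simplices. -/
abbrev Simplex (X : Type) [TopologicalSpace X] (n : ℕ) : Type :=
  C(stdSimplex ℝ (Fin (n + 1)), X)

/-- Singular `n`-chains. -/
abbrev Chain (X : Type) [TopologicalSpace X] (n : ℕ) : Type := Simplex X n →₀ ℤ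

/-- The inclusion of the `i`-th face. -/
def faceMap (n : ℕ) (i : Fin (n + 2)) :
    C(stdSimplex ℝ (Fin (n + 1)), stdSimplex ℝ (Fin (n + 2))) :=
  ⟨stdSimplex.map i.succAbove, stdSimplex.continuous_map _⟩

/-- The singular boundary map. -/
def boundary (X : Type) [TopologicalSpace X] (n : ℕ) : Chain X (n + 1) →ₗ[ℤ] Chain X n :=
  ∑ i : Fin (n + 2),
    (-1 : ℤ) ^ (i : ℕ) • Finsupp.lmapDomain ℤ ℤ (fun σ : Simplex X (n + 1) => σ.comp (faceMap n i))

/-- The chains whose simplices lie in `D`. -/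
def chainsIn {X : Type} [TopologicalSpace X] (D : Set X) (n : ℕ) : Submodule ℤ (Chain X n) :=
  Finsupp.supported ℤ ℤ {σ | Set.range σ ⊆ D}

theorem chainsIn_mono {X : Type} [TopologicalSpace X] {D E : Set X} (h : D ⊆ E) (n : ℕ) :
    chainsIn D n ≤ chainsIn E n :=
  Finsupp.supported_mono fun _ hσ => Set.Subset.trans hσ h

/-- Relative chains `C_n(X, D)`. -/
abbrev RelChain {X : Type} [TopologicalSpace X] (D : Set X) (n : ℕ) : Type :=
  Chain X n ⧸ chainsIn D n

theorem boundary_single {X : Type} [TopologicalSpace X] (n : ℕ) (σ : Simplex X (n + 1)) (a : ℤ) :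
    boundary X n (Finsupp.single σ a) =
      ∑ i : Fin (n + 2), (-1 : ℤ) ^ (i : ℕ) • Finsupp.single (σ.comp (faceMap n i)) a := by
  simp [boundary, LinearMap.sum_apply, Finsupp.mapDomain_single]

theorem boundary_mem {X : Type} [TopologicalSpace X] (D : Set X) (n : ℕ) :
    chainsIn D (n + 1) ≤ (chainsIn D n).comap (boundary X n) := by
  rw [chainsIn, Finsupp.supported_eq_span_single, Submodule.span_le]
  rintro _ ⟨σ, hσ, rfl⟩
  rw [SetLike.mem_coe, Submodule.mem_comap, boundary_single]
  refine Submodule.sum_mem _ fun i _ => Submodule.smul_mem _ _ ?_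
  refine Finsupp.single_mem_supported ℤ _ ?_
  rintro _ ⟨x, rfl⟩
  exact hσ ⟨_, rfl⟩

/-- The boundary map of `C_•(X, D)`. -/
def relBoundary {X : Type} [TopologicalSpace X] (D : Set X) (n : ℕ) :
    RelChain D (n + 1) →ₗ[ℤ] RelChain D n :=
  (chainsIn D (n + 1)).mapQ (chainsIn D n) (boundary X n) (boundary_mem D n)

/-- The projection `C_n(X, D) → C_n(X, E)` for `D ⊆ E`. -/
def relProj {X : Type} [TopologicalSpace X] {D E : Set X} (h : D ⊆ E) (n : ℕ) :
    RelChain D n →ₗ[ℤ] RelChain E n :=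
  Submodule.factor (chainsIn_mono h n)

theorem relProj_boundary {X : Type} [TopologicalSpace X] {D E : Set X} (h : D ⊆ E) (n : ℕ)
    (c : RelChain D (n + 1)) :
    relProj h n (relBoundary D n c) = relBoundary E n (relProj h (n + 1) c) := by
  obtain ⟨c, rfl⟩ := Submodule.Quotient.mk_surjective _ c
  rfl

/-- `lim_L C_n(X, D_L)` for a decreasing family `D_L`, as compatible families. -/
def limChain {X : Type} [TopologicalSpace X] (D : ℝ → Set X) (hD : Antitone D) (n : ℕ) :
    Submodule ℤ (∀ L : ℝ, RelChain (D L) n) where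
  carrier := {f | ∀ (L L' : ℝ) (h : L ≤ L'), relProj (hD h) n (f L') = f L}
  add_mem' := by
    intro f g hf hg L L' h
    simp only [Pi.add_apply, map_add, hf L L' h, hg L L' h]
  zero_mem' := by intro L L' h; simp
  smul_mem' := by
    intro a f hf L L' h
    simp only [Pi.smul_apply, map_smul, hf L L' h]

/-- The boundary map of `lim_L C_•(X, D_L)`. -/
def limBoundary {X : Type} [TopologicalSpace X] (D : ℝ → Set X) (hD : Antitone D) (n : ℕ) :
    limChain D hD (n + 1) →ₗ[ℤ] limChain D hD n :=
  LinearMap.restrict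
    (LinearMap.pi fun L => (relBoundary (D L) n).comp (LinearMap.proj L))
    (by
      intro f hf L L' h
      simp only [LinearMap.pi_apply, LinearMap.comp_apply, LinearMap.proj_apply]
      rw [relProj_boundary, hf L L' h])

/-- `H_1(lim_L C_•(X, D_L))`: cycles modulo boundaries. -/
abbrev LimH1 {X : Type} [TopologicalSpace X] (D : ℝ → Set X) (hD : Antitone D) : Type :=
  LinearMap.ker (limBoundary D hD 0) ⧸
    (LinearMap.range (limBoundary D hD 1)).submoduleOf (LinearMap.ker (limBoundary D hD 0))

/-- A curve `ℝ → X` both of whose ends eventually lie in every `D_L`. -/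
structure RelCurve {X : Type} [TopologicalSpace X] (D : ℝ → Set X) where
  /-- the parametrisation -/
  toFun : ℝ → X
  continuous_toFun : Continuous toFun
  ends_mem : ∀ L : ℝ, ∃ T : ℝ, ∀ t : ℝ, T ≤ |t| → toFun t ∈ D L

namespace RelCurve

/-- The piece of a curve over `[k, k + 1]`, as a singular `1`-simplex. -/
def piece {X : Type} [TopologicalSpace X] {D : ℝ → Set X} (γ : RelCurve D) (k : ℤ) :
    Simplex X 1 :=
  ⟨fun s => γ.toFun (k + s 1), γ.continuous_toFun.comp
    (continuous_const.add ((continuous_apply 1).comp continuous_subtype_val))⟩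

/-- The point `γ(k)`, as a singular `0`-simplex. -/
def point {X : Type} [TopologicalSpace X] {D : ℝ → Set X} (γ : RelCurve D) (k : ℤ) :
    Simplex X 0 := ContinuousMap.const _ (γ.toFun k)

theorem exists_nat_bound {X : Type} [TopologicalSpace X] {D : ℝ → Set X} (γ : RelCurve D)
    (L : ℝ) : ∃ N : ℤ, ∀ k : ℤ, k ∉ Finset.Icc (-N) N →
      ∀ s : ℝ, 0 ≤ s → s ≤ 1 → γ.toFun (k + s) ∈ D L := by
  obtain ⟨T, hT⟩ := γ.ends_mem L
  refine ⟨⌈|T|⌉ + 1, fun k hk s hs0 hs1 => hT _ ?_⟩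
  have h1 : |T| ≤ ⌈|T|⌉ := Int.le_ceil _
  have h2 : T ≤ |T| := le_abs_self T
  rw [Finset.mem_Icc, not_and_or, not_le, not_le] at hk
  rcases hk with hk | hk
  · have : (k : ℝ) + 1 ≤ -(⌈|T|⌉ + 1) := by exact_mod_cast hk
    have := neg_le_abs ((k : ℝ) + s)
    linarith
  · have : (⌈|T|⌉ + 1 : ℝ) ≤ k := by exact_mod_cast hk.le
    have := le_abs_self ((k : ℝ) + s)
    linarith

theorem simplex_coord_nonneg (s : stdSimplex ℝ (Fin 2)) : 0 ≤ s 1 := s.2.1 1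

theorem simplex_coord_le_one (s : stdSimplex ℝ (Fin 2)) : s 1 ≤ 1 := by
  have h := s.2.2
  rw [Fin.sum_univ_two] at h
  have := s.2.1 0
  change s.1 1 ≤ 1
  linarith

theorem finite_piece {X : Type} [TopologicalSpace X] {D : ℝ → Set X} (γ : RelCurve D) (L : ℝ) :
    Function.HasFiniteSupport fun k : ℤ =>
      ((chainsIn (D L) 1).mkQ (Finsupp.single (γ.piece k) 1)) := by
  obtain ⟨N, hN⟩ := γ.exists_nat_bound L
  refine (Finset.Icc (-N) N).finite_toSet.subset fun k hk => ?_
  by_contra hk'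
  refine hk ((Submodule.Quotient.mk_eq_zero _).2 (Finsupp.single_mem_supported ℤ _ ?_))
  rintro _ ⟨s, rfl⟩
  exact hN k hk' _ (simplex_coord_nonneg s) (simplex_coord_le_one s)

theorem finite_point {X : Type} [TopologicalSpace X] {D : ℝ → Set X} (γ : RelCurve D) (L : ℝ) :
    Function.HasFiniteSupport fun k : ℤ =>
      ((chainsIn (D L) 0).mkQ (Finsupp.single (γ.point k) 1)) := by
  obtain ⟨N, hN⟩ := γ.exists_nat_bound L
  refine (Finset.Icc (-N) N).finite_toSet.subset fun k hk => ?_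
  by_contra hk'
  refine hk ((Submodule.Quotient.mk_eq_zero _).2 (Finsupp.single_mem_supported ℤ _ ?_))
  rintro _ ⟨s, rfl⟩
  have := hN k hk' 0 le_rfl zero_le_one
  rwa [add_zero] at this

/-- The chain `∑_k γ|[k, k+1]` of a curve. Modulo `C_1(D_L)` only finitely many terms are
non-zero. -/
def chain {X : Type} [TopologicalSpace X] {D : ℝ → Set X} (γ : RelCurve D) (hD : Antitone D) :
    limChain D hD 1 :=
  ⟨fun L => ∑ᶠ k : ℤ, (chainsIn (D L) 1).mkQ (Finsupp.single (γ.piece k) 1), by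
    intro L L' h
    exact AddMonoidHom.map_finsum (relProj (hD h) 1).toAddMonoidHom (γ.finite_piece L')⟩

theorem boundary_piece {X : Type} [TopologicalSpace X] {D : ℝ → Set X} (γ : RelCurve D) (k : ℤ) :
    boundary X 0 (Finsupp.single (γ.piece k) 1) =
      Finsupp.single (γ.point (k + 1)) 1 - Finsupp.single (γ.point k) 1 := by
  have hv : ∀ x : stdSimplex ℝ (Fin 1), x = stdSimplex.vertex 0 := fun x => Subsingleton.elim _ _
  have h0 : (γ.piece k).comp (faceMap 0 0) = γ.point (k + 1) := by
    ext x
    rw [hv x]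
    change γ.toFun (k + (stdSimplex.map _ (stdSimplex.vertex 0)) 1) = γ.toFun _
    rw [stdSimplex.map_vertex]
    simp
  have h1 : (γ.piece k).comp (faceMap 0 1) = γ.point k := by
    ext x
    rw [hv x]
    change γ.toFun (k + (stdSimplex.map _ (stdSimplex.vertex 0)) 1) = γ.toFun _
    rw [stdSimplex.map_vertex]
    simp
  rw [boundary_single, Fin.sum_univ_two, h0, h1]
  simp [sub_eq_add_neg]

theorem chain_mem_ker {X : Type} [TopologicalSpace X] {D : ℝ → Set X} (γ : RelCurve D)
    (hD : Antitone D) : γ.chain hD ∈ LinearMap.ker (limBoundary D hD 0) := by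
  rw [LinearMap.mem_ker]
  refine Subtype.ext (funext fun L => ?_)
  have h1 : (limBoundary D hD 0 (γ.chain hD)).1 L =
      relBoundary (D L) 0 (∑ᶠ k : ℤ, (chainsIn (D L) 1).mkQ (Finsupp.single (γ.piece k) 1)) := rfl
  have h2 := AddMonoidHom.map_finsum (relBoundary (D L) 0).toAddMonoidHom (γ.finite_piece L)
  have h3 : ∀ k : ℤ, (relBoundary (D L) 0).toAddMonoidHom
      ((chainsIn (D L) 1).mkQ (Finsupp.single (γ.piece k) 1)) =
      (chainsIn (D L) 0).mkQ (Finsupp.single (γ.point (k + 1)) 1)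
        - (chainsIn (D L) 0).mkQ (Finsupp.single (γ.point k) 1) := fun k => by
    rw [← map_sub, ← boundary_piece]; rfl
  rw [h1]
  refine h2.trans ?_
  simp_rw [h3]
  have hfin := γ.finite_point L
  have hfin' : Function.HasFiniteSupport fun k : ℤ =>
      ((chainsIn (D L) 0).mkQ (Finsupp.single (γ.point (k + 1)) 1)) :=
    hfin.preimage (f := fun k : ℤ => k + 1) (add_left_injective 1).injOn
  rw [finsum_sub_distrib hfin' hfin]
  exact sub_eq_zero.2 (finsum_comp_equiv (Equiv.addRight (1 : ℤ))
    (f := fun k : ℤ => (chainsIn (D L) 0).mkQ (Finsupp.single (γ.point k) 1)))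

/-- The class of a curve in `H_1(lim_L C_•(X, D_L))`. -/
def cls {X : Type} [TopologicalSpace X] {D : ℝ → Set X} (γ : RelCurve D) (hD : Antitone D) :
    LimH1 D hD :=
  Submodule.Quotient.mk ⟨γ.chain hD, γ.chain_mem_ker hD⟩

end RelCurve

end Homology

/-! ### The regions `D_{L,θ}` and the contours -/

/-- The union `D_{L,θ}⁺` over the sheets `m₊ = 0, …, A - 1` of the component of
`{Im z₊ > 0, -Im(A/2 · z₊² · e^{-iθ}) > L}` that contains the far part of the ray
`e^{iθ/2 - iAε} ℝ_{> 0}`, `ε > 0` small. This component is singled out by the condition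
`max(0, θ/2 - π/2) < arg z₊ < min(π, θ/2)`. -/
def decayPlus (A B : ℕ) (θ L : ℝ) : Set (Surf A B) :=
  {p | ∃ (z : ℂ) (m : ℤ), IsPlusPt p z m ∧ 0 ≤ m ∧ m < A ∧
    (∃ ρ φ : ℝ, 0 < ρ ∧ max 0 (θ / 2 - Real.pi / 2) < φ ∧ φ < min Real.pi (θ / 2) ∧
      z = ρ * exp (φ * I)) ∧
    L < -((A : ℂ) / 2 * z ^ 2 * exp (-(θ * I))).im}

/-- The union `D_{L,θ}⁻` over the sheets `m₋ = 0, …, |A - B| - 1` of the component of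
`{Im z₋ < 0, -Im((A - B)/2 · z₋² · e^{-iθ}) > L}` that contains the far part of the ray
`-e^{iθ/2 - i(A - B)ε} ℝ_{> 0}`, `ε > 0` small. It is singled out by the condition on
`φ = arg z₋`. Because of `(z₋, m₋ + A - B) ∼ (z₋ + 1, m₋)` the sheets `m₋ = 0, …, |A - B| - 1`
are all the sheets of the lower half. -/
def decayMinus (A B : ℕ) (θ L : ℝ) : Set (Surf A B) :=
  {p | ∃ (z : ℂ) (m : ℤ), IsMinusPt p z m ∧ 0 ≤ m ∧ m < |(A : ℤ) - B| ∧
    (∃ ρ φ : ℝ, 0 < ρ ∧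
      max Real.pi (θ / 2 + 3 * Real.pi / 4
        - ((A : ℝ) - B) * Real.pi / (4 * |(A : ℝ) - B|)) < φ ∧
      φ < min (2 * Real.pi) (θ / 2 + 5 * Real.pi / 4
        - ((A : ℝ) - B) * Real.pi / (4 * |(A : ℝ) - B|)) ∧
      z = ρ * exp (φ * I)) ∧
    L < -(((A : ℂ) - B) / 2 * z ^ 2 * exp (-(θ * I))).im}

/-- `D_{L,θ} = D_{L,θ}⁺ ∪ D_{L,θ}⁻`. -/
def decay (A B : ℕ) (θ L : ℝ) : Set (Surf A B) := decayPlus A B θ L ∪ decayMinus A B θ L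

theorem decay_antitone (A B : ℕ) (θ : ℝ) : Antitone (decay A B θ) := by
  intro L L' h p hp
  rcases hp with ⟨z, m, h1, h2, h3, h4, h5⟩ | ⟨z, m, h1, h2, h3, h4, h5⟩
  · exact Or.inl ⟨z, m, h1, h2, h3, h4, lt_of_le_of_lt h h5⟩
  · exact Or.inr ⟨z, m, h1, h2, h3, h4, lt_of_le_of_lt h h5⟩

/-- `H_1(Σ, D_{∞,θ})`. -/
abbrev H1 (A B : ℕ) (θ : ℝ) : Type := LimH1 (decay A B θ) (decay_antitone A B θ)

/-- How small the `ε > 0` that tilts the straight rays has to be: the tilted rays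
`e^{iθ/2 - iAε} ℝ_{≥ 0}` and `-e^{iθ/2 - i(A - B)ε} ℝ_{≥ 0}` stay in the upper, respectively
lower half plane and point into `D_{∞,θ}`. -/
def SmallTilt (A B : ℕ) (θ ε : ℝ) : Prop :=
  0 < ε ∧ A * ε < min (θ / 2) (Real.pi - θ / 2) ∧
    |(A : ℝ) - B| * ε < min (θ / 2) (Real.pi - θ / 2)

/-- `J` parametrises the lift to the sheet `m₊ = m` of the state integral contour
`(i/√τ · e^{-iAε} ℝ_{≥ 0} - 1/2 + ℓ) ∪ (i/√τ · e^{-i(A - B)ε} ℝ_{≤ 0} - 1/2 + ℓ)`.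
The base point `(z₊, m₊) = (ℓ - 1/2, m)` is `(z₋, m₋) = (ℓ - 1/2, m + B(ℓ - 1))`, and the
coordinate `z₋` has no cuts in the lower half plane. -/
def IsStateContour {A B : ℕ} (τ : ℂ) (ε : ℝ) (l m : ℤ) (J : ℝ → Surf A B) : Prop :=
  (∀ t : ℝ, 0 ≤ t →
    IsPlusPt (J t) (t * (I / τ ^ (1 / 2 : ℂ) * exp (-(A * ε * I))) - 1 / 2 + l) m) ∧
  (∀ t : ℝ, t ≤ 0 →
    IsMinusPt (J t) (t * (I / τ ^ (1 / 2 : ℂ) * exp (-((A - B) * ε * I))) - 1 / 2 + l)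
      (m + B * (l - 1)))

/-- The curve `γ` represents a class in `H_1(Σ, D_{∞,θ})`, so do the lifted state integral
contours `J̃_{ℓ,m,τ}`, `ℓ ∈ ℤ`, `0 ≤ m < A`, and `[γ] = ∑ c_{ℓ,m} [J̃_{ℓ,m,τ}]`, a finite sum. -/
def IsStateCombination {A B : ℕ} (θ : ℝ) (τ : ℂ) (ε : ℝ) (γ : ℝ → Surf A B)
    (c : ℤ × Fin A →₀ ℤ) : Prop :=
  ∃ (g : RelCurve (decay A B θ)) (J : ℤ × Fin A → RelCurve (decay A B θ)),
    g.toFun = γ ∧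
    (∀ (l : ℤ) (m : Fin A), IsStateContour τ ε l (m : ℕ) (J (l, m)).toFun) ∧
    (g.cls (decay_antitone A B θ) : H1 A B θ) =
      c.sum fun x n => n • (J x).cls (decay_antitone A B θ)

/-- `τ ∈ ℂ ∖ ℝ_{≤ 0}` and `arg(-1/τ) = θ`. -/
def ArgCondition (τ : ℂ) (θ : ℝ) : Prop :=
  τ ∈ slitPlane ∧ -1 / τ = ‖-1 / τ‖ * exp (θ * I)

/-- `γ` is a parametrisation of the set `S` by the real line. -/
def IsLineParam {A B : ℕ} (γ : ℝ → Surf A B) (S : Set (Surf A B)) : Prop :=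
  Continuous γ ∧ Function.Injective γ ∧ Set.range γ = S

/-- `p` does not lie over the real axis: `Im z(p) ≠ 0`. -/
def OffReal {A B : ℕ} (p : Surf A B) : Prop :=
  (∃ z m, 0 < z.im ∧ IsPlusPt p z m) ∨ (∃ z m, z.im < 0 ∧ IsMinusPt p z m)

/-- `T` restricted to `[0, ∞)` is the tail based at `p`: the straight ray from `p` in the direction
`e^{iθ/2 - iAε}` if `Im z(p) > 0`, and `-e^{iθ/2 - i(A - B)ε}` if `Im z(p) < 0`. -/
def IsTail {A B : ℕ} (θ ε : ℝ) (p : Surf A B) (T : ℝ → Surf A B) : Prop :=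
  (∃ z m, 0 < z.im ∧ IsPlusPt p z m ∧
    ∀ s : ℝ, 0 ≤ s → IsPlusPt (T s) (z + s * exp (θ / 2 * I - A * ε * I)) m) ∨
  (∃ z m, z.im < 0 ∧ IsMinusPt p z m ∧
    ∀ s : ℝ, 0 ≤ s → IsMinusPt (T s) (z - s * exp (θ / 2 * I - (A - B) * ε * I)) m)

/-- `γ` parametrises the contour `γ_{p,θ}`, where `V(p) = V₀ - i e^{iϑ} lam` modulo `ℤ`: it runs in
along the tail at `p`, and then along `Γ_{p,ϑ}` starting from `p`. -/
def IsPointContour {A B : ℕ} (V₀ : ℂ) (ϑ lam θ ε : ℝ) (p : Surf A B) (γ : ℝ → Surf A B) : Prop :=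
  Continuous γ ∧ IsTail θ ε p (fun s => γ (-s)) ∧
    Set.InjOn γ (Set.Ici 0) ∧ γ '' Set.Ici 0 = levelComponent A B V₀ ϑ lam p

/-- `e` is a segment (an arc) with end points `a` and `b`. -/
def IsSegment {A B : ℕ} (e : Set (Surf A B)) (a b : Surf A B) : Prop :=
  ∃ η : ℝ → Surf A B, ContinuousOn η (Set.Icc 0 1) ∧ Set.InjOn η (Set.Icc 0 1) ∧
    η '' Set.Icc 0 1 = e ∧ η 0 = a ∧ η 1 = b

/-- `γ` parametrises the contour `γ_{e,θ}` of a segment `e` from `a` to `b`: it runs in along the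
tail at `a`, then along `e` from `a` to `b`, and out along the tail at `b`. -/
def IsEdgeContour {A B : ℕ} (θ ε : ℝ) (e : Set (Surf A B)) (a b : Surf A B)
    (γ : ℝ → Surf A B) : Prop :=
  Continuous γ ∧ IsTail θ ε a (fun s => γ (-s)) ∧ IsTail θ ε b (fun s => γ (1 + s)) ∧
    Set.InjOn γ (Set.Icc 0 1) ∧ γ '' Set.Icc 0 1 = e

end StateIntegral

end

/-! There are two halves: geometry, which controls where the level curves of `V` go, and homology,
which computes the classes of curves with controlled ends.

Geometry. With `x = e(z)` and `y = dV/dz` the surface becomes the closed curve `e(y) (1 - x)^B =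
(-1)^A x^A` in `ℂ²` (`isClosedEmbedding_xyc`), and because `A ≠ B` the sets `|y| ≤ R` are compact
(`isCompact_yc_le`). Away from critical points `V` is a local coordinate, so a level curve is a lift
of the ray `V₀ - i e^{iϑ} t`. Such a lift cannot break off at a finite time. The derivative of `y²`
along it is bounded as long as `x` stays away from `1`. And `x` cannot run into `1`: near a branch
point `V - z V'` tends to `0`, while the ray stays away from `ℤ`, so `|1 - x| |y|` is bounded below
and `log |1 - x|` changes at bounded speed (`IsLift.exists_lower`, `IsLift.exists_upper`,
`exists_lift`). `Im V` is bounded above over the real axis but grows along the ray, so the lift ends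
up in one half sheet. There `V` is a quadratic polynomial up to a bounded error, so `z` follows a
square root of the ray, and that direction lies in the cone of `D_{∞,θ}` for every `θ` with `|θ - ϑ|
< π/2` (`IsLift.exists_end`). At the non-degenerate point `p₀` one has `V = V₀ + w²`, and the two
lifts that start there form the thimble (`exists_thimble`).

Homology. Homotopies with controlled ends preserve the class, and a curve may be cut at any point by
inserting a ray out to `D_{∞,θ}` and back (`cls_homotopy`, `cls_concat`). The surface is covered by
slit planes indexed by `(ℓ, m)`, `0 ≤ m < A` (`exists_slit`); each is star-shaped about `ℓ - 1/2`
and contains `J̃_{ℓ,m}`. The compact middle part of a curve is cut into pieces that lie in slit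
planes. A piece, completed by rays, contracts to two straight rays through the centre: it is null if
both rays are in the same half plane, and `±J̃_{ℓ,m}` otherwise (`arcCurve_cls_of_slit`). The two
ends contract to rays because the cones of decay are convex (`cls_arrive`). The coefficients come
from the curve and its subdivision alone, so for the thimble they are the same for all `θ`
(`exists_stateCombination`). -/

noncomputable section

namespace StateIntegral

open Complex MeasureTheory Set Topology

/-! ### Locally finite chains, and the calculus of classes of curves -/

section LocallyFinite

variable {X : Type} [TopologicalSpace X] {D : ℝ → Set X} (hD : Antitone D)

/-- A family of simplices all but finitely many of which lie in `D L`, for every `L`. -/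
def LocFin {ι : Type} {n : ℕ} (D : ℝ → Set X) (σ : ι → Simplex X n) : Prop :=
  ∀ L, {i | ¬ Set.range (σ i) ⊆ D L}.Finite

theorem LocFin.support {ι : Type} {n : ℕ} {σ : ι → Simplex X n} (h : LocFin D σ) (L : ℝ) :
    Function.HasFiniteSupport fun i => (chainsIn (D L) n).mkQ (Finsupp.single (σ i) 1) := by
  refine (h L).subset fun i hi => ?_
  intro hi'
  exact hi ((Submodule.Quotient.mk_eq_zero _).2 (Finsupp.single_mem_supported ℤ _ hi'))

/-- The sum of a locally finite family of simplices. -/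
def lfChain {ι : Type} {n : ℕ} (σ : ι → Simplex X n) (h : LocFin D σ) : limChain D hD n :=
  ⟨fun L => ∑ᶠ i, (chainsIn (D L) n).mkQ (Finsupp.single (σ i) 1), by
    intro L L' hL
    exact AddMonoidHom.map_finsum (relProj (hD hL) n).toAddMonoidHom (h.support L')⟩

theorem lfChain_apply {ι : Type} {n : ℕ} (σ : ι → Simplex X n) (h : LocFin D σ) (L : ℝ) :
    (lfChain hD σ h).1 L = ∑ᶠ i, (chainsIn (D L) n).mkQ (Finsupp.single (σ i) 1) := rfl

theorem lfChain_congr {ι : Type} {n : ℕ} {σ τ : ι → Simplex X n} (h : LocFin D σ)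
    (h' : LocFin D τ) (e : ∀ i, σ i = τ i) : lfChain hD σ h = lfChain hD τ h' := by
  obtain rfl : σ = τ := funext e
  rfl

theorem lfChain_equiv {ι κ : Type} {n : ℕ} {σ : ι → Simplex X n} (h : LocFin D σ) (e : κ ≃ ι)
    (h' : LocFin D (σ ∘ e)) : lfChain hD (σ ∘ e) h' = lfChain hD σ h := by
  refine Subtype.ext (funext fun L => ?_)
  exact finsum_comp_equiv e (f := fun i => (chainsIn (D L) n).mkQ (Finsupp.single (σ i) 1))

/-- The singular segment traced out by a map on the real line. -/
def seg (f : ℝ → X) (hf : Continuous f) : Simplex X 1 :=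
  ⟨fun s => f (s 1), hf.comp ((continuous_apply 1).comp continuous_subtype_val)⟩

/-- The singular triangle traced out by a map on the plane. -/
def tri (h : ℝ × ℝ → X) (hh : Continuous h) : Simplex X 2 :=
  ⟨fun s => h (s 1, s 2), hh.comp (((continuous_apply 1).comp continuous_subtype_val).prodMk
    ((continuous_apply 2).comp continuous_subtype_val))⟩

theorem faceMap_apply (n : ℕ) (i : Fin (n + 2)) (s : stdSimplex ℝ (Fin (n + 1)))
    (j : Fin (n + 2)) :
    (faceMap n i s) j = ∑ k : Fin (n + 1), if i.succAbove k = j then s k else 0 := by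
  change (stdSimplex.map i.succAbove s) j = _
  rw [stdSimplex.map_coe, FunOnFinite.linearMap_apply_apply, Finset.sum_filter]

theorem tri_face_zero {h : ℝ × ℝ → X} (hh : Continuous h) :
    (tri h hh).comp (faceMap 1 0) = seg (fun t => h (1 - t, t)) (by fun_prop) := by
  ext s
  change h (faceMap 1 0 s 1, faceMap 1 0 s 2) = h (1 - s 1, s 1)
  have h1 := stdSimplex.add_eq_one s
  rw [faceMap_apply, faceMap_apply, Fin.sum_univ_two, Fin.sum_univ_two]
  simp [Fin.succAbove]
  grind

theorem tri_face_one {h : ℝ × ℝ → X} (hh : Continuous h) :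
    (tri h hh).comp (faceMap 1 1) = seg (fun t => h (0, t)) (by fun_prop) := by
  ext s
  change h (faceMap 1 1 s 1, faceMap 1 1 s 2) = h (0, s 1)
  rw [faceMap_apply, faceMap_apply, Fin.sum_univ_two, Fin.sum_univ_two]
  simp [Fin.succAbove]

theorem tri_face_two {h : ℝ × ℝ → X} (hh : Continuous h) :
    (tri h hh).comp (faceMap 1 2) = seg (fun t => h (t, 0)) (by fun_prop) := by
  ext s
  change h (faceMap 1 2 s 1, faceMap 1 2 s 2) = h (s 1, 0)
  rw [faceMap_apply, faceMap_apply, Fin.sum_univ_two, Fin.sum_univ_two]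
  simp [Fin.succAbove]

/-- Congruence of limit chains modulo boundaries. -/
def Homologous (a b : limChain D hD 1) : Prop := a - b ∈ LinearMap.range (limBoundary D hD 1)

theorem cls_eq_cls {f g : RelCurve D} (e : Homologous hD (f.chain hD) (g.chain hD)) :
    f.cls hD = g.cls hD :=
  (Submodule.Quotient.eq _).2 e

theorem cls_eq_zero {f : RelCurve D} (e : f.chain hD ∈ LinearMap.range (limBoundary D hD 1)) :
    f.cls hD = 0 :=
  (Submodule.Quotient.mk_eq_zero _).2 e

theorem LocFin.face {ι : Type} {n : ℕ} {σ : ι → Simplex X (n + 1)} (h : LocFin D σ)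
    (j : Fin (n + 2)) : LocFin D fun i => (σ i).comp (faceMap n j) := by
  intro L
  refine (h L).subset fun i hi hi' => hi ?_
  rintro _ ⟨x, rfl⟩
  exact hi' ⟨_, rfl⟩

/-- For each `L` only finitely many terms survive, so the boundary is taken term by term; the
families of faces are again locally finite. -/
theorem limBoundary_lfChain {ι : Type} {σ : ι → Simplex X 2} (h : LocFin D σ) :
    limBoundary D hD 1 (lfChain hD σ h) =
      lfChain hD _ (h.face 0) - lfChain hD _ (h.face 1) + lfChain hD _ (h.face 2) := by
  refine Subtype.ext (funext fun L => ?_)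
  change relBoundary (D L) 1 (∑ᶠ i, (chainsIn (D L) 2).mkQ (Finsupp.single (σ i) 1)) =
    (lfChain hD _ (h.face 0)).1 L - (lfChain hD _ (h.face 1)).1 L + (lfChain hD _ (h.face 2)).1 L
  have h2 := AddMonoidHom.map_finsum (relBoundary (D L) 1).toAddMonoidHom (h.support L)
  refine h2.trans ?_
  simp only [lfChain_apply]
  rw [← finsum_sub_distrib ((h.face 0).support L) ((h.face 1).support L),
    ← finsum_add_distrib (f := fun i => _ - _)
      (Function.HasFiniteSupport.sub ((h.face 0).support L) ((h.face 1).support L))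
      ((h.face 2).support L)]
  refine finsum_congr fun i => ?_
  change (chainsIn (D L) 1).mkQ (boundary X 1 (Finsupp.single (σ i) 1)) = _
  rw [boundary_single, Fin.sum_univ_three]
  simp [sub_eq_add_neg]

/-- The source of all boundaries used below: a homotopy is entered as a family of triangles, and the
signed sum of its three families of edges is null. -/
theorem lfChain_tri {ι : Type} (h : ι → ℝ × ℝ → X) (hh : ∀ i, Continuous (h i))
    (hl : ∀ L, {i | ¬ ∀ a b : ℝ, 0 ≤ a → 0 ≤ b → a + b ≤ 1 → h i (a, b) ∈ D L}.Finite) :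
    ∃ (l0 : LocFin D fun i => seg (fun t => h i (1 - t, t)) (by fun_prop))
      (l1 : LocFin D fun i => seg (fun t => h i (0, t)) (by fun_prop))
      (l2 : LocFin D fun i => seg (fun t => h i (t, 0)) (by fun_prop)),
      lfChain hD _ l0 - lfChain hD _ l1 + lfChain hD _ l2
        ∈ LinearMap.range (limBoundary D hD 1) := by
  have key : LocFin D fun i => tri (h i) (hh i) := by
    intro L
    refine (hl L).subset fun i hi hi' => hi ?_
    rintro _ ⟨s, rfl⟩
    refine hi' _ _ (s.2.1 1) (s.2.1 2) ?_
    have h1 := s.2.2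
    rw [Fin.sum_univ_three] at h1
    have := s.2.1 0
    change s.1 1 + s.1 2 ≤ 1
    linarith
  have l0 := key.face 0
  have l1 := key.face 1
  have l2 := key.face 2
  have e := limBoundary_lfChain hD key
  simp only [tri_face_zero, tri_face_one, tri_face_two] at l0 l1 l2 e
  exact ⟨l0, l1, l2, _, e⟩

theorem RelCurve.locFin (γ : RelCurve D) : LocFin D γ.piece := by
  intro L
  obtain ⟨N, hN⟩ := γ.exists_nat_bound L
  refine (Finset.Icc (-N) N).finite_toSet.subset fun k hk => ?_
  by_contra hk'
  refine hk ?_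
  rintro _ ⟨s, rfl⟩
  exact hN k hk' _ (RelCurve.simplex_coord_nonneg s) (RelCurve.simplex_coord_le_one s)

theorem finite_int_of_bounded {p : ℤ → Prop} {T : ℝ}
    (h : ∀ k : ℤ, T + 1 ≤ |(k : ℝ)| → ¬ p k) : {k | p k}.Finite := by
  refine (Set.finite_Icc (-⌈T + 1⌉) ⌈T + 1⌉).subset fun k hk => ?_
  by_contra hk'
  refine h k ?_ hk
  rw [Set.mem_Icc, ← abs_le, not_le] at hk'
  have h1 := Int.le_ceil (T + 1)
  have h2 : (⌈T + 1⌉ : ℝ) < |(k : ℝ)| := by exact_mod_cast hk'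
  linarith

/-- Homotopic curves, with ends that stay in the sets `D L`, have the same class. -/
theorem cls_homotopy (H : ℝ × ℝ → X) (hH : Continuous H)
    (hend : ∀ L, ∃ T, ∀ t u : ℝ, T ≤ |t| → 0 ≤ u → u ≤ 1 → H (t, u) ∈ D L)
    (f g : RelCurve D) (hf : ∀ t, f.toFun t = H (t, 0)) (hg : ∀ t, g.toFun t = H (t, 1)) :
    f.cls hD = g.cls hD := by
  have fin : ∀ L, {k : ℤ | ¬ ∀ a b : ℝ, 0 ≤ a → a ≤ 1 → 0 ≤ b → b ≤ 1 →
      H (k + a, b) ∈ D L}.Finite := by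
    intro L
    obtain ⟨T, hT⟩ := hend L
    refine finite_int_of_bounded (T := T) fun k hk => not_not.2 fun a b ha ha' hb hb' => ?_
    refine hT _ _ ?_ hb hb'
    have := abs_sub_abs_le_abs_sub (k : ℝ) (-a)
    rw [sub_neg_eq_add, abs_neg, abs_of_nonneg ha] at this
    linarith
  -- The square `[k, k+1] × [0, 1]` is cut along its diagonal. This triangle has the corners `(k,
  -- 0)`, `(k+1, 0)`, `(k+1, 1)`, the next one `(k, 0)`, `(k, 1)`, `(k+1, 1)`.
  obtain ⟨a0, a1, a2, ha⟩ := lfChain_tri hD (fun (k : ℤ) (q : ℝ × ℝ) => H (k + (q.1 + q.2), q.2))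
    (fun k => by fun_prop) (fun L => (fin L).subset fun k hk hk' => hk
      fun a b h1 h2 h3 => hk' _ _ (by linarith) (by linarith) h2 (by linarith))
  obtain ⟨b0, b1, b2, hb⟩ := lfChain_tri hD (fun (k : ℤ) (q : ℝ × ℝ) => H (k + q.2, q.1 + q.2))
    (fun k => by fun_prop) (fun L => (fin L).subset fun k hk hk' => hk
      fun a b h1 h2 h3 => hk' _ _ (by linarith) (by linarith) (by linarith) (by linarith))
  have e1 : lfChain hD _ a1 = lfChain hD _ b1 := lfChain_congr hD _ _ fun k => by
    ext s; simp [seg]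
  have e2 : lfChain hD _ a2 = f.chain hD := lfChain_congr hD _ f.locFin fun k => by
    ext s; simp [seg, RelCurve.piece, hf]
  have e3 : lfChain hD _ b0 = g.chain hD := lfChain_congr hD _ g.locFin fun k => by
    ext s; simp [seg, RelCurve.piece, hg]
  -- The right side of square `k` is the left side of square `k + 1`, so the vertical edges cancel
  -- after a shift of the index.
  have e4 : lfChain hD _ a0 = lfChain hD _ b2 := by
    have e : ∀ k : ℤ, seg (fun t => H (k + (1 - t + t), t)) (by fun_prop) =
      ((fun k : ℤ => seg (fun t => H (k + 0, t + 0)) (by fun_prop)) ∘ Equiv.addRight (1 : ℤ)) k := by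
      intro k
      ext s
      simp [seg]
    have l := a0
    simp only [e] at l
    exact (lfChain_congr hD a0 l e).trans (lfChain_equiv hD b2 _ l)
  refine cls_eq_cls hD ?_
  have := Submodule.sub_mem _ ha hb
  rw [e1, e2, e3, e4] at this
  change _ - _ ∈ _
  convert this using 1
  abel

/-- Separates the pieces of a curve before and after time `0`, so that `cls_even` can pair the piece
over `[n, n+1]` with the one over `[-n-1, -n]`. -/
theorem finsum_int {M : Type*} [AddCommMonoid M] {F : ℤ → M} (h : Function.HasFiniteSupport F) :
    ∑ᶠ k, F k = (∑ᶠ n : ℕ, F n) + ∑ᶠ n : ℕ, F (Int.negSucc n) := by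
  rw [← finsum_mem_univ, show (Set.univ : Set ℤ) = Set.range (fun n : ℕ => (n : ℤ)) ∪
    Set.range Int.negSucc from ?_, finsum_mem_union' ?_ (h.subset (by simp)) (h.subset (by simp)),
    finsum_mem_range Nat.cast_injective, finsum_mem_range (fun a b h => by simpa using h)]
  · rw [Set.disjoint_left]
    rintro _ ⟨a, rfl⟩ ⟨b, hb⟩
    simp at hb
  · refine (Set.eq_univ_of_forall fun k => ?_).symm
    cases k with
    | ofNat n => exact Or.inl ⟨n, rfl⟩
    | negSucc n => exact Or.inr ⟨n, rfl⟩

/-- A curve that runs back along itself has class zero. -/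
theorem cls_even (f : RelCurve D) (h : ∀ t, f.toFun (-t) = f.toFun t) : f.cls hD = 0 := by
  have fin : ∀ L, {k : ℕ | ¬ ∀ a : ℝ, 0 ≤ a → a ≤ 1 → f.toFun (k + a) ∈ D L}.Finite := by
    intro L
    obtain ⟨N, hN⟩ := f.exists_nat_bound L
    refine (Set.finite_Iic N.toNat).subset fun k hk => ?_
    by_contra hk'
    refine hk fun a ha ha' => ?_
    have := hN k (fun hc => hk' ?_) a ha ha'
    · exact_mod_cast this
    · rw [Finset.mem_Icc] at hc
      simp only [Set.mem_Iic]
      omega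
  have hc := f.continuous_toFun
  -- A triangle collapsed along its second coordinate has as edges a piece of `f`, the reversed
  -- piece and a constant. The constant triangles of the next family remove the constant edge.
  obtain ⟨a0, a1, a2, ha⟩ := lfChain_tri hD (fun (k : ℕ) (q : ℝ × ℝ) => f.toFun (k + q.1))
    (fun k => by fun_prop) (fun L => (fin L).subset fun k hk hk' => hk
      fun a b h1 h2 h3 => hk' _ (by linarith) (by linarith))
  obtain ⟨b0, b1, b2, hb⟩ := lfChain_tri hD (fun (k : ℕ) (q : ℝ × ℝ) => f.toFun (k + 0))
    (fun k => by fun_prop) (fun L => (fin L).subset fun k hk hk' => hk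
      fun a b h1 h2 h3 => hk' _ (by linarith) (by linarith))
  have e1 : lfChain hD _ a1 = lfChain hD _ b1 := rfl
  have e2 : lfChain hD _ b0 = lfChain hD _ b2 := rfl
  have e3 : lfChain hD _ b1 = lfChain hD _ b2 := rfl
  have e4 : f.chain hD = lfChain hD _ a2 + lfChain hD _ a0 := by
    refine Subtype.ext (funext fun L => ?_)
    refine (finsum_int (f.finite_piece L)).trans ?_
    change _ = (lfChain hD _ a2).1 L + (lfChain hD _ a0).1 L
    rw [lfChain_apply, lfChain_apply]
    congr 1
    refine finsum_congr fun n => ?_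
    congr 2
    ext s
    change f.toFun ((Int.negSucc n : ℤ) + s 1) = f.toFun (n + (1 - s 1))
    rw [← h]
    congr 1
    push_cast
    ring
  refine cls_eq_zero hD ?_
  have := Submodule.add_mem _ ha hb
  rw [e1, e2, e3] at this
  rw [e4]
  convert this using 1
  abel

/-- Inserting a ray and its inverse at time `0` cuts a curve into two. -/
theorem cls_concat (f g h : RelCurve D) (h1 : ∀ t ≤ 0, f.toFun t = h.toFun t)
    (h2 : ∀ t, 0 ≤ t → g.toFun t = h.toFun t) (h3 : ∀ t, 0 ≤ t → g.toFun (-t) = f.toFun t) :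
    h.cls hD = f.cls hD + g.cls hD := by
  -- `e` comes in along the ray by which `f` leaves and runs out again. Piece by piece, `h + e` and
  -- `f + g` consist of the same simplices.
  let e : RelCurve D :=
    ⟨fun t => f.toFun |t|, f.continuous_toFun.comp continuous_abs, fun L => by
      obtain ⟨T, hT⟩ := f.ends_mem L
      exact ⟨T, fun t ht => hT _ (by rwa [abs_abs])⟩⟩
  have he : e.cls hD = 0 := cls_even hD e fun t => by simp [e]
  have key : h.chain hD + e.chain hD = f.chain hD + g.chain hD := by
    refine Subtype.ext (funext fun L => ?_)
    change (h.chain hD).1 L + (e.chain hD).1 L = (f.chain hD).1 L + (g.chain hD).1 L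
    simp only [RelCurve.chain]
    rw [← finsum_add_distrib (h.finite_piece L) (e.finite_piece L),
      ← finsum_add_distrib (f.finite_piece L) (g.finite_piece L)]
    refine finsum_congr fun k => ?_
    rcases le_or_gt 0 k with hk | hk
    · have hk' : (0 : ℝ) ≤ k := by exact_mod_cast hk
      rw [show g.piece k = h.piece k from ?_, show f.piece k = e.piece k from ?_, add_comm]
      · ext s
        have := RelCurve.simplex_coord_nonneg s
        simp [RelCurve.piece, e, abs_of_nonneg (add_nonneg hk' this)]
      · ext s
        have := RelCurve.simplex_coord_nonneg s
        exact h2 _ (by linarith)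
    · have hk' : (k : ℝ) + 1 ≤ 0 := by exact_mod_cast hk
      rw [show f.piece k = h.piece k from ?_, show g.piece k = e.piece k from ?_]
      · ext s
        have := RelCurve.simplex_coord_le_one s
        have h4 := h3 (-(k + s 1)) (by linarith)
        rw [neg_neg] at h4
        change g.toFun (k + s 1) = f.toFun |k + s 1|
        rw [h4, abs_of_nonpos (by linarith)]
      · ext s
        have := RelCurve.simplex_coord_le_one s
        exact h1 _ (by linarith)
  have : h.cls hD + e.cls hD = f.cls hD + g.cls hD := by
    change Submodule.Quotient.mk _ + Submodule.Quotient.mk _ =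
      Submodule.Quotient.mk _ + Submodule.Quotient.mk _
    rw [← Submodule.Quotient.mk_add, ← Submodule.Quotient.mk_add]
    congr 1
    exact Subtype.ext key
  rwa [he, add_zero] at this

/-- Reversing a curve changes the sign of its class. -/
theorem cls_reverse (f g : RelCurve D) (h : ∀ t, g.toFun t = f.toFun (-t)) :
    g.cls hD = -f.cls hD := by
  -- `f` up to time `0` followed by `g` from time `0` on; it retraces its path, hence is null.
  let e : RelCurve D :=
    ⟨fun t => f.toFun (-|t|), f.continuous_toFun.comp continuous_abs.neg, fun L => by
      obtain ⟨T, hT⟩ := f.ends_mem L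
      exact ⟨T, fun t ht => hT _ (by rwa [abs_neg, abs_abs])⟩⟩
  have he : e.cls hD = 0 := cls_even hD e fun t => by simp [e]
  have := cls_concat hD f g e (fun t ht => by simp [e, abs_of_nonpos ht])
    (fun t ht => by simp [e, abs_of_nonneg ht, h]) (fun t _ => by simp [h])
  rw [he] at this
  rw [eq_neg_iff_add_eq_zero, add_comm, ← this]

/-- The class of a curve is unchanged by a shift of the parameter. -/
theorem cls_shift (f g : RelCurve D) (c : ℝ) (h : ∀ t, g.toFun t = f.toFun (t + c)) :
    g.cls hD = f.cls hD := by
  have hc := f.continuous_toFun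
  refine (cls_homotopy hD (fun q : ℝ × ℝ => f.toFun (q.1 + q.2 * c)) (by fun_prop) (fun L => ?_)
    f g (by simp) (by simp [h])).symm
  obtain ⟨T, hT⟩ := f.ends_mem L
  refine ⟨T + |c|, fun t u ht h0 h1 => hT _ ?_⟩
  have h2 := abs_sub_abs_le_abs_sub t (-(u * c))
  rw [sub_neg_eq_add, abs_neg, abs_mul, abs_of_nonneg h0] at h2
  have : u * |c| ≤ 1 * |c| := by gcongr
  simp only at *
  linarith

end LocallyFinite

/-! ### Coordinates on the surface -/

theorem ex_im_re (z : ℂ) : (ex z).re = Real.exp (-(2 * Real.pi * z.im)) * Real.cos (2 * Real.pi * z.re) ∧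
    (ex z).im = Real.exp (-(2 * Real.pi * z.im)) * Real.sin (2 * Real.pi * z.re) := by
  rw [ex, Complex.exp_re, Complex.exp_im]
  simp

theorem norm_ex (z : ℂ) : ‖ex z‖ = Real.exp (-(2 * Real.pi * z.im)) := by
  rw [ex, Complex.norm_exp]
  simp

theorem ex_eq_ex_iff {z w : ℂ} : ex z = ex w ↔ ∃ k : ℤ, w = z + k := by
  constructor
  · intro h
    rw [ex, ex, Complex.exp_eq_exp_iff_exists_int] at h
    obtain ⟨n, hn⟩ := h
    refine ⟨-n, ?_⟩
    have h2 : (2 * Real.pi * I : ℂ) ≠ 0 := by simp [Real.pi_ne_zero]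
    apply mul_left_cancel₀ h2
    push_cast
    linear_combination -hn
  · rintro ⟨k, rfl⟩
    exact (ex_add_int z k).symm

theorem exists_ex_eq {x : ℂ} (hx : x ≠ 0) : ∃ z, ex z = x := by
  refine ⟨Complex.log x / (2 * Real.pi * I), ?_⟩
  have h2 : (2 * Real.pi * I : ℂ) ≠ 0 := by simp [Real.pi_ne_zero]
  rw [ex, mul_div_cancel₀ _ h2, Complex.exp_log hx]

/-- The cuts below the integers are where `e(z)` is real and at least `1`, that is, where `1 - e(z)`
meets the cut of the logarithm. In this form openness and invariance under integer shifts are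
immediate. -/
theorem mem_UPlus_iff {z : ℂ} : z ∈ UPlus ↔ 1 - ex z ∈ slitPlane := by
  obtain ⟨hr, hi⟩ := ex_im_re z
  have hE := Real.exp_pos (-(2 * Real.pi * z.im))
  constructor
  · intro h
    by_contra hc
    rw [Complex.mem_slitPlane_iff, not_or] at hc
    simp only [sub_re, one_re, not_lt, sub_im, one_im, zero_sub, not_not, neg_eq_zero] at hc
    obtain ⟨h1, h2⟩ := hc
    rw [hi, mul_eq_zero, or_iff_right hE.ne', Real.sin_eq_zero_iff] at h2
    obtain ⟨n, hn⟩ := h2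
    rw [hr] at h1
    have hcos : 0 < Real.cos (2 * Real.pi * z.re) := by
      by_contra hneg
      have := mul_nonpos_of_nonneg_of_nonpos hE.le (not_lt.1 hneg)
      linarith
    -- `e(z)` is real, so `2 Re z = n`; an odd `n` would make `e(z)` negative.
    rcases Int.even_or_odd' n with ⟨k, rfl | rfl⟩
    · have hre : z.re = k := by
        have := Real.pi_ne_zero
        push_cast at hn
        field_simp at hn
        linarith
      refine h k z.im ?_ (by apply Complex.ext <;> simp [hre])
      by_contra hpos
      have h3 : Real.exp (-(2 * Real.pi * z.im)) < 1 := by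
        rw [Real.exp_lt_one_iff]
        have := mul_pos Real.pi_pos (not_le.1 hpos)
        linarith
      have := Real.cos_le_one (2 * Real.pi * z.re)
      nlinarith
    · rw [← hn] at hcos
      have : ((2 * k + 1 : ℤ) : ℝ) * Real.pi = Real.pi + k * (2 * Real.pi) := by push_cast; ring
      rw [this, Real.cos_add_int_mul_two_pi, Real.cos_pi] at hcos
      linarith
  · rintro h k y hy rfl
    have h1 : ex (k + y * I) = (Real.exp (-(2 * Real.pi * y)) : ℝ) := by
      rw [add_comm, ex_add_int, ex]
      push_cast
      congr 1
      linear_combination 2 * (Real.pi : ℂ) * y * Complex.I_sq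
    rw [h1, Complex.mem_slitPlane_iff] at h
    have h2 : 1 ≤ Real.exp (-(2 * Real.pi * y)) := by
      rw [Real.one_le_exp_iff]
      have := mul_nonneg_of_nonpos_of_nonpos (neg_nonpos.2 Real.pi_pos.le) hy
      linarith
    simp only [sub_re, one_re, ofReal_re, sub_im, one_im, ofReal_im, sub_self, ne_eq,
      not_true_eq_false, or_false] at h
    linarith

theorem mem_UMinus_iff_neg {z : ℂ} : z ∈ UMinus ↔ -z ∈ UPlus := by
  constructor
  · intro h k y hy e
    refine h (-k) (-y) (by linarith) ?_
    push_cast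
    linear_combination -e
  · intro h k y hy e
    refine h (-k) (-y) (by linarith) ?_
    push_cast
    linear_combination -e

theorem mem_UMinus_iff {z : ℂ} : z ∈ UMinus ↔ 1 - ex (-z) ∈ slitPlane := by
  rw [mem_UMinus_iff_neg, mem_UPlus_iff]

theorem add_int_mem_UPlus {z : ℂ} (k : ℤ) : z + k ∈ UPlus ↔ z ∈ UPlus := by
  rw [mem_UPlus_iff, mem_UPlus_iff, ex_add_int]

theorem add_int_mem_UMinus {z : ℂ} (k : ℤ) : z + k ∈ UMinus ↔ z ∈ UMinus := by
  rw [mem_UMinus_iff_neg, mem_UMinus_iff_neg, ← add_int_mem_UPlus k (z := -(z + k))]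
  simp

theorem continuous_ex : Continuous ex := by unfold ex; fun_prop

theorem isOpen_UPlus : IsOpen UPlus := by
  have : UPlus = (fun z => 1 - ex z) ⁻¹' slitPlane := Set.ext fun z => mem_UPlus_iff
  rw [this]
  exact isOpen_slitPlane.preimage (continuous_const.sub continuous_ex)

theorem isOpen_UMinus : IsOpen UMinus := by
  have : UMinus = Neg.neg ⁻¹' UPlus := Set.ext fun z => mem_UMinus_iff_neg
  rw [this]
  exact isOpen_UPlus.preimage continuous_neg

theorem mem_UPlus_of_im_pos {z : ℂ} (h : 0 < z.im) : z ∈ UPlus := by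
  rintro k y hy rfl
  simp at h
  linarith

theorem mem_UMinus_of_im_neg {z : ℂ} (h : z.im < 0) : z ∈ UMinus := by
  rintro k y hy rfl
  simp at h
  linarith

theorem mem_UPlus_of_strip {z : ℂ} {l : ℤ} (h : (l : ℝ) - 1 < z.re) (h' : z.re < l) :
    z ∈ UPlus := by
  rintro k y - rfl
  simp at h h'
  have : l - 1 < k := by exact_mod_cast h
  omega

theorem mem_UMinus_of_strip {z : ℂ} {l : ℤ} (h : (l : ℝ) - 1 < z.re) (h' : z.re < l) :
    z ∈ UMinus := by
  rintro k y - rfl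
  simp at h h'
  have : l - 1 < k := by exact_mod_cast h
  omega

/-- The derivative of `V` in the coordinates `(z₊, m₊)`. -/
def YPlus (A B : ℕ) (z : ℂ) (m : ℤ) : ℂ :=
  -(B * Complex.log (1 - ex z)) / (2 * Real.pi * I) + A * (z + 1 / 2) + m

/-- The derivative of `V` in the coordinates `(z₋, m₋)`. -/
def YMinus (A B : ℕ) (z : ℂ) (m : ℤ) : ℂ :=
  -(B * Complex.log (1 - ex (-z))) / (2 * Real.pi * I) - B * (z - 1 / 2) + A * (z + 1 / 2) + m

theorem hasDerivAt_VPlus (A B : ℕ) {z : ℂ} (hz : z ∈ UPlus) (m : ℤ) :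
    HasDerivAt (fun w => VPlus A B w m) (YPlus A B z m) z := by
  have hpi : (2 * Real.pi * I : ℂ) ≠ 0 := by simp [Real.pi_ne_zero]
  have d1 := (hasDerivAt_dilog (mem_UPlus_iff.1 hz) (ex_ne_zero z)).comp z (hasDerivAt_ex z)
  have d2 := (((d1.const_mul (B : ℂ)).div_const ((2 * Real.pi * I) ^ 2)).add_const (B / 24 : ℂ))
  have d3 := ((hasDerivAt_id z).mul ((hasDerivAt_id z).add_const 1)).const_mul (A / 2 : ℂ)
  have d4 := (hasDerivAt_id z).const_mul (m : ℂ)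
  refine ((d2.add d3).add d4).congr_deriv ?_
  have := ex_ne_zero z
  unfold YPlus
  simp only [id]
  field_simp
  ring

theorem hasDerivAt_VMinus (A B : ℕ) {z : ℂ} (hz : z ∈ UMinus) (m : ℤ) :
    HasDerivAt (fun w => VMinus A B w m) (YMinus A B z m) z := by
  have hpi : (2 * Real.pi * I : ℂ) ≠ 0 := by simp [Real.pi_ne_zero]
  have d1 := (hasDerivAt_dilog (mem_UMinus_iff.1 hz) (ex_ne_zero (-z))).comp z
    ((hasDerivAt_ex (-z)).comp z (hasDerivAt_neg z))
  have d2 := (((d1.const_mul (B : ℂ)).neg.div_const ((2 * Real.pi * I) ^ 2)).add_const (B / 12 : ℂ))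
  have d5 := (((hasDerivAt_id z).sub_const (1 / 2)).pow 2).const_mul (B / 2 : ℂ)
  have d3 := ((hasDerivAt_id z).mul ((hasDerivAt_id z).add_const 1)).const_mul (A / 2 : ℂ)
  have d4 := (hasDerivAt_id z).const_mul (m : ℂ)
  refine (((d2.sub d5).add d3).add d4).congr_deriv ?_
  have := ex_ne_zero (-z)
  unfold YMinus
  simp only [id]
  field_simp
  ring

theorem hasDerivAt_YPlus (A B : ℕ) {z : ℂ} (hz : z ∈ UPlus) (m : ℤ) :
    HasDerivAt (fun w => YPlus A B w m) (A + B * (ex z / (1 - ex z))) z := by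
  have hpi : (2 * Real.pi * I : ℂ) ≠ 0 := by simp [Real.pi_ne_zero]
  have hs := mem_UPlus_iff.1 hz
  have d1 := ((hasDerivAt_ex z).const_sub 1).clog hs
  have d2 := ((d1.const_mul (B : ℂ)).neg.div_const (2 * Real.pi * I))
  have d3 := ((hasDerivAt_id z).add_const (1 / 2)).const_mul (A : ℂ)
  refine ((d2.add d3).add_const (m : ℂ)).congr_deriv ?_
  have := slitPlane_ne_zero hs
  field_simp
  ring

theorem hasDerivAt_YMinus (A B : ℕ) {z : ℂ} (hz : z ∈ UMinus) (m : ℤ) :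
    HasDerivAt (fun w => YMinus A B w m) (A + B * (ex z / (1 - ex z))) z := by
  have hpi : (2 * Real.pi * I : ℂ) ≠ 0 := by simp [Real.pi_ne_zero]
  have hs := mem_UMinus_iff.1 hz
  have d1 := (((hasDerivAt_ex (-z)).comp z (hasDerivAt_neg z)).const_sub 1).clog hs
  have d2 := ((d1.const_mul (B : ℂ)).neg.div_const (2 * Real.pi * I))
  have d3 := ((hasDerivAt_id z).add_const (1 / 2)).const_mul (A : ℂ)
  have d5 := ((hasDerivAt_id z).sub_const (1 / 2)).const_mul (B : ℂ)
  refine (((d2.sub d5).add d3).add_const (m : ℂ)).congr_deriv ?_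
  have h0 := slitPlane_ne_zero hs
  have h1 := ex_ne_zero z
  rw [ex_neg] at h0
  have h2 : 1 - ex z ≠ 0 := by
    intro h
    apply h0
    rw [← sub_eq_zero.1 h]
    simp
  have e : (1 - (ex z)⁻¹) = -(1 - ex z) / ex z := by field_simp; ring
  simp only [Function.comp_apply, ex_neg, e]
  field_simp
  ring

/-- The derivative of `VPlus_sub_VMinus`: the identity `log_one_sub_ex` takes the place of the
inversion of the dilogarithm. The difference of the two sides of that formula is a constant, so here
no constant is left. -/
theorem YPlus_eq_YMinus (A B : ℕ) {z : ℂ} (h1 : z ∈ UPlus) (h2 : z ∈ UMinus) (m : ℤ) :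
    YPlus A B z m = YMinus A B z (m + B * ⌊z.re⌋) := by
  set k : ℤ := ⌊z.re⌋ with hk
  have hne : (k : ℝ) ≠ z.re := by
    intro h
    have hz : z = k + z.im * I := by
      apply Complex.ext <;> simp [h]
    rcases le_total z.im 0 with hy | hy
    · exact h1 k z.im hy hz
    · exact h2 k z.im hy hz
  have hlt : (k : ℝ) < z.re := lt_of_le_of_ne (Int.floor_le _) hne
  have hlt' : z.re < k + 1 := Int.lt_floor_add_one _
  have hinv := log_one_sub_ex (z := z - k) (by simp; linarith) (by simp; linarith)
  have e1 : ex (z - k) = ex z := by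
    have := ex_add_int z (-k)
    push_cast at this
    rwa [← sub_eq_add_neg] at this
  have e2 : ex (-(z - k)) = ex (-z) := by rw [ex_neg, e1, ex_neg]
  rw [e1, e2, sub_eq_iff_eq_add] at hinv
  have hpi : (Real.pi : ℂ) ≠ 0 := by exact_mod_cast Real.pi_ne_zero
  unfold YPlus YMinus
  rw [hinv]
  have := I_ne_zero
  push_cast
  field_simp
  ring

/-- The function `e(z)` on the surface. -/
def xc {A B : ℕ} : Surf A B → ℂ :=
  Quot.lift (fun p => match p with
    | Sum.inl (z, _) => ex z
    | Sum.inr (z, _) => ex z) (by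
    intro a b hab
    cases hab with
    | shift_plus z w m h => simpa [h] using (ex_add_int z 1).symm
    | shift_minus z w m h => simpa [h] using (ex_add_int z 1).symm
    | glue z w m h => simp [h])

/-- The derivative `dV/dz` as a function on the surface. -/
def yc {A B : ℕ} : Surf A B → ℂ :=
  Quot.lift (fun p => match p with
    | Sum.inl (z, m) => YPlus A B z m
    | Sum.inr (z, m) => YMinus A B z m) (by
    intro a b hab
    cases hab with
    | shift_plus z w m h =>
      have e : ex (z + 1) = ex z := by simpa using ex_add_int z 1
      simp only [h, YPlus, e]; push_cast; ring
    | shift_minus z w m h =>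
      have e : ex (-((z : ℂ) + 1)) = ex (-z) := by
        have := ex_add_int (-((z : ℂ) + 1)) 1
        rw [← this]; congr 1; push_cast; ring
      simp only [h, YMinus, e]; push_cast; ring
    | glue z w m h =>
      have := YPlus_eq_YMinus A B z.2 (h ▸ w.2) m
      simp only [h, this])

theorem continuous_YPlus (A B : ℕ) (m : ℤ) : ContinuousOn (fun z => YPlus A B z m) UPlus :=
  fun _ hz => (hasDerivAt_YPlus A B hz m).continuousAt.continuousWithinAt

theorem continuous_YMinus (A B : ℕ) (m : ℤ) : ContinuousOn (fun z => YMinus A B z m) UMinus :=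
  fun _ hz => (hasDerivAt_YMinus A B hz m).continuousAt.continuousWithinAt

theorem continuous_xc {A B : ℕ} : Continuous (xc : Surf A B → ℂ) := by
  refine continuous_quot_lift _ (continuous_sum_dom.2 ⟨?_, ?_⟩)
  · exact continuous_ex.comp (continuous_subtype_val.comp continuous_fst)
  · exact continuous_ex.comp (continuous_subtype_val.comp continuous_fst)

theorem continuous_yc {A B : ℕ} : Continuous (yc : Surf A B → ℂ) := by
  refine continuous_quot_lift _ (continuous_sum_dom.2 ⟨?_, ?_⟩)
  · refine continuous_prod_of_discrete_right.2 fun m => ?_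
    exact (continuousOn_iff_continuous_domRestrict.1 (continuous_YPlus A B m))
  · refine continuous_prod_of_discrete_right.2 fun m => ?_
    exact (continuousOn_iff_continuous_domRestrict.1 (continuous_YMinus A B m))

theorem IsPlusPt.xc_eq {A B : ℕ} {p : Surf A B} {z : ℂ} {m : ℤ} (h : IsPlusPt p z m) :
    xc p = ex z := by obtain ⟨_, rfl⟩ := h; rfl

theorem IsPlusPt.yc_eq {A B : ℕ} {p : Surf A B} {z : ℂ} {m : ℤ} (h : IsPlusPt p z m) :
    yc p = YPlus A B z m := by obtain ⟨_, rfl⟩ := h; rfl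

theorem IsPlusPt.vol_eq {A B : ℕ} {p : Surf A B} {z : ℂ} {m : ℤ} (h : IsPlusPt p z m) :
    vol A B p = modZ (VPlus A B z m) := by obtain ⟨_, rfl⟩ := h; rfl

theorem IsMinusPt.xc_eq {A B : ℕ} {p : Surf A B} {z : ℂ} {m : ℤ} (h : IsMinusPt p z m) :
    xc p = ex z := by obtain ⟨_, rfl⟩ := h; rfl

theorem IsMinusPt.yc_eq {A B : ℕ} {p : Surf A B} {z : ℂ} {m : ℤ} (h : IsMinusPt p z m) :
    yc p = YMinus A B z m := by obtain ⟨_, rfl⟩ := h; rfl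

theorem IsMinusPt.vol_eq {A B : ℕ} {p : Surf A B} {z : ℂ} {m : ℤ} (h : IsMinusPt p z m) :
    vol A B p = modZ (VMinus A B z m) := by obtain ⟨_, rfl⟩ := h; rfl

theorem IsPlusPt.unique {A B : ℕ} {p q : Surf A B} {z : ℂ} {m : ℤ} (h : IsPlusPt p z m)
    (h' : IsPlusPt q z m) : p = q := by obtain ⟨_, rfl⟩ := h; obtain ⟨_, rfl⟩ := h'; rfl

theorem IsMinusPt.unique {A B : ℕ} {p q : Surf A B} {z : ℂ} {m : ℤ} (h : IsMinusPt p z m)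
    (h' : IsMinusPt q z m) : p = q := by obtain ⟨_, rfl⟩ := h; obtain ⟨_, rfl⟩ := h'; rfl

theorem IsPlusPt.succ {A B : ℕ} {p : Surf A B} {z : ℂ} {m : ℤ} :
    IsPlusPt p z m ↔ IsPlusPt p (z + 1) (m - A) := by
  have hz : z + 1 ∈ UPlus ↔ z ∈ UPlus := by simpa using add_int_mem_UPlus (z := z) 1
  constructor
  · rintro ⟨h, rfl⟩
    refine ⟨hz.2 h, ?_⟩
    simpa using Quot.sound (SurfRel.shift_plus (A := A) (B := B) ⟨z, h⟩ ⟨z + 1, hz.2 h⟩ (m - A) rfl)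
  · rintro ⟨h, rfl⟩
    refine ⟨hz.1 h, ?_⟩
    simpa using (Quot.sound (SurfRel.shift_plus (A := A) (B := B) ⟨z, hz.1 h⟩ ⟨z + 1, h⟩
      (m - A) rfl)).symm

theorem IsMinusPt.succ {A B : ℕ} {p : Surf A B} {z : ℂ} {m : ℤ} :
    IsMinusPt p z m ↔ IsMinusPt p (z + 1) (m - (A - B)) := by
  have hz : z + 1 ∈ UMinus ↔ z ∈ UMinus := by simpa using add_int_mem_UMinus (z := z) 1
  have e : m - (A - B) + A - B = m := by ring
  constructor
  · rintro ⟨h, rfl⟩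
    refine ⟨hz.2 h, ?_⟩
    have := Quot.sound (SurfRel.shift_minus (A := A) (B := B) ⟨z, h⟩ ⟨z + 1, hz.2 h⟩
      (m - (A - B)) rfl)
    rwa [e] at this
  · rintro ⟨h, rfl⟩
    refine ⟨hz.1 h, ?_⟩
    have := (Quot.sound (SurfRel.shift_minus (A := A) (B := B) ⟨z, hz.1 h⟩ ⟨z + 1, h⟩
      (m - (A - B)) rfl)).symm
    rwa [e] at this

theorem IsPlusPt.shift {A B : ℕ} {p : Surf A B} {z : ℂ} {m : ℤ} (h : IsPlusPt p z m) (k : ℤ) :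
    IsPlusPt p (z + k) (m - A * k) := by
  induction k using Int.induction_on with
  | zero => simpa using h
  | succ i ih =>
    rw [IsPlusPt.succ] at ih
    convert ih using 1 <;> push_cast <;> ring
  | pred i ih =>
    rw [IsPlusPt.succ]
    convert ih using 1 <;> push_cast <;> ring

theorem IsMinusPt.shift {A B : ℕ} {p : Surf A B} {z : ℂ} {m : ℤ} (h : IsMinusPt p z m) (k : ℤ) :
    IsMinusPt p (z + k) (m - (A - B) * k) := by
  induction k using Int.induction_on with
  | zero => simpa using h
  | succ i ih =>
    rw [IsMinusPt.succ] at ih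
    convert ih using 1 <;> push_cast <;> ring
  | pred i ih =>
    rw [IsMinusPt.succ]
    convert ih using 1 <;> push_cast <;> ring

theorem IsPlusPt.toMinus {A B : ℕ} {p : Surf A B} {z : ℂ} {m : ℤ} (h : IsPlusPt p z m)
    (hz : z ∈ UMinus) : IsMinusPt p z (m + B * ⌊z.re⌋) := by
  obtain ⟨h, rfl⟩ := h
  exact ⟨hz, Quot.sound (SurfRel.glue _ _ _ rfl)⟩

theorem IsMinusPt.toPlus {A B : ℕ} {p : Surf A B} {z : ℂ} {m : ℤ} (h : IsMinusPt p z m)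
    (hz : z ∈ UPlus) : IsPlusPt p z (m - B * ⌊z.re⌋) := by
  obtain ⟨h, rfl⟩ := h
  refine ⟨hz, ?_⟩
  have := Quot.sound (SurfRel.glue (A := A) (B := B) ⟨z, hz⟩ ⟨z, h⟩ (m - B * ⌊z.re⌋) rfl)
  simpa using this.symm

theorem exists_isPlusPt {A B : ℕ} {p : Surf A B} {z : ℂ} (hz : z ∈ UPlus) (h : xc p = ex z) :
    ∃ m, IsPlusPt p z m := by
  induction p using Quot.ind with | mk a =>
  rcases a with ⟨w, n⟩ | ⟨w, n⟩
  · obtain ⟨k, rfl⟩ := ex_eq_ex_iff.1 h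
    exact ⟨_, IsPlusPt.shift ⟨w.2, rfl⟩ k⟩
  · obtain ⟨k, rfl⟩ := ex_eq_ex_iff.1 h
    have : IsMinusPt (Quot.mk (SurfRel A B) (Sum.inr (w, n))) w n := ⟨w.2, rfl⟩
    exact ⟨_, (this.toPlus ((add_int_mem_UPlus k).1 hz)).shift k⟩

theorem exists_isMinusPt {A B : ℕ} {p : Surf A B} {z : ℂ} (hz : z ∈ UMinus) (h : xc p = ex z) :
    ∃ m, IsMinusPt p z m := by
  induction p using Quot.ind with | mk a =>
  rcases a with ⟨w, n⟩ | ⟨w, n⟩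
  · obtain ⟨k, rfl⟩ := ex_eq_ex_iff.1 h
    have : IsPlusPt (Quot.mk (SurfRel A B) (Sum.inl (w, n))) w n := ⟨w.2, rfl⟩
    exact ⟨_, (this.toMinus ((add_int_mem_UMinus k).1 hz)).shift k⟩
  · obtain ⟨k, rfl⟩ := ex_eq_ex_iff.1 h
    exact ⟨_, IsMinusPt.shift ⟨w.2, rfl⟩ k⟩

/-! ### The two kinds of charts, treated together -/

/-- The domain of the coordinate `z₊` (`true`) or `z₋` (`false`). -/
def dom : Bool → Set ℂ
  | true => UPlus
  | false => UMinus

/-- `p` has coordinates `(z₊, m₊) = (z, m)`, respectively `(z₋, m₋) = (z, m)`. -/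
def IsPt {A B : ℕ} : Bool → Surf A B → ℂ → ℤ → Prop
  | true => IsPlusPt
  | false => IsMinusPt

/-- The function `V` in either chart. -/
def Vc (A B : ℕ) : Bool → ℂ → ℤ → ℂ
  | true => VPlus A B
  | false => VMinus A B

/-- The derivative of `V` in either chart. -/
def Yc (A B : ℕ) : Bool → ℂ → ℤ → ℂ
  | true => YPlus A B
  | false => YMinus A B

/-- The shift of the sheets that corresponds to `z ↦ z + 1`. -/
def per (A B : ℕ) : Bool → ℤ
  | true => A
  | false => A - B

theorem per_ne_zero {A B : ℕ} (hA : 0 < A) (hAB : A ≠ B) (σ : Bool) : per A B σ ≠ 0 := by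
  cases σ <;> simp only [per] <;> omega

theorem isOpen_dom (σ : Bool) : IsOpen (dom σ) := by
  cases σ
  exacts [isOpen_UMinus, isOpen_UPlus]

theorem hasDerivAt_Vc (A B : ℕ) {σ : Bool} {z : ℂ} (hz : z ∈ dom σ) (m : ℤ) :
    HasDerivAt (fun w => Vc A B σ w m) (Yc A B σ z m) z := by
  cases σ
  exacts [hasDerivAt_VMinus A B hz m, hasDerivAt_VPlus A B hz m]

theorem hasDerivAt_Yc (A B : ℕ) {σ : Bool} {z : ℂ} (hz : z ∈ dom σ) (m : ℤ) :
    HasDerivAt (fun w => Yc A B σ w m) (A + B * (ex z / (1 - ex z))) z := by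
  cases σ
  exacts [hasDerivAt_YMinus A B hz m, hasDerivAt_YPlus A B hz m]

/-- The sheet number enters `dV/dz` as an additive integer; hence `dV/dz` distinguishes the sheets
over a given `z`. -/
theorem Yc_add (A B : ℕ) (σ : Bool) (z : ℂ) (m n : ℤ) :
    Yc A B σ z (m + n) = Yc A B σ z m + n := by
  cases σ <;> simp only [Yc, YMinus, YPlus] <;> push_cast <;> ring

section

variable {A B : ℕ} {σ : Bool} {p q : Surf A B} {z w : ℂ} {m n : ℤ}

theorem IsPt.mem_dom (h : IsPt σ p z m) : z ∈ dom σ := by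
  cases σ
  exacts [h.1, h.1]

theorem IsPt.xc_eq (h : IsPt σ p z m) : xc p = ex z := by
  cases σ
  exacts [IsMinusPt.xc_eq h, IsPlusPt.xc_eq h]

theorem IsPt.yc_eq (h : IsPt σ p z m) : yc p = Yc A B σ z m := by
  cases σ
  exacts [IsMinusPt.yc_eq h, IsPlusPt.yc_eq h]

theorem IsPt.vol_eq (h : IsPt σ p z m) : vol A B p = modZ (Vc A B σ z m) := by
  cases σ
  exacts [IsMinusPt.vol_eq h, IsPlusPt.vol_eq h]

theorem IsPt.unique (h : IsPt σ p z m) (h' : IsPt σ q z m) : p = q := by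
  cases σ
  exacts [IsMinusPt.unique h h', IsPlusPt.unique h h']

theorem IsPt.shift (h : IsPt σ p z m) (k : ℤ) : IsPt σ p (z + k) (m - per A B σ * k) := by
  cases σ
  exacts [IsMinusPt.shift h k, IsPlusPt.shift h k]

theorem exists_isPt (hz : z ∈ dom σ) (h : xc p = ex z) : ∃ m, IsPt σ p z m := by
  cases σ
  exacts [exists_isMinusPt hz h, exists_isPlusPt hz h]

theorem exists_chart (p : Surf A B) : ∃ σ z m, IsPt σ p z m := by
  induction p using Quot.ind with | mk a =>
  rcases a with ⟨w, n⟩ | ⟨w, n⟩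
  · exact ⟨true, w, n, w.2, rfl⟩
  · exact ⟨false, w, n, w.2, rfl⟩

theorem IsPt.sheet_unique (h : IsPt σ p z m) (h' : IsPt σ p z n) : n = m := by
  have h1 := h'.yc_eq
  rw [h.yc_eq, show n = m + (n - m) by ring, Yc_add] at h1
  have h2 : ((n - m : ℤ) : ℂ) = 0 := by linear_combination -h1
  have h3 : n - m = 0 := by exact_mod_cast h2
  omega

theorem IsPt.exists_shift (h : IsPt σ p z m) (h' : IsPt σ p w n) :
    ∃ k : ℤ, w = z + k ∧ n = m - per A B σ * k := by
  obtain ⟨k, rfl⟩ := ex_eq_ex_iff.1 (h.xc_eq.symm.trans h'.xc_eq)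
  exact ⟨k, rfl, (h.shift k).sheet_unique h'⟩

/-- A shift of `z` by `k` changes the sheet by `per * k`, and `per ≠ 0` because `A > 0` and `A ≠ B`.
-/
theorem IsPt.coord_unique (hA : 0 < A) (hAB : A ≠ B) (h : IsPt σ p z m) (h' : IsPt σ p w m) :
    w = z := by
  obtain ⟨k, rfl, hk⟩ := h.exists_shift h'
  have : per A B σ * k = 0 := by omega
  rcases mul_eq_zero.1 this with h0 | rfl
  · exact absurd h0 (per_ne_zero hA hAB σ)
  · simp

end

/-- The point with given coordinates, with an irrelevant value outside the domain of the chart. -/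
def pt {A B : ℕ} (σ : Bool) (m : ℤ) (z : ℂ) : Surf A B := by
  classical
  exact match σ with
    | true => if h : z ∈ UPlus then Quot.mk _ (Sum.inl (⟨z, h⟩, m))
        else Quot.mk _ (Sum.inl (⟨I, mem_UPlus_of_im_pos (by simp)⟩, 0))
    | false => if h : z ∈ UMinus then Quot.mk _ (Sum.inr (⟨z, h⟩, m))
        else Quot.mk _ (Sum.inl (⟨I, mem_UPlus_of_im_pos (by simp)⟩, 0))

theorem isPt_pt {A B : ℕ} {σ : Bool} {z : ℂ} (hz : z ∈ dom σ) (m : ℤ) :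
    IsPt σ (pt σ m z : Surf A B) z m := by
  cases σ
  · exact ⟨hz, dif_pos hz⟩
  · exact ⟨hz, dif_pos hz⟩

theorem IsPt.eq_pt {A B : ℕ} {σ : Bool} {p : Surf A B} {z : ℂ} {m : ℤ} (h : IsPt σ p z m) :
    p = pt σ m z := h.unique (isPt_pt h.mem_dom m)

theorem pt_shift {A B : ℕ} {σ : Bool} {z : ℂ} (hz : z ∈ dom σ) (m k : ℤ) :
    (pt σ m z : Surf A B) = pt σ (m - per A B σ * k) (z + k) :=
  ((isPt_pt hz m).shift k).eq_pt

theorem continuousOn_pt {A B : ℕ} (σ : Bool) (m : ℤ) :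
    ContinuousOn (pt σ m : ℂ → Surf A B) (dom σ) := by
  rw [continuousOn_iff_continuous_domRestrict]
  cases σ
  · have : (dom false).domRestrict (pt false m : ℂ → Surf A B) =
        fun z : UMinus => Quot.mk _ (Sum.inr (z, m)) := funext fun z => dif_pos z.2
    rw [this]
    exact continuous_quot_mk.comp (continuous_inr.comp (continuous_id.prodMk continuous_const))
  · have : (dom true).domRestrict (pt true m : ℂ → Surf A B) =
        fun z : UPlus => Quot.mk _ (Sum.inl (z, m)) := funext fun z => dif_pos z.2
    rw [this]
    exact continuous_quot_mk.comp (continuous_inl.comp (continuous_id.prodMk continuous_const))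

theorem injOn_pt {A B : ℕ} (hA : 0 < A) (hAB : A ≠ B) (σ : Bool) (m : ℤ) :
    InjOn (pt σ m : ℂ → Surf A B) (dom σ) := fun _ hz _ hw h =>
  ((isPt_pt hz m).coord_unique hA hAB (h ▸ isPt_pt hw m)).symm

/-! ### The surface as a closed curve in `ℂ²` -/

/-- The pair `(e(z), dV/dz)`. -/
def xyc {A B : ℕ} (p : Surf A B) : ℂ × ℂ := (xc p, yc p)

theorem continuous_xyc {A B : ℕ} : Continuous (xyc : Surf A B → ℂ × ℂ) :=
  continuous_xc.prodMk continuous_yc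

theorem map_ex_nhds (z : ℂ) : Filter.map ex (𝓝 z) = 𝓝 (ex z) := by
  have h : HasStrictDerivAt ex (ex z * (2 * Real.pi * I)) z := by
    have h1 : HasStrictDerivAt (fun w : ℂ => 2 * Real.pi * I * w) (2 * Real.pi * I) z := by
      simpa using (hasStrictDerivAt_id z).const_mul (2 * Real.pi * I)
    exact h1.cexp
  exact h.map_nhds_eq (mul_ne_zero (ex_ne_zero z) (by simp [Real.pi_ne_zero]))

/-- A value of `e(z)` close to the given one provides a coordinate in `W`; a close value of `dV/dz`
then forces the same sheet, since sheets over one `z` differ there by integers. This yields both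
that charts are open and that `xyc` induces the topology. -/
theorem image_pt_mem_comap {A B : ℕ} {σ : Bool} {z : ℂ} (hz : z ∈ dom σ) (m : ℤ) {W : Set ℂ}
    (hW : W ∈ 𝓝 z) :
    (pt σ m '' W : Set (Surf A B)) ∈ Filter.comap xyc (𝓝 (xyc (pt σ m z : Surf A B))) := by
  have hc := (hasDerivAt_Yc A B hz m).continuousAt
  -- The two tolerances `1 / 2` add up to `1`, the gap between neighbouring sheets.
  set W' : Set ℂ := W ∩ dom σ ∩ {w | dist (Yc A B σ w m) (Yc A B σ z m) < 1 / 2} with hW'def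
  have hW' : W' ∈ 𝓝 z :=
    Filter.inter_mem (Filter.inter_mem hW ((isOpen_dom σ).mem_nhds hz))
      (hc (Metric.ball_mem_nhds _ (by norm_num)))
  have hp : IsPt σ (pt σ m z : Surf A B) z m := isPt_pt hz m
  refine ⟨(ex '' W') ×ˢ Metric.ball (Yc A B σ z m) (1 / 2), ?_, ?_⟩
  · rw [xyc, hp.xc_eq, hp.yc_eq]
    refine prod_mem_nhds ?_ (Metric.ball_mem_nhds _ (by norm_num))
    rw [← map_ex_nhds]
    exact Filter.image_mem_map hW'
  · rintro q ⟨⟨w, ⟨⟨hwW, hwd⟩, hwY⟩, hx⟩, hy⟩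
    obtain ⟨n, hn⟩ := exists_isPt hwd hx.symm
    have h1 : dist (yc q) (Yc A B σ z m) < 1 / 2 := hy
    rw [hn.yc_eq, show n = m + (n - m) by ring, Yc_add] at h1
    have h2 : dist (Yc A B σ w m) (Yc A B σ z m) < 1 / 2 := hwY
    have h3 : ‖((n - m : ℤ) : ℂ)‖ < 1 := by
      have := dist_triangle (Yc A B σ w m + (n - m : ℤ)) (Yc A B σ z m) (Yc A B σ w m)
      rw [dist_comm (Yc A B σ z m)] at this
      rw [dist_eq_norm, add_sub_cancel_left] at this
      linarith
    rw [Complex.norm_intCast] at h3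
    have h4 : |n - m| < 1 := by exact_mod_cast h3
    have h5 : n = m := by rw [abs_lt] at h4; omega
    subst h5
    exact ⟨w, hwW, hn.eq_pt.symm⟩

theorem isOpen_image_pt {A B : ℕ} {σ : Bool} (m : ℤ) {U : Set ℂ} (hU : IsOpen U)
    (hUd : U ⊆ dom σ) : IsOpen (pt σ m '' U : Set (Surf A B)) := by
  rw [isOpen_iff_mem_nhds]
  rintro _ ⟨z, hz, rfl⟩
  exact (continuous_xyc.tendsto _).le_comap (image_pt_mem_comap (hUd hz) m (hU.mem_nhds hz))

theorem injective_xyc {A B : ℕ} : Function.Injective (xyc : Surf A B → ℂ × ℂ) := by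
  intro p q h
  obtain ⟨σ, z, m, hp⟩ := exists_chart p
  have hx : xc q = ex z := by rw [← hp.xc_eq]; exact (congrArg Prod.fst h).symm
  obtain ⟨n, hq⟩ := exists_isPt hp.mem_dom hx
  have hy : yc p = yc q := congrArg Prod.snd h
  rw [hp.yc_eq, hq.yc_eq, show n = m + (n - m) by ring, Yc_add] at hy
  have h2 : ((n - m : ℤ) : ℂ) = 0 := by linear_combination -hy
  have h3 : n - m = 0 := by exact_mod_cast h2
  obtain rfl : n = m := by omega
  exact hp.unique hq

theorem ex_add (z w : ℂ) : ex (z + w) = ex z * ex w := by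
  rw [ex, ex, ex, ← Complex.exp_add]; congr 1; ring

theorem ex_nat_mul (n : ℕ) (z : ℂ) : ex (n * z) = ex z ^ n := by
  rw [ex, ex, ← Complex.exp_nat_mul]; congr 1; ring

theorem ex_int (n : ℤ) : ex n = 1 := by
  have := ex_add_int 0 n
  rw [zero_add] at this
  rw [this, ex]; simp

theorem ex_log_div {x : ℂ} (hx : x ≠ 0) (B : ℕ) :
    ex (-(B * Complex.log x) / (2 * Real.pi * I)) * x ^ B = 1 := by
  have h2 : (2 * Real.pi * I : ℂ) ≠ 0 := by simp [Real.pi_ne_zero]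
  rw [ex, mul_div_cancel₀ _ h2]
  nth_rw 2 [← Complex.exp_log hx]
  rw [← Complex.exp_nat_mul, ← Complex.exp_add]
  simp

/-- Exponentiating `dV/dz` removes the logarithm and the sheet number. -/
theorem xyc_relation {A B : ℕ} (p : Surf A B) :
    ex (yc p) * (1 - xc p) ^ B = (-1) ^ A * xc p ^ A := by
  obtain ⟨σ, z, m, hp⟩ := exists_chart p
  rw [hp.xc_eq, hp.yc_eq]
  cases σ
  · have h0 := slitPlane_ne_zero (mem_UMinus_iff.1 hp.mem_dom)
    have h1 := ex_log_div h0 B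
    have e1 : Yc A B false z m = -(B * Complex.log (1 - ex (-z))) / (2 * Real.pi * I)
        + B * (-z) + B * (1 / 2) + A * z + A * (1 / 2) + m := by
      simp only [Yc, YMinus]; ring
    rw [e1]
    simp only [ex_add, ex_int, ex_nat_mul, ex_half, mul_one]
    have h2 : (1 - ex z) = (1 - ex (-z)) * (-1) * ex z := by
      rw [ex_neg]; have := ex_ne_zero z; field_simp; ring
    rw [h2, mul_pow, mul_pow]
    have h3 : ex (-z) ^ B * ex z ^ B = 1 := by
      rw [← mul_pow, ex_neg, inv_mul_cancel₀ (ex_ne_zero z), one_pow]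
    have h4 : ((-1 : ℂ) ^ B) * (-1) ^ B = 1 := by
      rw [← mul_pow]; simp
    linear_combination (ex (-z) ^ B * ex z ^ B * ((-1 : ℂ) ^ B) * (-1) ^ B * (-1) ^ A * ex z ^ A) * h1
      + ((-1 : ℂ) ^ B * (-1) ^ B * (-1) ^ A * ex z ^ A) * h3 + ((-1) ^ A * ex z ^ A) * h4
  · have h0 := slitPlane_ne_zero (mem_UPlus_iff.1 hp.mem_dom)
    have h1 := ex_log_div h0 B
    have e1 : Yc A B true z m = -(B * Complex.log (1 - ex z)) / (2 * Real.pi * I)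
        + A * z + A * (1 / 2) + m := by
      simp only [Yc, YPlus]; ring
    rw [e1]
    simp only [ex_add, ex_int, ex_nat_mul, ex_half, mul_one]
    linear_combination ((-1) ^ A * ex z ^ A) * h1

theorem xc_ne_zero {A B : ℕ} (p : Surf A B) : xc p ≠ 0 := by
  obtain ⟨σ, z, m, hp⟩ := exists_chart p
  rw [hp.xc_eq]
  exact ex_ne_zero z

theorem xc_ne_one {A B : ℕ} (hB : 0 < B) (p : Surf A B) : 1 - xc p ≠ 0 := by
  intro h
  have h1 := xyc_relation p
  rw [h, zero_pow hB.ne', mul_zero, eq_comm, mul_eq_zero] at h1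
  rcases h1 with h1 | h1
  · exact absurd h1 (by simp)
  · exact pow_ne_zero A (xc_ne_zero p) h1

theorem mem_dom_or {z : ℂ} (h : ex z ≠ 1) : ∃ σ, z ∈ dom σ := by
  by_cases h1 : z ∈ UPlus
  · exact ⟨true, h1⟩
  refine ⟨false, fun k y hy e => ?_⟩
  simp only [UPlus, mem_ofPred_eq, not_forall, not_not] at h1
  obtain ⟨k', y', hy', e'⟩ := h1
  have h2 : y = y' := by
    have := congrArg Complex.im (e.symm.trans e')
    simpa using this
  have h3 : y = 0 := by linarith
  subst h3
  apply h
  rw [e]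
  simpa using ex_int k

/-- A solution has `x ≠ 0` and `x ≠ 1`, so `x = e(z)` with `z` in a chart. The relation then
determines `y` up to an integer, which a change of sheet absorbs. -/
theorem range_xyc {A B : ℕ} (hA : 0 < A) (hB : 0 < B) :
    Set.range (xyc : Surf A B → ℂ × ℂ) =
      {q | ex q.2 * (1 - q.1) ^ B = (-1) ^ A * q.1 ^ A} := by
  ext ⟨x, y⟩
  constructor
  · rintro ⟨p, hp⟩
    have := xyc_relation p
    rw [← hp]
    exact this
  · intro h
    simp only [mem_ofPred_eq] at h
    have hx0 : x ≠ 0 := by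
      rintro rfl
      rw [zero_pow hA.ne'] at h
      simp [ex_ne_zero] at h
    have hx1 : 1 - x ≠ 0 := by
      intro h1
      rw [h1, zero_pow hB.ne', mul_zero, eq_comm] at h
      simp [hx0] at h
    obtain ⟨z, rfl⟩ := exists_ex_eq hx0
    obtain ⟨σ, hσ⟩ := mem_dom_or (z := z) (fun h => hx1 (by rw [h, sub_self]))
    have h1 := xyc_relation (pt σ 0 z : Surf A B)
    have h0 := isPt_pt (A := A) (B := B) hσ 0
    rw [h0.xc_eq, ← h] at h1
    have h2 := mul_right_cancel₀ (pow_ne_zero B hx1) h1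
    obtain ⟨k, hk⟩ := ex_eq_ex_iff.1 h2
    have h3 := isPt_pt (A := A) (B := B) hσ (0 + k)
    refine ⟨pt σ (0 + k) z, ?_⟩
    rw [xyc, h3.xc_eq, h3.yc_eq, Yc_add, hk, h0.yc_eq]

/-- The range is the zero set of a continuous equation, hence closed. The Hausdorff property and the
compactness used for continuing lifts both come from here. -/
theorem isClosedEmbedding_xyc {A B : ℕ} (hA : 0 < A) (hB : 0 < B) :
    IsClosedEmbedding (xyc : Surf A B → ℂ × ℂ) := by
  refine ⟨⟨isInducing_iff_nhds.2 fun p => le_antisymm (continuous_xyc.tendsto _).le_comap ?_,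
    injective_xyc⟩, ?_⟩
  · intro N hN
    obtain ⟨σ, z, m, hp⟩ := exists_chart p
    rw [hp.eq_pt] at hN ⊢
    have hc := (continuousOn_pt (A := A) (B := B) σ m).continuousAt
      ((isOpen_dom σ).mem_nhds hp.mem_dom)
    refine Filter.mem_of_superset (image_pt_mem_comap hp.mem_dom m (hc hN)) ?_
    rintro _ ⟨w, hw, rfl⟩
    exact hw
  · rw [range_xyc hA hB]
    exact isClosed_eq (((continuous_ex.comp continuous_snd)).mul
      ((continuous_const.sub continuous_fst).pow B)) (continuous_const.mul (continuous_fst.pow A))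

theorem t2Space_surf {A B : ℕ} (hA : 0 < A) (hB : 0 < B) : T2Space (Surf A B) :=
  (isClosedEmbedding_xyc hA hB).isEmbedding.t2Space

theorem norm_ex_bounds {y : ℂ} {R : ℝ} (h : ‖y‖ ≤ R) :
    Real.exp (-(2 * Real.pi * R)) ≤ ‖ex y‖ ∧ ‖ex y‖ ≤ Real.exp (2 * Real.pi * R) := by
  have h1 := abs_le.1 ((Complex.abs_im_le_norm y).trans h)
  rw [norm_ex]
  have := Real.pi_pos
  constructor <;> rw [Real.exp_le_exp] <;> nlinarith

/-- A bound on `|y|` bounds `|e(y)|` from above and below, so `|1 - x|^B` and `|x|^A` are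
comparable. For large `|x|` this contradicts `A ≠ B`, so `x` is bounded as well. -/
theorem isCompact_yc_le {A B : ℕ} (hA : 0 < A) (hB : 0 < B) (hAB : A ≠ B) (R : ℝ) :
    IsCompact {p : Surf A B | ‖yc p‖ ≤ R} := by
  set E := Real.exp (2 * Real.pi * R) with hE
  have hE0 : 0 < E := Real.exp_pos _
  have key : ∀ p : Surf A B, ‖yc p‖ ≤ R → ‖xc p‖ ≤ 2 + E * 2 ^ B := by
    intro p hp
    obtain ⟨h1, h2⟩ := norm_ex_bounds hp
    rw [Real.exp_neg, ← hE] at h1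
    by_contra hc
    rw [not_le] at hc
    have hE2 : 0 < E * 2 ^ B := by positivity
    set r := ‖xc p‖ with hr
    have hr2 : 2 < r := by linarith
    have hrel := congrArg norm (xyc_relation p)
    rw [norm_mul, norm_mul, norm_pow, norm_pow, norm_pow, norm_neg, norm_one, one_pow, one_mul,
      ← hr] at hrel
    have h3 : ‖1 - xc p‖ ≤ 2 * r := by
      have := norm_sub_le (1 : ℂ) (xc p)
      rw [norm_one] at this
      linarith
    have h4 : r / 2 ≤ ‖1 - xc p‖ := by
      have := norm_sub_norm_le (xc p) 1
      rw [norm_one, norm_sub_rev] at this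
      linarith
    rcases lt_or_gt_of_ne hAB with hlt | hlt
    · obtain ⟨d, rfl⟩ := Nat.exists_eq_add_of_lt hlt
      have h5 : E⁻¹ * (r / 2) ^ (A + d + 1) ≤ r ^ A := by
        rw [← hrel]; gcongr
      have h6 : r ^ A * r ^ (d + 1) ≤ r ^ A * (E * 2 ^ (A + d + 1)) := by
        rw [div_pow] at h5
        have : r ^ (A + d + 1) ≤ r ^ A * (E * 2 ^ (A + d + 1)) := by
          field_simp at h5
          linarith
        rwa [← pow_add, ← add_assoc]
      have h7 := le_of_mul_le_mul_left h6 (by positivity)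
      have h8 : r ≤ r ^ (d + 1) := le_self_pow₀ (by linarith) (by omega)
      linarith
    · obtain ⟨d, rfl⟩ := Nat.exists_eq_add_of_lt hlt
      have h5 : r ^ (B + d + 1) ≤ E * (2 * r) ^ B := by
        rw [← hrel]; gcongr
      have h6 : r ^ B * r ^ (d + 1) ≤ r ^ B * (E * 2 ^ B) := by
        rw [← pow_add, ← add_assoc]
        calc _ ≤ _ := h5
          _ = _ := by rw [mul_pow]; ring
      have h7 := le_of_mul_le_mul_left h6 (by positivity)
      have h8 : r ≤ r ^ (d + 1) := le_self_pow₀ (by linarith) (by omega)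
      linarith
  have hK : IsCompact (Metric.closedBall (0 : ℂ) (2 + E * 2 ^ B) ×ˢ Metric.closedBall (0 : ℂ) R) :=
    (isCompact_closedBall _ _).prod (isCompact_closedBall _ _)
  refine ((isClosedEmbedding_xyc hA hB).isCompact_preimage hK).of_isClosed_subset
    (isClosed_le continuous_yc.norm continuous_const) fun p hp => ?_
  exact ⟨mem_closedBall_zero_iff.2 (key p hp), mem_closedBall_zero_iff.2 hp⟩

/-- Coordinates of a continuous family in an open injective chart are continuous. -/
theorem continuousOn_of_chart {X T : Type*} [TopologicalSpace X] [TopologicalSpace T] {Φ : ℂ → X}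
    {R : Set ℂ} (hR : IsOpen R) (hinj : InjOn Φ R)
    (hopen : ∀ U : Set ℂ, IsOpen U → U ⊆ R → IsOpen (Φ '' U)) {s : Set T} {γ : T → X}
    (hγ : ContinuousOn γ s) {c : T → ℂ} (hc : ∀ t ∈ s, c t ∈ R) (h : ∀ t ∈ s, Φ (c t) = γ t) :
    ContinuousOn c s := by
  intro t ht U hU
  obtain ⟨W, hWU, hWo, hW⟩ := mem_nhds_iff.1 hU
  have h1 : Φ '' (W ∩ R) ∈ 𝓝 (γ t) :=
    (hopen _ (hWo.inter hR) inter_subset_right).mem_nhds ⟨c t, ⟨hW, hc t ht⟩, h t ht⟩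
  rw [Filter.mem_map]
  filter_upwards [hγ t ht h1, self_mem_nhdsWithin] with t' ⟨w, hw, e⟩ ht'
  have : w = c t' := hinj hw.2 (hc t' ht') (e.trans (h t' ht').symm)
  exact hWU (this ▸ hw.1)

/-! ### The cones of decay -/

/-- The concave function `z ↦ min_i Re (z a_i)` that measures how deep `z` lies in the cone
`Re (z a_i) > 0`. -/
def depth (a b c : ℂ) (z : ℂ) : ℝ := min (z * a).re (min (z * b).re (z * c).re)

theorem depth_add (a b c x y : ℂ) : depth a b c x + depth a b c y ≤ depth a b c (x + y) := by
  simp only [depth, add_mul, add_re]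
  refine le_min ?_ (le_min ?_ ?_)
  · exact add_le_add (min_le_left _ _) (min_le_left _ _)
  · exact add_le_add ((min_le_right _ _).trans (min_le_left _ _))
      ((min_le_right _ _).trans (min_le_left _ _))
  · exact add_le_add ((min_le_right _ _).trans (min_le_right _ _))
      ((min_le_right _ _).trans (min_le_right _ _))

theorem depth_smul (a b c x : ℂ) {s : ℝ} (hs : 0 ≤ s) :
    depth a b c (s * x) = s * depth a b c x := by
  simp only [depth, mul_assoc, re_ofReal_mul]
  rw [mul_min_of_nonneg _ _ hs, mul_min_of_nonneg _ _ hs]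

theorem neg_norm_le_depth {a b c : ℂ} (ha : ‖a‖ ≤ 1) (hb : ‖b‖ ≤ 1) (hc : ‖c‖ ≤ 1) (x : ℂ) :
    -‖x‖ ≤ depth a b c x := by
  have key : ∀ d : ℂ, ‖d‖ ≤ 1 → -‖x‖ ≤ (x * d).re := fun d hd => by
    have h1 := neg_le_of_abs_le (Complex.abs_re_le_norm (x * d))
    rw [norm_mul] at h1
    have h2 : ‖x‖ * ‖d‖ ≤ ‖x‖ * 1 := by gcongr
    linarith
  exact le_min (key a ha) (le_min (key b hb) (key c hc))

/-- The sign of `A - B`. -/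
def sgn (A B : ℕ) : ℝ := ((A : ℝ) - B) / |(A : ℝ) - B|

theorem sgn_eq {A B : ℕ} (hAB : A ≠ B) :
    (B < A ∧ sgn A B = 1 ∧ |(A : ℝ) - B| = A - B) ∨
      (A < B ∧ sgn A B = -1 ∧ |(A : ℝ) - B| = B - A) := by
  rcases lt_or_gt_of_ne hAB with h | h
  · right
    have h' : (A : ℝ) < B := by exact_mod_cast h
    have e : |(A : ℝ) - B| = B - A := by rw [abs_of_neg (by linarith)]; ring
    refine ⟨h, ?_, e⟩
    rw [sgn, e, div_eq_iff (by linarith)]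
    ring
  · left
    have h' : (B : ℝ) < A := by exact_mod_cast h
    have e : |(A : ℝ) - B| = A - B := by rw [abs_of_pos (by linarith)]
    refine ⟨h, ?_, e⟩
    rw [sgn, e, div_self (by linarith)]

/-- How deep `z` lies in the cone at infinity of `D_{∞,θ}` in the upper or the lower half plane. -/
def cone (A B : ℕ) (θ : ℝ) : Bool → ℂ → ℝ
  | true => depth (-I) (exp (-(θ / 2 * I))) (exp (-(θ / 2 * I)) * I)
  | false => depth I (-exp (-(θ / 2 * I))) (-(sgn A B * exp (-(θ / 2 * I)) * I))

theorem norm_exp_half (θ : ℝ) : ‖exp (-(θ / 2 * I))‖ = 1 := by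
  rw [Complex.norm_exp]; simp

theorem norm_sgn_le (A B : ℕ) : |sgn A B| ≤ 1 := by
  rw [sgn, abs_div, abs_abs]
  exact div_self_le_one _

theorem cone_add (A B : ℕ) (θ : ℝ) (σ : Bool) (x y : ℂ) :
    cone A B θ σ x + cone A B θ σ y ≤ cone A B θ σ (x + y) := by
  cases σ <;> exact depth_add _ _ _ _ _

theorem cone_smul (A B : ℕ) (θ : ℝ) (σ : Bool) (x : ℂ) {s : ℝ} (hs : 0 ≤ s) :
    cone A B θ σ (s * x) = s * cone A B θ σ x := by
  cases σ <;> exact depth_smul _ _ _ _ hs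

theorem neg_norm_le_cone (A B : ℕ) (θ : ℝ) (σ : Bool) (x : ℂ) : -‖x‖ ≤ cone A B θ σ x := by
  cases σ
  · refine neg_norm_le_depth (by simp) (by rw [norm_neg, norm_exp_half]) ?_ x
    simpa [norm_exp_half] using norm_sgn_le A B
  · exact neg_norm_le_depth (by simp) (by rw [norm_exp_half]) (by simp [norm_exp_half]) x

/-- Concavity of `cone`: a straight homotopy between two points deep in the cone stays deep in it.
This is what allows the ends of curves to be straightened. -/
theorem cone_combo (A B : ℕ) (θ : ℝ) (σ : Bool) {x y : ℂ} {N u : ℝ} (hx : N ≤ cone A B θ σ x)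
    (hy : N ≤ cone A B θ σ y) (h0 : 0 ≤ u) (h1 : u ≤ 1) :
    N ≤ cone A B θ σ ((1 - u : ℝ) * x + u * y) := by
  refine le_trans ?_ (cone_add A B θ σ _ _)
  rw [cone_smul _ _ _ _ _ (by linarith), cone_smul _ _ _ _ _ h0]
  nlinarith

theorem cone_true (A B : ℕ) (θ : ℝ) (z : ℂ) : cone A B θ true z =
    min z.im (min (z * exp (-(θ / 2 * I))).re (-(z * exp (-(θ / 2 * I))).im)) := by
  simp only [cone, depth, ← mul_assoc]
  congr 1
  · simp
  · congr 1
    simp only [mul_re, I_re, I_im]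
    ring

theorem cone_false (A B : ℕ) (θ : ℝ) (z : ℂ) : cone A B θ false z =
    min (-z.im) (min (-(z * exp (-(θ / 2 * I))).re) (sgn A B * (z * exp (-(θ / 2 * I))).im)) := by
  simp only [cone, depth]
  congr 1
  · simp
  · congr 1
    · simp
    · rw [show z * -(sgn A B * exp (-(θ / 2 * I)) * I) =
        (sgn A B : ℂ) * (-(z * exp (-(θ / 2 * I)) * I)) by ring, re_ofReal_mul]
      simp only [neg_re, mul_re, I_re, I_im]
      ring

/-- The open half plane of a chart. -/
def half : Bool → Set ℂ
  | true => {z | 0 < z.im}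
  | false => {z | z.im < 0}

theorem half_subset_dom (σ : Bool) : half σ ⊆ dom σ := by
  cases σ
  · exact fun z hz => mem_UMinus_of_im_neg hz
  · exact fun z hz => mem_UPlus_of_im_pos hz

theorem isOpen_half (σ : Bool) : IsOpen (half σ) := by
  cases σ
  · exact isOpen_lt continuous_im continuous_const
  · exact isOpen_lt continuous_const continuous_im

theorem half_of_cone_pos {A B : ℕ} {θ : ℝ} {σ : Bool} {z : ℂ} (h : 0 < cone A B θ σ z) :
    z ∈ half σ := by
  cases σ
  · rw [cone_false] at h
    have := lt_of_lt_of_le h (min_le_left _ _)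
    change z.im < 0
    linarith
  · rw [cone_true] at h
    exact lt_of_lt_of_le h (min_le_left _ _)

/-- In the rotated coordinate `z e^{-iθ/2}` the decay function is a product of real and imaginary
part, so it is large as soon as both are large with the right signs. -/
theorem im_sq_mul (a : ℝ) (z : ℂ) (θ : ℝ) :
    -((a : ℂ) / 2 * z ^ 2 * exp (-(θ * I))).im =
      a * ((z * exp (-(θ / 2 * I))).re * -(z * exp (-(θ / 2 * I))).im) := by
  have : (a : ℂ) / 2 * z ^ 2 * exp (-(θ * I)) = (a / 2 : ℝ) * (z * exp (-(θ / 2 * I))) ^ 2 := by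
    rw [mul_pow, ← Complex.exp_nat_mul]
    push_cast
    rw [show (2 : ℂ) * -(θ / 2 * I) = -(θ * I) by ring]
    ring
  rw [this, im_ofReal_mul, pow_two, mul_im]
  ring

theorem polar_rotate {z : ℂ} {φ θ : ℝ} (hz : z = ‖z‖ * exp (φ * I)) :
    (z * exp (-(θ / 2 * I))).re = ‖z‖ * Real.cos (φ - θ / 2) ∧
      (z * exp (-(θ / 2 * I))).im = ‖z‖ * Real.sin (φ - θ / 2) := by
  have : z * exp (-(θ / 2 * I)) = (‖z‖ : ℂ) * exp ((φ - θ / 2 : ℝ) * I) := by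
    nth_rw 1 [hz]
    rw [mul_assoc, ← Complex.exp_add]
    push_cast
    congr 2
    ring
  rw [this, re_ofReal_mul, im_ofReal_mul, exp_ofReal_mul_I_re, exp_ofReal_mul_I_im]
  exact ⟨rfl, rfl⟩

/-- The first entry of `cone` puts `z` into the upper half plane, the other two put `arg z - θ/2`
into `(-π/2, 0)`. Their product is at least `(1 + |L|)² > L`, and `A ≥ 1`. -/
theorem mem_decayPlus {A B : ℕ} {θ L : ℝ} (hθ0 : 0 < θ) (hθ : θ < 2 * Real.pi) (hA : 0 < A)
    {z : ℂ} {m : ℤ} (hm0 : 0 ≤ m) (hm : m < A) (hz : 1 + |L| < cone A B θ true z) :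
    (pt true m z : Surf A B) ∈ decayPlus A B θ L := by
  have hL := abs_nonneg L
  have hh : 0 < z.im := half_of_cone_pos (σ := true) (lt_trans (by linarith) hz)
  rw [cone_true, lt_min_iff, lt_min_iff] at hz
  obtain ⟨h1, h2, h3⟩ := hz
  have hz0 : 0 < ‖z‖ := by
    rw [norm_pos_iff]
    rintro rfl
    simp at hh
  have hpolar : z = ‖z‖ * exp (arg z * I) := (norm_mul_exp_arg_mul_I z).symm
  obtain ⟨e1, e2⟩ := polar_rotate (θ := θ) hpolar
  have hg0 : 0 < arg z := by
    rcases lt_or_eq_of_le (Complex.arg_nonneg_iff.2 hh.le) with h | h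
    · exact h
    · have := (Complex.arg_eq_zero_iff.1 h.symm).2
      linarith
  have hgpi : arg z < Real.pi := by
    refine lt_of_le_of_ne (Complex.arg_le_pi z) fun h => ?_
    have := (Complex.arg_eq_pi_iff.1 h).2
    linarith
  have hcos : 0 < Real.cos (arg z - θ / 2) := by
    by_contra hc
    have := mul_nonpos_of_nonneg_of_nonpos hz0.le (not_lt.1 hc)
    linarith
  have hsin : Real.sin (arg z - θ / 2) < 0 := by
    by_contra hc
    have := mul_nonneg hz0.le (not_lt.1 hc)
    linarith
  have hb1 : arg z - θ / 2 < 0 := by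
    by_contra hc
    have := Real.sin_nonneg_of_nonneg_of_le_pi (not_lt.1 hc) (by linarith)
    linarith
  have hb2 : -(Real.pi / 2) < arg z - θ / 2 := by
    by_contra hc
    have := Real.cos_nonpos_of_pi_div_two_le_of_le (x := -(arg z - θ / 2)) (by linarith)
      (by linarith)
    rw [Real.cos_neg] at this
    linarith
  refine ⟨z, m, isPt_pt (σ := true) (mem_UPlus_of_im_pos hh) m, hm0, hm,
    ⟨‖z‖, arg z, hz0, max_lt hg0 (by linarith), lt_min hgpi (by linarith), hpolar⟩, ?_⟩
  have := im_sq_mul A z θ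
  push_cast at this
  rw [this]
  have hA1 : (1 : ℝ) ≤ A := by exact_mod_cast hA
  have h4 : (1 + |L|) * (1 + |L|) ≤
      (z * exp (-(θ / 2 * I))).re * -(z * exp (-(θ / 2 * I))).im := by
    exact mul_le_mul h2.le h3.le (by positivity) (by linarith)
  have := le_abs_self L
  nlinarith

theorem mem_decayMinus {A B : ℕ} {θ L : ℝ} (hθ0 : 0 < θ) (hθ : θ < 2 * Real.pi) (hAB : A ≠ B)
    {z : ℂ} {m : ℤ} (hm0 : 0 ≤ m) (hm : m < |(A : ℤ) - B|) (hz : 1 + |L| < cone A B θ false z) :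
    (pt false m z : Surf A B) ∈ decayMinus A B θ L := by
  have hL := abs_nonneg L
  have hh : z.im < 0 := half_of_cone_pos (σ := false) (lt_trans (by linarith) hz)
  rw [cone_false, lt_min_iff, lt_min_iff] at hz
  obtain ⟨h1, h2, h3⟩ := hz
  have hz0 : 0 < ‖z‖ := by
    rw [norm_pos_iff]
    rintro rfl
    simp at hh
  -- The region is described by arguments in `(π, 2π)`, so the principal argument, negative here, is
  -- raised by `2π`.
  have hpolar : z = ‖z‖ * exp ((arg z + 2 * Real.pi : ℝ) * I) := by
    have h := (norm_mul_exp_arg_mul_I z).symm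
    push_cast
    rw [add_mul, Complex.exp_add, Complex.exp_two_pi_mul_I, mul_one]
    exact h
  obtain ⟨e1, e2⟩ := polar_rotate (θ := θ) hpolar
  have hg0 : arg z < 0 := Complex.arg_neg_iff.2 hh
  have hgpi := Complex.neg_pi_lt_arg z
  -- The angle of `-z` relative to the direction `θ/2`.
  set ψ := arg z + Real.pi - θ / 2 with hψ
  have e0 : arg z + 2 * Real.pi - θ / 2 = ψ + Real.pi := by rw [hψ]; ring
  rw [e0, Real.cos_add_pi] at e1
  rw [e0, Real.sin_add_pi] at e2
  have hcos : 0 < Real.cos ψ := by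
    by_contra hc
    have := mul_nonpos_of_nonneg_of_nonpos hz0.le (not_lt.1 hc)
    linarith
  have hlow : -(Real.pi / 2) < ψ := by
    by_contra hc
    have := Real.cos_nonpos_of_pi_div_two_le_of_le (x := -ψ) (by linarith) (by linarith)
    rw [Real.cos_neg] at this
    linarith
  have hup : ψ < Real.pi / 2 := by
    by_contra hc
    have := Real.cos_nonpos_of_pi_div_two_le_of_le (x := ψ) (by linarith) (by linarith)
    linarith
  have hquad : (A : ℝ) - B ≠ 0 := sub_ne_zero.2 (by exact_mod_cast hAB)
  have hrange : max Real.pi (θ / 2 + 3 * Real.pi / 4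
        - ((A : ℝ) - B) * Real.pi / (4 * |(A : ℝ) - B|)) < arg z + 2 * Real.pi ∧
      arg z + 2 * Real.pi < min (2 * Real.pi) (θ / 2 + 5 * Real.pi / 4
        - ((A : ℝ) - B) * Real.pi / (4 * |(A : ℝ) - B|)) := by
    have e3 : ((A : ℝ) - B) * Real.pi / (4 * |(A : ℝ) - B|) = sgn A B * Real.pi / 4 := by
      rw [sgn]; have := abs_ne_zero.2 hquad; field_simp
    rw [e3]
    -- The sign of `A - B` decides on which side of the ray `-e^{iθ/2}` the region lies.
    rcases sgn_eq hAB with ⟨-, hs, -⟩ | ⟨-, hs, -⟩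
    · rw [hs, e2] at h3
      have hsin : Real.sin ψ < 0 := by
        by_contra hc
        have := mul_nonneg hz0.le (not_lt.1 hc)
        linarith
      have hb1 : ψ < 0 := by
        by_contra hc
        have := Real.sin_nonneg_of_nonneg_of_le_pi (not_lt.1 hc) (by linarith)
        linarith
      rw [hs]
      exact ⟨max_lt (by linarith) (by linarith), lt_min (by linarith) (by linarith)⟩
    · rw [hs, e2] at h3
      have hsin : 0 < Real.sin ψ := by
        by_contra hc
        have := mul_nonpos_of_nonneg_of_nonpos hz0.le (not_lt.1 hc)
        linarith
      have hb1 : 0 < ψ := by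
        by_contra hc
        have := Real.sin_nonpos_of_nonpos_of_neg_pi_le (not_lt.1 hc) (by linarith)
        linarith
      rw [hs]
      exact ⟨max_lt (by linarith) (by linarith), lt_min (by linarith) (by linarith)⟩
  refine ⟨z, m, isPt_pt (σ := false) (mem_UMinus_of_im_neg hh) m, hm0, hm,
    ⟨‖z‖, _, hz0, hrange.1, hrange.2, hpolar⟩, ?_⟩
  have := im_sq_mul (A - B) z θ
  push_cast at this
  rw [this]
  have h4 : (1 + |L|) * (1 + |L|) ≤
      -(z * exp (-(θ / 2 * I))).re * (sgn A B * (z * exp (-(θ / 2 * I))).im) := by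
    exact mul_le_mul h2.le h3.le (by positivity) (by linarith)
  have := le_abs_self L
  rcases sgn_eq hAB with ⟨hlt, hs, -⟩ | ⟨hlt, hs, -⟩
  · have : (1 : ℝ) ≤ A - B := by
      have : (B : ℝ) + 1 ≤ A := by exact_mod_cast hlt
      linarith
    rw [hs] at h4
    nlinarith
  · have : (1 : ℝ) ≤ B - A := by
      have : (A : ℝ) + 1 ≤ B := by exact_mod_cast hlt
      linarith
    rw [hs] at h4
    nlinarith

/-- `D_{L,θ}` is described by reduced sheet numbers only. Reducing `m` modulo `per` moves `z` by a
fixed integer `k`, which costs at most `|k|` of depth. -/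
theorem exists_cone_far {A B : ℕ} {θ : ℝ} (hθ0 : 0 < θ) (hθ : θ < 2 * Real.pi) (hA : 0 < A)
    (hAB : A ≠ B) (σ : Bool) (m : ℤ) (L : ℝ) :
    ∃ N : ℝ, 0 ≤ N ∧ ∀ z, N < cone A B θ σ z → (pt σ m z : Surf A B) ∈ decay A B θ L := by
  set k : ℤ := m / per A B σ with hk
  have hper := per_ne_zero hA hAB σ
  have e : m - per A B σ * k = m % per A B σ := by
    have := Int.mul_ediv_add_emod m (per A B σ)
    linarith
  refine ⟨‖(k : ℂ)‖ + (1 + |L|), by positivity, fun z hz => ?_⟩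
  have h0 : 0 < cone A B θ σ z := lt_trans (by positivity) hz
  have h1 := cone_add A B θ σ z k
  have h2 := neg_norm_le_cone A B θ σ k
  have h3 : 1 + |L| < cone A B θ σ (z + k) := by linarith
  have hm0 := Int.emod_nonneg m hper
  have hm := Int.emod_lt_abs m hper
  rw [pt_shift (half_subset_dom σ (half_of_cone_pos h0)) m k, e]
  cases σ
  · exact Or.inr (mem_decayMinus hθ0 hθ hAB hm0 hm h3)
  · refine Or.inl (mem_decayPlus hθ0 hθ hA hm0 ?_ h3)
    simpa [per] using hm

/-- The directions of the tails. -/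
def dir (A B : ℕ) (θ ε : ℝ) : Bool → ℂ
  | true => exp (θ / 2 * I - A * ε * I)
  | false => -exp (θ / 2 * I - (A - B) * ε * I)

/-- The directions `±e^{iθ/2}` lie on the boundary of the cones. The tilt turns them into the
interior, and the bound on `ε` keeps them in their half planes. -/
theorem cone_dir_pos {A B : ℕ} {θ ε : ℝ} (hA : 0 < A) (hAB : A ≠ B)
    (hε : SmallTilt A B θ ε) (σ : Bool) : 0 < cone A B θ σ (dir A B θ ε σ) := by
  obtain ⟨h0, h1, h2⟩ := hε
  have h3 := lt_of_lt_of_le h1 (min_le_left _ _)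
  have h4 := lt_of_lt_of_le h1 (min_le_right _ _)
  have h5 := lt_of_lt_of_le h2 (min_le_left _ _)
  have h6 := lt_of_lt_of_le h2 (min_le_right _ _)
  have e : ∀ a : ℝ, exp (θ / 2 * I - a * ε * I) = exp ((θ / 2 - a * ε : ℝ) * I) := fun a => by
    push_cast; ring_nf
  have e' : ∀ a : ℝ, exp (θ / 2 * I - a * ε * I) * exp (-(θ / 2 * I)) = exp ((-(a * ε) : ℝ) * I) :=
    fun a => by rw [← Complex.exp_add]; push_cast; ring_nf
  cases σ
  · rw [cone_false, lt_min_iff, lt_min_iff]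
    have e1 := e (A - B)
    have e2 := e' (A - B)
    have hc : (((A : ℝ) - B : ℝ) : ℂ) = A - B := by push_cast; rfl
    rw [hc] at e1 e2
    simp only [dir, neg_mul, neg_im, neg_re, neg_neg, e2]
    rw [e1, exp_ofReal_mul_I_im, exp_ofReal_mul_I_re, exp_ofReal_mul_I_im]
    have h7 := abs_le.1 (le_of_eq (abs_mul ((A : ℝ) - B) ε))
    rw [abs_of_pos h0] at h7
    refine ⟨Real.sin_pos_of_pos_of_lt_pi (by linarith) (by linarith),
      Real.cos_pos_of_mem_Ioo ⟨by linarith, by linarith⟩, ?_⟩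
    rw [Real.sin_neg]
    rcases sgn_eq hAB with ⟨hlt, hs, ha⟩ | ⟨hlt, hs, ha⟩
    · have hlt' : (B : ℝ) < A := by exact_mod_cast hlt
      rw [hs, neg_neg, one_mul]
      exact Real.sin_pos_of_pos_of_lt_pi (mul_pos (by linarith) h0) (by linarith)
    · have hlt' : (A : ℝ) < B := by exact_mod_cast hlt
      rw [hs, neg_neg, neg_one_mul, ← Real.sin_neg]
      exact Real.sin_pos_of_pos_of_lt_pi (by nlinarith) (by linarith)
  · rw [cone_true, lt_min_iff, lt_min_iff]
    have e1 := e A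
    have e2 := e' A
    rw [ofReal_natCast] at e1 e2
    have hA' : 0 < (A : ℝ) * ε := mul_pos (by exact_mod_cast hA) h0
    simp only [dir, e2]
    rw [e1, exp_ofReal_mul_I_im, exp_ofReal_mul_I_re, exp_ofReal_mul_I_im, Real.sin_neg, neg_neg]
    exact ⟨Real.sin_pos_of_pos_of_lt_pi (by linarith) (by linarith),
      Real.cos_pos_of_mem_Ioo ⟨by linarith, by linarith⟩,
      Real.sin_pos_of_pos_of_lt_pi hA' (by linarith)⟩

/-- `arg(-1/τ) = θ` means `log τ = log |τ| + i (π - θ)`, the principal value because `0 < θ < 2π`.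
Hence the state integral contours have the directions of the tails. -/
theorem I_div_sqrt_eq {τ : ℂ} {θ : ℝ} (hθ0 : 0 < θ) (hθ : θ < 2 * Real.pi)
    (h : ArgCondition τ θ) :
    ∃ κ : ℝ, 0 < κ ∧ I / τ ^ (1 / 2 : ℂ) = κ * exp (θ / 2 * I) := by
  obtain ⟨hτ, hθτ⟩ := h
  have h0 := slitPlane_ne_zero hτ
  have hn : 0 < ‖τ‖ := norm_pos_iff.2 h0
  have h1 : τ = exp ((Real.log ‖τ‖ : ℝ) + (Real.pi - θ : ℝ) * I) := by
    rw [Complex.exp_add, ← Complex.ofReal_exp, Real.exp_log hn]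
    push_cast
    rw [sub_mul, Complex.exp_sub, Complex.exp_pi_mul_I]
    rw [norm_div, norm_neg, norm_one] at hθτ
    have h2 : (‖τ‖ : ℂ) ≠ 0 := by exact_mod_cast hn.ne'
    have h3 := Complex.exp_ne_zero (θ * I)
    push_cast at hθτ
    field_simp at hθτ ⊢
    linear_combination -hθτ
  have h2 : Complex.log τ = (Real.log ‖τ‖ : ℝ) + (Real.pi - θ : ℝ) * I := by
    nth_rw 1 [h1]
    apply Complex.log_exp <;> simp <;> linarith
  refine ⟨Real.exp (-(Real.log ‖τ‖ / 2)), Real.exp_pos _, ?_⟩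
  rw [Complex.cpow_def_of_ne_zero h0, h2, div_eq_mul_inv, ← Complex.exp_neg]
  push_cast
  rw [← Complex.exp_add]
  have h3 : I = exp (Real.pi / 2 * I) := (Complex.exp_pi_div_two_mul_I).symm
  nth_rw 1 [h3]
  rw [← Complex.exp_add]
  congr 1
  ring

/-! ### Slit charts -/

/-- The plane without the real rays `(-∞, l - 1]` and `[l, ∞)`. -/
def slit (l : ℤ) : Set ℂ := {z | z.im ≠ 0 ∨ ((l : ℝ) - 1 < z.re ∧ z.re < l)}

/-- The part of `slit l` in which the coordinate `z₊`, respectively `z₋`, is used. -/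
def slitPart (l : ℤ) (σ : Bool) : Set ℂ := half σ ∪ {z | (l : ℝ) - 1 < z.re ∧ z.re < l}

theorem isOpen_slitPart (l : ℤ) (σ : Bool) : IsOpen (slitPart l σ) :=
  (isOpen_half σ).union ((isOpen_lt continuous_const continuous_re).inter
    (isOpen_lt continuous_re continuous_const))

theorem slit_eq (l : ℤ) : slit l = slitPart l true ∪ slitPart l false := by
  ext z
  simp only [slit, slitPart, half, mem_union, mem_ofPred_eq, ne_iff_lt_or_gt]
  tauto

theorem isOpen_slit (l : ℤ) : IsOpen (slit l) := by
  rw [slit_eq]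
  exact (isOpen_slitPart l true).union (isOpen_slitPart l false)

theorem slitPart_subset_dom (l : ℤ) (σ : Bool) : slitPart l σ ⊆ dom σ := by
  rintro z (h | h)
  · exact half_subset_dom σ h
  · cases σ
    · exact mem_UMinus_of_strip h.1 h.2
    · exact mem_UPlus_of_strip h.1 h.2

/-- The sheet used by the slit chart in either half. -/
def slitSheet (B : ℕ) (l m : ℤ) : Bool → ℤ
  | true => m
  | false => m + B * (l - 1)

/-- Which half plane a point of the plane belongs to; real points count as upper. -/
def sideOf (z : ℂ) : Bool := decide (0 ≤ z.im)

/-- The chart of the surface on `slit l` with upper sheet `m`. -/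
def slitPt {A B : ℕ} (l m : ℤ) (z : ℂ) : Surf A B := pt (sideOf z) (slitSheet B l m (sideOf z)) z

/-- In the strip both coordinates are available and `⌊Re z⌋ = l - 1`, so the change of coordinates
is the one built into `slitSheet`: the two halves glue to one chart. -/
theorem slitPt_eq {A B : ℕ} {l : ℤ} (m : ℤ) {σ : Bool} {z : ℂ} (hz : z ∈ slitPart l σ) :
    (slitPt l m z : Surf A B) = pt σ (slitSheet B l m σ) z := by
  by_cases hσ : sideOf z = σ
  · rw [slitPt, hσ]
  obtain ⟨h1, h2⟩ : (l : ℝ) - 1 < z.re ∧ z.re < l := by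
    rcases hz with hz | hz
    · exfalso
      apply hσ
      cases σ
      · have : z.im < 0 := hz
        simp [sideOf, this]
      · have : 0 < z.im := hz
        simp [sideOf, this.le]
    · exact hz
  have hfloor : ⌊z.re⌋ = l - 1 := by
    rw [Int.floor_eq_iff]; push_cast; constructor <;> linarith
  have key : (pt true m z : Surf A B) = pt false (m + B * (l - 1)) z := by
    have hp : IsPlusPt (pt true m z : Surf A B) z m := isPt_pt (σ := true) (mem_UPlus_of_strip h1 h2) m
    have := hp.toMinus (mem_UMinus_of_strip h1 h2)
    rw [hfloor] at this
    exact IsPt.eq_pt (σ := false) this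
  rw [slitPt]
  cases σ
  · rw [Bool.not_eq_false] at hσ
    rw [hσ]
    exact key
  · rw [Bool.not_eq_true] at hσ
    rw [hσ]
    exact key.symm

theorem sideOf_mem_slitPart {l : ℤ} {z : ℂ} (hz : z ∈ slit l) : z ∈ slitPart l (sideOf z) := by
  rcases hz with h | h
  · left
    by_cases h0 : 0 ≤ z.im
    · simpa [sideOf, h0, half] using lt_of_le_of_ne h0 h.symm
    · rw [sideOf, decide_eq_false h0]
      exact not_le.1 h0
  · exact Or.inr h

theorem isPt_slitPt {A B : ℕ} {l : ℤ} (m : ℤ) {z : ℂ} (hz : z ∈ slit l) :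
    IsPt (sideOf z) (slitPt l m z : Surf A B) z (slitSheet B l m (sideOf z)) :=
  isPt_pt (slitPart_subset_dom l _ (sideOf_mem_slitPart hz)) _

theorem continuousOn_slitPt {A B : ℕ} (l m : ℤ) :
    ContinuousOn (slitPt l m : ℂ → Surf A B) (slit l) := by
  intro z hz
  have h1 := sideOf_mem_slitPart hz
  have h2 := (isOpen_slitPart l (sideOf z)).mem_nhds h1
  have h3 := (continuousOn_pt (A := A) (B := B) (sideOf z) (slitSheet B l m (sideOf z))).continuousAt
    ((isOpen_dom _).mem_nhds (slitPart_subset_dom l _ h1))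
  refine (h3.congr ?_).continuousWithinAt
  filter_upwards [h2] with w hw
  exact (slitPt_eq m hw).symm

theorem isOpen_image_slitPt {A B : ℕ} (l m : ℤ) {U : Set ℂ} (hU : IsOpen U) (hUs : U ⊆ slit l) :
    IsOpen (slitPt l m '' U : Set (Surf A B)) := by
  have key : ∀ σ, IsOpen (slitPt l m '' (U ∩ slitPart l σ) : Set (Surf A B)) := fun σ => by
    have : (slitPt l m '' (U ∩ slitPart l σ) : Set (Surf A B)) =
        pt σ (slitSheet B l m σ) '' (U ∩ slitPart l σ) :=
      Set.image_congr fun z hz => slitPt_eq m hz.2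
    rw [this]
    exact isOpen_image_pt _ (hU.inter (isOpen_slitPart l σ))
      (inter_subset_right.trans (slitPart_subset_dom l σ))
  have : U = (U ∩ slitPart l true) ∪ (U ∩ slitPart l false) := by
    rw [← inter_union_distrib_left, ← slit_eq, inter_eq_left.2 hUs]
  rw [this, image_union]
  exact (key true).union (key false)

/-- The side of a point of the surface; real points count as upper. -/
def side {A B : ℕ} (p : Surf A B) : Bool := decide (‖xc p‖ ≤ 1)

theorem IsPt.side_eq {A B : ℕ} {σ : Bool} {p : Surf A B} {z : ℂ} {m : ℤ} (h : IsPt σ p z m) :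
    side p = sideOf z := by
  rw [side, sideOf, h.xc_eq, norm_ex]
  congr 1
  rw [Real.exp_le_one_iff, neg_nonpos]
  exact propext ⟨fun h => nonneg_of_mul_nonneg_right h (by positivity),
    fun h => mul_nonneg (by positivity) h⟩

/-- Equal points have the same `|e(z)|`, hence lie on the same side, and on one side the coordinate
of a chart is unique. -/
theorem injOn_slitPt {A B : ℕ} (hA : 0 < A) (hAB : A ≠ B) (l m : ℤ) :
    InjOn (slitPt l m : ℂ → Surf A B) (slit l) := by
  intro z hz w hw h
  have h1 := isPt_slitPt (A := A) (B := B) m hz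
  have h2 := isPt_slitPt (A := A) (B := B) m hw
  rw [← h] at h2
  rw [← h2.side_eq] at h2
  rw [← h1.side_eq] at h1
  exact (h1.coord_unique hA hAB h2).symm

/-- Shifting `z` by `n / A` reduces the sheet number modulo `A` in the upper half. In the lower half
the same shift changes the sheet by `A - B` per step, and the missing `B` per step is absorbed by
the choice of `l`. -/
theorem exists_slit (A B : ℕ) (hA : 0 < A) (hB : 0 < B) (p : Surf A B) :
    ∃ (l : ℤ) (m : Fin A), ∃ z ∈ slit l, (slitPt l (m : ℕ) z : Surf A B) = p := by
  have hA' : (A : ℤ) ≠ 0 := by exact_mod_cast hA.ne'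
  have fin : ∀ n : ℤ, ∃ m : Fin A, ((m : ℕ) : ℤ) = n - A * (n / A) := fun n => by
    have h0 := Int.emod_nonneg n hA'
    have h1 := Int.emod_lt_of_pos n (show (0 : ℤ) < A by exact_mod_cast hA)
    have h2 := Int.mul_ediv_add_emod n A
    refine ⟨⟨(n % A).toNat, by omega⟩, ?_⟩
    simp only [Int.toNat_of_nonneg h0]
    linarith
  obtain ⟨σ, z, n, hp⟩ := exists_chart p
  rcases lt_trichotomy z.im 0 with h | h | h
  · obtain ⟨n', hp⟩ := exists_isPt (σ := false) (mem_UMinus_of_im_neg h) hp.xc_eq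
    obtain ⟨m, hm⟩ := fin n'
    have hp' := hp.shift (n' / A)
    have him : (z + (n' / A : ℤ)).im < 0 := by simpa using h
    refine ⟨n' / A + 1, m, z + (n' / A : ℤ), Or.inl him.ne, ?_⟩
    rw [slitPt_eq (σ := false) _ (Or.inl him), hm]
    refine (IsPt.eq_pt ?_).symm
    convert hp' using 1
    simp only [slitSheet, per]
    ring
  · have hz : z ∈ UPlus := by
      rintro j y hy rfl
      have hy0 : y = 0 := by simpa using h
      apply xc_ne_one hB p
      rw [hp.xc_eq, hy0]
      simp [ex_int]
    obtain ⟨n', hp⟩ := exists_isPt (σ := true) hz hp.xc_eq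
    obtain ⟨m, hm⟩ := fin n'
    have hp' := hp.shift (n' / A)
    set w := z + (n' / A : ℤ) with hw
    have him : w.im = 0 := by simpa [hw] using h
    have hstrip : w ∈ slitPart (⌊w.re⌋ + 1) true := by
      right
      have h1 := Int.floor_le w.re
      have h2 := Int.lt_floor_add_one w.re
      refine ⟨?_, by push_cast; exact h2⟩
      push_cast
      rw [add_sub_cancel_right]
      refine lt_of_le_of_ne h1 fun h3 => ?_
      exact hp'.mem_dom ⌊w.re⌋ 0 le_rfl (by apply Complex.ext <;> simp [h3, him])
    refine ⟨⌊w.re⌋ + 1, m, w, slit_eq _ ▸ Or.inl hstrip, ?_⟩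
    rw [slitPt_eq _ hstrip, hm]
    exact hp'.eq_pt.symm
  · obtain ⟨n', hp⟩ := exists_isPt (σ := true) (mem_UPlus_of_im_pos h) hp.xc_eq
    obtain ⟨m, hm⟩ := fin n'
    have hp' := hp.shift (n' / A)
    have him : 0 < (z + (n' / A : ℤ)).im := by simpa using h
    refine ⟨1, m, z + (n' / A : ℤ), Or.inl him.ne', ?_⟩
    rw [slitPt_eq (σ := true) _ (Or.inl him), hm]
    exact hp'.eq_pt.symm

/-! ### Rays and arcs -/

theorem exists_isPt_side {A B : ℕ} (hA : 0 < A) (hB : 0 < B) (p : Surf A B) :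
    ∃ z m, IsPt (side p) p z m := by
  obtain ⟨l, m, z, hz, rfl⟩ := exists_slit A B hA hB p
  have := isPt_slitPt (A := A) (B := B) m hz
  rw [← this.side_eq] at this
  exact ⟨_, _, this⟩

open Classical in
/-- The straight ray from `p` in the direction `d (side p)`. -/
def ray {A B : ℕ} (d : Bool → ℂ) (p : Surf A B) (s : ℝ) : Surf A B :=
  if h : ∃ q : ℂ × ℤ, IsPt (side p) p q.1 q.2 then
    pt (side p) h.choose.2 (h.choose.1 + s * d (side p)) else p

/-- Directions that point into the respective half planes. -/
def Pointing (d : Bool → ℂ) : Prop := ∀ σ, d σ ∈ half σ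

theorem im_nonneg_of_sideOf {z : ℂ} (h : sideOf z = true) : 0 ≤ z.im := by simpa [sideOf] using h

theorem im_neg_of_sideOf {z : ℂ} (h : sideOf z = false) : z.im < 0 := by simpa [sideOf] using h

/-- `z` lies in the closed half plane of the given side. -/
def ClosedHalf : Bool → ℂ → Prop
  | true, z => 0 ≤ z.im
  | false, z => z.im ≤ 0

theorem closedHalf_sideOf (z : ℂ) : ClosedHalf (sideOf z) z := by
  cases h : sideOf z
  · exact (im_neg_of_sideOf h).le
  · exact im_nonneg_of_sideOf h

theorem ClosedHalf.add_mem_half {σ : Bool} {z w : ℂ} (hz : ClosedHalf σ z) (hw : w ∈ half σ) :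
    z + w ∈ half σ := by
  cases σ
  · change (z + w).im < 0
    have h1 : z.im ≤ 0 := hz
    have h2 : w.im < 0 := hw
    rw [add_im]; linarith
  · change 0 < (z + w).im
    have h1 : 0 ≤ z.im := hz
    have h2 : 0 < w.im := hw
    rw [add_im]; linarith

theorem smul_mem_half {σ : Bool} {w : ℂ} (hw : w ∈ half σ) {s : ℝ} (hs : 0 < s) :
    (s : ℂ) * w ∈ half σ := by
  cases σ
  · have h2 : w.im < 0 := hw
    change ((s : ℂ) * w).im < 0
    rw [im_ofReal_mul]; nlinarith
  · have h2 : 0 < w.im := hw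
    change 0 < ((s : ℂ) * w).im
    rw [im_ofReal_mul]; positivity

/-- The coordinates chosen in `ray` differ from any others by an integer shift, which commutes with
translation along the ray; so the ray does not depend on the choice. -/
theorem ray_eq {A B : ℕ} {d : Bool → ℂ} (hd : Pointing d) {σ : Bool} {p : Surf A B} {z : ℂ} {m : ℤ}
    (h : IsPt σ p z m) (hσ : side p = σ) {s : ℝ} (hs : 0 ≤ s) :
    ray d p s = pt σ m (z + s * d σ) := by
  subst hσ
  have hex : ∃ q : ℂ × ℤ, IsPt (side p) p q.1 q.2 := ⟨(z, m), h⟩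
  rw [ray, dif_pos hex]
  obtain ⟨k, h1, h2⟩ := h.exists_shift hex.choose_spec
  rw [h1, h2]
  have hmem : z + s * d (side p) ∈ dom (side p) := by
    rcases hs.eq_or_lt with rfl | hs
    · simpa using h.mem_dom
    · refine half_subset_dom _ (ClosedHalf.add_mem_half ?_ (smul_mem_half (hd _) hs))
      rw [h.side_eq]
      exact closedHalf_sideOf z
  rw [pt_shift hmem m k]
  congr 1
  ring

theorem ray_zero {A B : ℕ} {d : Bool → ℂ} (p : Surf A B) : ray d p 0 = p := by
  rw [ray]
  split_ifs with h
  · simpa using h.choose_spec.eq_pt.symm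
  · rfl

theorem add_mem_slit {l : ℤ} {d : Bool → ℂ} (hd : Pointing d) {σ : Bool} {z : ℂ} (hz : z ∈ slit l)
    (hσ : ClosedHalf σ z) {s : ℝ} (hs : 0 ≤ s) : z + s * d σ ∈ slit l := by
  rcases hs.eq_or_lt with rfl | hs
  · simpa using hz
  · have := hσ.add_mem_half (smul_mem_half (hd σ) hs)
    rw [slit_eq]
    cases σ
    · exact Or.inr (Or.inl this)
    · exact Or.inl (Or.inl this)

theorem add_mem_slitPart {l : ℤ} {d : Bool → ℂ} (hd : Pointing d) {σ : Bool} {z : ℂ}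
    (hz : z ∈ slitPart l σ) (hσ : ClosedHalf σ z) {s : ℝ} (hs : 0 ≤ s) :
    z + s * d σ ∈ slitPart l σ := by
  rcases hs.eq_or_lt with rfl | hs
  · simpa using hz
  · exact Or.inl (hσ.add_mem_half (smul_mem_half (hd σ) hs))

theorem ray_slitPt {A B : ℕ} {l m : ℤ} {d : Bool → ℂ} (hd : Pointing d) {z : ℂ} (hz : z ∈ slit l)
    {s : ℝ} (hs : 0 ≤ s) :
    ray d (slitPt l m z : Surf A B) s = slitPt l m (z + s * d (sideOf z)) := by
  have h := isPt_slitPt (A := A) (B := B) m hz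
  rw [ray_eq hd h h.side_eq hs]
  exact (slitPt_eq m (add_mem_slitPart hd (sideOf_mem_slitPart hz) (closedHalf_sideOf z) hs)).symm

theorem continuousOn_ray {A B : ℕ} (hA : 0 < A) (hB : 0 < B) {d : Bool → ℂ} (hd : Pointing d)
    (p : Surf A B) : ContinuousOn (ray d p) (Ici 0) := by
  obtain ⟨l, m, z, hz, rfl⟩ := exists_slit A B hA hB p
  have : ContinuousOn (fun s : ℝ => (slitPt l (m : ℕ) (z + s * d (sideOf z)) : Surf A B)) (Ici 0) :=
    (continuousOn_slitPt l _).comp (by fun_prop)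
      fun s hs => add_mem_slit hd hz (closedHalf_sideOf z) hs
  exact this.congr fun s hs => ray_slitPt hd hz hs

/-- Run in along the ray from `γ a`, along `γ` from `a` to `b`, and out along the ray from `γ b`. -/
def arc {A B : ℕ} (d : Bool → ℂ) (γ : ℝ → Surf A B) (a b : ℝ) (t : ℝ) : Surf A B :=
  if t ≤ a then ray d (γ a) (a - t) else if t ≤ b then γ t else ray d (γ b) (t - b)

/-- Run along `γ` up to time `b`, and out along the ray from `γ b`. -/
def leave {A B : ℕ} (d : Bool → ℂ) (γ : ℝ → Surf A B) (b : ℝ) (t : ℝ) : Surf A B :=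
  if t ≤ b then γ t else ray d (γ b) (t - b)

theorem continuous_leave {A B : ℕ} (hA : 0 < A) (hB : 0 < B) {d : Bool → ℂ} (hd : Pointing d)
    {γ : ℝ → Surf A B} (hγ : Continuous γ) (b : ℝ) : Continuous (leave d γ b) := by
  unfold leave
  refine continuous_if_le continuous_id continuous_const hγ.continuousOn ?_ fun t ht => ?_
  · exact (continuousOn_ray hA hB hd _).comp (by fun_prop) fun t ht => by simpa using ht
  · rw [ht, sub_self, ray_zero]

theorem continuous_arc {A B : ℕ} (hA : 0 < A) (hB : 0 < B) {d : Bool → ℂ} (hd : Pointing d)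
    {γ : ℝ → Surf A B} (hγ : Continuous γ) {a b : ℝ} (hab : a ≤ b) : Continuous (arc d γ a b) := by
  unfold arc
  refine continuous_if_le continuous_id continuous_const ?_
    (continuous_leave hA hB hd hγ b).continuousOn fun t ht => ?_
  · exact (continuousOn_ray hA hB hd _).comp (by fun_prop) fun t ht => by simpa using ht
  · rw [ht, sub_self, ray_zero, if_pos hab]

/-! ### Classes of curves on the surface -/

/-- The standing assumptions on the surface, the angle `θ` and the tilt `ε`. -/
structure Tilt (A B : ℕ) (θ ε : ℝ) : Prop where
  hA : 0 < A
  hB : 0 < B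
  hAB : A ≠ B
  pos : 0 < θ
  lt : θ < 2 * Real.pi
  small : SmallTilt A B θ ε

section

variable {A B : ℕ} {θ ε : ℝ}

theorem Tilt.pointing (h : Tilt A B θ ε) : Pointing (dir A B θ ε) := fun σ =>
  half_of_cone_pos (cone_dir_pos h.hA h.hAB h.small σ)

/-- Depth grows linearly along a tail and a bounded displacement costs a bounded amount, so the time
is uniform in the base point. -/
theorem Tilt.exists_far (h : Tilt A B θ ε) (σ : Bool) (m : ℤ) (L K : ℝ) :
    ∃ T, ∀ (w : ℂ) (s : ℝ), ‖w‖ ≤ K → T ≤ s → w + s * dir A B θ ε σ ∈ half σ ∧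
      (pt σ m (w + s * dir A B θ ε σ) : Surf A B) ∈ decay A B θ L := by
  obtain ⟨N, hN0, hN⟩ := exists_cone_far h.pos h.lt h.hA h.hAB σ m L
  have hd := cone_dir_pos h.hA h.hAB h.small σ
  set δ := cone A B θ σ (dir A B θ ε σ)
  refine ⟨max 0 ((N + K + 1) / δ), fun w s hw hs => ?_⟩
  have hs0 : 0 ≤ s := (le_max_left _ _).trans hs
  have hs1 : N + K + 1 ≤ s * δ := by
    rw [← div_le_iff₀ hd]
    exact (le_max_right _ _).trans hs
  have h1 := cone_add A B θ σ w (s * dir A B θ ε σ)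
  rw [cone_smul _ _ _ _ _ hs0] at h1
  have h2 := neg_norm_le_cone A B θ σ w
  exact ⟨half_of_cone_pos (by linarith), hN _ (by linarith)⟩

theorem Tilt.exists_far_slit (h : Tilt A B θ ε) (l m : ℤ) (σ : Bool) (L K : ℝ) :
    ∃ T, ∀ (w : ℂ) (s : ℝ), ‖w‖ ≤ K → T ≤ s →
      (slitPt l m (w + s * dir A B θ ε σ) : Surf A B) ∈ decay A B θ L := by
  obtain ⟨T, hT⟩ := h.exists_far σ (slitSheet B l m σ) L K
  refine ⟨T, fun w s hw hs => ?_⟩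
  obtain ⟨h1, h2⟩ := hT w s hw hs
  rwa [slitPt_eq m (Or.inl h1)]

theorem Tilt.exists_far_ray (h : Tilt A B θ ε) (p : Surf A B) (L : ℝ) :
    ∃ T, ∀ s, T ≤ s → ray (dir A B θ ε) p s ∈ decay A B θ L := by
  obtain ⟨z, m, hp⟩ := exists_isPt_side h.hA h.hB p
  obtain ⟨T, hT⟩ := h.exists_far (side p) m L ‖z‖
  refine ⟨max 0 T, fun s hs => ?_⟩
  rw [ray_eq h.pointing hp rfl ((le_max_left _ _).trans hs)]
  exact (hT z s le_rfl ((le_max_right _ _).trans hs)).2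

/-- The curve `arc` as a relative curve. -/
def arcCurve (h : Tilt A B θ ε) {γ : ℝ → Surf A B} (hγ : Continuous γ) {a b : ℝ} (hab : a ≤ b) :
    RelCurve (decay A B θ) where
  toFun := arc (dir A B θ ε) γ a b
  continuous_toFun := continuous_arc h.hA h.hB h.pointing hγ hab
  ends_mem L := by
    obtain ⟨T₁, h1⟩ := h.exists_far_ray (γ a) L
    obtain ⟨T₂, h2⟩ := h.exists_far_ray (γ b) L
    refine ⟨max (|a| + |b| + 1) (max (T₁ + |a|) (T₂ + |b|)), fun t ht => ?_⟩
    obtain ⟨h3, h4⟩ := max_le_iff.1 ht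
    obtain ⟨h4, h5⟩ := max_le_iff.1 h4
    have h6 := abs_le.1 (le_refl |a|)
    have h7 := abs_le.1 (le_refl |b|)
    rcases le_total 0 t with h0 | h0
    · rw [abs_of_nonneg h0] at *
      rw [arc, if_neg (by linarith), if_neg (by linarith)]
      exact h2 _ (by linarith)
    · rw [abs_of_nonpos h0] at *
      rw [arc, if_pos (by linarith)]
      exact h1 _ (by linarith)

/-- A piecewise straight curve through the centre of the slit chart. -/
def stdFun (d : Bool → ℂ) (l : ℤ) (σ σ' : Bool) (k a b t : ℝ) : ℂ :=
  (l - 1 / 2 : ℂ) + (k * max (a - t) 0 : ℝ) * d σ + (k * max (t - b) 0 : ℝ) * d σ'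

theorem center_mem_slit (l : ℤ) : (l - 1 / 2 : ℂ) ∈ slit l := by
  right
  have : (l - 1 / 2 : ℂ).re = l - 1 / 2 := by
    simp
  rw [this]
  constructor <;> linarith

theorem center_im (l : ℤ) : (l - 1 / 2 : ℂ).im = 0 := by simp

theorem center_closedHalf (l : ℤ) (σ : Bool) : ClosedHalf σ (l - 1 / 2 : ℂ) := by
  cases σ
  · exact (center_im l).le
  · exact (center_im l).ge

theorem stdFun_mem_slit {d : Bool → ℂ} (hd : Pointing d) (l : ℤ) (σ σ' : Bool) {k a b : ℝ}
    (hk : 0 ≤ k) (hab : a ≤ b) (t : ℝ) : stdFun d l σ σ' k a b t ∈ slit l := by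
  rw [stdFun]
  rcases le_total a t with h | h
  · rw [max_eq_right (sub_nonpos.2 h), mul_zero, ofReal_zero, zero_mul, add_zero]
    exact add_mem_slit hd (center_mem_slit l) (center_closedHalf l _)
      (mul_nonneg hk (le_max_right _ _))
  · rw [max_eq_right (sub_nonpos.2 (h.trans hab)), mul_zero, ofReal_zero, zero_mul, add_zero]
    exact add_mem_slit hd (center_mem_slit l) (center_closedHalf l _)
      (mul_nonneg hk (le_max_right _ _))

/-- Uniform in the speed `k` and the pause `[a, b]`, as the homotopy in `stdCurve_cls` needs. -/
theorem Tilt.exists_far_std (h : Tilt A B θ ε) (l m : ℤ) (σ σ' : Bool) (L M : ℝ) {k₀ : ℝ}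
    (hk₀ : 0 < k₀) : ∃ T, ∀ t k a b : ℝ, T ≤ |t| → k₀ ≤ k → |a| ≤ M → |b| ≤ M →
      (slitPt l m (stdFun (dir A B θ ε) l σ σ' k a b t) : Surf A B) ∈ decay A B θ L := by
  obtain ⟨T₁, h1⟩ := h.exists_far_slit l m σ L ‖(l - 1 / 2 : ℂ)‖
  obtain ⟨T₂, h2⟩ := h.exists_far_slit l m σ' L ‖(l - 1 / 2 : ℂ)‖
  refine ⟨M + max 0 (max (T₁ / k₀) (T₂ / k₀)), fun t k a b ht hk ha hb => ?_⟩
  obtain ⟨ha1, ha2⟩ := abs_le.1 ha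
  obtain ⟨hb1, hb2⟩ := abs_le.1 hb
  have g0 := le_max_left 0 (max (T₁ / k₀) (T₂ / k₀))
  have g1 := (le_max_left _ _).trans (le_max_right 0 (max (T₁ / k₀) (T₂ / k₀)))
  have g2 := (le_max_right _ _).trans (le_max_right 0 (max (T₁ / k₀) (T₂ / k₀)))
  rw [stdFun]
  rcases le_total 0 t with h0 | h0
  · rw [abs_of_nonneg h0] at ht
    rw [max_eq_right (by linarith : a - t ≤ 0), mul_zero, ofReal_zero, zero_mul, add_zero]
    refine h2 _ _ le_rfl ?_
    have h3 : T₂ ≤ k₀ * (t - b) := by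
      rw [mul_comm, ← div_le_iff₀ hk₀]; linarith
    rw [max_eq_left (by linarith)]
    nlinarith
  · rw [abs_of_nonpos h0] at ht
    rw [max_eq_right (by linarith : t - b ≤ 0), mul_zero, ofReal_zero, zero_mul, add_zero]
    refine h1 _ _ le_rfl ?_
    have h3 : T₁ ≤ k₀ * (a - t) := by
      rw [mul_comm, ← div_le_iff₀ hk₀]; linarith
    rw [max_eq_left (by linarith)]
    nlinarith

/-- The piecewise straight curve through the centre of the slit chart, on the surface. -/
def stdCurve (h : Tilt A B θ ε) (l m : ℤ) (σ σ' : Bool) {k a b : ℝ} (hk : 0 < k) (hab : a ≤ b) :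
    RelCurve (decay A B θ) where
  toFun t := slitPt l m (stdFun (dir A B θ ε) l σ σ' k a b t)
  continuous_toFun := (continuousOn_slitPt l m).comp_continuous
    (by unfold stdFun; fun_prop) (stdFun_mem_slit h.pointing l σ σ' hk.le hab)
  ends_mem L := by
    obtain ⟨T, hT⟩ := h.exists_far_std l m σ σ' L (max |a| |b|) hk
    exact ⟨T, fun t ht => hT t k a b ht le_rfl (le_max_left _ _) (le_max_right _ _)⟩

theorem clamp_mem (u : ℝ) : 0 ≤ max 0 (min u 1) ∧ max 0 (min u 1) ≤ 1 :=
  ⟨le_max_left _ _, max_le zero_le_one (min_le_right _ _)⟩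

/-- Speed and pause affect only the parametrisation; interpolating the three numbers linearly is a
homotopy. -/
theorem stdCurve_cls (h : Tilt A B θ ε) (l m : ℤ) (σ σ' : Bool) {k a b k' a' b' : ℝ} (hk : 0 < k)
    (hab : a ≤ b) (hk' : 0 < k') (hab' : a' ≤ b') :
    (stdCurve h l m σ σ' hk hab).cls (decay_antitone A B θ) =
      (stdCurve h l m σ σ' hk' hab').cls (decay_antitone A B θ) := by
  -- `cls_homotopy` asks for a map on all of `ℝ × ℝ`, so the homotopy parameter is clamped to `[0,
  -- 1]`.
  let c : ℝ → ℝ := fun u => max 0 (min u 1)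
  have hc : Continuous c := by fun_prop
  let ip : ℝ → ℝ → ℝ → ℝ := fun x y u => (1 - c u) * x + c u * y
  have hmin : ∀ u, min k k' ≤ ip k k' u := fun u => by
    have h1 := (clamp_mem u).1
    have h2 := (clamp_mem u).2
    have h3 := min_le_left k k'
    have h4 := min_le_right k k'
    change min k k' ≤ (1 - max 0 (min u 1)) * k + max 0 (min u 1) * k'
    nlinarith
  have hle : ∀ x y u, |ip x y u| ≤ |x| + |y| := fun x y u => by
    have h1 := (clamp_mem u).1
    have h2 := (clamp_mem u).2
    refine (abs_add_le _ _).trans ?_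
    rw [abs_mul, abs_mul, abs_of_nonneg h1, abs_of_nonneg (sub_nonneg.2 h2)]
    have := abs_nonneg x
    have := abs_nonneg y
    nlinarith
  refine cls_homotopy _ (fun q : ℝ × ℝ => slitPt l m (stdFun (dir A B θ ε) l σ σ'
    (ip k k' q.2) (ip a a' q.2) (ip b b' q.2) q.1)) ?_ (fun L => ?_) _ _ (fun t => ?_) (fun t => ?_)
  · refine (continuousOn_slitPt l m).comp_continuous (by unfold stdFun; fun_prop) fun q => ?_
    refine stdFun_mem_slit h.pointing l σ σ' ((lt_min hk hk').le.trans (hmin _)) ?_ _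
    have h1 := (clamp_mem q.2).1
    have h2 := (clamp_mem q.2).2
    change (1 - max 0 (min q.2 1)) * a + max 0 (min q.2 1) * a' ≤
      (1 - max 0 (min q.2 1)) * b + max 0 (min q.2 1) * b'
    nlinarith
  · obtain ⟨T, hT⟩ := h.exists_far_std l m σ σ' L (max (|a| + |a'|) (|b| + |b'|)) (lt_min hk hk')
    exact ⟨T, fun t u ht _ _ => hT _ _ _ _ ht (hmin _) ((hle _ _ _).trans (le_max_left _ _))
      ((hle _ _ _).trans (le_max_right _ _))⟩
  · simp [stdCurve, ip, c]
  · simp [stdCurve, ip, c]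

/-- The crossing number of a curve in a slit chart. -/
def jump : Bool → Bool → ℤ
  | true, false => -1
  | false, true => 1
  | true, true => 0
  | false, false => 0

/-- With both ends in the same half plane the curve retraces itself and is null; otherwise it is the
contour from the lower to the upper half plane, or its reverse. -/
theorem stdCurve_cls_eq_jump (h : Tilt A B θ ε) (l m : ℤ) (σ σ' : Bool) {k a b κ : ℝ} (hk : 0 < k)
    (hab : a ≤ b) (hκ : 0 < κ) :
    (stdCurve h l m σ σ' hk hab).cls (decay_antitone A B θ) =
      jump σ σ' • (stdCurve h l m false true hκ (le_refl 0)).cls (decay_antitone A B θ) := by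
  rw [stdCurve_cls h l m σ σ' hk hab hκ (le_refl 0)]
  have even : ∀ σ, (stdCurve h l m σ σ hκ (le_refl 0)).cls (decay_antitone A B θ) = 0 := fun σ => by
    refine cls_even _ _ fun t => ?_
    simp only [stdCurve, stdFun]
    congr 1
    simp only [zero_sub, sub_zero, neg_neg]
    ring
  cases σ <;> cases σ'
  · rw [even, jump, zero_smul]
  · rw [jump, one_smul]
  · rw [jump, neg_one_smul]
    refine cls_reverse _ _ _ fun t => ?_
    simp only [stdCurve, stdFun]
    congr 1
    simp only [zero_sub, sub_zero, neg_neg]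
    ring
  · rw [even, jump, zero_smul]

/-- Star-shapedness of the slit plane about its centre. -/
theorem segment_mem_slit {l : ℤ} {z : ℂ} (hz : z ∈ slit l) {u : ℝ} (h0 : 0 ≤ u) (h1 : u ≤ 1) :
    ((1 - u : ℝ) : ℂ) * z + u * (l - 1 / 2 : ℂ) ∈ slit l := by
  have him : (((1 - u : ℝ) : ℂ) * z + u * (l - 1 / 2 : ℂ)).im = (1 - u) * z.im := by
    rw [add_im, im_ofReal_mul, im_ofReal_mul, center_im, mul_zero, add_zero]
  have hre : (((1 - u : ℝ) : ℂ) * z + u * (l - 1 / 2 : ℂ)).re =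
      (1 - u) * z.re + u * (l - 1 / 2) := by
    rw [add_re, re_ofReal_mul, re_ofReal_mul]; simp
  rcases h1.eq_or_lt with rfl | h1
  · simpa using center_mem_slit l
  · rcases hz with hz | hz
    · left
      rw [him]
      exact mul_ne_zero (by linarith) hz
    · right
      rw [hre]
      constructor <;> nlinarith [hz.1, hz.2]

theorem segment_closedHalf {l : ℤ} {σ : Bool} {z : ℂ} (hz : ClosedHalf σ z) {u : ℝ} (h1 : u ≤ 1) :
    ClosedHalf σ (((1 - u : ℝ) : ℂ) * z + u * (l - 1 / 2 : ℂ)) := by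
  have him : (((1 - u : ℝ) : ℂ) * z + u * (l - 1 / 2 : ℂ)).im = (1 - u) * z.im := by
    rw [add_im, im_ofReal_mul, im_ofReal_mul, center_im, mul_zero, add_zero]
  cases σ
  · change _ ≤ (0 : ℝ)
    rw [him]
    exact mul_nonpos_of_nonneg_of_nonpos (by linarith) hz
  · change (0 : ℝ) ≤ _
    rw [him]
    exact mul_nonneg (by linarith) hz

/-- The class of an arc that stays in one slit chart. -/
theorem arcCurve_cls_of_slit (h : Tilt A B θ ε) {γ : ℝ → Surf A B} (hγ : Continuous γ) {a b : ℝ}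
    (hab : a ≤ b) {l m : ℤ} (hs : ∀ t ∈ Icc a b, γ t ∈ slitPt l m '' slit l) {κ : ℝ} (hκ : 0 < κ) :
    (arcCurve h hγ hab).cls (decay_antitone A B θ) = jump (side (γ a)) (side (γ b)) •
      (stdCurve h l m false true hκ (le_refl 0)).cls (decay_antitone A B θ) := by
  choose! c hcm hc using hs
  have hcont : ContinuousOn c (Icc a b) :=
    continuousOn_of_chart (isOpen_slit l) (injOn_slitPt h.hA h.hAB l m)
      (fun U hU hUs => isOpen_image_slitPt l m hU hUs) hγ.continuousOn hcm hc
  have haI : a ∈ Icc a b := ⟨le_rfl, hab⟩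
  have hbI : b ∈ Icc a b := ⟨hab, le_rfl⟩
  have sideEq : ∀ t ∈ Icc a b, side (γ t) = sideOf (c t) := fun t ht => by
    have := (isPt_slitPt (A := A) (B := B) m (hcm t ht)).side_eq
    rwa [hc t ht] at this
  rw [sideEq a haI, sideEq b hbI, ← stdCurve_cls_eq_jump h l m _ _ one_pos hab hκ]
  set σ := sideOf (c a)
  set σ' := sideOf (c b)
  -- Time clamped to `[a, b]`: on the tails the base point `c (P t)` stands still.
  let P : ℝ → ℝ := fun t => max a (min t b)
  have hPI : ∀ t, P t ∈ Icc a b := fun t => ⟨le_max_left _ _, max_le hab (min_le_right _ _)⟩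
  have hPc : Continuous P := by fun_prop
  have hcP : Continuous fun t => c (P t) := hcont.comp_continuous hPc hPI
  let v : ℝ → ℝ := fun u => max 0 (min u 1)
  have hv : Continuous v := by fun_prop
  -- The arc is pulled to the centre along segments, each tail being translated with its base point.
  -- The base point of a tail never leaves its closed half plane, so the tail does not hit the
  -- slits.
  let w : ℝ → ℝ → ℂ := fun t u => ((1 - v u : ℝ) : ℂ) * c (P t) + v u * (l - 1 / 2 : ℂ)
  have hw : Continuous fun q : ℝ × ℝ => w q.1 q.2 := by
    have : Continuous fun q : ℝ × ℝ => c (P q.1) := hcP.comp continuous_fst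
    exact ((continuous_ofReal.comp (continuous_const.sub (hv.comp continuous_snd))).mul this).add
      ((continuous_ofReal.comp (hv.comp continuous_snd)).mul continuous_const)
  obtain ⟨K, hK⟩ := (isCompact_Icc.image_of_continuousOn hcont).isBounded.exists_norm_le
  have hwK : ∀ t u, ‖w t u‖ ≤ K + ‖(l - 1 / 2 : ℂ)‖ := fun t u => by
    have h1 := (clamp_mem u).1
    have h2 := (clamp_mem u).2
    have h3 := hK _ ⟨P t, hPI t, rfl⟩
    have h4 := norm_nonneg (c (P t))
    have h5 := norm_nonneg (l - 1 / 2 : ℂ)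
    refine (norm_add_le _ _).trans ?_
    rw [norm_mul, norm_mul, Complex.norm_real, Complex.norm_real, Real.norm_eq_abs,
      Real.norm_eq_abs, abs_of_nonneg h1, abs_of_nonneg (sub_nonneg.2 h2)]
    nlinarith
  have hPa : ∀ t, t ≤ a → P t = a := fun t ht => by
    simp only [P]; rw [min_eq_left (ht.trans hab), max_eq_left ht]
  have hPb : ∀ t, b ≤ t → P t = b := fun t ht => by
    simp only [P]; rw [min_eq_right ht, max_eq_right hab]
  have hPm : ∀ t, a ≤ t → t ≤ b → P t = t := fun t ht ht' => by
    simp only [P]; rw [min_eq_left ht', max_eq_right ht]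
  refine cls_homotopy _ (fun q : ℝ × ℝ => slitPt l m (w q.1 q.2 +
    ((max (a - q.1) 0 : ℝ) : ℂ) * dir A B θ ε σ + ((max (q.1 - b) 0 : ℝ) : ℂ) * dir A B θ ε σ'))
    ?_ (fun L => ?_) _ _ (fun t => ?_) (fun t => ?_)
  · refine (continuousOn_slitPt l m).comp_continuous (by fun_prop) fun ⟨t, u⟩ => ?_
    have h1 := (clamp_mem u).1
    have h2 := (clamp_mem u).2
    have hwm : w t u ∈ slit l := segment_mem_slit (hcm _ (hPI t)) h1 h2
    simp only
    rcases le_total t a with ha | ha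
    · rw [max_eq_right (sub_nonpos.2 (ha.trans hab)), ofReal_zero, zero_mul, add_zero]
      refine add_mem_slit h.pointing hwm (segment_closedHalf ?_ h2) (le_max_right _ _)
      rw [hPa t ha]
      exact closedHalf_sideOf _
    · rw [max_eq_right (sub_nonpos.2 ha), ofReal_zero, zero_mul, add_zero]
      rcases le_total t b with hb | hb
      · rw [max_eq_right (sub_nonpos.2 hb), ofReal_zero, zero_mul, add_zero]
        exact hwm
      · refine add_mem_slit h.pointing hwm (segment_closedHalf ?_ h2) (le_max_right _ _)
        rw [hPb t hb]
        exact closedHalf_sideOf _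
  · obtain ⟨T₁, h1⟩ := h.exists_far_slit l m σ L (K + ‖(l - 1 / 2 : ℂ)‖)
    obtain ⟨T₂, h2⟩ := h.exists_far_slit l m σ' L (K + ‖(l - 1 / 2 : ℂ)‖)
    refine ⟨|a| + |b| + max 0 (max T₁ T₂), fun t u ht _ _ => ?_⟩
    have g0 := le_max_left 0 (max T₁ T₂)
    have g1 := (le_max_left _ _).trans (le_max_right 0 (max T₁ T₂))
    have g2 := (le_max_right _ _).trans (le_max_right 0 (max T₁ T₂))
    have h6 := abs_le.1 (le_refl |a|)
    have h7 := abs_le.1 (le_refl |b|)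
    simp only
    rcases le_total 0 t with h0 | h0
    · rw [abs_of_nonneg h0] at ht
      rw [max_eq_right (by linarith : a - t ≤ 0), ofReal_zero, zero_mul, add_zero]
      exact h2 _ _ (hwK t u) ((by linarith : T₂ ≤ t - b).trans (le_max_left _ _))
    · rw [abs_of_nonpos h0] at ht
      rw [max_eq_right (by linarith : t - b ≤ 0), ofReal_zero, zero_mul, add_zero]
      exact h1 _ _ (hwK t u) ((by linarith : T₁ ≤ a - t).trans (le_max_left _ _))
  · have hw0 : w t 0 = c (P t) := by simp [w, v]
    simp only [hw0]
    change arc _ γ a b t = _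
    rw [arc]
    split_ifs with h1 h2
    · rw [hPa t h1, max_eq_right (sub_nonpos.2 (h1.trans hab)), max_eq_left (sub_nonneg.2 h1),
        ofReal_zero, zero_mul, add_zero, ← hc a haI]
      exact ray_slitPt h.pointing (hcm a haI) (sub_nonneg.2 h1)
    · rw [not_le] at h1
      rw [hPm t h1.le h2, max_eq_right (sub_nonpos.2 h1.le), max_eq_right (sub_nonpos.2 h2),
        ofReal_zero, zero_mul, zero_mul, add_zero, add_zero, hc t ⟨h1.le, h2⟩]
    · rw [not_le] at h1 h2
      rw [hPb t h2.le, max_eq_right (sub_nonpos.2 h1.le), max_eq_left (sub_nonneg.2 h2.le),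
        ofReal_zero, zero_mul, add_zero, ← hc b hbI]
      exact ray_slitPt h.pointing (hcm b hbI) (sub_nonneg.2 h2.le)
  · have hw1 : w t 1 = (l - 1 / 2 : ℂ) := by simp [w, v]
    simp only [hw1]
    change slitPt l m (stdFun _ l σ σ' 1 a b t) = _
    simp [stdFun]

end

/-- Cutting a curve at time `c` by means of a ray. -/
theorem cls_concat_at {X : Type} [TopologicalSpace X] {D : ℝ → Set X} (hD : Antitone D) (c : ℝ)
    (f g h : RelCurve D) (h1 : ∀ t ≤ c, f.toFun t = h.toFun t)
    (h2 : ∀ t, c ≤ t → g.toFun t = h.toFun t)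
    (h3 : ∀ t, 0 ≤ t → g.toFun (c - t) = f.toFun (c + t)) :
    h.cls hD = f.cls hD + g.cls hD := by
  have sh : ∀ f : RelCurve D, ∃ f' : RelCurve D, ∀ t, f'.toFun t = f.toFun (t + c) := fun f => by
    refine ⟨⟨fun t => f.toFun (t + c), f.continuous_toFun.comp (continuous_add_const c),
      fun L => ?_⟩, fun t => rfl⟩
    obtain ⟨T, hT⟩ := f.ends_mem L
    refine ⟨T + |c|, fun t ht => hT _ ?_⟩
    have := abs_sub_abs_le_abs_sub t (-c)
    rw [sub_neg_eq_add, abs_neg] at this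
    linarith
  obtain ⟨f', hf⟩ := sh f
  obtain ⟨g', hg⟩ := sh g
  obtain ⟨h', hh⟩ := sh h
  rw [← cls_shift hD f f' c hf, ← cls_shift hD g g' c hg, ← cls_shift hD h h' c hh]
  refine cls_concat hD f' g' h' (fun t ht => ?_) (fun t ht => ?_) (fun t ht => ?_)
  · rw [hf, hh]; exact h1 _ (by linarith)
  · rw [hg, hh]; exact h2 _ (by linarith)
  · rw [hf, hg, neg_add_eq_sub, add_comm t]
    exact h3 t ht

section

variable {A B : ℕ} {θ ε : ℝ}

/-- The inserted ray at `γ b` is run outwards by the first arc and inwards by the second. -/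
theorem arcCurve_cls_add (h : Tilt A B θ ε) {γ : ℝ → Surf A B} (hγ : Continuous γ) {a b c : ℝ}
    (hab : a ≤ b) (hbc : b ≤ c) :
    (arcCurve h hγ (hab.trans hbc)).cls (decay_antitone A B θ) =
      (arcCurve h hγ hab).cls (decay_antitone A B θ) +
        (arcCurve h hγ hbc).cls (decay_antitone A B θ) := by
  refine cls_concat_at _ b _ _ _ (fun t ht => ?_) (fun t ht => ?_) (fun t ht => ?_)
  · change arc _ γ a b t = arc _ γ a c t
    rw [arc, arc, if_pos ht, if_pos (ht.trans hbc)]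
  · change arc _ γ b c t = arc _ γ a c t
    rcases ht.eq_or_lt with rfl | ht
    · rw [arc, if_pos le_rfl, sub_self, ray_zero, arc]
      split_ifs with h1
      · rw [le_antisymm h1 hab, sub_self, ray_zero]
      · rfl
    · rw [arc, if_neg (not_le.2 ht), arc, if_neg (not_le.2 (hab.trans_lt ht))]
  · change arc _ γ b c (b - t) = arc _ γ a b (b + t)
    rw [arc, if_pos (by linarith), sub_sub_cancel]
    rcases ht.eq_or_lt with rfl | ht
    · rw [add_zero, ray_zero, arc]
      split_ifs with h1 h2
      · rw [le_antisymm h1 hab, sub_self, ray_zero]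
      · rfl
      · exact absurd le_rfl h2
    · rw [arc, if_neg (by linarith), if_neg (by linarith), add_sub_cancel_left]

/-! ### Replacing the ends of a curve by rays -/

/-- From time `T` on, the curve stays in one open half sheet, and `z` is its coordinate there. -/
def HasEnd (γ : ℝ → Surf A B) (T : ℝ) (σ : Bool) (m : ℤ) (z : ℝ → ℂ) : Prop :=
  ∀ t, T ≤ t → z t ∈ half σ ∧ IsPt σ (γ t) (z t) m

theorem sideOf_of_half {σ : Bool} {z : ℂ} (h : z ∈ half σ) : sideOf z = σ := by
  cases σ
  · have : z.im < 0 := h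
    simp [sideOf, this]
  · have : 0 < z.im := h
    simp [sideOf, this.le]

theorem HasEnd.eventually_mem (h : Tilt A B θ ε) {γ : ℝ → Surf A B} {T : ℝ} {σ : Bool} {m : ℤ}
    {z : ℝ → ℂ} (he : HasEnd γ T σ m z)
    (hz : Filter.Tendsto (fun t => cone A B θ σ (z t)) Filter.atTop Filter.atTop) (L : ℝ) :
    ∃ S, ∀ t, S ≤ t → γ t ∈ decay A B θ L := by
  obtain ⟨N, hN0, hN⟩ := exists_cone_far h.pos h.lt h.hA h.hAB σ m L
  obtain ⟨S, hS⟩ := Filter.eventually_atTop.1 (hz.eventually_gt_atTop N)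
  refine ⟨max S T, fun t ht => ?_⟩
  rw [(he t ((le_max_right _ _).trans ht)).2.eq_pt]
  exact hN _ (hS t ((le_max_left _ _).trans ht))

/-- Run in along the ray from `γ b`, and along `γ` from time `b` on. -/
def arrive (d : Bool → ℂ) (γ : ℝ → Surf A B) (b : ℝ) (t : ℝ) : Surf A B :=
  if t ≤ b then ray d (γ b) (b - t) else γ t

theorem combo_mem_half {σ : Bool} {x y : ℂ} (hx : x ∈ half σ) (hy : y ∈ half σ) {u : ℝ}
    (h0 : 0 ≤ u) (h1 : u ≤ 1) : ((1 - u : ℝ) : ℂ) * x + u * y ∈ half σ := by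
  have him : (((1 - u : ℝ) : ℂ) * x + u * y).im = (1 - u) * x.im + u * y.im := by
    rw [add_im, im_ofReal_mul, im_ofReal_mul]
  cases σ
  · have hx' : x.im < 0 := hx
    have hy' : y.im < 0 := hy
    change _ < (0 : ℝ)
    rw [him]
    rcases h0.eq_or_lt with rfl | h0
    · linarith
    · nlinarith
  · have hx' : 0 < x.im := hx
    have hy' : 0 < y.im := hy
    change (0 : ℝ) < _
    rw [him]
    rcases h0.eq_or_lt with rfl | h0
    · linarith
    · nlinarith

theorem closedHalf_of_half {σ : Bool} {z : ℂ} (h : z ∈ half σ) : ClosedHalf σ z := by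
  cases σ
  · exact le_of_lt h
  · exact le_of_lt h

/-- A curve that comes in along a ray and leaves through the same half sheet has class zero. -/
theorem cls_arrive (h : Tilt A B θ ε) {γ : ℝ → Surf A B} (hγ : Continuous γ) {T : ℝ} {σ : Bool}
    {m : ℤ} {z : ℝ → ℂ} (he : HasEnd γ T σ m z)
    (hz : Filter.Tendsto (fun t => cone A B θ σ (z t)) Filter.atTop Filter.atTop)
    (g : RelCurve (decay A B θ)) (hg : ∀ t, g.toFun t = arrive (dir A B θ ε) γ T t) :
    g.cls (decay_antitone A B θ) = 0 := by
  set d := dir A B θ ε with hd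
  have hpt := h.pointing
  have hzc : ContinuousOn z (Ici T) :=
    continuousOn_of_chart (Φ := (pt σ m : ℂ → Surf A B)) (isOpen_half σ)
      ((injOn_pt h.hA h.hAB σ m).mono (half_subset_dom σ))
      (fun U hU hUs => isOpen_image_pt m hU (hUs.trans (half_subset_dom σ)))
      hγ.continuousOn (fun t ht => (he t ht).1) fun t ht => (he t ht).2.eq_pt.symm
  have hTT := he T le_rfl
  have hline : ∀ s : ℝ, 0 ≤ s → z T + s * d σ ∈ half σ := fun s hs => by
    rcases hs.eq_or_lt with rfl | hs
    · simpa using hTT.1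
    · exact (closedHalf_of_half hTT.1).add_mem_half (smul_mem_half (hpt σ) hs)
  have hcd := cone_dir_pos h.hA h.hAB h.small σ
  have hconeLine : ∀ s : ℝ, 0 ≤ s → s * cone A B θ σ (d σ) - ‖z T‖ ≤ cone A B θ σ (z T + s * d σ) :=
    fun s hs => by
      have h1 := cone_add A B θ σ (z T) (s * d σ)
      rw [cone_smul _ _ _ _ _ hs] at h1
      have h2 := neg_norm_le_cone A B θ σ (z T)
      linarith
  have hfar : ∀ L, ∃ S, ∀ s : ℝ, S ≤ s → (pt σ m (z T + s * d σ) : Surf A B) ∈ decay A B θ L :=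
    fun L => by
      obtain ⟨S, hS⟩ := h.exists_far σ m L ‖z T‖
      exact ⟨S, fun s hs => (hS _ s le_rfl hs).2⟩
  -- `e` runs in and out along the ray from `γ T`, so it is even and null. `e'` is the same curve
  -- turning at time `T`; it is the target of the homotopy.
  let e : RelCurve (decay A B θ) :=
    ⟨fun t => pt σ m (z T + (|t| : ℝ) * d σ),
      (continuousOn_pt σ m).comp_continuous (by fun_prop)
        fun t => half_subset_dom σ (hline _ (abs_nonneg t)),
      fun L => (hfar L).imp fun S hS t ht => hS _ ht⟩
  let e' : RelCurve (decay A B θ) :=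
    ⟨fun t => pt σ m (z T + (|t - T| : ℝ) * d σ),
      (continuousOn_pt σ m).comp_continuous (by fun_prop)
        fun t => half_subset_dom σ (hline _ (abs_nonneg _)),
      fun L => by
        obtain ⟨S, hS⟩ := hfar L
        refine ⟨S + |T|, fun t ht => hS _ ?_⟩
        have := abs_sub_abs_le_abs_sub t T
        linarith⟩
  have he0 : e.cls (decay_antitone A B θ) = 0 := cls_even _ e fun t => by simp [e]
  have hee : e'.cls (decay_antitone A B θ) = e.cls (decay_antitone A B θ) :=
    (cls_shift _ e' e T fun t => by simp [e, e']).symm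
  rw [← he0, ← hee]
  let v : ℝ → ℝ := fun u => max 0 (min u 1)
  have hv : Continuous v := by fun_prop
  have hzm : Continuous fun t => z (max t T) :=
    hzc.comp_continuous (by fun_prop) fun t => mem_Ici.2 (le_max_right _ _)
  have hmT : ∀ t : ℝ, 0 ≤ max t T - T := fun t => sub_nonneg.2 (le_max_right _ _)
  -- From `z t` to the point of the ray at the same time, along a segment in the convex half plane.
  let w : ℝ → ℝ → ℂ := fun t u => ((1 - v u : ℝ) : ℂ) * z (max t T) +
    v u * (z T + (max t T - T : ℝ) * d σ)
  have hw : Continuous fun q : ℝ × ℝ => w q.1 q.2 := by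
    have : Continuous fun q : ℝ × ℝ => z (max q.1 T) := hzm.comp continuous_fst
    have h2 : Continuous fun q : ℝ × ℝ => z T + ((max q.1 T - T : ℝ) : ℂ) * d σ := by fun_prop
    exact ((continuous_ofReal.comp (continuous_const.sub (hv.comp continuous_snd))).mul this).add
      ((continuous_ofReal.comp (hv.comp continuous_snd)).mul h2)
  have hwh : ∀ t u, w t u ∈ half σ := fun t u =>
    combo_mem_half (he _ (le_max_right _ _)).1 (hline _ (hmT t)) (clamp_mem u).1 (clamp_mem u).2
  have hmem : ∀ t u, w t u + (max (T - t) 0 : ℝ) * d σ ∈ half σ := fun t u => by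
    rcases (le_max_right (T - t) 0).eq_or_lt with h0 | h0
    · rw [← h0]; simpa using hwh t u
    · exact (closedHalf_of_half (hwh t u)).add_mem_half (smul_mem_half (hpt σ) h0)
  refine cls_homotopy _ (fun q : ℝ × ℝ =>
    pt σ m (w q.1 q.2 + ((max (T - q.1) 0 : ℝ) : ℂ) * d σ)) ?_ (fun L => ?_) _ _
    (fun t => ?_) (fun t => ?_)
  · exact (continuousOn_pt σ m).comp_continuous (hw.add (by fun_prop))
      fun q => half_subset_dom σ (hmem q.1 q.2)
  · obtain ⟨N, hN0, hN⟩ := exists_cone_far h.pos h.lt h.hA h.hAB σ m L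
    obtain ⟨S₁, hS₁⟩ := Filter.eventually_atTop.1 (hz.eventually_gt_atTop N)
    obtain ⟨S₂, hS₂⟩ := h.exists_far σ m L ‖z T‖
    refine ⟨max (|S₁| + 2 * |T|) (max (|S₂| + |T|) ((N + 1 + ‖z T‖) / cone A B θ σ (d σ) + |T|)),
      fun t u ht _ _ => ?_⟩
    obtain ⟨ht1, ht⟩ := max_le_iff.1 ht
    obtain ⟨ht2, ht3⟩ := max_le_iff.1 ht
    have g1 := le_abs_self S₁
    have g2 := le_abs_self S₂
    have g3 := le_abs_self T
    have g4 := neg_abs_le T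
    have g5 := abs_nonneg S₁
    have g6 := abs_nonneg S₂
    simp only
    rcases le_total 0 t with h0 | h0
    · rw [abs_of_nonneg h0] at ht1 ht2 ht3
      have hTt : T ≤ t := by linarith
      rw [max_eq_right (sub_nonpos.2 hTt), ofReal_zero, zero_mul, add_zero]
      have hx : N + 1 ≤ cone A B θ σ (z T + (t - T : ℝ) * d σ) := by
        refine le_trans ?_ (hconeLine _ (sub_nonneg.2 hTt))
        have : (N + 1 + ‖z T‖) ≤ (t - T) * cone A B θ σ (d σ) := by
          rw [← div_le_iff₀ hcd]; linarith
        linarith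
      have hy := hS₁ t (by linarith)
      -- Both ends of the segment are deeper than `N`, hence so are all its points.
      have := cone_combo A B θ σ (N := min (N + 1) (cone A B θ σ (z t))) (min_le_right _ _)
        ((min_le_left _ _).trans hx) (clamp_mem u).1 (clamp_mem u).2
      refine hN _ (lt_of_lt_of_le (lt_min (lt_add_one N) hy) ?_)
      simp only [w, v]
      rwa [max_eq_left hTt]
    · rw [abs_of_nonpos h0] at ht1 ht2 ht3
      have hTt : t ≤ T := by linarith
      have hwT : w t u = z T := by
        simp only [w]
        rw [max_eq_right hTt, sub_self]
        push_cast
        ring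
      rw [hwT]
      exact (hS₂ _ _ le_rfl ((by linarith : S₂ ≤ T - t).trans (le_max_left _ _))).2
  · rw [hg]
    have hw0 : w t 0 = z (max t T) := by simp [w, v]
    simp only [hw0]
    rw [arrive]
    have hs : side (γ T) = σ := by rw [hTT.2.side_eq, sideOf_of_half hTT.1]
    split_ifs with h1
    · rw [max_eq_right h1, max_eq_left (sub_nonneg.2 h1)]
      exact ray_eq hpt hTT.2 hs (sub_nonneg.2 h1)
    · rw [not_le] at h1
      rw [max_eq_left h1.le, max_eq_right (sub_nonpos.2 h1.le), ofReal_zero, zero_mul, add_zero]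
      exact (he t h1.le).2.eq_pt
  · have hw1 : w t 1 = z T + (max t T - T : ℝ) * d σ := by simp [w, v]
    simp only [hw1]
    change pt σ m _ = _
    congr 1
    rw [add_assoc, ← add_mul, ← ofReal_add]
    congr 3
    rcases le_total t T with h1 | h1
    · rw [max_eq_right h1, max_eq_left (sub_nonneg.2 h1), abs_of_nonpos (sub_nonpos.2 h1)]; ring
    · rw [max_eq_left h1, max_eq_right (sub_nonpos.2 h1), abs_of_nonneg (sub_nonneg.2 h1)]; ring

/-- With speed `κ = |i/√τ|` the curve from the lower to the upper half plane is literally the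
prescribed parametrisation of the state integral contour. -/
theorem isStateContour_std (h : Tilt A B θ ε) {τ : ℂ} {κ : ℝ} (hκ : 0 < κ)
    (e : I / τ ^ (1 / 2 : ℂ) = κ * exp (θ / 2 * I)) (l m : ℤ) :
    IsStateContour τ ε l m (stdCurve h l m false true hκ (le_refl 0)).toFun := by
  have hmem := stdFun_mem_slit h.pointing l false true hκ.le (le_refl (0 : ℝ))
  have hc : ∀ σ, (l - 1 / 2 : ℂ) ∈ slitPart l σ := fun σ => Or.inr (by
    rcases center_mem_slit l with h | h
    · exact absurd (center_im l) h
    · exact h)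
  refine ⟨fun t ht => ?_, fun t ht => ?_⟩
  · have e1 : stdFun (dir A B θ ε) l false true κ 0 0 t =
        (l - 1 / 2 : ℂ) + (κ * t : ℝ) * dir A B θ ε true := by
      rw [stdFun, max_eq_right (by linarith), mul_zero, ofReal_zero, zero_mul, add_zero, sub_zero,
        max_eq_left ht]
    have e2 : t * (I / τ ^ (1 / 2 : ℂ) * exp (-(A * ε * I))) - 1 / 2 + l =
        (l - 1 / 2 : ℂ) + (κ * t : ℝ) * dir A B θ ε true := by
      rw [e, dir, sub_eq_add_neg (θ / 2 * I : ℂ), Complex.exp_add]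
      push_cast
      ring
    have hp := add_mem_slitPart h.pointing (hc true) (center_closedHalf l true)
      (mul_nonneg hκ.le ht)
    rw [e2]
    change IsPt true (slitPt l m (stdFun (dir A B θ ε) l false true κ 0 0 t)) _ m
    rw [e1, slitPt_eq m hp]
    exact isPt_pt (slitPart_subset_dom l true hp) _
  · have e1 : stdFun (dir A B θ ε) l false true κ 0 0 t =
        (l - 1 / 2 : ℂ) + (κ * -t : ℝ) * dir A B θ ε false := by
      rw [stdFun, max_eq_left (by linarith : (0 : ℝ) ≤ 0 - t),
        max_eq_right (by linarith : t - 0 ≤ 0), mul_zero, ofReal_zero, zero_mul, add_zero, zero_sub]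
    have e2 : t * (I / τ ^ (1 / 2 : ℂ) * exp (-((A - B) * ε * I))) - 1 / 2 + l =
        (l - 1 / 2 : ℂ) + (κ * -t : ℝ) * dir A B θ ε false := by
      rw [e, dir, sub_eq_add_neg (θ / 2 * I : ℂ), Complex.exp_add]
      push_cast
      ring
    have hp := add_mem_slitPart h.pointing (hc false) (center_closedHalf l false)
      (mul_nonneg hκ.le (neg_nonneg.2 ht))
    rw [e2]
    change IsPt false (slitPt l m (stdFun (dir A B θ ε) l false true κ 0 0 t)) _ _
    rw [e1, slitPt_eq m hp]
    exact isPt_pt (slitPart_subset_dom l false hp) _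

theorem HasEnd.ends_mem (h : Tilt A B θ ε) {γ : ℝ → Surf A B} {T₁ T₂ : ℝ} {σ₁ σ₂ : Bool}
    {m₁ m₂ : ℤ} {z₁ z₂ : ℝ → ℂ} (h₁ : HasEnd γ T₁ σ₁ m₁ z₁)
    (h₂ : HasEnd (fun t => γ (-t)) T₂ σ₂ m₂ z₂)
    (hz₁ : Filter.Tendsto (fun t => cone A B θ σ₁ (z₁ t)) Filter.atTop Filter.atTop)
    (hz₂ : Filter.Tendsto (fun t => cone A B θ σ₂ (z₂ t)) Filter.atTop Filter.atTop) (L : ℝ) :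
    ∃ S, ∀ s : ℝ, S ≤ |s| → γ s ∈ decay A B θ L := by
  obtain ⟨S₁, g1⟩ := h₁.eventually_mem h hz₁ L
  obtain ⟨S₂, g2⟩ := h₂.eventually_mem h hz₂ L
  refine ⟨max S₁ S₂, fun s hs => ?_⟩
  rcases le_total 0 s with h0 | h0
  · rw [abs_of_nonneg h0] at hs
    exact g1 s ((le_max_left _ _).trans hs)
  · rw [abs_of_nonpos h0] at hs
    have := g2 (-s) ((le_max_right _ _).trans hs)
    rwa [neg_neg] at this

theorem exists_leaveCurve (h : Tilt A B θ ε) (g : RelCurve (decay A B θ)) (b : ℝ) :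
    ∃ f : RelCurve (decay A B θ), ∀ s, f.toFun s = leave (dir A B θ ε) g.toFun b s := by
  refine ⟨⟨leave (dir A B θ ε) g.toFun b,
    continuous_leave h.hA h.hB h.pointing g.continuous_toFun b, fun L => ?_⟩, fun s => rfl⟩
  obtain ⟨S₁, g1⟩ := g.ends_mem L
  obtain ⟨S₂, g2⟩ := h.exists_far_ray (g.toFun b) L
  refine ⟨max S₁ (S₂ + |b|), fun s hs => ?_⟩
  obtain ⟨hs1, hs2⟩ := max_le_iff.1 hs
  have := neg_abs_le b
  have := le_abs_self b
  rw [leave]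
  split_ifs with hb
  · exact g1 s hs1
  · rw [not_le] at hb
    rcases le_total 0 s with h0 | h0
    · rw [abs_of_nonneg h0] at hs2
      exact g2 _ (by linarith)
    · rw [abs_of_nonpos h0] at hs2
      exact g2 _ (by linarith)

theorem exists_reverse {X : Type} [TopologicalSpace X] {D : ℝ → Set X} (g : RelCurve D) :
    ∃ f : RelCurve D, ∀ s, f.toFun s = g.toFun (-s) := by
  refine ⟨⟨fun s => g.toFun (-s), g.continuous_toFun.comp continuous_neg, fun L => ?_⟩,
    fun s => rfl⟩
  obtain ⟨S, hS⟩ := g.ends_mem L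
  exact ⟨S, fun s hs => hS _ (by rwa [abs_neg])⟩

theorem leave_neg (d : Bool → ℂ) (γ : ℝ → Surf A B) (b t : ℝ) :
    leave d (fun s => γ (-s)) (-b) (-t) = arrive d γ b t := by
  rw [leave, arrive]
  rcases lt_trichotomy t b with h | h | h
  · rw [if_neg (by linarith), if_pos h.le, neg_neg]
    congr 1
    ring
  · subst h
    rw [if_pos le_rfl, if_pos le_rfl, sub_self, ray_zero, neg_neg]
  · rw [if_pos (by linarith), if_neg (by linarith), neg_neg]

theorem cls_leave_add_arrive (g f f' : RelCurve (decay A B θ)) (b : ℝ)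
    (hf : ∀ s, f.toFun s = leave (dir A B θ ε) g.toFun b s)
    (hf' : ∀ s, f'.toFun s = arrive (dir A B θ ε) g.toFun b s) :
    g.cls (decay_antitone A B θ) =
      f.cls (decay_antitone A B θ) + f'.cls (decay_antitone A B θ) := by
  refine cls_concat_at _ b _ _ _ (fun t ht => ?_) (fun t ht => ?_) (fun t ht => ?_)
  · rw [hf, leave, if_pos ht]
  · rw [hf', arrive]
    split_ifs with h1
    · rw [le_antisymm h1 ht, sub_self, ray_zero]
    · rfl
  · rw [hf, hf', arrive, if_pos (by linarith), leave, sub_sub_cancel]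
    rcases ht.eq_or_lt with rfl | ht
    · rw [add_zero, if_pos le_rfl, ray_zero]
    · rw [if_neg (by linarith), add_sub_cancel_left]

/-- The ends of a curve can be replaced by rays. -/
theorem cls_eq_cls_arc (h : Tilt A B θ ε) (g : RelCurve (decay A B θ)) {T : ℝ} (hT : -T ≤ T)
    {σ₁ σ₂ : Bool} {m₁ m₂ : ℤ} {z₁ z₂ : ℝ → ℂ} (h₁ : HasEnd g.toFun T σ₁ m₁ z₁)
    (h₂ : HasEnd (fun t => g.toFun (-t)) T σ₂ m₂ z₂)
    (hz₁ : Filter.Tendsto (fun t => cone A B θ σ₁ (z₁ t)) Filter.atTop Filter.atTop)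
    (hz₂ : Filter.Tendsto (fun t => cone A B θ σ₂ (z₂ t)) Filter.atTop Filter.atTop) :
    g.cls (decay_antitone A B θ) =
      (arcCurve h g.continuous_toFun hT).cls (decay_antitone A B θ) := by
  have arr : ∀ (g : RelCurve (decay A B θ)) (b : ℝ), ∃ f : RelCurve (decay A B θ),
      ∀ s, f.toFun s = arrive (dir A B θ ε) g.toFun b s := fun g b => by
    obtain ⟨r, hr⟩ := exists_reverse g
    obtain ⟨f, hf⟩ := exists_leaveCurve h r (-b)
    obtain ⟨f', hf'⟩ := exists_reverse f
    refine ⟨f', fun s => ?_⟩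
    rw [hf', hf, ← leave_neg, show r.toFun = fun s => g.toFun (-s) from funext hr]
  obtain ⟨f₁, hf₁⟩ := exists_leaveCurve h g T
  obtain ⟨f₂, hf₂⟩ := arr g T
  obtain ⟨r, hr⟩ := exists_reverse g
  obtain ⟨f₃, hf₃⟩ := arr r T
  obtain ⟨f₄, hf₄⟩ := exists_reverse f₃
  have hr' : r.toFun = fun s => g.toFun (-s) := funext hr
  have e1 := cls_leave_add_arrive g f₁ f₂ T hf₁ hf₂
  have e2 := cls_arrive h g.continuous_toFun h₁ hz₁ f₂ hf₂
  have e3 := cls_arrive h (g.continuous_toFun.comp continuous_neg) h₂ hz₂ f₃ fun s => by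
    rw [hf₃, hr']; rfl
  have e4 := cls_reverse (decay_antitone A B θ) f₃ f₄ hf₄
  -- The second cut, at `-T`: what leaves at `T` is what leaves at `-T` followed by the arc in
  -- between.
  have e5 : f₁.cls (decay_antitone A B θ) = f₄.cls (decay_antitone A B θ) +
      (arcCurve h g.continuous_toFun hT).cls (decay_antitone A B θ) := by
    have hf4 : ∀ s, f₄.toFun s = leave (dir A B θ ε) g.toFun (-T) s := fun s => by
      rw [hf₄, hf₃, hr', ← leave_neg, neg_neg]
      simp only [neg_neg]
    refine cls_concat_at _ (-T) _ _ _ (fun t ht => ?_) (fun t ht => ?_) (fun t ht => ?_)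
    · rw [hf4, leave, if_pos ht, hf₁, leave, if_pos (ht.trans hT)]
    · change arc _ g.toFun (-T) T t = _
      rw [hf₁, leave, arc]
      split_ifs with h3 h4 h4
      · rw [le_antisymm h3 ht, sub_self, ray_zero]
      · exact absurd (h3.trans hT) h4
      · rfl
      · rfl
    · change arc _ g.toFun (-T) T _ = _
      rw [hf4, leave, arc, if_pos (by linarith), sub_sub_cancel]
      rcases ht.eq_or_lt with rfl | ht
      · rw [add_zero, if_pos le_rfl, ray_zero]
      · rw [if_neg (by linarith), add_sub_cancel_left]
  rw [e1, e2, e5, e4, e3, neg_zero]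
  exact (add_zero _).trans (zero_add _)

/-- The class of an arc, subdivided into pieces that lie in slit charts. -/
theorem arcCurve_cls_eq_sum (h : Tilt A B θ ε) {γ : ℝ → Surf A B} (hγ : Continuous γ) {T : ℝ}
    (t : ℕ → ℝ) (hmono : Monotone t) (ht0 : t 0 = -T) (i : ℕ → ℤ × Fin A)
    (hpiece : ∀ n, ∀ s ∈ Icc (t n) (t (n + 1)), γ s ∈ slitPt (i n).1 ((i n).2 : ℕ) '' slit (i n).1)
    {κ : ℝ} (hκ : 0 < κ) (n : ℕ) (hn : -T ≤ t n) :
    (arcCurve h hγ hn).cls (decay_antitone A B θ) =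
      ∑ k ∈ Finset.range n, jump (side (γ (t k))) (side (γ (t (k + 1)))) •
        (stdCurve h (i k).1 ((i k).2 : ℕ) false true hκ (le_refl 0)).cls
          (decay_antitone A B θ) := by
  induction n with
  | zero =>
    rw [Finset.sum_range_zero, arcCurve_cls_of_slit h hγ hn (l := (i 0).1)
      (m := ((i 0).2 : ℕ)) (fun s hs => hpiece 0 s ?_) hκ]
    · rw [ht0]
      -- The arc over a single time begins and ends on the same side, so its crossing number is `0`.
      cases side (γ (-T)) <;> exact zero_smul ℤ _
    · rw [ht0] at hs ⊢
      exact ⟨hs.1, hs.2.trans (ht0 ▸ hmono (Nat.le_succ 0))⟩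
  | succ n ih =>
    have hm : t n ≤ t (n + 1) := hmono (Nat.le_succ n)
    have hle : -T ≤ t n := ht0 ▸ hmono (Nat.zero_le n)
    rw [Finset.sum_range_succ, ← ih hle, ← arcCurve_cls_of_slit h hγ hm (hpiece n) hκ]
    exact arcCurve_cls_add h hγ hle hm

theorem HasEnd.mono {γ : ℝ → Surf A B} {T T' : ℝ} {σ : Bool} {m : ℤ} {z : ℝ → ℂ}
    (h : HasEnd γ T σ m z) (hT : T ≤ T') : HasEnd γ T' σ m z := fun t ht => h t (hT.trans ht)

end

theorem sum_finset_single {ι M : Type*} [AddCommGroup M] (N : ℕ) (i : ℕ → ι) (j : ℕ → ℤ)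
    (F : ι → M) : (Finsupp.sum (∑ n ∈ Finset.range N, Finsupp.single (i n) (j n)) fun x n =>
      n • F x) = ∑ n ∈ Finset.range N, j n • F (i n) := by
  rw [← Finsupp.linearCombination_apply, map_sum]
  exact Finset.sum_congr rfl fun n _ => Finsupp.linearCombination_single _ _ _

/-- Every curve whose ends decay is a combination of state integral contours, with coefficients
that do not depend on the angle. -/
theorem exists_stateCombination {A B : ℕ} (hA : 0 < A) (hB : 0 < B) (hAB : A ≠ B)
    {γ : ℝ → Surf A B} (hγ : Continuous γ) {T₁ T₂ : ℝ} {σ₁ σ₂ : Bool} {m₁ m₂ : ℤ} {z₁ z₂ : ℝ → ℂ}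
    (h₁ : HasEnd γ T₁ σ₁ m₁ z₁) (h₂ : HasEnd (fun t => γ (-t)) T₂ σ₂ m₂ z₂) :
    ∃ c : ℤ × Fin A →₀ ℤ, ∀ (θ : ℝ) (τ : ℂ) (ε : ℝ), 0 < θ → θ < 2 * Real.pi →
      ArgCondition τ θ → SmallTilt A B θ ε →
      Filter.Tendsto (fun t => cone A B θ σ₁ (z₁ t)) Filter.atTop Filter.atTop →
      Filter.Tendsto (fun t => cone A B θ σ₂ (z₂ t)) Filter.atTop Filter.atTop →
      IsStateCombination θ τ ε γ c := by
  set T := max (max T₁ T₂) 0 with hT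
  have hT1 : T₁ ≤ T := (le_max_left _ _).trans (le_max_left _ _)
  have hT2 : T₂ ≤ T := (le_max_right _ _).trans (le_max_left _ _)
  have hT0 : -T ≤ T := by
    have : 0 ≤ T := le_max_right _ _
    linarith
  -- Subdivision of the compact middle part into pieces, each inside one slit chart.
  obtain ⟨t, ht0, hmono, ⟨N, hN⟩, hcover⟩ := exists_monotone_Icc_subset_open_cover_Icc hT0
    (c := fun i : ℤ × Fin A => {s : Icc (-T) T | γ s ∈ slitPt i.1 (i.2 : ℕ) '' slit i.1})
    (fun i => (isOpen_image_slitPt _ _ (isOpen_slit _) subset_rfl).preimage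
      (hγ.comp continuous_subtype_val))
    (fun s _ => by
      obtain ⟨l, m, z, hz, e⟩ := exists_slit A B hA hB (γ s)
      exact mem_iUnion.2 ⟨(l, m), z, hz, e⟩)
  choose i hi using hcover
  have hpiece : ∀ n, ∀ s ∈ Icc (t n : ℝ) (t (n + 1)),
      γ s ∈ slitPt (i n).1 ((i n).2 : ℕ) '' slit (i n).1 := fun n s hs =>
    hi n (show (⟨s, (t n).2.1.trans hs.1, hs.2.trans (t (n + 1)).2.2⟩ : Icc (-T) T) ∈
      Icc (t n) (t (n + 1)) from ⟨hs.1, hs.2⟩)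
  -- The coefficients are fixed by the curve and its subdivision, before `θ`, `τ` and `ε` appear.
  refine ⟨∑ n ∈ Finset.range N, Finsupp.single (i n)
    (jump (side (γ (t n))) (side (γ (t (n + 1))))), ?_⟩
  intro θ τ ε hθ0 hθ hτ hε hz₁ hz₂
  have h : Tilt A B θ ε := ⟨hA, hB, hAB, hθ0, hθ, hε⟩
  obtain ⟨κ, hκ, eκ⟩ := I_div_sqrt_eq hθ0 hθ hτ
  refine ⟨⟨γ, hγ, HasEnd.ends_mem h h₁ h₂ hz₁ hz₂⟩, fun x =>
    stdCurve h x.1 (x.2 : ℕ) false true hκ (le_refl 0), rfl,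
    fun l m => isStateContour_std h hκ eκ l _, ?_⟩
  have hNT : (t N : ℝ) = T := hN N le_rfl
  have hn : -T ≤ (t N : ℝ) := (t N).2.1
  have hsum := arcCurve_cls_eq_sum h hγ (fun n => (t n : ℝ)) hmono ht0 i hpiece hκ N hn
  rw [sum_finset_single, ← hsum]
  have key := cls_eq_cls_arc h ⟨γ, hγ, HasEnd.ends_mem h h₁ h₂ hz₁ hz₂⟩ hT0 (h₁.mono hT1)
    (h₂.mono hT2) hz₁ hz₂
  rw [key]
  congr 2
  exact hNT.symm

/-! ### The dilogarithm on the closed unit disc -/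

/-- Termwise comparison of the Taylor series at `w` with the one at `|w|`. -/
theorem norm_log_one_sub_le {w : ℂ} (hw : ‖w‖ < 1) : ‖log (1 - w)‖ ≤ -Real.log (1 - ‖w‖) := by
  have h1 := Complex.hasSum_taylorSeries_neg_log hw
  have h2 := Complex.hasSum_taylorSeries_neg_log (z := (‖w‖ : ℂ)) (by simpa using hw)
  have h3 : HasSum (fun n : ℕ => ‖w‖ ^ n / n) (-Real.log (1 - ‖w‖)) := by
    rw [← Complex.hasSum_ofReal]
    have e : (((-Real.log (1 - ‖w‖) : ℝ)) : ℂ) = -log (1 - (‖w‖ : ℂ)) := by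
      rw [ofReal_neg, ofReal_log (by linarith)]
      push_cast
      rfl
    rw [e]
    refine hasSum_of_pointwise h2 fun n => by push_cast; rfl
  rw [← norm_neg, ← h1.tsum_eq]
  refine tsum_of_norm_bounded h3 fun n => ?_
  rw [norm_div, norm_pow, Complex.norm_natCast]

/-- With `r = √(1 - t)`: `-log(1 - t) = 2 log(1/r) ≤ 2 (1/r - 1) ≤ 2 t / r`. The factor `t` cancels
the denominator of the dilogarithm integrand, and what is left is integrable at `t = 1`. -/
theorem neg_log_one_sub_le {t : ℝ} (h0 : 0 < t) (h1 : t < 1) :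
    -Real.log (1 - t) ≤ t * (2 * (1 - t) ^ (-(1 / 2) : ℝ)) := by
  have hp : 0 < 1 - t := by linarith
  set r := Real.sqrt (1 - t) with hr
  have hr0 : 0 < r := Real.sqrt_pos.2 hp
  have hr2 : r ^ 2 = 1 - t := Real.sq_sqrt hp.le
  have hlog : Real.log (1 - t) = 2 * Real.log r := by
    rw [← hr2, Real.log_pow]; norm_num
  have hle := Real.log_le_sub_one_of_pos (inv_pos.2 hr0)
  rw [Real.log_inv] at hle
  rw [Real.rpow_neg hp.le, ← Real.sqrt_eq_rpow, ← hr, hlog]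
  have h3 : r⁻¹ - 1 ≤ t * r⁻¹ := by
    have : t * r⁻¹ - (r⁻¹ - 1) = (1 - r) := by
      have : t = 1 - r ^ 2 := by linarith
      rw [this]; field_simp; ring
    have : r ≤ 1 := by nlinarith
    linarith
  linarith

theorem norm_dilog_integrand_le {x : ℂ} (hx : ‖x‖ ≤ 1) {t : ℝ} (h0 : 0 < t) (h1 : t < 1) :
    ‖log (1 - t * x) / t‖ ≤ 2 * (1 - t) ^ (-(1 / 2) : ℝ) := by
  have hn : ‖(t : ℂ) * x‖ ≤ t := by
    rw [norm_mul, Complex.norm_real, Real.norm_eq_abs, abs_of_pos h0]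
    nlinarith
  rw [norm_div, Complex.norm_real, Real.norm_eq_abs, abs_of_pos h0, div_le_iff₀ h0, mul_comm _ t]
  refine (norm_log_one_sub_le (hn.trans_lt h1)).trans (le_trans ?_ (neg_log_one_sub_le h0 h1))
  exact neg_le_neg (Real.log_le_log (by linarith) (by linarith))

theorem intervalIntegrable_dilog_bound :
    IntervalIntegrable (fun t : ℝ => 2 * (1 - t) ^ (-(1 / 2) : ℝ)) volume 0 1 := by
  have h := (intervalIntegral.intervalIntegrable_rpow' (a := 0) (b := 1)
    (r := -(1 / 2)) (by norm_num)).comp_sub_left 1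
  simpa using (h.symm).const_mul 2

theorem ae_lt_one : ∀ᵐ t : ℝ, t ≠ 1 := by
  rw [MeasureTheory.ae_iff]
  simp

/-- Dominated convergence with the bound of `norm_dilog_integrand_le`. The disc must be closed: it
has to contain `x = 1`, the branch point, and to be compact. -/
theorem continuousOn_dilog : ContinuousOn dilog (Metric.closedBall 0 1) := by
  intro x hx
  refine ContinuousWithinAt.neg ?_
  refine intervalIntegral.continuousWithinAt_of_dominated_interval
    (bound := fun t : ℝ => 2 * (1 - t) ^ (-(1 / 2) : ℝ)) ?_ ?_ intervalIntegrable_dilog_bound ?_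
  · refine Filter.Eventually.of_forall fun y => Measurable.aestronglyMeasurable ?_
    fun_prop
  · filter_upwards [self_mem_nhdsWithin] with y hy
    filter_upwards [ae_lt_one] with t ht1 ht
    rw [uIoc_of_le zero_le_one] at ht
    exact norm_dilog_integrand_le (by simpa using hy) ht.1 (lt_of_le_of_ne ht.2 ht1)
  · filter_upwards [ae_lt_one] with t ht1 ht
    rw [uIoc_of_le zero_le_one] at ht
    have ht1' : t < 1 := lt_of_le_of_ne ht.2 ht1
    refine ContinuousAt.continuousWithinAt (ContinuousAt.div_const (ContinuousAt.clog (by fun_prop)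
      ?_) _)
    rw [Complex.mem_slitPlane_iff]
    left
    have h1 : (t * x : ℂ).re ≤ ‖(t * x : ℂ)‖ := Complex.re_le_norm _
    have h2 : ‖(t * x : ℂ)‖ ≤ t := by
      rw [norm_mul, Complex.norm_real, Real.norm_eq_abs, abs_of_pos ht.1]
      have : ‖x‖ ≤ 1 := by simpa using hx
      nlinarith [ht.1]
    simp only [sub_re, one_re]
    linarith

theorem exists_dilog_bound : ∃ C : ℝ, 0 ≤ C ∧ ∀ x : ℂ, ‖x‖ ≤ 1 → ‖dilog x‖ ≤ C := by
  obtain ⟨C, hC⟩ := (isCompact_closedBall (0 : ℂ) 1).exists_bound_of_continuousOn continuousOn_dilog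
  exact ⟨max C 0, le_max_right _ _, fun x hx => (hC x (by simpa using hx)).trans (le_max_left _ _)⟩

/-- Limit of `dilog_inversion` as `z → 0` through positive reals, where both dilogarithms tend to
`Li₂(1)`. -/
theorem dilog_one : dilog 1 = (Real.pi : ℂ) ^ 2 / 6 := by
  have hl : ∀ s : ℝ, Filter.Tendsto (fun r : ℝ => dilog (ex (s * r))) (𝓝[>] 0) (𝓝 (dilog 1)) := by
    intro s
    have h1 : Filter.Tendsto (fun r : ℝ => ex (s * r)) (𝓝[>] 0)
        (𝓝[Metric.closedBall 0 1] 1) := by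
      refine tendsto_nhdsWithin_iff.2 ⟨?_, Filter.Eventually.of_forall fun r => ?_⟩
      · have : Continuous fun r : ℝ => ex (s * r) := continuous_ex.comp (by fun_prop)
        have := (this.tendsto 0).mono_left (nhdsWithin_le_nhds (s := Ioi 0))
        simpa [ex] using this
      · rw [mem_closedBall_zero_iff, norm_ex]
        simp
    exact (continuousOn_dilog 1 (by simp)).tendsto.comp h1
  have h2 : Filter.Tendsto (fun r : ℝ => dilog (ex (r : ℂ)) + dilog (ex (-(r : ℂ)))
      + (2 * Real.pi * I) ^ 2 / 2 * ((r : ℂ) - 1 / 2) ^ 2) (𝓝[>] 0)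
      (𝓝 (dilog 1 + dilog 1 + (2 * Real.pi * I) ^ 2 / 2 * ((0 : ℂ) - 1 / 2) ^ 2)) := by
    refine ((?_ : Filter.Tendsto _ _ _).add ?_).add ?_
    · simpa using hl 1
    · simpa using hl (-1)
    · have : Continuous fun r : ℝ => (2 * Real.pi * I) ^ 2 / 2 * ((r : ℂ) - 1 / 2) ^ 2 := by
        fun_prop
      have := (this.tendsto 0).mono_left (nhdsWithin_le_nhds (s := Ioi 0))
      simpa using this
  have h3 : ∀ᶠ r : ℝ in 𝓝[>] 0, dilog (ex (r : ℂ)) + dilog (ex (-(r : ℂ)))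
      + (2 * Real.pi * I) ^ 2 / 2 * ((r : ℂ) - 1 / 2) ^ 2 = -(Real.pi : ℂ) ^ 2 / 6 := by
    filter_upwards [Ioo_mem_nhdsGT one_pos] with r hr
    exact dilog_inversion (by simpa using hr.1) (by simpa using hr.2)
  have h4 := tendsto_nhds_unique (tendsto_const_nhds.congr' (h3.mono fun _ h => h.symm)) h2
  have hI : (2 * Real.pi * I : ℂ) ^ 2 = -(4 * Real.pi ^ 2) := by
    rw [mul_pow, I_sq]; ring
  rw [hI] at h4
  linear_combination -(h4 / 2)

/-! ### The exponential of `V` -/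

theorem modZ_eq_iff {u v : ℂ} : modZ u = modZ v ↔ ex u = ex v := by
  rw [ex_eq_ex_iff]
  constructor
  · intro h
    obtain ⟨k, hk⟩ := AddSubgroup.mem_zmultiples_iff.1 (QuotientAddGroup.eq.1 h)
    refine ⟨k, ?_⟩
    simp only [zsmul_eq_mul, mul_one] at hk
    rw [hk]; ring
  · rintro ⟨k, rfl⟩
    exact modZ_eq_of_sub_eq_int (-k) (by push_cast; ring)

/-- `e(V)`. -/
def ev {A B : ℕ} (p : Surf A B) : ℂ := ex (Quotient.out (vol A B p))

/-- Through `e` the group `ℂ/ℤ` is replaced by `ℂ ∖ 0`, so statements about `V` become equations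
between complex functions. -/
theorem vol_eq_iff {A B : ℕ} {p : Surf A B} {v : ℂ} : vol A B p = modZ v ↔ ev p = ex v := by
  rw [ev, ← modZ_eq_iff]
  have : modZ (Quotient.out (vol A B p)) = vol A B p := Quotient.out_eq _
  rw [this]

theorem IsPt.ev_eq {A B : ℕ} {σ : Bool} {p : Surf A B} {z : ℂ} {m : ℤ} (h : IsPt σ p z m) :
    ev p = ex (Vc A B σ z m) := vol_eq_iff.1 h.vol_eq

theorem continuous_ev {A B : ℕ} : Continuous (ev : Surf A B → ℂ) := by
  rw [continuous_iff_continuousAt]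
  intro p
  obtain ⟨σ, z, m, hp⟩ := exists_chart p
  rw [ContinuousAt, Filter.tendsto_def]
  intro s hs
  have hc : ContinuousAt (fun w => ex (Vc A B σ w m)) z :=
    continuous_ex.continuousAt.comp (hasDerivAt_Vc A B hp.mem_dom m).continuousAt
  rw [hp.ev_eq] at hs
  obtain ⟨U, hU, hUo, hzU⟩ := mem_nhds_iff.1 (Filter.inter_mem (hc hs)
    ((isOpen_dom σ).mem_nhds hp.mem_dom))
  refine Filter.mem_of_superset ((isOpen_image_pt (A := A) (B := B) m hUo
    (hU.trans inter_subset_right)).mem_nhds ⟨z, hzU, hp.eq_pt.symm⟩) ?_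
  rintro _ ⟨w, hw, rfl⟩
  rw [mem_preimage, (isPt_pt (hU hw).2 m).ev_eq]
  exact (hU hw).1

theorem ev_ne_zero {A B : ℕ} (p : Surf A B) : ev p ≠ 0 := ex_ne_zero _

/-- The imaginary part of `V`. -/
def imV {A B : ℕ} (p : Surf A B) : ℝ := -(Real.log ‖ev p‖ / (2 * Real.pi))

theorem continuous_imV {A B : ℕ} : Continuous (imV : Surf A B → ℝ) :=
  ((continuous_ev.norm.log fun p => norm_ne_zero_iff.2 (ev_ne_zero p)).div_const _).neg

theorem imV_eq {A B : ℕ} {p : Surf A B} {v : ℂ} (h : ev p = ex v) : imV p = v.im := by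
  rw [imV, h, norm_ex, Real.log_exp]
  have := Real.pi_pos
  field_simp

/-! ### Critical points -/

theorem isCritical_iff {A B : ℕ} {p : Surf A B} : IsCritical p ↔ yc p = 0 := by
  constructor
  · rintro (⟨z, m, hp, hd⟩ | ⟨z, m, hp, hd⟩)
    · rw [hp.yc_eq]
      exact (hasDerivAt_VPlus A B hp.1 m).unique hd
    · rw [hp.yc_eq]
      exact (hasDerivAt_VMinus A B hp.1 m).unique hd
  · intro h
    obtain ⟨σ, z, m, hp⟩ := exists_chart p
    have hd := hasDerivAt_Vc A B hp.mem_dom m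
    rw [← hp.yc_eq, h] at hd
    cases σ
    · exact Or.inr ⟨z, m, hp, hd⟩
    · exact Or.inl ⟨z, m, hp, hd⟩

/-- For `N = a + b` this is `a^a b^b < (a + b)^(a + b)`, the inequality that excludes degenerate
critical points. -/
theorem pow_mul_pow_lt {a b : ℝ} {m n : ℕ} {N : ℝ} (ha0 : 0 ≤ a) (hb0 : 0 ≤ b) (ha : a < N)
    (hb : b ≤ N) (hm : m ≠ 0) : a ^ m * b ^ n < N ^ (m + n) := by
  have hN : 0 < N := lt_of_le_of_lt ha0 ha
  rw [pow_add]
  have h1 : a ^ m < N ^ m := pow_lt_pow_left₀ ha ha0 hm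
  have h2 : b ^ n ≤ N ^ n := pow_le_pow_left₀ hb0 hb n
  exact lt_of_le_of_lt (mul_le_mul_of_nonneg_left h2 (pow_nonneg ha0 m))
    (mul_lt_mul_of_pos_right h1 (pow_pos hN n))

/-- The critical points of `V` are non-degenerate. -/
theorem deriv_yc_ne_zero {A B : ℕ} (hA : 0 < A) (hB : 0 < B) (hAB : A ≠ B) {p : Surf A B}
    (hp : yc p = 0) : (A : ℂ) + B * (xc p / (1 - xc p)) ≠ 0 := by
  intro h
  have h1 := xc_ne_one hB p
  have hrel := xyc_relation p
  rw [hp, show ex 0 = 1 by simp [ex], one_mul] at hrel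
  -- If `V''` vanished, then `x = A/(A - B)` and `1 - x = -B/(A - B)`. In absolute values the
  -- critical point equation would read `B^B d^A = A^A d^B` with `d = |A - B|`, against
  -- `pow_mul_pow_lt`.
  have hx : ((A : ℂ) - B) * xc p = A := by
    field_simp at h
    linear_combination -h
  have hx' : ((A : ℂ) - B) * (1 - xc p) = -B := by linear_combination -hx
  set d : ℝ := |(A : ℝ) - B| with hd
  have hnd : ‖((A : ℂ) - B)‖ = d := by
    rw [hd, ← Real.norm_eq_abs, ← Complex.norm_real]; push_cast; rfl
  have nx : d * ‖xc p‖ = A := by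
    have := congrArg norm hx
    rwa [norm_mul, hnd, Complex.norm_natCast] at this
  have nx' : d * ‖1 - xc p‖ = B := by
    have := congrArg norm hx'
    rwa [norm_mul, hnd, norm_neg, Complex.norm_natCast] at this
  have nrel : ‖1 - xc p‖ ^ B = ‖xc p‖ ^ A := by
    have := congrArg norm hrel
    simpa using this
  have key : (B : ℝ) ^ B * d ^ A = A ^ A * d ^ B := by
    rw [← nx, ← nx', mul_pow, mul_pow, nrel]; ring
  have hA' : (0 : ℝ) < A := by exact_mod_cast hA
  have hB' : (0 : ℝ) < B := by exact_mod_cast hB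
  rcases lt_or_gt_of_ne hAB with hlt | hlt
  · have hlt' : (A : ℝ) < B := by exact_mod_cast hlt
    obtain ⟨k, rfl⟩ := Nat.exists_eq_add_of_le hlt.le
    have e : d = k := by
      rw [hd, abs_sub_comm]; push_cast; rw [add_sub_cancel_left]; exact abs_of_nonneg (by positivity)
    have hk : (0 : ℝ) < k := by push_cast at hlt'; linarith
    rw [e] at key
    have h3 := pow_mul_pow_lt (m := A) (n := k) hA'.le hk.le hlt'
      (by push_cast; linarith) hA.ne'
    have h4 : (k : ℝ) ^ A * ((A + k : ℕ) : ℝ) ^ (A + k) =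
        (k : ℝ) ^ A * ((A : ℝ) ^ A * (k : ℝ) ^ k) := by
      rw [mul_comm, key, pow_add]; ring
    exact absurd (mul_left_cancel₀ (pow_pos hk A).ne' h4) h3.ne'
  · have hlt' : (B : ℝ) < A := by exact_mod_cast hlt
    obtain ⟨k, rfl⟩ := Nat.exists_eq_add_of_le hlt.le
    have e : d = k := by
      rw [hd]; push_cast; rw [add_sub_cancel_left]; exact abs_of_nonneg (by positivity)
    have hk : (0 : ℝ) < k := by push_cast at hlt'; linarith
    rw [e] at key
    have h3 := pow_mul_pow_lt (m := B) (n := k) hB'.le hk.le hlt'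
      (by push_cast; linarith) hB.ne'
    have h4 : (k : ℝ) ^ B * ((B + k : ℕ) : ℝ) ^ (B + k) =
        (k : ℝ) ^ B * ((B : ℝ) ^ B * (k : ℝ) ^ k) := by
      rw [mul_comm, ← key, pow_add]; ring
    exact absurd (mul_left_cancel₀ (pow_pos hk B).ne' h4) h3.ne'

/-! ### Local sections of `V` -/

theorem hasStrictDerivAt_of_eventually {f f' : ℂ → ℂ} {U : Set ℂ} (hU : IsOpen U)
    (h : ∀ z ∈ U, HasDerivAt f (f' z) z) {z : ℂ} (hz : z ∈ U) : HasStrictDerivAt f (f' z) z := by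
  have hd : DifferentiableOn ℂ f U := fun w hw => (h w hw).differentiableAt.differentiableWithinAt
  have := (hd.analyticAt (hU.mem_nhds hz)).hasStrictDerivAt
  rwa [(h z hz).deriv] at this

theorem eq_of_norm_sub_lt_one {k n : ℤ} (h : ‖((k : ℂ) - n)‖ < 1) : k = n := by
  rw [← Int.cast_sub, Complex.norm_intCast] at h
  have h2 : |k - n| < 1 := by exact_mod_cast h
  rw [abs_lt] at h2
  omega

/-- A local homeomorphism `ψ` of the plane, read through a chart, describes `e(V)` near `q`:
`e(V(chart z)) = e(F(ψ z))`. -/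
theorem exists_local_section {A B : ℕ} {q : Surf A B} {σ : Bool} {z₀ : ℂ} {m : ℤ}
    (hq : IsPt σ q z₀ m) {ψ : ℂ → ℂ} {ψ' : ℂ} (hψ : HasStrictDerivAt ψ ψ' z₀) (hψ' : ψ' ≠ 0) :
    ∃ ζ : ℂ → ℂ, ζ (ψ z₀) = z₀ ∧ HasDerivAt ζ ψ'⁻¹ (ψ z₀) ∧
      (∀ᶠ w in 𝓝 (ψ z₀), ζ w ∈ dom σ ∧ ψ (ζ w) = w ∧ ContinuousAt ζ w) ∧
      ∀ W ∈ 𝓝 z₀, ∃ N ∈ 𝓝 q, ∀ p ∈ N, ∃ z ∈ W, z ∈ dom σ ∧ ζ (ψ z) = z ∧ IsPt σ p z m := by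
  have hf := HasStrictDerivAt.hasStrictFDerivAt_equiv hψ hψ'
  set h := hf.toOpenPartialHomeomorph ψ with hh
  have hz : z₀ ∈ h.source := hf.mem_toOpenPartialHomeomorph_source
  have hl : ∀ z ∈ h.source, h.symm (ψ z) = z := fun z hz => h.left_inv hz
  have htgt : ψ z₀ ∈ h.target := h.map_source hz
  have hd : HasStrictDerivAt h.symm ψ'⁻¹ (ψ z₀) :=
    HasStrictDerivAt.to_localInverse hψ hψ'
  have hcont : ∀ᶠ w in 𝓝 (ψ z₀), ContinuousAt h.symm w := by
    filter_upwards [h.open_target.mem_nhds htgt] with w hw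
    exact h.continuousAt_symm hw
  refine ⟨h.symm, hl _ hz, hd.hasDerivAt, ?_, fun W hW => ?_⟩
  · have h1 : ∀ᶠ w in 𝓝 (ψ z₀), h.symm w ∈ dom σ := by
      refine hd.hasDerivAt.continuousAt ((isOpen_dom σ).mem_nhds ?_)
      rw [hl _ hz]
      exact hq.mem_dom
    filter_upwards [h1, hcont, h.open_target.mem_nhds htgt] with w h1 h2 h3
    exact ⟨h1, h.right_inv h3, h2⟩
  · obtain ⟨U, hU, hUo, hzU⟩ := mem_nhds_iff.1 (Filter.inter_mem hW (Filter.inter_mem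
      ((isOpen_dom σ).mem_nhds hq.mem_dom) (h.open_source.mem_nhds hz)))
    refine ⟨_, (isOpen_image_pt (A := A) (B := B) m hUo fun z hz => (hU hz).2.1).mem_nhds
      ⟨z₀, hzU, hq.eq_pt.symm⟩, ?_⟩
    rintro _ ⟨z, hz, rfl⟩
    exact ⟨z, (hU hz).1, (hU hz).2.1, hl z (hU hz).2.2, isPt_pt (hU hz).2.1 m⟩

/-- The local section of `V` at a point where its derivative does not vanish. -/
theorem exists_section {A B : ℕ} {q : Surf A B} (hq : yc q ≠ 0) {v₀ : ℂ} (hv : ev q = ex v₀) :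
    ∃ S : ℂ → Surf A B, S v₀ = q ∧ (∀ᶠ v in 𝓝 v₀, ContinuousAt S v ∧ ev (S v) = ex v) ∧
      HasDerivAt (fun v => xc (S v)) (2 * Real.pi * I * xc q / yc q) v₀ ∧
      HasDerivAt (fun v => yc (S v)) ((A + B * (xc q / (1 - xc q))) / yc q) v₀ ∧
      ∃ N ∈ 𝓝 q, ∀ᶠ v in 𝓝 v₀, ∀ p ∈ N, ev p = ex v → p = S v := by
  obtain ⟨σ, z₀, m, hp⟩ := exists_chart q
  obtain ⟨n, hn⟩ := ex_eq_ex_iff.1 (hv.symm.trans hp.ev_eq)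
  have hst : HasStrictDerivAt (fun z => Vc A B σ z m - n) (yc q) z₀ := by
    have := hasStrictDerivAt_of_eventually (isOpen_dom σ)
      (fun z hz => hasDerivAt_Vc A B hz m) hp.mem_dom
    rw [← hp.yc_eq] at this
    exact this.sub_const (n : ℂ)
  have e0 : Vc A B σ z₀ m - n = v₀ := by rw [hn]; ring
  obtain ⟨ζ, h0, hd, hev, hN⟩ := exists_local_section hp hst hq
  simp only [e0] at h0 hd hev
  have hev' : ∀ᶠ v in 𝓝 v₀, ev (pt σ m (ζ v) : Surf A B) = ex v := by
    filter_upwards [hev] with v h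
    have h2 := h.2.1
    rw [(isPt_pt h.1 m).ev_eq, ex_eq_ex_iff]
    exact ⟨-n, by push_cast; linear_combination -h2⟩
  refine ⟨fun v => pt σ m (ζ v), ?_, ?_, ?_, ?_, ?_⟩
  · simp only [h0]; exact hp.eq_pt.symm
  · filter_upwards [hev, hev'] with v h h'
    exact ⟨((continuousOn_pt σ m).continuousAt ((isOpen_dom σ).mem_nhds h.1)).comp h.2.2, h'⟩
  · have h1 : HasDerivAt (fun v => ex (ζ v)) (2 * Real.pi * I * ex (ζ v₀) * (yc q)⁻¹) v₀ :=
      (hasDerivAt_ex _).comp v₀ hd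
    rw [h0, ← hp.xc_eq, ← div_eq_mul_inv] at h1
    refine h1.congr_of_eventuallyEq ?_
    filter_upwards [hev] with v h
    exact (isPt_pt h.1 m).xc_eq
  · have hY := hasDerivAt_Yc A B hp.mem_dom m
    rw [← h0] at hY
    have h1 := hY.comp v₀ hd
    rw [h0, ← hp.xc_eq, ← div_eq_mul_inv] at h1
    refine h1.congr_of_eventuallyEq ?_
    filter_upwards [hev] with v h
    exact (isPt_pt h.1 m).yc_eq
  · have hc : ContinuousAt (fun z => Vc A B σ z m) z₀ :=
      (hasDerivAt_Vc A B hp.mem_dom m).continuousAt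
    -- Here `V` varies by less than `1/2`, and so does `v` below; thus `e(V) = e(v)` fixes the
    -- branch, not just the class modulo `ℤ`.
    obtain ⟨N, hN, hN'⟩ := hN {z | dist (Vc A B σ z m) (Vc A B σ z₀ m) < 1 / 2}
      (hc (Metric.ball_mem_nhds _ (by norm_num)))
    refine ⟨N, hN, ?_⟩
    filter_upwards [Metric.ball_mem_nhds v₀ (by norm_num : (0 : ℝ) < 1 / 2)] with v hvb p hpN hpv
    obtain ⟨z, hzW, hz, hζ, hpz⟩ := hN' p hpN
    obtain ⟨k, hk⟩ := ex_eq_ex_iff.1 (hpv.symm.trans hpz.ev_eq)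
    have hkn : k = n := by
      refine eq_of_norm_sub_lt_one ?_
      have e : (k : ℂ) - n = (Vc A B σ z m - Vc A B σ z₀ m) - (v - v₀) := by rw [hk, hn]; ring
      rw [e]
      have h1 : ‖Vc A B σ z m - Vc A B σ z₀ m‖ < 1 / 2 := by rw [← dist_eq_norm]; exact hzW
      have h2 : ‖v - v₀‖ < 1 / 2 := by rw [← dist_eq_norm]; exact hvb
      exact (norm_sub_le _ _).trans_lt (by linarith)
    rw [hk, hkn, add_sub_cancel_right] at hζ
    rw [hpz.eq_pt, ← hζ, hζ]

/-- An analytic function with a non-degenerate critical point is a square up to a constant. -/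
theorem exists_sqrt_of_critical {f Y : ℂ → ℂ} {U : Set ℂ} (hU : IsOpen U) {z₀ : ℂ} (hz₀ : z₀ ∈ U)
    (hf : ∀ z ∈ U, HasDerivAt f (Y z) z) (hY0 : Y z₀ = 0) {c : ℂ} (hY : HasDerivAt Y c z₀)
    (hc : c ≠ 0) : ∃ (ψ : ℂ → ℂ) (ψ' : ℂ), HasStrictDerivAt ψ ψ' z₀ ∧ ψ' ≠ 0 ∧ ψ z₀ = 0 ∧
      ∀ᶠ z in 𝓝 z₀, f z = f z₀ + ψ z ^ 2 := by
  have hfd : DifferentiableOn ℂ f U := fun z hz =>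
    (hf z hz).differentiableAt.differentiableWithinAt
  -- Two divided differences: `f = f(z₀) + (z - z₀)² f₂`, where `f₂(z₀)` is half the second
  -- derivative.
  set f₁ := dslope f z₀ with hf₁
  have h₁ : DifferentiableOn ℂ f₁ U :=
    (Complex.differentiableOn_dslope (hU.mem_nhds hz₀)).2 hfd
  set f₂ := dslope f₁ z₀ with hf₂
  have h₂ : DifferentiableOn ℂ f₂ U :=
    (Complex.differentiableOn_dslope (hU.mem_nhds hz₀)).2 h₁
  have e₁ : ∀ z, f z = f z₀ + (z - z₀) * f₁ z := fun z => by
    have := sub_smul_dslope f z₀ z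
    rw [smul_eq_mul] at this
    rw [hf₁, this]; ring
  have h10 : f₁ z₀ = 0 := by rw [hf₁, dslope_same, (hf z₀ hz₀).deriv, hY0]
  have e₂ : ∀ z, f₁ z = (z - z₀) * f₂ z := fun z => by
    have := sub_smul_dslope f₁ z₀ z
    rw [smul_eq_mul, h10, sub_zero] at this
    exact this.symm
  have a₁ : AnalyticAt ℂ f₁ z₀ := h₁.analyticAt (hU.mem_nhds hz₀)
  have a₂ : AnalyticAt ℂ f₂ z₀ := h₂.analyticAt (hU.mem_nhds hz₀)
  have hYe : ∀ z ∈ U, Y z = f₁ z + (z - z₀) * deriv f₁ z := fun z hz => by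
    have hd1 : HasDerivAt f₁ (deriv f₁ z) z :=
      (h₁.differentiableAt (hU.mem_nhds hz)).hasDerivAt
    have := ((((hasDerivAt_id z).sub_const z₀).mul hd1).const_add (f z₀))
    have h3 := (hf z hz).congr_of_eventuallyEq (f₁ := fun z => f z₀ + (z - z₀) * f₁ z)
      (Filter.Eventually.of_forall fun z => (e₁ z).symm)
    rw [h3.unique this]
    simp
  have hc2 : c = 2 * f₂ z₀ := by
    have hd1 : HasDerivAt f₁ (deriv f₁ z₀) z₀ := a₁.differentiableAt.hasDerivAt
    have hd2 : HasDerivAt (deriv f₁) (deriv (deriv f₁) z₀) z₀ :=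
      a₁.deriv.differentiableAt.hasDerivAt
    have h3 := hd1.add (((hasDerivAt_id z₀).sub_const z₀).mul hd2)
    have h4 := hY.congr_of_eventuallyEq
      (f₁ := fun z => f₁ z + (z - z₀) * deriv f₁ z) (by
        filter_upwards [hU.mem_nhds hz₀] with z hz
        exact (hYe z hz).symm)
    rw [h4.unique h3, hf₂, dslope_same]
    simp; ring
  have h20 : f₂ z₀ ≠ 0 := fun h => hc (by rw [hc2, h, mul_zero])
  obtain ⟨r, hr⟩ := IsAlgClosed.exists_pow_nat_eq (f₂ z₀) (n := 2) (by norm_num)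
  have hr0 : r ≠ 0 := fun h => h20 (by rw [← hr, h]; simp)
  -- A root of `f₂`: after division by `f₂(z₀)` the argument is near `1`, off the cut of the
  -- logarithm.
  let u : ℂ → ℂ := fun z => r * exp (log (f₂ z / f₂ z₀) / 2)
  have hu0 : u z₀ = r := by simp [u, h20]
  have hslit : f₂ z₀ / f₂ z₀ ∈ slitPlane := by rw [div_self h20]; simp
  have hua : AnalyticAt ℂ u z₀ := by
    have h5 : AnalyticAt ℂ (fun z => f₂ z / f₂ z₀) z₀ := a₂.div_const
    exact analyticAt_const.mul ((h5.clog hslit).div_const.cexp)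
  have hu2 : ∀ᶠ z in 𝓝 z₀, u z ^ 2 = f₂ z := by
    filter_upwards [a₂.continuousAt.eventually_ne h20] with z hz
    simp only [u]
    rw [mul_pow, hr, ← Complex.exp_nat_mul]
    push_cast
    rw [mul_div_cancel₀ _ (two_ne_zero' ℂ), Complex.exp_log (div_ne_zero hz h20)]
    field_simp
  refine ⟨fun z => (z - z₀) * u z, r, ?_, hr0, by simp, ?_⟩
  · have := HasStrictDerivAt.mul ((hasStrictDerivAt_id z₀).sub_const z₀) hua.hasStrictDerivAt
    simp only [id_eq, sub_self, zero_mul, add_zero, one_mul, hu0] at this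
    exact this
  · filter_upwards [hu2] with z hz
    rw [mul_pow, hz, e₁ z, e₂ z]; ring

/-- The local section of the square root of `V - V(q)` at a critical point `q`. -/
theorem exists_sqrt_section {A B : ℕ} (hA : 0 < A) (hB : 0 < B) (hAB : A ≠ B) {q : Surf A B}
    (hq : yc q = 0) {v₀ : ℂ} (hv : ev q = ex v₀) :
    ∃ S : ℂ → Surf A B, S 0 = q ∧ (∀ᶠ w in 𝓝 0, ContinuousAt S w ∧ ev (S w) = ex (v₀ + w ^ 2)) ∧
      (∃ U ∈ 𝓝 (0 : ℂ), InjOn S U) ∧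
      ∃ N ∈ 𝓝 q, ∀ᶠ v in 𝓝 v₀, ∀ p ∈ N, ev p = ex v → ∃ w, v = v₀ + w ^ 2 ∧ p = S w := by
  obtain ⟨σ, z₀, m, hp⟩ := exists_chart q
  obtain ⟨n, hn⟩ := ex_eq_ex_iff.1 (hv.symm.trans hp.ev_eq)
  have hY := hasDerivAt_Yc A B hp.mem_dom m
  have hc0 := deriv_yc_ne_zero hA hB hAB hq
  rw [hp.xc_eq] at hc0
  obtain ⟨ψ, ψ', hψ, hψ', hψ0, hsq⟩ := exists_sqrt_of_critical (isOpen_dom σ) hp.mem_dom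
    (fun z hz => hasDerivAt_Vc A B hz m) (by rw [← hp.yc_eq, hq]) hY hc0
  obtain ⟨ζ, h0, hd, hev, hN⟩ := exists_local_section hp hψ hψ'
  rw [hψ0] at h0 hd hev
  have hsq' : ∀ᶠ w in 𝓝 0, Vc A B σ (ζ w) m = Vc A B σ z₀ m + w ^ 2 := by
    have hc : Filter.Tendsto ζ (𝓝 0) (𝓝 z₀) := by
      have := hd.continuousAt.tendsto
      rwa [h0] at this
    filter_upwards [hc.eventually hsq, hev] with w h1 h2
    rw [h1, h2.2.1]
  refine ⟨fun w => pt σ m (ζ w), ?_, ?_, ?_, ?_⟩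
  · simp only [h0]; exact hp.eq_pt.symm
  · filter_upwards [hev, hsq'] with w h h'
    refine ⟨((continuousOn_pt σ m).continuousAt ((isOpen_dom σ).mem_nhds h.1)).comp h.2.2, ?_⟩
    rw [(isPt_pt h.1 m).ev_eq, h', hn, ex_eq_ex_iff]
    exact ⟨-n, by push_cast; ring⟩
  · refine ⟨_, hev, fun w hw w' hw' e => ?_⟩
    have := injOn_pt hA hAB σ m hw.1 hw'.1 e
    rw [← hw.2.1, ← hw'.2.1, this]
  · have hc : ContinuousAt (fun z => Vc A B σ z m) z₀ :=
      (hasDerivAt_Vc A B hp.mem_dom m).continuousAt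
    obtain ⟨N, hN, hN'⟩ := hN _ (Filter.inter_mem hsq
      (hc (Metric.ball_mem_nhds _ (by norm_num : (0 : ℝ) < 1 / 2))))
    refine ⟨N, hN, ?_⟩
    filter_upwards [Metric.ball_mem_nhds v₀ (by norm_num : (0 : ℝ) < 1 / 2)] with v hvb p hpN hpv
    obtain ⟨z, ⟨hz2, hzW⟩, hz, hζ, hpz⟩ := hN' p hpN
    obtain ⟨k, hk⟩ := ex_eq_ex_iff.1 (hpv.symm.trans hpz.ev_eq)
    have hkn : k = n := by
      refine eq_of_norm_sub_lt_one ?_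
      have e : (k : ℂ) - n = (Vc A B σ z m - Vc A B σ z₀ m) - (v - v₀) := by rw [hk, hn]; ring
      rw [e]
      have h1 : ‖Vc A B σ z m - Vc A B σ z₀ m‖ < 1 / 2 := by rw [← dist_eq_norm]; exact hzW
      have h2 : ‖v - v₀‖ < 1 / 2 := by rw [← dist_eq_norm]; exact hvb
      exact (norm_sub_le _ _).trans_lt (by linarith)
    refine ⟨ψ z, ?_, ?_⟩
    · have hz2' : Vc A B σ z m = Vc A B σ z₀ m + ψ z ^ 2 := hz2
      rw [hk, hn, hkn] at hz2'
      linear_combination hz2'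
    · simp only [hζ]
      exact hpz.eq_pt

/-! ### Lifts of a ray -/

/-- The ray `V₀ + e ℝ_{> 0}` runs upwards and does not meet the critical values. -/
structure Regular (A B : ℕ) (V₀ e : ℂ) : Prop where
  im_pos : 0 < e.im
  notMem : ∀ t : ℝ, 0 < t → V₀ + e * t ∉ critValues A B

/-- `s` is a continuous lift of the ray `V₀ + e t`, `t ∈ T`. -/
def IsLift {A B : ℕ} (V₀ e : ℂ) (T : Set ℝ) (s : ℝ → Surf A B) : Prop :=
  ContinuousOn s T ∧ ∀ t ∈ T, ev (s t) = ex (V₀ + e * t)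

section

variable {A B : ℕ} {V₀ e : ℂ}

theorem Regular.yc_ne_zero (h : Regular A B V₀ e) {p : Surf A B} {t : ℝ} (ht : 0 < t)
    (hp : ev p = ex (V₀ + e * t)) : yc p ≠ 0 := fun h0 =>
  h.notMem t ht (Or.inl ⟨p, isCritical_iff.2 h0, vol_eq_iff.2 hp⟩)

theorem Regular.ex_ne_one (h : Regular A B V₀ e) {t : ℝ} (ht : 0 < t) : ex (V₀ + e * t) ≠ 1 := by
  intro h1
  rw [← ex_int 0, Int.cast_zero, eq_comm, ex_eq_ex_iff] at h1
  obtain ⟨k, hk⟩ := h1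
  exact h.notMem t ht (Or.inr ⟨k, by simp [hk]⟩)

theorem IsLift.mono {T T' : Set ℝ} {s : ℝ → Surf A B} (h : IsLift V₀ e T s) (hT : T' ⊆ T) :
    IsLift V₀ e T' s := ⟨h.1.mono hT, fun t ht => h.2 t (hT ht)⟩

theorem IsLift.congr {T : Set ℝ} {s s' : ℝ → Surf A B} (h : IsLift V₀ e T s) (hs : EqOn s' s T) :
    IsLift V₀ e T s' := ⟨h.1.congr hs, fun t ht => (hs ht).symm ▸ h.2 t ht⟩

theorem continuous_rayPt : Continuous fun t : ℝ => V₀ + e * t := by fun_prop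

/-- Near every point a lift is given by a local section of `V`. -/
theorem IsLift.eventually_eq {T : Set ℝ} {s : ℝ → Surf A B} (h : IsLift V₀ e T s) {t₀ : ℝ}
    (ht : t₀ ∈ T) {S : ℂ → Surf A B} {N : Set (Surf A B)} (hN : N ∈ 𝓝 (s t₀))
    (hS : ∀ᶠ v in 𝓝 (V₀ + e * t₀), ∀ p ∈ N, ev p = ex v → p = S v) :
    ∀ᶠ t : ℝ in 𝓝[T] t₀, s t = S (V₀ + e * t) := by
  have h1 : ∀ᶠ t : ℝ in 𝓝[T] t₀, s t ∈ N := h.1 t₀ ht hN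
  have h2 := ((continuous_rayPt (V₀ := V₀) (e := e)).tendsto t₀).mono_left
    (nhdsWithin_le_nhds (s := T))
  filter_upwards [h1, h2.eventually hS, self_mem_nhdsWithin] with t a1 a2 a3
  exact a2 _ a1 (h.2 t a3)

/-- Chain rule: `V` moves with velocity `e`, hence `z` with velocity `e / y`. -/
theorem IsLift.hasDerivWithinAt (hR : Regular A B V₀ e) {T : Set ℝ} {s : ℝ → Surf A B}
    (h : IsLift V₀ e T s) {t₀ : ℝ} (ht : t₀ ∈ T) (h0 : 0 < t₀) :
    HasDerivWithinAt (fun t => xc (s t)) (2 * Real.pi * I * xc (s t₀) / yc (s t₀) * e) T t₀ ∧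
    HasDerivWithinAt (fun t => yc (s t))
      ((A + B * (xc (s t₀) / (1 - xc (s t₀)))) / yc (s t₀) * e) T t₀ := by
  obtain ⟨S, hS0, -, hx, hy, N, hN, hu⟩ := exists_section (hR.yc_ne_zero h0 (h.2 t₀ ht)) (h.2 t₀ ht)
  have heq := h.eventually_eq ht hN hu
  have hray : HasDerivAt (fun w : ℂ => V₀ + e * w) e (t₀ : ℂ) := by
    simpa using ((hasDerivAt_id (t₀ : ℂ)).const_mul e).const_add V₀
  constructor
  · refine ((hx.comp (t₀ : ℂ) hray).comp_ofReal.hasDerivWithinAt).congr_of_eventuallyEq ?_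
      (by simp only [Function.comp_apply, hS0])
    filter_upwards [heq] with t ht
    simp only [Function.comp_apply, ht]
  · refine ((hy.comp (t₀ : ℂ) hray).comp_ofReal.hasDerivWithinAt).congr_of_eventuallyEq ?_
      (by simp only [Function.comp_apply, hS0])
    filter_upwards [heq] with t ht
    simp only [Function.comp_apply, ht]

/-- Lifts are determined by one value. -/
theorem IsLift.eqOn (hA : 0 < A) (hB : 0 < B) (hR : Regular A B V₀ e) {T : Set ℝ}
    (hT : IsPreconnected T) (hT0 : T ⊆ Ioi 0) {s s' : ℝ → Surf A B} (h : IsLift V₀ e T s)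
    (h' : IsLift V₀ e T s') {t₀ : ℝ} (ht : t₀ ∈ T) (h0 : s t₀ = s' t₀) : EqOn s s' T := by
  have := t2Space_surf (A := A) (B := B) hA hB
  have := isPreconnected_iff_preconnectedSpace.1 hT
  -- Closed because the surface is Hausdorff; open because near a common point both lifts are the
  -- same local section.
  have hcl : IsClopen {t : T | s t = s' t} := by
    constructor
    · exact isClosed_eq (continuousOn_iff_continuous_domRestrict.1 h.1)
        (continuousOn_iff_continuous_domRestrict.1 h'.1)
    · rw [isOpen_iff_mem_nhds]
      rintro ⟨t₁, ht₁⟩ e₁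
      have e₁' : s t₁ = s' t₁ := e₁
      obtain ⟨S, -, -, -, -, N, hN, hu⟩ :=
        exists_section (hR.yc_ne_zero (hT0 ht₁) (h.2 t₁ ht₁)) (h.2 t₁ ht₁)
      have a1 := h.eventually_eq ht₁ hN hu
      have a2 := h'.eventually_eq ht₁ (e₁' ▸ hN) hu
      have a3 : ∀ᶠ t : ℝ in 𝓝[T] t₁, s t = s' t := by
        filter_upwards [a1, a2] with t b1 b2
        rw [b1, b2]
      rw [nhdsWithin_eq_map_subtype_coe ht₁] at a3
      exact a3
  have huniv := hcl.eq_univ ⟨⟨t₀, ht⟩, h0⟩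
  intro t ht
  have : (⟨t, ht⟩ : T) ∈ {t : T | s t = s' t} := huniv ▸ mem_univ _
  exact this

theorem IsLift.glue {T₁ T₂ : Set ℝ} {c : ℝ} {s₁ s₂ : ℝ → Surf A B} (h₁ : IsLift V₀ e T₁ s₁)
    (h₂ : IsLift V₀ e T₂ s₂) (hT₁ : ∀ t ∈ T₁, t ≤ c) (hT₂ : ∀ t ∈ T₂, c ≤ t)
    (hc₁ : IsClosed T₁) (hc₂ : IsClosed T₂) (hc : s₁ c = s₂ c) :
    IsLift V₀ e (T₁ ∪ T₂) fun t => if t ≤ c then s₁ t else s₂ t := by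
  have e₁ : EqOn (fun t => if t ≤ c then s₁ t else s₂ t) s₁ T₁ := fun t ht => by
    simp only [if_pos (hT₁ t ht)]
  have e₂ : EqOn (fun t => if t ≤ c then s₁ t else s₂ t) s₂ T₂ := fun t ht => by
    simp only
    split_ifs with h
    · rw [le_antisymm h (hT₂ t ht), hc]
    · rfl
  have g₁ := h₁.congr e₁
  have g₂ := h₂.congr e₂
  refine ⟨g₁.1.union_of_isClosed g₂.1 hc₁ hc₂, ?_⟩
  rintro t (ht | ht)
  · exact g₁.2 t ht
  · exact g₂.2 t ht

end

/-! ### Behaviour near the branch points -/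

theorem tendsto_mul_clog : Filter.Tendsto (fun w : ℂ => w * log w) (𝓝 0) (𝓝 0) := by
  rw [tendsto_zero_iff_norm_tendsto_zero]
  have h1 : Filter.Tendsto (fun w : ℂ => |‖w‖ * Real.log ‖w‖| + Real.pi * ‖w‖) (𝓝 0) (𝓝 0) := by
    have hc : Continuous fun w : ℂ => |‖w‖ * Real.log ‖w‖| + Real.pi * ‖w‖ :=
      ((Real.continuous_mul_log.comp continuous_norm).abs).add (by fun_prop)
    simpa using hc.tendsto 0
  refine squeeze_zero (fun _ => norm_nonneg _) (fun w => ?_) h1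
  have h2 : ‖log w‖ ≤ |Real.log ‖w‖| + Real.pi := by
    refine (Complex.norm_le_abs_re_add_abs_im _).trans ?_
    rw [Complex.log_re, Complex.log_im]
    exact add_le_add le_rfl (Complex.abs_arg_le_pi w)
  rw [norm_mul, abs_mul, abs_of_nonneg (norm_nonneg w)]
  nlinarith [norm_nonneg w]

theorem tendsto_div_one_sub_ex :
    Filter.Tendsto (fun z : ℂ => z / (1 - ex z)) (𝓝[≠] 0) (𝓝 (-(2 * Real.pi * I))⁻¹) := by
  have h0 : ex 0 = 1 := by simp [ex]
  have h1 := (hasDerivAt_ex 0).tendsto_slope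
  rw [h0, mul_one] at h1
  have h2 := (h1.neg).inv₀ (neg_ne_zero.2 two_pi_I_ne_zero)
  refine h2.congr fun z => ?_
  rw [slope_def_field, h0, sub_zero, ← neg_div, neg_sub, inv_div]

/-- The main part of `V - z V'` near a branch point. -/
def branchRem (B : ℕ) (z : ℂ) : ℂ :=
  B * dilog (ex z) / (2 * Real.pi * I) ^ 2 + B / 24 + B * (z * log (1 - ex z)) / (2 * Real.pi * I)

/-- `z log(1 - e(z))` tends to `0`, and the constant `B/24` of `V` cancels `B Li₂(1)/(2πi)² =
-B/24`. The restriction to `Im z ≥ 0` keeps `e(z)` in the closed disc, where `dilog` is continuous.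
-/
theorem tendsto_branchRem (B : ℕ) :
    Filter.Tendsto (branchRem B) (𝓝[{z : ℂ | 0 ≤ z.im ∧ z ≠ 0}] 0) (𝓝 0) := by
  have h0 : ex 0 = 1 := by simp [ex]
  have hle : 𝓝[{z : ℂ | 0 ≤ z.im ∧ z ≠ 0}] (0 : ℂ) ≤ 𝓝[≠] 0 := nhdsWithin_mono _ fun z hz => hz.2
  have h1 : Filter.Tendsto (fun z => dilog (ex z)) (𝓝[{z : ℂ | 0 ≤ z.im ∧ z ≠ 0}] 0)
      (𝓝 (dilog 1)) := by
    refine (continuousOn_dilog 1 (by simp)).tendsto.comp (tendsto_nhdsWithin_iff.2 ⟨?_, ?_⟩)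
    · rw [← h0]
      exact (continuous_ex.tendsto 0).mono_left nhdsWithin_le_nhds
    · filter_upwards [self_mem_nhdsWithin] with z hz
      rw [mem_closedBall_zero_iff, norm_ex, Real.exp_le_one_iff]
      have := mul_nonneg Real.two_pi_pos.le hz.1
      linarith
  have h2 : Filter.Tendsto (fun z => z * log (1 - ex z)) (𝓝[{z : ℂ | 0 ≤ z.im ∧ z ≠ 0}] 0)
      (𝓝 0) := by
    have a1 := tendsto_div_one_sub_ex.mono_left hle
    have a2 : Filter.Tendsto (fun z => 1 - ex z) (𝓝[{z : ℂ | 0 ≤ z.im ∧ z ≠ 0}] 0) (𝓝 0) := by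
      have : Filter.Tendsto (fun z => 1 - ex z) (𝓝 0) (𝓝 (1 - ex 0)) :=
        (continuous_const.sub continuous_ex).tendsto 0
      rw [h0, sub_self] at this
      exact this.mono_left nhdsWithin_le_nhds
    have a3 := a1.mul (tendsto_mul_clog.comp a2)
    rw [mul_zero] at a3
    refine a3.congr fun z => ?_
    simp only [Function.comp_apply]
    rcases eq_or_ne (1 - ex z) 0 with h | h
    · rw [h]; simp
    · field_simp
  have h3 := (((h1.const_mul (B : ℂ)).div_const ((2 * Real.pi * I) ^ 2)).add_const
    ((B : ℂ) / 24)).add ((h2.const_mul (B : ℂ)).div_const (2 * Real.pi * I))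
  have e : (B : ℂ) * dilog 1 / (2 * Real.pi * I) ^ 2 + B / 24 + B * 0 / (2 * Real.pi * I) = 0 := by
    have hpi : (Real.pi : ℂ) ≠ 0 := by exact_mod_cast Real.pi_ne_zero
    rw [dilog_one, mul_pow, I_sq]
    field_simp
    ring
  rw [e] at h3
  exact h3

/-- Subtracting `z V'` removes the sheet number, so the estimate at a branch point is uniform over
the sheets. The lower half plane is reduced to the upper one by `z ↦ -z`. -/
theorem Vc_sub_mul_Yc (A B : ℕ) (z : ℂ) (m : ℤ) :
    Vc A B true z m - z * Yc A B true z m = branchRem B z - A / 2 * z ^ 2 ∧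
    Vc A B false z m - z * Yc A B false z m = -branchRem B (-z) + (B - A) / 2 * z ^ 2 := by
  have hpi : (Real.pi : ℂ) ≠ 0 := by exact_mod_cast Real.pi_ne_zero
  constructor
  · simp only [Vc, Yc, VPlus, YPlus, branchRem]
    ring
  · simp only [Vc, Yc, VMinus, YMinus, branchRem]
    ring

theorem exists_branch_bound (A B : ℕ) {η : ℝ} (hη : 0 < η) : ∃ r > 0, ∀ (σ : Bool) (z : ℂ) (m : ℤ),
    z ≠ 0 → ‖z‖ < r → ClosedHalf σ z → ‖Vc A B σ z m - z * Yc A B σ z m‖ < η := by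
  have hη2 : 0 < η / 2 := by linarith
  obtain ⟨r₁, hr₁, h1⟩ := Metric.mem_nhdsWithin_iff.1
    ((tendsto_branchRem B) (Metric.ball_mem_nhds 0 hη2))
  have hq : Filter.Tendsto (fun z : ℂ => ((A : ℝ) + B) / 2 * ‖z‖ ^ 2) (𝓝 0) (𝓝 0) := by
    have : Continuous fun z : ℂ => ((A : ℝ) + B) / 2 * ‖z‖ ^ 2 := by fun_prop
    simpa using this.tendsto 0
  obtain ⟨r₂, hr₂, h2⟩ := Metric.mem_nhds_iff.1 (hq (Iio_mem_nhds hη2))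
  refine ⟨min r₁ r₂, lt_min hr₁ hr₂, fun σ z m hz hzr hσ => ?_⟩
  have hz2 : ((A : ℝ) + B) / 2 * ‖z‖ ^ 2 < η / 2 :=
    h2 (by simpa using hzr.trans_le (min_le_right _ _))
  have hA : (0 : ℝ) ≤ A := by positivity
  have hB : (0 : ℝ) ≤ B := by positivity
  cases σ
  · rw [(Vc_sub_mul_Yc A B z m).2]
    have h3 : ‖branchRem B (-z)‖ < η / 2 := by
      have : -z ∈ Metric.ball (0 : ℂ) r₁ ∩ {z : ℂ | 0 ≤ z.im ∧ z ≠ 0} :=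
        ⟨by simpa using hzr.trans_le (min_le_left _ _), by
          have : z.im ≤ 0 := hσ
          simpa using this, neg_ne_zero.2 hz⟩
      simpa using h1 this
    have h4 : ‖((B : ℂ) - A) / 2 * z ^ 2‖ ≤ ((A : ℝ) + B) / 2 * ‖z‖ ^ 2 := by
      rw [norm_mul, norm_div, norm_pow, Complex.norm_two]
      have : ‖((B : ℂ) - A)‖ ≤ A + B := by
        refine (norm_sub_le _ _).trans ?_
        rw [Complex.norm_natCast, Complex.norm_natCast, add_comm]
      gcongr
    refine (norm_add_le _ _).trans_lt ?_
    rw [norm_neg]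
    linarith
  · rw [(Vc_sub_mul_Yc A B z m).1]
    have h3 : ‖branchRem B z‖ < η / 2 := by
      have : z ∈ Metric.ball (0 : ℂ) r₁ ∩ {z : ℂ | 0 ≤ z.im ∧ z ≠ 0} :=
        ⟨by simpa using hzr.trans_le (min_le_left _ _), hσ, hz⟩
      simpa using h1 this
    have h4 : ‖(A : ℂ) / 2 * z ^ 2‖ ≤ ((A : ℝ) + B) / 2 * ‖z‖ ^ 2 := by
      rw [norm_mul, norm_div, norm_pow, Complex.norm_two, Complex.norm_natCast]
      gcongr
      linarith
    refine (norm_sub_le _ _).trans_lt ?_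
    linarith

/-- Near a branch point, and away from the value `0` of `V` there, `(1 - x) V'` is bounded below. -/
theorem exists_yc_lower {A B : ℕ} (hB : 0 < B) {μ : ℝ} (hμ : 0 < μ) :
    ∃ c > 0, ∃ δ > 0, δ ≤ 1 ∧ ∀ p : Surf A B, μ ≤ ‖ev p - 1‖ → ‖1 - xc p‖ < δ →
      c ≤ ‖yc p‖ * ‖1 - xc p‖ := by
  have h0 : ex 0 = 1 := by simp [ex]
  obtain ⟨η, hη, hex⟩ := Metric.mem_nhds_iff.1
    (continuous_ex.continuousAt (x := 0) (Metric.ball_mem_nhds _ hμ))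
  obtain ⟨r, hr, hrem⟩ := exists_branch_bound A B (half_pos hη)
  refine ⟨η / 2, half_pos hη, min (1 / 2) r, lt_min (by norm_num) hr,
    (min_le_left _ _).trans (by norm_num), fun p hp hx => ?_⟩
  set x := xc p with hxdef
  have hx0 : x ≠ 0 := xc_ne_zero p
  -- All branch points lie over integers, so by periodicity the coordinate close to `0` can be
  -- taken.
  set z := log x / (2 * Real.pi * I) with hz
  have hexz : ex z = x := by
    rw [ex, hz, mul_div_cancel₀ _ two_pi_I_ne_zero, exp_log hx0]
  have hlog : ‖log x‖ ≤ 3 / 2 * ‖1 - x‖ := by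
    have := Complex.norm_log_one_add_half_le_self (z := x - 1)
      (by rw [norm_sub_rev]; exact (hx.trans_le (min_le_left _ _)).le)
    rwa [add_sub_cancel, norm_sub_rev] at this
  have hzx : ‖z‖ ≤ ‖1 - x‖ := by
    have h2 : ‖(2 * Real.pi * I : ℂ)‖ = 2 * Real.pi := by
      rw [norm_mul, norm_mul, Complex.norm_I, Complex.norm_two, Complex.norm_real,
        Real.norm_eq_abs, abs_of_pos Real.pi_pos, mul_one]
    rw [hz, norm_div, h2, div_le_iff₀ Real.two_pi_pos]
    nlinarith [Real.pi_gt_three, norm_nonneg (1 - x)]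
  have hz0 : z ≠ 0 := fun h => xc_ne_one hB p (by rw [← hxdef, ← hexz, h, h0, sub_self])
  have hz1 : ‖z‖ < 1 := hzx.trans_lt ((hx.trans_le (min_le_left _ _)).trans (by norm_num))
  -- A non-zero `z` with `|z| < 1` lies in the slit plane `0` or `1`, hence in the domain of the
  -- chart of its side.
  have hslit : ∃ l : ℤ, z ∈ slit l := by
    have hre := (abs_le.1 ((Complex.abs_re_le_norm z).trans hz1.le))
    have hre' := abs_lt.1 ((Complex.abs_re_le_norm z).trans_lt hz1)
    by_cases him : z.im = 0
    · rcases lt_trichotomy z.re 0 with h | h | h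
      · exact ⟨0, Or.inr ⟨by push_cast; linarith, by push_cast; linarith⟩⟩
      · exact absurd (Complex.ext h him) hz0
      · exact ⟨1, Or.inr ⟨by push_cast; linarith, by push_cast; linarith⟩⟩
    · exact ⟨0, Or.inl him⟩
  obtain ⟨l, hl⟩ := hslit
  have hdom := slitPart_subset_dom l _ (sideOf_mem_slitPart hl)
  obtain ⟨m, hm⟩ := exists_isPt (A := A) (B := B) hdom (by rw [hexz] : xc p = ex z)
  have hb := hrem (sideOf z) z m hz0
    (hzx.trans_lt (hx.trans_le (min_le_right _ _))) (closedHalf_sideOf z)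
  rw [← hm.yc_eq] at hb
  -- If `z y` were small as well, `V` would be close to `0` and `e(V)` close to `1`.
  by_contra! hc
  have hzy : ‖z * yc p‖ < η / 2 := by
    rw [norm_mul]
    have := norm_nonneg (yc p)
    nlinarith
  have hV : ‖Vc A B (sideOf z) z m‖ < η := by
    have := norm_add_le (Vc A B (sideOf z) z m - z * yc p) (z * yc p)
    rw [sub_add_cancel] at this
    linarith
  have := hex (show Vc A B (sideOf z) z m ∈ Metric.ball 0 η by simpa using hV)
  rw [mem_preimage, h0, ← hm.ev_eq, mem_ball_iff_norm] at this
  linarith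

/-! ### Existence of lifts -/

section

variable {A B : ℕ} {V₀ e : ℂ}

theorem Regular.exists_ev_lower (hR : Regular A B V₀ e) {a b : ℝ} (ha : 0 < a) (hab : a ≤ b) :
    ∃ μ > 0, ∀ t ∈ Icc a b, μ ≤ ‖ex (V₀ + e * t) - 1‖ := by
  have hc : Continuous fun t : ℝ => ‖ex (V₀ + e * t) - 1‖ :=
    ((continuous_ex.comp continuous_rayPt).sub continuous_const).norm
  obtain ⟨t, ht, hmin⟩ := isCompact_Icc.exists_isMinOn (nonempty_Icc.2 hab) hc.continuousOn
  exact ⟨_, norm_pos_iff.2 (sub_ne_zero.2 (hR.ex_ne_one (ha.trans_le ht.1))), hmin⟩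

theorem IsLift.hasDerivRight (hR : Regular A B V₀ e) {a b : ℝ} {s : ℝ → Surf A B} (ha : 0 < a)
    (h : IsLift V₀ e (Ico a b) s) {t : ℝ} (ht : t ∈ Ico a b) :
    HasDerivWithinAt (fun t => xc (s t)) (2 * Real.pi * I * xc (s t) / yc (s t) * e) (Ici t) t ∧
    HasDerivWithinAt (fun t => yc (s t))
      ((A + B * (xc (s t) / (1 - xc (s t)))) / yc (s t) * e) (Ici t) t := by
  have hd := (h.mono (Ico_subset_Ico_left ht.1)).hasDerivWithinAt hR ⟨le_rfl, ht.2⟩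
    (ha.trans_le ht.1)
  have hn : Ico t b ∈ 𝓝[Ici t] t := Ico_mem_nhdsGE ht.2
  exact ⟨hd.1.mono_of_mem_nhdsWithin hn, hd.2.mono_of_mem_nhdsWithin hn⟩

/-- While `|1 - x| < δ`, the speed of `x` is at most a constant times `1/|y|`, hence at most a
constant times `|1 - x|`. So `|1 - x|²` decays at most exponentially and cannot reach `0` in finite
time. -/
theorem IsLift.exists_lower (hB : 0 < B) (hR : Regular A B V₀ e) {a b : ℝ} {s : ℝ → Surf A B}
    (ha : 0 < a) (hab : a < b) (h : IsLift V₀ e (Ico a b) s) :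
    ∃ κ > 0, ∀ t ∈ Ico a b, κ ≤ ‖1 - xc (s t)‖ := by
  obtain ⟨μ, hμ, hμ'⟩ := hR.exists_ev_lower ha hab.le
  obtain ⟨c, hc, δ, hδ, hδ1, hlow⟩ := exists_yc_lower (A := A) hB hμ
  -- `2π · 2 · ‖e‖` bounds `|2πi x e|` for `|x| ≤ 2`, the division by `c` comes from `1/|y| ≤ |1 -
  -- x|/c`, and the outer `2` from differentiating a square.
  set K : ℝ := 2 * (2 * Real.pi * 2 * ‖e‖ / c) with hK
  have hK0 : 0 ≤ K := by have := Real.pi_pos; positivity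
  have hpos : ∀ t, 0 < ‖1 - xc (s t)‖ := fun t => norm_pos_iff.2 (xc_ne_one hB _)
  -- Halved so that the comparison function starts strictly below `|1 - x|²` and stays below `δ²`; a
  -- contact can then occur only where the differential inequality holds.
  set κ : ℝ := min (‖1 - xc (s a)‖ ^ 2) (δ ^ 2) / 2 with hκ
  have hκ0 : 0 < κ := by have := hpos a; positivity
  have hκ1 : κ < ‖1 - xc (s a)‖ ^ 2 := by
    have := min_le_left (‖1 - xc (s a)‖ ^ 2) (δ ^ 2)
    have := pow_pos (hpos a) 2
    linarith
  have hκ2 : κ < δ ^ 2 := by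
    have := min_le_right (‖1 - xc (s a)‖ ^ 2) (δ ^ 2)
    have := pow_pos hδ 2
    linarith
  set f' : ℝ → ℝ := fun t => -(2 * inner ℝ (1 - xc (s t))
    (-(2 * Real.pi * I * xc (s t) / yc (s t) * e)))
  have hf' : ∀ t ∈ Ico a b, HasDerivWithinAt (fun t => -‖1 - xc (s t)‖ ^ 2) (f' t) (Ici t) t :=
    fun t ht => ((h.hasDerivRight hR ha ht).1.const_sub 1).norm_sq.neg
  have hfb : ∀ t ∈ Ico a b, ‖1 - xc (s t)‖ < δ → f' t ≤ K * ‖1 - xc (s t)‖ ^ 2 := by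
    intro t ht hlt
    have h1 := hlow (s t) (by rw [h.2 t ht]; exact hμ' t ⟨ht.1, ht.2.le⟩) hlt
    have hy : 0 < ‖yc (s t)‖ := by
      by_contra hcon
      have : ‖yc (s t)‖ = 0 := le_antisymm (not_lt.1 hcon) (norm_nonneg _)
      rw [this, zero_mul] at h1
      linarith
    have hx : ‖xc (s t)‖ ≤ 2 := by
      have := norm_sub_norm_le (xc (s t)) 1
      rw [norm_one, norm_sub_rev] at this
      linarith
    have h2 : f' t ≤ 2 * (‖1 - xc (s t)‖ * ‖2 * Real.pi * I * xc (s t) / yc (s t) * e‖) := by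
      have := neg_le_of_abs_le (abs_real_inner_le_norm (1 - xc (s t))
        (-(2 * Real.pi * I * xc (s t) / yc (s t) * e)))
      rw [norm_neg] at this
      simp only [f']
      linarith
    refine h2.trans ?_
    have h3 : ‖2 * Real.pi * I * xc (s t) / yc (s t) * e‖ =
        2 * Real.pi * ‖xc (s t)‖ * ‖e‖ / ‖yc (s t)‖ := by
      rw [norm_mul, norm_div, norm_mul, norm_mul, norm_mul, Complex.norm_I, Complex.norm_two,
        Complex.norm_real, Real.norm_eq_abs, abs_of_pos Real.pi_pos]
      ring
    have h4 : 2 * Real.pi * ‖xc (s t)‖ * ‖e‖ / ‖yc (s t)‖ ≤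
        2 * Real.pi * 2 * ‖e‖ / c * ‖1 - xc (s t)‖ := by
      rw [div_le_iff₀ hy]
      have e1 : 2 * Real.pi * 2 * ‖e‖ / c * ‖1 - xc (s t)‖ * ‖yc (s t)‖ =
        2 * Real.pi * 2 * ‖e‖ * (‖yc (s t)‖ * ‖1 - xc (s t)‖ / c) := by ring
      rw [e1]
      have h5 : 1 ≤ ‖yc (s t)‖ * ‖1 - xc (s t)‖ / c := (one_le_div hc).2 h1
      have := Real.pi_pos
      calc 2 * Real.pi * ‖xc (s t)‖ * ‖e‖ ≤ 2 * Real.pi * 2 * ‖e‖ * 1 := by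
            rw [mul_one]; gcongr
        _ ≤ _ := by gcongr
    rw [h3]
    calc 2 * (‖1 - xc (s t)‖ * (2 * Real.pi * ‖xc (s t)‖ * ‖e‖ / ‖yc (s t)‖))
        ≤ 2 * (‖1 - xc (s t)‖ * (2 * Real.pi * 2 * ‖e‖ / c * ‖1 - xc (s t)‖)) := by gcongr
      _ = K * ‖1 - xc (s t)‖ ^ 2 := by rw [hK]; ring
  -- The rate `K + 1` instead of `K` makes the inequality between the derivatives strict at a
  -- contact.
  have hG : ∀ t : ℝ, HasDerivAt (fun t : ℝ => -(κ * Real.exp (-((K + 1) * (t - a)))))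
      ((K + 1) * (κ * Real.exp (-((K + 1) * (t - a))))) t := fun t => by
    have h1 : HasDerivAt (fun t : ℝ => -((K + 1) * (t - a))) (-((K + 1) * 1)) t :=
      (((hasDerivAt_id t).sub_const a).const_mul (K + 1)).neg
    exact ((h1.exp.const_mul κ).neg).congr_deriv (by ring)
  have hbound : ∀ t ∈ Ico a b, κ * Real.exp (-((K + 1) * (t - a))) ≤ ‖1 - xc (s t)‖ ^ 2 := by
    intro t₁ ht₁
    have key := image_le_of_deriv_right_lt_deriv_boundary (a := a) (b := t₁)
      (f := fun t => -‖1 - xc (s t)‖ ^ 2) (f' := f')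
      (B := fun t : ℝ => -(κ * Real.exp (-((K + 1) * (t - a)))))
      (B' := fun t : ℝ => (K + 1) * (κ * Real.exp (-((K + 1) * (t - a)))))
      (((continuous_const.sub continuous_xc).norm.pow 2).neg.comp_continuousOn
        (h.1.mono (Icc_subset_Ico_right ht₁.2)))
      (fun t ht => hf' t ⟨ht.1, ht.2.trans ht₁.2⟩)
      (by simp; exact hκ1.le) hG
      (fun t ht heq => by
        have hpe := Real.exp_pos (-((K + 1) * (t - a)))
        have heq' : ‖1 - xc (s t)‖ ^ 2 = κ * Real.exp (-((K + 1) * (t - a))) := neg_inj.1 heq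
        have hle1 : Real.exp (-((K + 1) * (t - a))) ≤ 1 := by
          rw [Real.exp_le_one_iff]
          have := mul_nonneg (by linarith : 0 ≤ K + 1) (sub_nonneg.2 ht.1)
          linarith
        have hlt : ‖1 - xc (s t)‖ < δ := by
          refine lt_of_pow_lt_pow_left₀ 2 hδ.le ?_
          rw [heq']
          nlinarith
        have := hfb t ⟨ht.1, ht.2.trans ht₁.2⟩ hlt
        rw [heq'] at this
        have := mul_pos hκ0 hpe
        linarith)
    have := key (right_mem_Icc.2 ht₁.1)
    linarith
  refine ⟨Real.sqrt (κ * Real.exp (-((K + 1) * (b - a)))),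
    Real.sqrt_pos.2 (mul_pos hκ0 (Real.exp_pos _)), fun t ht => ?_⟩
  refine Real.sqrt_le_iff.2 ⟨norm_nonneg _, le_trans ?_ (hbound t ht)⟩
  gcongr
  exact ht.2.le

/-- In the derivative of `y²` the denominator `y` cancels: it is `2 e (A + B x/(1 - x))`, bounded
once `x` stays away from `1`. -/
theorem IsLift.exists_upper (hB : 0 < B) (hR : Regular A B V₀ e) {a b : ℝ} {s : ℝ → Surf A B}
    (ha : 0 < a) (hab : a < b) (h : IsLift V₀ e (Ico a b) s) :
    ∃ R : ℝ, ∀ t ∈ Ico a b, ‖yc (s t)‖ ≤ R := by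
  obtain ⟨κ, hκ, hlow⟩ := h.exists_lower hB hR ha hab
  set M : ℝ := 2 * ‖e‖ * (A + B * (1 + 1 / κ)) with hM
  have hM0 : 0 ≤ M := by positivity
  have hd : ∀ t ∈ Ico a b, HasDerivWithinAt (fun t => yc (s t) ^ 2)
      (2 * e * (A + B * (xc (s t) / (1 - xc (s t))))) (Ici t) t := fun t ht => by
    refine ((h.hasDerivRight hR ha ht).2.pow 2).congr_deriv ?_
    have := hR.yc_ne_zero (ha.trans_le ht.1) (h.2 t ht)
    push_cast
    field_simp
  have hdb : ∀ t ∈ Ico a b, ‖2 * e * (A + B * (xc (s t) / (1 - xc (s t))))‖ ≤ M := fun t ht => by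
    have h1 : xc (s t) / (1 - xc (s t)) = -1 + 1 / (1 - xc (s t)) := by
      have := xc_ne_one hB (s t)
      field_simp
      ring
    have h2 : ‖xc (s t) / (1 - xc (s t))‖ ≤ 1 + 1 / κ := by
      rw [h1]
      refine (norm_add_le _ _).trans ?_
      rw [norm_neg, norm_one, norm_div, norm_one]
      have := hlow t ht
      gcongr
    rw [norm_mul, norm_mul, Complex.norm_two, hM]
    gcongr
    refine (norm_add_le _ _).trans ?_
    rw [norm_mul, Complex.norm_natCast, Complex.norm_natCast]
    gcongr
  refine ⟨Real.sqrt (‖yc (s a) ^ 2‖ + M * (b - a)), fun t₁ ht₁ => ?_⟩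
  have key := norm_image_sub_le_of_norm_deriv_right_le_segment (a := a) (b := t₁) (C := M)
    (f := fun t => yc (s t) ^ 2) (f' := fun t => 2 * e * (A + B * (xc (s t) / (1 - xc (s t)))))
    ((continuous_yc.pow 2).comp_continuousOn (h.1.mono (Icc_subset_Ico_right ht₁.2)))
    (fun t ht => hd t ⟨ht.1, ht.2.trans ht₁.2⟩) (fun t ht => hdb t ⟨ht.1, ht.2.trans ht₁.2⟩)
    t₁ (right_mem_Icc.2 ht₁.1)
  refine Real.le_sqrt_of_sq_le ?_
  have h3 := norm_sub_norm_le (yc (s t₁) ^ 2) (yc (s a) ^ 2)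
  have h4 : M * (t₁ - a) ≤ M * (b - a) := by
    have := ht₁.2.le
    gcongr
  rw [← norm_pow]
  linarith

/-- A lift over a half-open interval extends to its end point. -/
theorem IsLift.exists_extension (hA : 0 < A) (hB : 0 < B) (hAB : A ≠ B) (hR : Regular A B V₀ e)
    {a b : ℝ} {s : ℝ → Surf A B} (ha : 0 < a) (hab : a < b) (h : IsLift V₀ e (Ico a b) s) :
    ∃ s' : ℝ → Surf A B, IsLift V₀ e (Icc a b) s' ∧ s' a = s a := by
  obtain ⟨R, hR'⟩ := h.exists_upper hB hR ha hab
  have hcomp := isCompact_yc_le hA hB hAB R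
  have hmap : Filter.map s (𝓝[<] b) ≤ Filter.principal {p | ‖yc p‖ ≤ R} := by
    rw [Filter.le_principal_iff, Filter.mem_map]
    filter_upwards [Ico_mem_nhdsLT hab] with t ht
    exact hR' t ht
  -- A cluster point exists by compactness. Its local section meets the lift at some time close to
  -- `b` and continues it from there.
  obtain ⟨q, -, hq⟩ := hcomp hmap
  have hevq : ev q = ex (V₀ + e * b) := by
    have h1 : Filter.Tendsto (fun t => ev (s t)) (𝓝[<] b) (𝓝 (ex (V₀ + e * b))) := by
      have h2 : Filter.Tendsto (fun t : ℝ => ex (V₀ + e * t)) (𝓝[<] b) (𝓝 (ex (V₀ + e * b))) :=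
        ((continuous_ex.comp continuous_rayPt).tendsto b).mono_left nhdsWithin_le_nhds
      refine h2.congr' ?_
      filter_upwards [Ico_mem_nhdsLT hab] with t ht
      exact (h.2 t ht).symm
    have h3 : ClusterPt (ev q) (Filter.map ev (Filter.map s (𝓝[<] b))) :=
      hq.map continuous_ev.continuousAt Filter.tendsto_map
    rw [Filter.map_map] at h3
    have h4 : ClusterPt (ev q) (𝓝 (ex (V₀ + e * b))) := h3.mono h1
    exact (eq_of_nhds_neBot h4)
  obtain ⟨S, hS0, hSc, -, -, N, hN, hu⟩ :=
    exists_section (hR.yc_ne_zero (ha.trans hab) hevq) hevq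
  have hray := (continuous_rayPt (V₀ := V₀) (e := e)).tendsto b
  obtain ⟨r, hr, hball⟩ := Metric.mem_nhds_iff.1 (hray.eventually (hSc.and hu))
  have hfreq : ∃ᶠ t in 𝓝[<] b, s t ∈ N := by
    have := (clusterPt_iff_frequently.1 hq) N hN
    exact this
  obtain ⟨t₁, ⟨ht₁N, ht₁⟩⟩ := (hfreq.and_eventually
    (Ico_mem_nhdsLT (max_lt hab (by linarith : b - r / 2 < b)))).exists
  have hat : a ≤ t₁ := (le_max_left _ _).trans ht₁.1
  have hin : ∀ t ∈ Icc t₁ b, t ∈ Metric.ball b r := fun t ht => by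
    have := (le_max_right a (b - r / 2)).trans ht₁.1
    rw [Metric.mem_ball, Real.dist_eq, abs_lt]
    constructor <;> linarith [ht.1, ht.2]
  have hL : IsLift V₀ e (Icc t₁ b) fun t => S (V₀ + e * t) :=
    ⟨fun t ht => (ContinuousAt.comp (f := fun t : ℝ => V₀ + e * t) (hball (hin t ht)).1.1
      (continuous_rayPt.continuousAt (x := t))).continuousWithinAt,
      fun t ht => (hball (hin t ht)).1.2⟩
  have hg := (h.mono (Icc_subset_Ico_right ht₁.2)).glue hL (fun t ht => ht.2) (fun t ht => ht.1)
    isClosed_Icc isClosed_Icc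
    ((hball (hin t₁ ⟨le_rfl, ht₁.2.le⟩)).2 _ ht₁N (h.2 t₁ ⟨hat, ht₁.2⟩))
  rw [Icc_union_Icc_eq_Icc hat ht₁.2.le] at hg
  exact ⟨_, hg, by simp only [if_pos hat]⟩

/-- Lifts over a nested family of intervals fit together. -/
theorem exists_lift_union (hA : 0 < A) (hB : 0 < B) (hR : Regular A B V₀ e) {a : ℝ} (ha : 0 < a)
    {T : Set ℝ} (hTa : ∀ t ∈ T, a ≤ t) (haT : a ∈ T) (hT : ∀ t ∈ T, ∃ b ∈ T, t < b) {p : Surf A B}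
    (h : ∀ b ∈ T, ∃ s : ℝ → Surf A B, IsLift V₀ e (Icc a b) s ∧ s a = p) :
    ∃ s : ℝ → Surf A B, IsLift V₀ e T s ∧ s a = p := by
  have : Nonempty (Surf A B) := ⟨p⟩
  -- `F b` is a lift up to time `b`; by uniqueness the diagonal `t ↦ F t t` agrees with it on the
  -- times of `T` up to `b`.
  choose! F hF hFa using h
  have heq : ∀ b ∈ T, ∀ t ∈ T, t ≤ b → F t t = F b t := fun b hb t ht htb =>
    (hF t ht).eqOn hA hB hR isPreconnected_Icc (fun u hu => ha.trans_le hu.1)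
      ((hF b hb).mono (Icc_subset_Icc_right htb)) ⟨le_rfl, hTa t ht⟩
      ((hFa t ht).trans (hFa b hb).symm) ⟨hTa t ht, le_rfl⟩
  refine ⟨fun t => F t t, ⟨fun t ht => ?_, fun t ht => (hF t ht).2 t ⟨hTa t ht, le_rfl⟩⟩, hFa a haT⟩
  obtain ⟨b, hb, htb⟩ := hT t ht
  have hn : Icc a b ∈ 𝓝[T] t := by
    filter_upwards [self_mem_nhdsWithin, mem_nhdsWithin_of_mem_nhds (Iio_mem_nhds htb)] with u h1 h2
    exact ⟨hTa u h1, le_of_lt h2⟩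
  have hn' : ∀ᶠ u in 𝓝[T] t, F u u = F b u := by
    filter_upwards [self_mem_nhdsWithin, hn] with u h1 h2
    exact heq b hb u h1 h2.2
  exact (((hF b hb).1 t ⟨hTa t ht, htb.le⟩).mono_of_mem_nhdsWithin hn).congr_of_eventuallyEq hn'
    (heq b hb t ht htb.le)

theorem IsLift.exists_step (hR : Regular A B V₀ e) {a b : ℝ} {s : ℝ → Surf A B} (ha : 0 < a)
    (hab : a ≤ b) (h : IsLift V₀ e (Icc a b) s) :
    ∃ b' > b, ∃ s' : ℝ → Surf A B, IsLift V₀ e (Icc a b') s' ∧ s' a = s a := by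
  have hb := h.2 b ⟨hab, le_rfl⟩
  obtain ⟨S, hS0, hSc, -⟩ := exists_section (hR.yc_ne_zero (ha.trans_le hab) hb) hb
  have hray := (continuous_rayPt (V₀ := V₀) (e := e)).tendsto b
  obtain ⟨r, hr, hball⟩ := Metric.mem_nhds_iff.1 (hray.eventually hSc)
  have hin : ∀ t ∈ Icc b (b + r / 2), t ∈ Metric.ball b r := fun t ht => by
    rw [Metric.mem_ball, Real.dist_eq, abs_lt]
    constructor <;> linarith [ht.1, ht.2]
  have hL : IsLift V₀ e (Icc b (b + r / 2)) fun t => S (V₀ + e * t) :=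
    ⟨fun t ht => (ContinuousAt.comp (f := fun t : ℝ => V₀ + e * t) (hball (hin t ht)).1
      (continuous_rayPt.continuousAt (x := t))).continuousWithinAt,
      fun t ht => (hball (hin t ht)).2⟩
  have hg := h.glue hL (fun t ht => ht.2) (fun t ht => ht.1) isClosed_Icc isClosed_Icc hS0.symm
  rw [Icc_union_Icc_eq_Icc hab (by linarith)] at hg
  exact ⟨b + r / 2, by linarith, _, hg, by simp only [if_pos hab]⟩

/-- Continuation to the supremum of the attainable times: `IsLift.exists_extension` shows that it is
attained, `IsLift.exists_step` that it could be exceeded. -/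
theorem exists_lift_Icc (hA : 0 < A) (hB : 0 < B) (hAB : A ≠ B) (hR : Regular A B V₀ e) {a : ℝ}
    (ha : 0 < a) {p : Surf A B} (hp : ev p = ex (V₀ + e * a)) (b : ℝ) :
    ∃ s : ℝ → Surf A B, IsLift V₀ e (Icc a b) s ∧ s a = p := by
  set P : ℝ → Prop := fun b => ∃ s : ℝ → Surf A B, IsLift V₀ e (Icc a b) s ∧ s a = p with hP
  have hmono : ∀ b b', P b → b' ≤ b → P b' := by
    rintro b b' ⟨s, hs, hsa⟩ hb
    exact ⟨s, hs.mono (Icc_subset_Icc_right hb), hsa⟩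
  have hPa : P a := ⟨fun _ => p, ⟨continuousOn_const, fun t ht => by
    rw [le_antisymm ht.2 ht.1]; exact hp⟩, rfl⟩
  by_contra hcon
  have hbdd : BddAbove {b | P b} := ⟨b, fun b' hb' => by
    by_contra! hlt
    exact hcon (hmono _ _ hb' hlt.le)⟩
  set c := sSup {b | P b} with hc
  have hac : a ≤ c := le_csSup hbdd hPa
  have hlt : ∀ b' < c, P b' := fun b' hb' => by
    obtain ⟨d, hd, hbd⟩ := exists_lt_of_lt_csSup ⟨a, hPa⟩ hb'
    exact hmono _ _ hd hbd.le
  have hPc : P c := by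
    rcases hac.eq_or_lt with h | h
    · rwa [← h]
    · obtain ⟨s, hs, hsa⟩ := exists_lift_union hA hB hR ha (T := Ico a c) (fun t ht => ht.1)
        ⟨le_rfl, h⟩ (fun t ht => ⟨(t + c) / 2, ⟨by linarith [ht.1, ht.2], by linarith [ht.2]⟩,
          by linarith [ht.2]⟩) (fun b' hb' => hlt b' hb'.2)
      obtain ⟨s', hs', hsa'⟩ := hs.exists_extension hA hB hAB hR ha h
      exact ⟨s', hs', hsa'.trans hsa⟩
  obtain ⟨s, hs, hsa⟩ := hPc
  obtain ⟨b', hb', s', hs', hsa'⟩ := hs.exists_step hR ha hac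
  exact absurd (le_csSup hbdd (show P b' from ⟨s', hs', hsa'.trans hsa⟩)) (not_le.2 hb')

/-- The lift of the ray `V₀ + e [a, ∞)` through a given point. -/
theorem exists_lift (hA : 0 < A) (hB : 0 < B) (hAB : A ≠ B) (hR : Regular A B V₀ e) {a : ℝ}
    (ha : 0 < a) {p : Surf A B} (hp : ev p = ex (V₀ + e * a)) :
    ∃ s : ℝ → Surf A B, IsLift V₀ e (Ici a) s ∧ s a = p :=
  exists_lift_union hA hB hR ha (fun _ ht => ht) (mem_Ici.2 le_rfl)
    (fun t ht => ⟨t + 1, (mem_Ici.1 ht).trans (by linarith), by linarith⟩)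
    fun b _ => exists_lift_Icc hA hB hAB hR ha hp b

end

/-! ### The ends of the lifts -/

/-- The linear coefficient of the quadratic polynomial that approximates `V`. -/
def lin (A B : ℕ) (m : ℤ) : Bool → ℝ
  | true => A / 2 + m
  | false => (A + B) / 2 + m

theorem norm_ex_le_one {z : ℂ} (h : 0 ≤ z.im) : ‖ex z‖ ≤ 1 := by
  rw [norm_ex, Real.exp_le_one_iff]
  have := mul_nonneg Real.two_pi_pos.le h
  linarith

/-- In its own half plane each chart evaluates the dilogarithm in the closed unit disc, where it is
bounded; the rest of `V` is the quadratic polynomial and a constant. -/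
theorem exists_Vc_bound (A B : ℕ) : ∃ K : ℝ, ∀ (σ : Bool) (z : ℂ) (m : ℤ), ClosedHalf σ z →
    ‖Vc A B σ z m - (((per A B σ : ℝ) : ℂ) / 2 * z ^ 2 + (lin A B m σ : ℂ) * z)‖ ≤ K := by
  obtain ⟨C, hC, hd⟩ := exists_dilog_bound
  have hb : ∀ x : ℂ, ‖x‖ ≤ 1 → ‖(B : ℂ) * dilog x / (2 * Real.pi * I) ^ 2‖ ≤
      B * C / ‖(2 * Real.pi * I : ℂ) ^ 2‖ := fun x hx => by
    rw [norm_div, norm_mul, Complex.norm_natCast]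
    have := hd x hx
    gcongr
  refine ⟨B * C / ‖(2 * Real.pi * I : ℂ) ^ 2‖ + ‖(B / 24 : ℂ)‖, fun σ z m hσ => ?_⟩
  cases σ
  · have hz : 0 ≤ (-z).im := by
      have : z.im ≤ 0 := hσ
      simpa using this
    have e : Vc A B false z m - (((per A B false : ℝ) : ℂ) / 2 * z ^ 2 +
        (lin A B m false : ℂ) * z) = -(B * dilog (ex (-z)) / (2 * Real.pi * I) ^ 2) - B / 24 := by
      simp only [Vc, VMinus, per, lin]
      push_cast
      ring
    rw [e]
    refine (norm_sub_le _ _).trans ?_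
    rw [norm_neg]
    exact add_le_add (hb _ (norm_ex_le_one hz)) le_rfl
  · have e : Vc A B true z m - (((per A B true : ℝ) : ℂ) / 2 * z ^ 2 +
        (lin A B m true : ℂ) * z) = B * dilog (ex z) / (2 * Real.pi * I) ^ 2 + B / 24 := by
      simp only [Vc, VPlus, per, lin]
      push_cast
      ring
    rw [e]
    exact (norm_add_le _ _).trans (add_le_add (hb _ (norm_ex_le_one hσ)) le_rfl)

/-- `Im V` is bounded over the real axis. -/
theorem exists_imV_bound {A B : ℕ} (hA : 0 < A) (hB : 0 < B) :
    ∃ K : ℝ, ∀ p : Surf A B, ‖xc p‖ = 1 → imV p ≤ K := by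
  obtain ⟨K, hK⟩ := exists_Vc_bound A B
  refine ⟨K, fun p hp => ?_⟩
  obtain ⟨z, m, hz⟩ := exists_isPt_side hA hB p
  have him : z.im = 0 := by
    rw [hz.xc_eq, norm_ex, Real.exp_eq_one_iff, neg_eq_zero] at hp
    exact (mul_eq_zero.1 hp).resolve_left Real.two_pi_pos.ne'
  have hσ : ClosedHalf (side p) z := by
    cases side p
    · exact him.le
    · exact him.ge
  have h1 := (Complex.abs_im_le_norm _).trans (hK (side p) z m hσ)
  -- The quadratic polynomial has real coefficients, so it is real on the real axis.
  have h2 : (((per A B (side p) : ℝ) : ℂ) / 2 * z ^ 2 + (lin A B m (side p) : ℂ) * z).im = 0 := by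
    have hzr : z = (z.re : ℂ) := Complex.ext rfl (by simp [him])
    rw [hzr]
    have e : (((per A B (side p) : ℝ) : ℂ) / 2 * (z.re : ℂ) ^ 2 +
        (lin A B m (side p) : ℂ) * (z.re : ℂ)) =
        (((per A B (side p) : ℝ) / 2 * z.re ^ 2 + lin A B m (side p) * z.re : ℝ) : ℂ) := by
      push_cast; ring
    rw [e, ofReal_im]
  rw [sub_im, h2, sub_zero] at h1
  rw [imV_eq hz.ev_eq]
  exact (le_abs_self _).trans h1

theorem isPt_half_norm {A B : ℕ} {σ : Bool} {p : Surf A B} {z : ℂ} {m : ℤ} (h : IsPt σ p z m)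
    (hz : z ∈ half σ) : side p = σ := by rw [h.side_eq, sideOf_of_half hz]

/-- A connected set that avoids the real axis lies in one half sheet. -/
theorem exists_half_sheet {A B : ℕ} (hA : 0 < A) (hB : 0 < B) {C : Set (Surf A B)}
    (hC : IsPreconnected C) (hne : C.Nonempty) (h1 : ∀ p ∈ C, ‖xc p‖ ≠ 1) :
    ∃ (σ : Bool) (m : ℤ), C ⊆ pt σ m '' half σ := by
  have hmem : ∀ p ∈ C, ∃ (σ : Bool) (m : ℤ), p ∈ pt σ m '' half σ := fun p hp => by
    obtain ⟨z, m, hz⟩ := exists_isPt_side hA hB p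
    refine ⟨side p, m, z, ?_, hz.eq_pt.symm⟩
    have hne := h1 p hp
    rw [hz.xc_eq, norm_ex, ne_eq, Real.exp_eq_one_iff, neg_eq_zero] at hne
    have him : z.im ≠ 0 := fun h => hne (by rw [h, mul_zero])
    have hs := closedHalf_sideOf z
    rw [← hz.side_eq] at hs
    revert hs
    cases side p
    · exact fun hs => lt_of_le_of_ne hs him
    · exact fun hs => lt_of_le_of_ne hs him.symm
  obtain ⟨p₀, hp₀⟩ := hne
  obtain ⟨σ, m, hσ⟩ := hmem p₀ hp₀
  have hopen : ∀ (σ : Bool) (m : ℤ), IsOpen (pt σ m '' half σ : Set (Surf A B)) := fun σ m =>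
    isOpen_image_pt m (isOpen_half σ) (half_subset_dom σ)
  -- Half sheets are open, and two of them coincide or are disjoint. The second open set is the
  -- union of those disjoint from the first.
  refine ⟨σ, m, hC.subset_left_of_subset_union (hopen σ m)
    (isOpen_iUnion fun i : {i : Bool × ℤ // Disjoint (pt σ m '' half σ : Set (Surf A B))
      (pt i.1 i.2 '' half i.1)} => hopen i.1.1 i.1.2)
    (disjoint_iUnion_right.2 fun i => i.2) (fun p hp => ?_) ⟨p₀, hp₀, hσ⟩⟩
  obtain ⟨σ', m', hp'⟩ := hmem p hp
  by_cases hd : Disjoint (pt σ m '' half σ : Set (Surf A B)) (pt σ' m' '' half σ')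
  · exact Or.inr (mem_iUnion.2 ⟨⟨(σ', m'), hd⟩, hp'⟩)
  · left
    obtain ⟨q, ⟨z, hz, hzq⟩, ⟨w, hw, hwq⟩⟩ := not_disjoint_iff.1 hd
    have hqz : IsPt σ q z m := hzq ▸ isPt_pt (half_subset_dom σ hz) m
    have hqw : IsPt σ' q w m' := hwq ▸ isPt_pt (half_subset_dom σ' hw) m'
    have hσσ : σ' = σ := (isPt_half_norm hqw hw).symm.trans (isPt_half_norm hqz hz)
    subst hσσ
    obtain ⟨k, -, hk⟩ := hqw.exists_shift hqz
    obtain ⟨v, hv, rfl⟩ := hp'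
    refine ⟨v + k, ?_, ?_⟩
    · cases σ'
      · have : v.im < 0 := hv
        change (v + k).im < 0
        simpa using this
      · have : 0 < v.im := hv
        change 0 < (v + k).im
        simpa using this
    · rw [pt_shift (half_subset_dom _ hv) m' k, hk]

/-- The direction of the lifts of the ray at infinity. -/
theorem exists_direction {A B : ℕ} (hA : 0 < A) (hAB : A ≠ B) {ϑ : ℝ}
    (hϑ : ϑ ∈ Ioo (Real.pi / 2) (3 * Real.pi / 2)) (σ : Bool) :
    ∃ u ∈ half σ, ((per A B σ : ℝ) : ℂ) * u ^ 2 = (|(per A B σ : ℝ)| : ℝ) * (-I * exp (ϑ * I)) ∧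
      ∀ θ ∈ Ioo (ϑ - Real.pi / 2) (ϑ + Real.pi / 2), 0 < cone A B θ σ u := by
  have hpi := Real.pi_pos
  have hf : ∀ φ : ℝ, ∀ θ : ℝ, exp (φ * I) * exp (-(θ / 2 * I)) = exp ((φ - θ / 2 : ℝ) * I) :=
    fun φ θ => by rw [← Complex.exp_add]; congr 1; push_cast; ring
  have hsq : ∀ φ : ℝ, exp (φ * I) ^ 2 = exp ((2 * φ : ℝ) * I) := fun φ => by
    rw [← Complex.exp_nat_mul]; congr 1; push_cast; ring
  have hI : exp ((-(Real.pi / 2) : ℝ) * I) = -I := by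
    push_cast
    rw [neg_mul, Complex.exp_neg, Complex.exp_pi_div_two_mul_I, inv_I]
  have hI' : exp ((Real.pi / 2 : ℝ) * I) = I := by
    push_cast
    exact Complex.exp_pi_div_two_mul_I
  have e0 : exp ((ϑ / 2 - Real.pi / 4 : ℝ) * I) ^ 2 = -I * exp (ϑ * I) := by
    rw [hsq, ← hI, ← Complex.exp_add]; congr 1; push_cast; ring
  have e1 : exp ((ϑ / 2 + Real.pi / 4 : ℝ) * I) ^ 2 = I * exp (ϑ * I) := by
    rw [hsq]; nth_rewrite 2 [← hI']; rw [← Complex.exp_add]; congr 1; push_cast; ring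
  have him : ∀ φ : ℝ, 0 < φ → φ < Real.pi → 0 < (exp (φ * I)).im := fun φ h0 h1 => by
    rw [Complex.exp_ofReal_mul_I_im]; exact Real.sin_pos_of_pos_of_lt_pi h0 h1
  have i0 := him (ϑ / 2 - Real.pi / 4) (by linarith [hϑ.1]) (by linarith [hϑ.2])
  have i1 := him (ϑ / 2 + Real.pi / 4) (by linarith [hϑ.1]) (by linarith [hϑ.2])
  -- The angle relative to `θ/2` is `(ϑ - θ)/2 - π/4`, which lies in `(-π/2, 0)` precisely when `|θ
  -- - ϑ| < π/2`. This is the origin of the range of `θ`.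
  have c0 : ∀ θ ∈ Ioo (ϑ - Real.pi / 2) (ϑ + Real.pi / 2),
      0 < (exp ((ϑ / 2 - Real.pi / 4 : ℝ) * I) * exp (-(θ / 2 * I))).re ∧
      0 < -(exp ((ϑ / 2 - Real.pi / 4 : ℝ) * I) * exp (-(θ / 2 * I))).im := fun θ hθ => by
    rw [hf, Complex.exp_ofReal_mul_I_re, Complex.exp_ofReal_mul_I_im]
    exact ⟨Real.cos_pos_of_mem_Ioo ⟨by linarith [hθ.2], by linarith [hθ.1]⟩,
      neg_pos.2 (Real.sin_neg_of_neg_of_neg_pi_lt (by linarith [hθ.1]) (by linarith [hθ.2]))⟩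
  have c1 : ∀ θ ∈ Ioo (ϑ - Real.pi / 2) (ϑ + Real.pi / 2),
      0 < (exp ((ϑ / 2 + Real.pi / 4 : ℝ) * I) * exp (-(θ / 2 * I))).re ∧
      0 < (exp ((ϑ / 2 + Real.pi / 4 : ℝ) * I) * exp (-(θ / 2 * I))).im := fun θ hθ => by
    rw [hf, Complex.exp_ofReal_mul_I_re, Complex.exp_ofReal_mul_I_im]
    exact ⟨Real.cos_pos_of_mem_Ioo ⟨by linarith [hθ.2], by linarith [hθ.1]⟩,
      Real.sin_pos_of_pos_of_lt_pi (by linarith [hθ.2]) (by linarith [hθ.1])⟩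
  cases σ
  · rcases sgn_eq hAB with ⟨hlt, hs, -⟩ | ⟨hlt, hs, -⟩
    · have hlt' : (0 : ℝ) < (per A B false : ℝ) := by
        simp only [per]; push_cast
        exact sub_pos.2 (by exact_mod_cast hlt)
      refine ⟨-exp ((ϑ / 2 - Real.pi / 4 : ℝ) * I), ?_, ?_, fun θ hθ => ?_⟩
      · change (-exp ((ϑ / 2 - Real.pi / 4 : ℝ) * I)).im < 0
        rw [neg_im]; linarith
      · rw [neg_sq, e0, abs_of_pos hlt']
      · obtain ⟨h1, h2⟩ := c0 θ hθ
        rw [cone_false, hs, neg_mul, neg_im, neg_re, neg_im]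
        refine lt_min (by linarith) (lt_min (by linarith) (by linarith))
    -- A negative leading coefficient changes the required square to `i e^{iϑ}`, so the root is
    -- turned by `π/2`.
    · have hlt' : (per A B false : ℝ) < 0 := by
        simp only [per]; push_cast
        exact sub_neg.2 (by exact_mod_cast hlt)
      refine ⟨-exp ((ϑ / 2 + Real.pi / 4 : ℝ) * I), ?_, ?_, fun θ hθ => ?_⟩
      · change (-exp ((ϑ / 2 + Real.pi / 4 : ℝ) * I)).im < 0
        rw [neg_im]; linarith
      · rw [neg_sq, e1, abs_of_neg hlt']
        push_cast; ring
      · obtain ⟨h1, h2⟩ := c1 θ hθ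
        rw [cone_false, hs, neg_mul, neg_im, neg_re, neg_im]
        refine lt_min (by linarith) (lt_min (by linarith) (by linarith))
  · refine ⟨exp ((ϑ / 2 - Real.pi / 4 : ℝ) * I), i0, ?_, fun θ hθ => ?_⟩
    · have : (0 : ℝ) ≤ (per A B true : ℝ) := by simp only [per]; positivity
      rw [e0, abs_of_nonneg this]
    · obtain ⟨h1, h2⟩ := c0 θ hθ
      rw [cone_true]
      exact lt_min i0 (lt_min h1 h2)

/-- `y² - (r u)² = (y - r u)(y + r u)`, and `|y + r u| ≥ |Im u|` because `y` and `u` are in the same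
half plane and `r ≥ 1`. -/
theorem norm_sub_le_of_sq {σ : Bool} {u y : ℂ} (hu : u ∈ half σ) (hy : y ∈ half σ) {r K : ℝ}
    (hr : 1 ≤ r) (h : ‖y ^ 2 - (r * u) ^ 2‖ ≤ K) : ‖y - r * u‖ ≤ K / |u.im| := by
  have hu0 : 0 < |u.im| := by
    cases σ
    · exact abs_pos.2 (ne_of_lt hu)
    · exact abs_pos.2 (ne_of_gt hu)
  have h1 : |u.im| ≤ ‖y + r * u‖ := by
    refine le_trans ?_ (Complex.abs_im_le_norm _)
    rw [add_im, im_ofReal_mul]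
    cases σ
    · have hu' : u.im < 0 := hu
      have hy' : y.im < 0 := hy
      rw [abs_of_neg hu', abs_of_neg (by nlinarith)]
      nlinarith
    · have hu' : 0 < u.im := hu
      have hy' : 0 < y.im := hy
      rw [abs_of_pos hu', abs_of_pos (by nlinarith)]
      nlinarith
  rw [le_div_iff₀ hu0]
  rw [sq_sub_sq, norm_mul] at h
  have := norm_nonneg (y - r * u)
  nlinarith

theorem eq_of_continuousOn_int {T : Set ℝ} (hT : IsPreconnected T) {f : ℝ → ℂ}
    (hf : ContinuousOn f T) {n : ℝ → ℤ} (hn : ∀ t ∈ T, f t = n t) {t t' : ℝ} (ht : t ∈ T)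
    (ht' : t' ∈ T) : n t = n t' := by
  have h1 : ContinuousOn (fun t => (n t : ℝ)) T := by
    refine (continuous_re.comp_continuousOn hf).congr fun t ht => ?_
    simp [hn t ht]
  have h2 : ContinuousOn n T := Int.isClosedEmbedding_coe_real.isInducing.continuousOn_iff.2 h1
  exact hT.constant h2 ht ht'

/-- A lift of the ray `V₀ - i e^{iϑ} [a, ∞)` runs to infinity in one half sheet, inside the cones
of decay. -/
theorem IsLift.exists_end {A B : ℕ} (hA : 0 < A) (hB : 0 < B) (hAB : A ≠ B) {V₀ : ℂ} {ϑ : ℝ}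
    (hϑ : ϑ ∈ Ioo (Real.pi / 2) (3 * Real.pi / 2)) (him : 0 < (-I * exp (ϑ * I)).im) {a : ℝ}
    {s : ℝ → Surf A B} (hs : IsLift V₀ (-I * exp (ϑ * I)) (Ici a) s) :
    ∃ (T : ℝ) (σ : Bool) (m : ℤ) (z : ℝ → ℂ), HasEnd s T σ m z ∧
      ∀ θ ∈ Ioo (ϑ - Real.pi / 2) (ϑ + Real.pi / 2),
        Filter.Tendsto (fun t => cone A B θ σ (z t)) Filter.atTop Filter.atTop := by
  set e := -I * exp (ϑ * I) with he
  obtain ⟨K₀, hK₀⟩ := exists_imV_bound (A := A) (B := B) hA hB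
  -- From this time on `Im V` exceeds its bound over the real axis by at least `1`.
  set T := max a ((K₀ + 1 - V₀.im) / e.im) with hT
  have hTa : a ≤ T := le_max_left _ _
  have hlift := hs.mono (Ici_subset_Ici.2 hTa)
  have hoff : ∀ p ∈ s '' Ici T, ‖xc p‖ ≠ 1 := by
    rintro _ ⟨t, ht, rfl⟩ h1
    have h2 := hK₀ _ h1
    rw [imV_eq (hlift.2 t ht), add_im, mul_comm, im_ofReal_mul] at h2
    have h3 : (K₀ + 1 - V₀.im) / e.im ≤ t := (le_max_right _ _).trans ht
    rw [div_le_iff₀ him] at h3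
    linarith
  obtain ⟨σ, m, hsheet⟩ := exists_half_sheet hA hB (isPreconnected_Ici.image s hlift.1)
    ⟨s T, T, mem_Ici.2 le_rfl, rfl⟩ hoff
  have hz : ∀ t, T ≤ t → ∃ z ∈ half σ, (pt σ m z : Surf A B) = s t := fun t ht =>
    hsheet ⟨t, ht, rfl⟩
  choose! z hzh hzp using hz
  have hend : HasEnd s T σ m z := fun t ht =>
    ⟨hzh t ht, hzp t ht ▸ isPt_pt (half_subset_dom σ (hzh t ht)) m⟩
  refine ⟨T, σ, m, z, hend, fun θ hθ => ?_⟩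
  have hzc : ContinuousOn z (Ici T) :=
    continuousOn_of_chart (Φ := (pt σ m : ℂ → Surf A B)) (isOpen_half σ)
      ((injOn_pt hA hAB σ m).mono (half_subset_dom σ))
      (fun U hU hUs => isOpen_image_pt m hU (hUs.trans (half_subset_dom σ)))
      hlift.1 (fun t ht => hzh t ht) fun t ht => hzp t ht
  have hVc : ContinuousOn (fun t => Vc A B σ (z t) m) (Ici T) := fun t ht =>
    ((hasDerivAt_Vc A B (half_subset_dom σ (hzh t ht)) m).continuousAt).comp_continuousWithinAt
      (f := z) (hzc t ht)
  have hn : ∀ t, T ≤ t → ∃ n : ℤ, Vc A B σ (z t) m = V₀ + e * t + n := fun t ht =>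
    ex_eq_ex_iff.1 ((hlift.2 t ht).symm.trans (hend t ht).2.ev_eq)
  choose! n hn using hn
  -- The difference between `V` in the chart and the ray is continuous and integer valued.
  have hconst : ∀ t, T ≤ t → n t = n T := fun t ht =>
    eq_of_continuousOn_int isPreconnected_Ici
      (f := fun t => Vc A B σ (z t) m - (V₀ + e * t))
      (hVc.sub continuous_rayPt.continuousOn)
      (fun t ht => by rw [hn t ht]; ring) ht (mem_Ici.2 le_rfl)
  obtain ⟨K, hK⟩ := exists_Vc_bound A B
  obtain ⟨u, hu, hu2, hcone⟩ := exists_direction hA hAB hϑ σ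
  set P : ℝ := (per A B σ : ℝ) with hP
  have hP0 : P ≠ 0 := by rw [hP]; exact_mod_cast per_ne_zero hA hAB σ
  have hPC : (P : ℂ) ≠ 0 := by exact_mod_cast hP0
  set β : ℝ := lin A B m σ with hβ
  -- Completing the square: `P/2 z² + β z = P/2 ((z + α)² - α²)`.
  set α : ℝ := β / P with hα
  set K' : ℝ := (K + ‖V₀ + n T + ((P / 2 * α ^ 2 : ℝ) : ℂ)‖) * (2 / |P|) with hK'
  have habsP : 0 < |P| := abs_pos.2 hP0
  have hest : ∀ t, T ≤ t → ‖(z t + α) ^ 2 - ((2 * t / |P| : ℝ) : ℂ) * u ^ 2‖ ≤ K' := fun t ht => by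
    have h1 := hK σ (z t) m (closedHalf_of_half (hzh t ht))
    rw [hn t ht, hconst t ht] at h1
    have hαβ : (β : ℂ) = P * α := by rw [hα]; push_cast; field_simp
    have h2 : (P : ℂ) / 2 * ((z t + α) ^ 2 - ((2 * t / |P| : ℝ) : ℂ) * u ^ 2) =
        -(V₀ + e * t + n T - ((P : ℂ) / 2 * z t ^ 2 + β * z t)) +
          (V₀ + n T + ((P / 2 * α ^ 2 : ℝ) : ℂ)) := by
      have h3 : (P : ℂ) / 2 * (((2 * t / |P| : ℝ) : ℂ) * u ^ 2) = e * t := by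
        have habsC : ((|P| : ℝ) : ℂ) ≠ 0 := by exact_mod_cast habsP.ne'
        have : (P : ℂ) / 2 * (((2 * t / |P| : ℝ) : ℂ) * u ^ 2) =
            (t / (|P| : ℝ)) * (P * u ^ 2) := by push_cast; ring
        rw [this, hu2, ← he]
        field_simp
      rw [mul_sub, h3, hαβ]
      push_cast
      ring
    have h4 : ‖(P : ℂ) / 2 * ((z t + α) ^ 2 - ((2 * t / |P| : ℝ) : ℂ) * u ^ 2)‖ ≤
        K + ‖V₀ + n T + ((P / 2 * α ^ 2 : ℝ) : ℂ)‖ := by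
      rw [h2]
      refine (norm_add_le _ _).trans ?_
      rw [norm_neg]
      exact add_le_add h1 le_rfl
    rw [norm_mul, norm_div, Complex.norm_real, Real.norm_eq_abs, Complex.norm_two] at h4
    rw [hK', ← div_le_iff₀ (by positivity)]
    rw [div_div_eq_mul_div]
    linarith
  have hαh : ∀ t, T ≤ t → z t + α ∈ half σ := fun t ht => by
    have h1 := hzh t ht
    revert h1
    cases σ
    · intro h1
      have h1' : (z t).im < 0 := h1
      change (z t + α).im < 0
      simpa using h1'
    · intro h1
      have h1' : 0 < (z t).im := h1
      change 0 < (z t + α).im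
      simpa using h1'
  -- So `z` equals `√(2t/|P|) u` up to a bounded error, and its depth grows like `√t`.
  have hlow : ∀ t, max (max T 0) (|P| / 2) ≤ t →
      Real.sqrt (2 * t / |P|) * cone A B θ σ u - (K' / |u.im| + |α|) ≤ cone A B θ σ (z t) :=
    fun t ht => by
      obtain ⟨ht1, ht2⟩ := max_le_iff.1 ht
      obtain ⟨ht1, ht0⟩ := max_le_iff.1 ht1
      set r := Real.sqrt (2 * t / |P|) with hr
      have hr1 : 1 ≤ r := by
        rw [hr, Real.one_le_sqrt, one_le_div habsP]
        linarith
      have hr2 : ((r : ℂ) * u) ^ 2 = ((2 * t / |P| : ℝ) : ℂ) * u ^ 2 := by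
        rw [mul_pow, ← ofReal_pow, hr, Real.sq_sqrt (by positivity)]
      have h1 := norm_sub_le_of_sq (K := K') hu (hαh t ht1) hr1 (hr2 ▸ hest t ht1)
      have h2 := cone_add A B θ σ (r * u) (z t + α - r * u - α)
      rw [cone_smul _ _ _ _ _ (zero_le_one.trans hr1)] at h2
      have h3 := neg_norm_le_cone A B θ σ (z t + α - r * u - α)
      have h4 := norm_sub_le (z t + α - r * u) (α : ℂ)
      rw [Complex.norm_real, Real.norm_eq_abs] at h4
      have e5 : (r : ℂ) * u + (z t + α - r * u - α) = z t := by ring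
      rw [e5] at h2
      linarith
  have htend : Filter.Tendsto (fun t : ℝ => Real.sqrt (2 * t / |P|) * cone A B θ σ u -
      (K' / |u.im| + |α|)) Filter.atTop Filter.atTop := by
    refine Filter.tendsto_atTop_add_const_right _ _ (Filter.Tendsto.atTop_mul_const (hcone θ hθ) ?_)
    refine Real.tendsto_sqrt_atTop.comp (Filter.Tendsto.atTop_div_const habsP ?_)
    exact Filter.tendsto_id.const_mul_atTop (by norm_num)
  refine Filter.tendsto_atTop_mono' _ ?_ htend
  filter_upwards [Filter.eventually_ge_atTop (max (max T 0) (|P| / 2))] with t ht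
  exact hlow t ht

/-! ### Components of level sets -/

/-- Near a limit point `g` is bounded, so only a compact part of the parameter set contributes
there. -/
theorem isClosed_image_of_coercive {X : Type*} [TopologicalSpace X] [T2Space X] {f : ℝ → X}
    {g : X → ℝ} (hg : Continuous g) {F : Set ℝ} (hF : IsClosed F) (hf : ContinuousOn f F)
    (h : ∀ t ∈ F, |t| ≤ g (f t)) : IsClosed (f '' F) := by
  refine isClosed_of_closure_subset fun q hq => ?_
  set K := f '' (F ∩ Icc (-(g q + 1)) (g q + 1)) with hK
  have hKc : IsClosed K :=
    ((isCompact_Icc.inter_left hF).image_of_continuousOn (hf.mono inter_subset_left)).isClosed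
  have hKF : K ⊆ f '' F := image_mono inter_subset_left
  by_contra hcon
  have hqK : q ∉ K := fun h => hcon (hKF h)
  obtain ⟨_, ⟨h1, h2⟩, ⟨t, ht, rfl⟩⟩ := mem_closure_iff.1 hq (Kᶜ ∩ {p | g p < g q + 1})
    (hKc.isOpen_compl.inter (isOpen_lt hg continuous_const)) ⟨hqK, by simp⟩
  exact h1 ⟨t, ⟨ht, abs_le.1 ((h t ht).trans (le_of_lt h2))⟩, rfl⟩

/-- A connected subset that is closed and relatively open in `S` cannot be properly contained in a
connected one. -/
theorem eq_connectedComponentIn {X : Type*} [TopologicalSpace X] {C S : Set X} {p : X}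
    (hp : p ∈ C) (hCS : C ⊆ S) (hpre : IsPreconnected C) (hclosed : IsClosed C)
    (hopen : ∀ q ∈ C, ∃ N ∈ 𝓝 q, ∀ r ∈ N, r ∈ S → r ∈ C) : C = connectedComponentIn S p := by
  refine Subset.antisymm (hpre.subset_connectedComponentIn hp hCS) ?_
  set U := interior {r | r ∈ S → r ∈ C} with hU
  have hCU : C ⊆ U := fun q hq => by
    obtain ⟨N, hN, h⟩ := hopen q hq
    exact mem_interior_iff_mem_nhds.2 (Filter.mem_of_superset hN h)
  have hKS := connectedComponentIn_subset S p
  rcases isPreconnected_iff_subset_of_disjoint.1 (isPreconnected_connectedComponentIn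
    (F := S) (x := p)) U Cᶜ isOpen_interior hclosed.isOpen_compl
    (fun q _ => (em (q ∈ C)).imp (fun h => hCU h) id)
    (eq_empty_of_forall_notMem fun q hq => hq.2.2 (interior_subset hq.2.1 (hKS hq.1))) with h | h
  · exact fun q hq => interior_subset (h hq) (hKS hq)
  · exact absurd hp (h (mem_connectedComponentIn (hCS hp)))

section

variable {A B : ℕ} {V₀ e : ℂ}

/-- The parameter of a point over the ray `V₀ + e t`. -/
def level (V₀ e : ℂ) (p : Surf A B) : ℝ := (imV p - V₀.im) / e.im

theorem continuous_level (V₀ e : ℂ) : Continuous (level V₀ e : Surf A B → ℝ) :=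
  (continuous_imV.sub continuous_const).div_const _

theorem level_eq (he : 0 < e.im) {p : Surf A B} {t : ℝ} (h : ev p = ex (V₀ + e * t)) :
    level V₀ e p = t := by
  rw [level, imV_eq h, add_im, mul_comm, im_ofReal_mul]
  field_simp
  ring

/-- A lift contains all points over the ray that are close to it. -/
theorem IsLift.exists_nhds (hR : Regular A B V₀ e) {T : Set ℝ} {s : ℝ → Surf A B}
    (h : IsLift V₀ e T s) {t₀ : ℝ} (ht : t₀ ∈ T) (h0 : 0 < t₀) :
    ∃ N ∈ 𝓝 (s t₀), ∀ r ∈ N, ∀ t ∈ T, ev r = ex (V₀ + e * t) → r = s t := by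
  obtain ⟨S, -, -, -, -, N, hN, hu⟩ :=
    exists_section (hR.yc_ne_zero h0 (h.2 t₀ ht)) (h.2 t₀ ht)
  have h1 := h.eventually_eq ht hN hu
  rw [eventually_nhdsWithin_iff] at h1
  have h2 := ((continuous_rayPt (V₀ := V₀) (e := e)).tendsto t₀).eventually hu
  have h3 : ∀ᶠ r in 𝓝 (s t₀), (level V₀ e r ∈ T → s (level V₀ e r) = S (V₀ + e * level V₀ e r)) ∧
      ∀ p ∈ N, ev p = ex (V₀ + e * level V₀ e r) → p = S (V₀ + e * level V₀ e r) := by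
    have := (continuous_level (A := A) (B := B) V₀ e).tendsto (s t₀)
    rw [level_eq hR.im_pos (h.2 t₀ ht)] at this
    exact this.eventually (h1.and h2)
  refine ⟨_, Filter.inter_mem hN h3, ?_⟩
  rintro r ⟨hrN, hr⟩ t htT hrt
  have hl := level_eq hR.im_pos hrt
  have hr' : (level V₀ e r ∈ T → s (level V₀ e r) = S (V₀ + e * level V₀ e r)) ∧
      ∀ p ∈ N, ev p = ex (V₀ + e * level V₀ e r) → p = S (V₀ + e * level V₀ e r) := hr
  rw [hl] at hr'
  rw [hr'.1 htT]
  exact hr'.2 r hrN hrt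

theorem mem_levelSet_iff {ϑ lam : ℝ} {p : Surf A B} : p ∈ levelSet A B V₀ ϑ lam ↔
    ∃ t : ℝ, lam ≤ t ∧ ev p = ex (V₀ + -I * exp (ϑ * I) * t) := by
  refine exists_congr fun t => and_congr_right fun _ => ?_
  rw [vol_eq_iff, show V₀ - I * exp (ϑ * I) * t = V₀ + -I * exp (ϑ * I) * t by ring]

/-- The image is closed because `level` recovers the parameter from the point, and open in the level
set because nearby points over the ray belong to the lift (`IsLift.exists_nhds`). -/
theorem IsLift.image_eq_levelComponent (hA : 0 < A) (hB : 0 < B) {ϑ lam : ℝ} (hlam : 0 < lam)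
    (hR : Regular A B V₀ (-I * exp (ϑ * I))) {s : ℝ → Surf A B}
    (h : IsLift V₀ (-I * exp (ϑ * I)) (Ici lam) s) :
    s '' Ici lam = levelComponent A B V₀ ϑ lam (s lam) := by
  have := t2Space_surf (A := A) (B := B) hA hB
  refine eq_connectedComponentIn ⟨lam, mem_Ici.2 le_rfl, rfl⟩ ?_ (isPreconnected_Ici.image s h.1)
    ?_ ?_
  · rintro _ ⟨t, ht, rfl⟩
    exact mem_levelSet_iff.2 ⟨t, ht, h.2 t ht⟩
  · refine isClosed_image_of_coercive (continuous_level V₀ (-I * exp (ϑ * I))) isClosed_Ici h.1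
      fun t ht => ?_
    rw [level_eq hR.im_pos (h.2 t ht), abs_of_pos (hlam.trans_le ht)]
  · rintro _ ⟨t, ht, rfl⟩
    obtain ⟨N, hN, hN'⟩ := h.exists_nhds hR ht (hlam.trans_le ht)
    refine ⟨N, hN, fun r hr hrS => ?_⟩
    obtain ⟨t', ht', hev⟩ := mem_levelSet_iff.1 hrS
    exact ⟨t', ht', (hN' r hr t' ht' hev).symm⟩

/-! ### The thimble -/

/-- One half of the thimble, in the parameter `√t`. -/
theorem exists_half_thimble (hA : 0 < A) (hB : 0 < B) (hAB : A ≠ B) (hR : Regular A B V₀ e)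
    {S : ℂ → Surf A B} (hS : ∀ᶠ w in 𝓝 (0 : ℂ), ContinuousAt S w ∧ ev (S w) = ex (V₀ + w ^ 2))
    {f : ℂ} (hf : f ^ 2 = e) :
    ∃ h : ℝ → Surf A B, ContinuousOn h (Ici 0) ∧ (∀ x, 0 ≤ x → ev (h x) = ex (V₀ + e * (x ^ 2 : ℝ))) ∧
      ∃ d > 0, ∀ x ∈ Icc 0 d, h x = S (x * f) := by
  have hline : Continuous fun x : ℝ => (x : ℂ) * f := by fun_prop
  have hl0 : Filter.Tendsto (fun x : ℝ => (x : ℂ) * f) (𝓝 0) (𝓝 0) := by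
    simpa using hline.tendsto 0
  obtain ⟨d, hd, hball⟩ := Metric.nhds_basis_closedBall.mem_iff.1 (hl0.eventually hS)
  have hin : ∀ x ∈ Icc 0 d, ContinuousAt S (x * f) ∧ ev (S (x * f)) = ex (V₀ + e * (x ^ 2 : ℝ)) :=
    fun x hx => by
      have h1 := hball (show x ∈ Metric.closedBall 0 d by
        rw [Metric.mem_closedBall, Real.dist_eq, sub_zero, abs_of_nonneg hx.1]; exact hx.2)
      refine ⟨h1.1, h1.2.trans ?_⟩
      rw [mul_pow, hf]
      push_cast
      rw [mul_comm]
  -- The square root section serves on `[0, d]`; beyond the value `V₀ + e d²` the lift of the ray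
  -- takes over.
  obtain ⟨s, hs, hsd⟩ := exists_lift hA hB hAB hR (pow_pos hd 2) (hin d ⟨hd.le, le_rfl⟩).2
  refine ⟨fun x => if x ≤ d then S (x * f) else s (x ^ 2), ?_, fun x hx => ?_, d, hd,
    fun x hx => if_pos hx.2⟩
  · have e₁ : ContinuousOn (fun x : ℝ => if x ≤ d then S (x * f) else s (x ^ 2)) (Icc 0 d) := by
      refine ContinuousOn.congr (f := fun x : ℝ => S (x * f)) (fun x hx => ?_)
        fun x hx => if_pos hx.2
      exact (ContinuousAt.comp (f := fun x : ℝ => (x : ℂ) * f) (hin x hx).1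
        hline.continuousAt).continuousWithinAt
    have e₂ : ContinuousOn (fun x : ℝ => if x ≤ d then S (x * f) else s (x ^ 2)) (Ici d) := by
      refine ContinuousOn.congr (f := fun x : ℝ => s (x ^ 2)) (hs.1.comp (by fun_prop)
        fun x hx => mem_Ici.2 (pow_le_pow_left₀ hd.le hx 2)) fun x hx => ?_
      simp only
      split_ifs with hxd
      · rw [le_antisymm hxd hx, hsd]
      · rfl
    have := e₁.union_of_isClosed e₂ isClosed_Icc isClosed_Ici
    rwa [Icc_union_Ici_eq_Ici hd.le] at this
  · simp only
    split_ifs with hxd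
    · exact (hin x ⟨hx, hxd⟩).2
    · exact hs.2 _ (mem_Ici.2 (pow_le_pow_left₀ hd.le (not_le.1 hxd).le 2))

theorem isLift_sqrt {h : ℝ → Surf A B} (hc : ContinuousOn h (Ici 0))
    (hev : ∀ x, 0 ≤ x → ev (h x) = ex (V₀ + e * (x ^ 2 : ℝ))) :
    IsLift V₀ e (Ioi 0) fun t => h (Real.sqrt t) :=
  ⟨hc.comp Real.continuous_sqrt.continuousOn fun t _ => Real.sqrt_nonneg t, fun t ht => by
    rw [hev _ (Real.sqrt_nonneg t), Real.sq_sqrt (le_of_lt ht)]⟩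

/-- Near `p₀` one has `V = V₀ + w²`, and over `V₀ + e t` lie the two roots `w = ±√t f` with `f² =
e`. The two half thimbles join at `p₀` to a line on which the level is the square of the parameter.
-/
theorem exists_thimble (hA : 0 < A) (hB : 0 < B) (hAB : A ≠ B) {ϑ : ℝ}
    (hR : Regular A B V₀ (-I * exp (ϑ * I))) {p₀ : Surf A B} (hy : yc p₀ = 0)
    (hp₀ : ev p₀ = ex V₀) :
    ∃ γ : ℝ → Surf A B, Continuous γ ∧ Function.Injective γ ∧
      (∀ t : ℝ, ev (γ t) = ex (V₀ + -I * exp (ϑ * I) * (t ^ 2 : ℝ))) ∧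
      range γ = levelComponent A B V₀ ϑ 0 p₀ := by
  have := t2Space_surf (A := A) (B := B) hA hB
  set e := -I * exp (ϑ * I) with he
  have he0 : e ≠ 0 := fun h => by
    have := hR.im_pos
    rw [h] at this
    simp at this
  obtain ⟨S, hS0, hS, ⟨U, hU, hinj⟩, N, hN, hu⟩ := exists_sqrt_section hA hB hAB hy hp₀
  obtain ⟨f, hf⟩ := IsAlgClosed.exists_pow_nat_eq e (n := 2) (by norm_num)
  have hf0 : f ≠ 0 := fun h => he0 (by rw [← hf, h]; simp)
  obtain ⟨h₁, hc₁, hev₁, d₁, hd₁, hS₁⟩ := exists_half_thimble hA hB hAB hR hS hf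
  obtain ⟨h₂, hc₂, hev₂, d₂, hd₂, hS₂⟩ := exists_half_thimble hA hB hAB hR hS
    ((neg_sq f).trans hf)
  -- If the halves met at one level, uniqueness of lifts would make them equal at all positive
  -- levels, against the injectivity of the section near `p₀`.
  have hne : ∀ x > 0, h₁ x ≠ h₂ x := by
    intro x hx hxx
    have heq := (isLift_sqrt hc₁ hev₁).eqOn hA hB hR isPreconnected_Ioi subset_rfl
      (isLift_sqrt hc₂ hev₂) (t₀ := x ^ 2) (pow_pos hx 2)
      (by simp only [Real.sqrt_sq hx.le]; exact hxx)
    have hl : ∀ g : ℂ, Filter.Tendsto (fun x : ℝ => (x : ℂ) * g) (𝓝[>] 0) (𝓝 0) := fun g => by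
      have hline : Continuous fun x : ℝ => (x : ℂ) * g := by fun_prop
      have := (hline.tendsto 0).mono_left (nhdsWithin_le_nhds (s := Ioi 0))
      simpa using this
    have hsmall : ∀ᶠ y : ℝ in 𝓝[>] 0,
        0 < y ∧ y ∈ Ioc 0 d₁ ∧ y ∈ Ioc 0 d₂ ∧ (y : ℂ) * f ∈ U ∧ (y : ℂ) * -f ∈ U := by
      filter_upwards [self_mem_nhdsWithin, Ioc_mem_nhdsGT hd₁, Ioc_mem_nhdsGT hd₂, hl f hU,
        hl (-f) hU] with y a1 a2 a3 a4 a5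
      exact ⟨a1, a2, a3, a4, a5⟩
    obtain ⟨y, hy0, hy1, hy2, hy3, hy4⟩ := hsmall.exists
    have h3 := heq (show y ^ 2 ∈ Ioi (0 : ℝ) from pow_pos hy0 2)
    simp only [Real.sqrt_sq hy0.le] at h3
    rw [hS₁ y ⟨hy0.le, hy1.2⟩, hS₂ y ⟨hy0.le, hy2.2⟩] at h3
    have h4 := hinj hy3 hy4 h3
    have hy0' : (y : ℂ) ≠ 0 := by exact_mod_cast hy0.ne'
    have h5 : (2 : ℂ) * (y * f) = 0 := by linear_combination h4
    exact (mul_ne_zero two_ne_zero (mul_ne_zero hy0' hf0)) h5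
  set γ : ℝ → Surf A B := fun t => if t ≤ 0 then h₂ (-t) else h₁ t with hγ
  have h00 : h₁ 0 = p₀ ∧ h₂ 0 = p₀ := by
    rw [hS₁ 0 ⟨le_rfl, hd₁.le⟩, hS₂ 0 ⟨le_rfl, hd₂.le⟩]
    simp [hS0]
  have hγp : ∀ x, 0 ≤ x → γ x = h₁ x := fun x hx => by
    simp only [hγ]
    split_ifs with h
    · rw [le_antisymm h hx, neg_zero, h00.1, h00.2]
    · rfl
  have hγn : ∀ x, 0 ≤ x → γ (-x) = h₂ x := fun x hx => by
    simp only [hγ]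
    rw [if_pos (by linarith), neg_neg]
  have hγc : Continuous γ := by
    refine continuous_if_le continuous_id continuous_const ?_ ?_ fun t ht => ?_
    · exact hc₂.comp continuous_neg.continuousOn fun t ht => by simpa using ht
    · exact hc₁.mono fun t ht => by simpa using ht
    · rw [ht, neg_zero, h00.1, h00.2]
  have hγev : ∀ t : ℝ, ev (γ t) = ex (V₀ + e * (t ^ 2 : ℝ)) := fun t => by
    rcases le_total 0 t with h | h
    · rw [hγp t h, hev₁ t h]
    · rw [← neg_neg t, hγn (-t) (by linarith), hev₂ _ (by linarith), neg_neg, neg_sq]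
  have hlev : ∀ t, level V₀ e (γ t) = t ^ 2 := fun t => level_eq hR.im_pos (hγev t)
  have hγne : ∀ x > 0, γ x ≠ γ (-x) := fun x hx => by
    rw [hγp x hx.le, hγn x hx.le]
    exact hne x hx
  refine ⟨γ, hγc, fun t t' htt => ?_, hγev, ?_⟩
  · have hsq : t ^ 2 = t' ^ 2 := by rw [← hlev, ← hlev, htt]
    rcases sq_eq_sq_iff_eq_or_eq_neg.1 hsq with h | h
    · exact h
    · rcases lt_trichotomy t 0 with h0 | h0 | h0
      · refine absurd ?_ (hγne (-t) (by linarith))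
        rw [neg_neg, htt, h, neg_neg]
      · rw [h0] at h
        linarith
      · refine absurd ?_ (hγne t h0)
        rw [htt, h, neg_neg]
  · refine eq_connectedComponentIn ⟨0, (hγp 0 le_rfl).trans h00.1⟩ ?_
      (isPreconnected_range hγc) ?_ ?_
    · rintro _ ⟨t, rfl⟩
      exact mem_levelSet_iff.2 ⟨t ^ 2, sq_nonneg t, hγev t⟩
    · rw [← image_univ]
      -- The `+ 1` is there for `|t| ≤ t² + 1`.
      refine isClosed_image_of_coercive (g := fun p => level V₀ e p + 1)
        ((continuous_level V₀ e).add continuous_const) isClosed_univ hγc.continuousOn fun t _ => ?_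
      simp only [hlev]
      rcases abs_cases t with h | h <;> nlinarith [sq_nonneg (t - 1), sq_nonneg (t + 1)]
    -- Away from `p₀` the level stays positive nearby, and the curve is locally a lift.
    · have hoff : ∀ (h : ℝ → Surf A B), IsLift V₀ e (Ioi 0) (fun t => h (Real.sqrt t)) →
          (∀ x, 0 ≤ x → h x ∈ range γ) → ∀ x > 0, ∃ N ∈ 𝓝 (h x), ∀ r ∈ N,
            r ∈ levelSet A B V₀ ϑ 0 → r ∈ range γ := by
        intro h hl hrange x hx
        obtain ⟨N, hN, hN'⟩ := hl.exists_nhds hR (t₀ := x ^ 2) (pow_pos hx 2) (pow_pos hx 2)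
        have hlx := level_eq hR.im_pos (hl.2 (x ^ 2) (pow_pos hx 2))
        simp only [Real.sqrt_sq hx.le] at hN hlx
        refine ⟨_, Filter.inter_mem hN ((continuous_level V₀ e).continuousAt
          (Ioi_mem_nhds (show 0 < level V₀ e (h x) by rw [hlx]; positivity))), ?_⟩
        rintro r ⟨hrN, hr0⟩ hrS
        obtain ⟨t, -, hev⟩ := mem_levelSet_iff.1 hrS
        have hr0' : 0 < level V₀ e r := hr0
        rw [level_eq hR.im_pos hev] at hr0'
        rw [hN' r hrN t hr0' hev]
        exact hrange _ (Real.sqrt_nonneg t)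
      rintro _ ⟨t, rfl⟩
      rcases lt_trichotomy t 0 with h0 | h0 | h0
      · have := hoff h₂ (isLift_sqrt hc₂ hev₂) (fun x hx => ⟨-x, hγn x hx⟩) (-t) (by linarith)
        rwa [← hγn (-t) (by linarith), neg_neg] at this
      · rw [h0, hγp 0 le_rfl, h00.1]
        -- At `p₀`: a nearby point over the ray is `S w` with `w² = e t`, so `w = ±√t f` and the
        -- point is on one of the halves.
        have hray := ((continuous_rayPt (V₀ := V₀) (e := e)).tendsto 0)
        rw [ofReal_zero, mul_zero, add_zero] at hray
        have hsm : ∀ᶠ t : ℝ in 𝓝 0, (∀ p ∈ N, ev p = ex (V₀ + e * t) →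
            ∃ w, V₀ + e * t = V₀ + w ^ 2 ∧ p = S w) ∧ t < min d₁ d₂ ^ 2 :=
          (hray.eventually hu).and (Iio_mem_nhds (by have := lt_min hd₁ hd₂; positivity))
        have hl0 : level V₀ e p₀ = 0 := level_eq hR.im_pos (by simpa using hp₀)
        have hsm' : ∀ᶠ r in 𝓝 p₀, (∀ p ∈ N, ev p = ex (V₀ + e * level V₀ e r) →
            ∃ w, V₀ + e * level V₀ e r = V₀ + w ^ 2 ∧ p = S w) ∧
              level V₀ e r < min d₁ d₂ ^ 2 := by
          have := (continuous_level (A := A) (B := B) V₀ e).tendsto p₀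
          rw [hl0] at this
          exact this.eventually hsm
        refine ⟨_, Filter.inter_mem hN hsm', ?_⟩
        rintro r ⟨hrN, hr⟩ hrS
        obtain ⟨t, ht, hev⟩ := mem_levelSet_iff.1 hrS
        have hr' : (∀ p ∈ N, ev p = ex (V₀ + e * level V₀ e r) →
            ∃ w, V₀ + e * level V₀ e r = V₀ + w ^ 2 ∧ p = S w) ∧
              level V₀ e r < min d₁ d₂ ^ 2 := hr
        rw [level_eq hR.im_pos hev] at hr'
        obtain ⟨w, hw, rfl⟩ := hr'.1 r hrN hev
        have hx0 := Real.sqrt_nonneg t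
        have hxd : Real.sqrt t ≤ min d₁ d₂ := by
          refine Real.sqrt_le_iff.2 ⟨(lt_min hd₁ hd₂).le, hr'.2.le⟩
        have hw2 : w ^ 2 = ((Real.sqrt t : ℂ) * f) ^ 2 := by
          rw [mul_pow, hf, ← ofReal_pow, Real.sq_sqrt ht]
          linear_combination -hw
        rcases sq_eq_sq_iff_eq_or_eq_neg.1 hw2 with h | h
        · refine ⟨Real.sqrt t, ?_⟩
          rw [hγp _ hx0, hS₁ _ ⟨hx0, hxd.trans (min_le_left _ _)⟩, h]
        · refine ⟨-Real.sqrt t, ?_⟩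
          rw [hγn _ hx0, hS₂ _ ⟨hx0, hxd.trans (min_le_right _ _)⟩, h, mul_neg]
      · have := hoff h₁ (isLift_sqrt hc₁ hev₁) (fun x hx => ⟨x, hγp x hx⟩) t h0
        rwa [← hγp t h0.le] at this

end

/-! ### The classes of the contours -/

section

variable {A B : ℕ}

/-- The curve runs to infinity in one half sheet, inside the cones of decay for `θ ∈ Θ`. -/
def GoodEnd (Θ : Set ℝ) (γ : ℝ → Surf A B) : Prop :=
  ∃ (T : ℝ) (σ : Bool) (m : ℤ) (z : ℝ → ℂ), HasEnd γ T σ m z ∧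
    ∀ θ ∈ Θ, Filter.Tendsto (fun t => cone A B θ σ (z t)) Filter.atTop Filter.atTop

theorem GoodEnd.comp {Θ : Set ℝ} {s γ : ℝ → Surf A B} (h : GoodEnd Θ s) {φ : ℝ → ℝ}
    (hφ : Filter.Tendsto φ Filter.atTop Filter.atTop)
    (hγ : ∀ᶠ t in Filter.atTop, γ t = s (φ t)) : GoodEnd Θ γ := by
  obtain ⟨T, σ, m, z, hs, hz⟩ := h
  obtain ⟨T', hT'⟩ := Filter.eventually_atTop.1 (hγ.and (hφ.eventually_ge_atTop T))
  refine ⟨T', σ, m, fun t => z (φ t), fun t ht => ?_, fun θ hθ => (hz θ hθ).comp hφ⟩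
  rw [(hT' t ht).1]
  exact hs _ (hT' t ht).2

theorem GoodEnd.exists_stateCombination (hA : 0 < A) (hB : 0 < B) (hAB : A ≠ B) {Θ : Set ℝ}
    (hΘ : Θ ⊆ Ioo 0 (2 * Real.pi)) {γ : ℝ → Surf A B} (hγ : Continuous γ) (h₁ : GoodEnd Θ γ)
    (h₂ : GoodEnd Θ fun t => γ (-t)) :
    ∃ c : ℤ × Fin A →₀ ℤ, ∀ θ ∈ Θ, ∀ (τ : ℂ) (ε : ℝ), ArgCondition τ θ → SmallTilt A B θ ε →
      IsStateCombination θ τ ε γ c := by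
  obtain ⟨T₁, σ₁, m₁, z₁, e₁, hz₁⟩ := h₁
  obtain ⟨T₂, σ₂, m₂, z₂, e₂, hz₂⟩ := h₂
  obtain ⟨c, hc⟩ := StateIntegral.exists_stateCombination hA hB hAB hγ e₁ e₂
  exact ⟨c, fun θ hθ τ ε hτ hε => hc θ τ ε (hΘ hθ).1 (hΘ hθ).2 hτ hε (hz₁ θ hθ) (hz₂ θ hθ)⟩

theorem subset_Ioo_two_pi {ϑ : ℝ} (hϑ : ϑ ∈ Ioo (Real.pi / 2) (3 * Real.pi / 2)) :
    Ioo (ϑ - Real.pi / 2) (ϑ + Real.pi / 2) ⊆ Ioo 0 (2 * Real.pi) := fun θ hθ =>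
  ⟨by linarith [hϑ.1, hθ.1], by linarith [hϑ.2, hθ.2]⟩

/-- `Im(-i e^{iϑ}) = -cos ϑ > 0`, and a critical value at time `t` of the ray would put `-e^{-iϑ}`
on its Stokes ray, with factor `t/(2π)`. -/
theorem regular_of_notMem_stokes {V₀ : ℂ} {ϑ : ℝ} (hϑ : ϑ ∈ Ioo (Real.pi / 2) (3 * Real.pi / 2))
    (hS : -exp (-(ϑ * I)) ∉ stokes A B V₀) : Regular A B V₀ (-I * exp (ϑ * I)) := by
  have him : 0 < (-I * exp (ϑ * I)).im := by
    rw [neg_mul, neg_im, I_mul_im, Complex.exp_ofReal_mul_I_re]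
    have := Real.cos_neg_of_pi_div_two_lt_of_lt hϑ.1 (by linarith [hϑ.2])
    linarith
  refine ⟨him, fun t ht hmem => hS ?_⟩
  have ht0 : (t : ℂ) ≠ 0 := by exact_mod_cast ht.ne'
  have hpi : (Real.pi : ℂ) ≠ 0 := by exact_mod_cast Real.pi_ne_zero
  have hexp := Complex.exp_ne_zero (ϑ * I)
  refine ⟨_, hmem, ?_, t / (2 * Real.pi), by have := Real.pi_pos; positivity, ?_⟩
  · rw [ne_eq, add_eq_left]
    exact mul_ne_zero (mul_ne_zero (neg_ne_zero.2 I_ne_zero) hexp) ht0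
  · rw [add_sub_cancel_left, Complex.exp_neg]
    push_cast
    have := I_ne_zero
    field_simp

/-- Two parametrisations of a properly embedded line differ by a monotone change of the parameter. -/
theorem exists_monotone_reparam {X : Type*} [TopologicalSpace X] [T2Space X] {γ₀ γ : ℝ → X}
    {g : X → ℝ} (hg : Continuous g) (h₀ : Continuous γ₀) (hi₀ : Function.Injective γ₀)
    (hco : ∀ t, |t| ≤ g (γ₀ t)) (hγ : Continuous γ) (hi : Function.Injective γ)
    (hr : range γ = range γ₀) : ∃ φ : ℝ → ℝ, (∀ t, γ t = γ₀ (φ t)) ∧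
      ((Filter.Tendsto φ Filter.atTop Filter.atTop ∧ Filter.Tendsto φ Filter.atBot Filter.atBot) ∨
      (Filter.Tendsto φ Filter.atTop Filter.atBot ∧
        Filter.Tendsto φ Filter.atBot Filter.atTop)) := by
  -- Properness makes `γ₀` a homeomorphism onto its image, so the change of parameter is a
  -- continuous bijection of `ℝ`, hence strictly monotone or antitone.
  have hemb : IsClosedEmbedding γ₀ := .of_continuous_injective_isClosedMap h₀ hi₀ fun F hF =>
    isClosed_image_of_coercive hg hF h₀.continuousOn fun t _ => hco t
  have hex : ∀ t, ∃ x, γ₀ x = γ t := fun t => by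
    have : γ t ∈ range γ₀ := hr ▸ mem_range_self t
    exact this
  choose φ hφ using hex
  have hφc : Continuous φ := by
    rw [hemb.isEmbedding.continuous_iff]
    exact hγ.congr fun t => (hφ t).symm
  have hφi : Function.Injective φ := fun t t' h => hi (by rw [← hφ, ← hφ, h])
  have hφs : Function.Surjective φ := fun x => by
    obtain ⟨t, ht⟩ : γ₀ x ∈ range γ := hr ▸ mem_range_self x
    exact ⟨t, hi₀ ((hφ t).trans ht)⟩
  refine ⟨φ, fun t => (hφ t).symm, ?_⟩
  rcases hφc.strictMono_of_inj hφi with h | h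
  · exact Or.inl ⟨h.monotone.tendsto_atTop_atTop fun b => (hφs b).imp fun a ha => ha.ge,
      h.monotone.tendsto_atBot_atBot fun b => (hφs b).imp fun a ha => ha.le⟩
  · exact Or.inr ⟨Filter.tendsto_atTop_atBot_of_antitone h.antitone fun b => (hφs b).imp fun a ha => ha.le,
      Filter.tendsto_atBot_atTop_of_antitone h.antitone fun b => (hφs b).imp fun a ha => ha.ge⟩

/-- After the substitution `t ↦ √t` the curve is a lift of the ray, to which `IsLift.exists_end`
applies. -/
theorem goodEnd_sq (hA : 0 < A) (hB : 0 < B) (hAB : A ≠ B) {V₀ : ℂ} {ϑ : ℝ}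
    (hϑ : ϑ ∈ Ioo (Real.pi / 2) (3 * Real.pi / 2)) (hR : Regular A B V₀ (-I * exp (ϑ * I)))
    {γ : ℝ → Surf A B} (hγ : Continuous γ)
    (hev : ∀ t : ℝ, ev (γ t) = ex (V₀ + -I * exp (ϑ * I) * (t ^ 2 : ℝ))) :
    GoodEnd (Ioo (ϑ - Real.pi / 2) (ϑ + Real.pi / 2)) γ := by
  have h1 := (isLift_sqrt hγ.continuousOn fun x _ => hev x).mono
    (Ici_subset_Ioi.2 (zero_lt_one (α := ℝ)))
  obtain ⟨T, σ, m, z, h2⟩ := h1.exists_end hA hB hAB hϑ hR.im_pos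
  refine GoodEnd.comp (⟨T, σ, m, z, h2⟩ : GoodEnd _ fun t => γ (Real.sqrt t))
    (Filter.tendsto_pow_atTop two_ne_zero) ?_
  filter_upwards [Filter.eventually_ge_atTop 0] with t ht
  rw [Real.sqrt_sq ht]

/-- Every parametrisation of the thimble has good ends. -/
theorem thimble_goodEnd (hA : 0 < A) (hB : 0 < B) (hAB : A ≠ B) {V₀ : ℂ} {ϑ : ℝ}
    (hϑ : ϑ ∈ Ioo (Real.pi / 2) (3 * Real.pi / 2)) (hR : Regular A B V₀ (-I * exp (ϑ * I)))
    {γ₀ γ : ℝ → Surf A B} (h₀ : Continuous γ₀) (hi₀ : Function.Injective γ₀)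
    (hev : ∀ t : ℝ, ev (γ₀ t) = ex (V₀ + -I * exp (ϑ * I) * (t ^ 2 : ℝ)))
    (hγ : Continuous γ) (hi : Function.Injective γ) (hr : range γ = range γ₀) :
    GoodEnd (Ioo (ϑ - Real.pi / 2) (ϑ + Real.pi / 2)) γ ∧
      GoodEnd (Ioo (ϑ - Real.pi / 2) (ϑ + Real.pi / 2)) fun t => γ (-t) := by
  have := t2Space_surf (A := A) (B := B) hA hB
  have g1 := goodEnd_sq hA hB hAB hϑ hR h₀ hev
  have g2 := goodEnd_sq hA hB hAB hϑ hR (h₀.comp continuous_neg) fun t => by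
    rw [Function.comp_apply, hev, neg_sq]
  obtain ⟨φ, hφ, h⟩ := exists_monotone_reparam (g := fun p => level V₀ (-I * exp (ϑ * I)) p + 1)
    ((continuous_level V₀ _).add continuous_const) h₀ hi₀ (fun t => by
      rw [level_eq hR.im_pos (hev t)]
      rcases abs_cases t with h | h <;> nlinarith [sq_nonneg (t - 1), sq_nonneg (t + 1)]) hγ hi hr
  -- A decreasing change of parameter exchanges the two ends.
  rcases h with ⟨h1, h2⟩ | ⟨h1, h2⟩
  · exact ⟨g1.comp h1 (.of_forall hφ),
      g2.comp (Filter.tendsto_neg_atBot_atTop.comp (h2.comp Filter.tendsto_neg_atTop_atBot))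
        (.of_forall fun t => by simp [hφ])⟩
  · exact ⟨g2.comp (Filter.tendsto_neg_atBot_atTop.comp h1) (.of_forall fun t => by simp [hφ]),
      g1.comp (h2.comp Filter.tendsto_neg_atTop_atBot) (.of_forall fun t => hφ _)⟩

/-! ### Tails -/

variable {θ ε : ℝ}

theorem Tilt.add_mem_half (h : Tilt A B θ ε) {σ : Bool} {z : ℂ} (hz : z ∈ half σ) {s : ℝ}
    (hs : 0 ≤ s) : z + s * dir A B θ ε σ ∈ half σ := by
  rcases hs.eq_or_lt with rfl | hs
  · simpa using hz
  · exact (closedHalf_of_half hz).add_mem_half (smul_mem_half (h.pointing σ) hs)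

theorem isTail_iff {p : Surf A B} {T : ℝ → Surf A B} : IsTail θ ε p T ↔
    ∃ (σ : Bool) (z : ℂ) (m : ℤ), z ∈ half σ ∧ IsPt σ p z m ∧
      ∀ s : ℝ, 0 ≤ s → IsPt σ (T s) (z + s * dir A B θ ε σ) m := by
  have e : ∀ (z : ℂ) (s : ℝ), z - s * exp (θ / 2 * I - (A - B) * ε * I) =
      z + s * dir A B θ ε false := fun z s => by
    rw [dir]; ring
  constructor
  · rintro (⟨z, m, hz, hp, hT⟩ | ⟨z, m, hz, hp, hT⟩)
    · exact ⟨true, z, m, hz, hp, hT⟩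
    · exact ⟨false, z, m, hz, hp, fun s hs => by rw [← e]; exact hT s hs⟩
  · rintro ⟨σ, z, m, hz, hp, hT⟩
    cases σ
    · exact Or.inr ⟨z, m, hz, hp, fun s hs => by rw [e]; exact hT s hs⟩
    · exact Or.inl ⟨z, m, hz, hp, hT⟩

theorem offReal_iff {p : Surf A B} : OffReal p ↔ ∃ (σ : Bool) (z : ℂ) (m : ℤ),
    z ∈ half σ ∧ IsPt σ p z m := by
  constructor
  · rintro (⟨z, m, hz, hp⟩ | ⟨z, m, hz, hp⟩)
    · exact ⟨true, z, m, hz, hp⟩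
    · exact ⟨false, z, m, hz, hp⟩
  · rintro ⟨σ, z, m, hz, hp⟩
    cases σ
    · exact Or.inr ⟨z, m, hz, hp⟩
    · exact Or.inl ⟨z, m, hz, hp⟩

theorem isTail_of_eq_ray (h : Tilt A B θ ε) {p : Surf A B} (hp : OffReal p) {T : ℝ → Surf A B}
    (hT : ∀ s, 0 ≤ s → T s = ray (dir A B θ ε) p s) : IsTail θ ε p T := by
  obtain ⟨σ, z, m, hz, hpz⟩ := offReal_iff.1 hp
  refine isTail_iff.2 ⟨σ, z, m, hz, hpz, fun s hs => ?_⟩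
  rw [hT s hs, ray_eq h.pointing hpz (isPt_half_norm hpz hz) hs]
  exact isPt_pt (half_subset_dom σ (h.add_mem_half hz hs)) m

theorem IsTail.apply_zero {p : Surf A B} {T : ℝ → Surf A B} (h : IsTail θ ε p T) : T 0 = p := by
  obtain ⟨σ, z, m, -, hp, hT⟩ := isTail_iff.1 h
  have := hT 0 le_rfl
  rw [ofReal_zero, zero_mul, add_zero] at this
  exact this.unique hp

theorem IsTail.goodEnd (h : Tilt A B θ ε) {p : Surf A B} {T : ℝ → Surf A B}
    (hT : IsTail θ ε p T) : GoodEnd {θ} T := by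
  obtain ⟨σ, z, m, hz, hp, hT⟩ := isTail_iff.1 hT
  refine ⟨0, σ, m, fun s => z + s * dir A B θ ε σ, fun s hs => ⟨h.add_mem_half hz hs, hT s hs⟩, ?_⟩
  intro θ' hθ'
  rw [mem_singleton_iff.1 hθ']
  have hd := cone_dir_pos h.hA h.hAB h.small σ
  have htend : Filter.Tendsto (fun s : ℝ => s * cone A B θ σ (dir A B θ ε σ) + -‖z‖)
      Filter.atTop Filter.atTop :=
    Filter.tendsto_atTop_add_const_right _ _ (Filter.tendsto_id.atTop_mul_const hd)
  refine Filter.tendsto_atTop_mono' _ ?_ htend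
  filter_upwards [Filter.eventually_ge_atTop 0] with s hs
  have h1 := cone_add A B θ σ z (s * dir A B θ ε σ)
  rw [cone_smul _ _ _ _ _ hs] at h1
  have h2 := neg_norm_le_cone A B θ σ z
  linarith

/-! ### The contours of points and of segments -/

theorem exists_isPointContour (h : Tilt A B θ ε) {V₀ : ℂ} {ϑ lam : ℝ} (hlam : 0 < lam)
    (hR : Regular A B V₀ (-I * exp (ϑ * I))) {p : Surf A B}
    (hp : ev p = ex (V₀ + -I * exp (ϑ * I) * lam)) (hoff : OffReal p) :
    ∃ γ : ℝ → Surf A B, IsPointContour V₀ ϑ lam θ ε p γ := by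
  obtain ⟨s, hs, hsp⟩ := exists_lift h.hA h.hB h.hAB hR hlam hp
  have himg := hs.image_eq_levelComponent h.hA h.hB hlam hR
  rw [hsp] at himg
  set γ : ℝ → Surf A B := fun t => if t ≤ 0 then ray (dir A B θ ε) p (-t) else s (lam + t) with hγ
  have hpos : ∀ t, 0 ≤ t → γ t = s (lam + t) := fun t ht => by
    simp only [hγ]
    split_ifs with h0
    · rw [le_antisymm h0 ht, neg_zero, ray_zero, add_zero, hsp]
    · rfl
  refine ⟨γ, ?_, ?_, ?_, ?_⟩
  · refine continuous_if_le continuous_id continuous_const ?_ ?_ fun t ht => ?_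
    · exact (continuousOn_ray h.hA h.hB h.pointing p).comp continuous_neg.continuousOn
        fun t ht => by simpa using ht
    · exact hs.1.comp (by fun_prop) fun t ht => by simpa using ht
    · rw [ht, neg_zero, ray_zero, add_zero, hsp]
  · refine isTail_of_eq_ray h hoff fun t ht => ?_
    simp only [hγ]
    rw [if_pos (by linarith), neg_neg]
  · intro t ht t' ht' htt
    rw [hpos t ht, hpos t' ht'] at htt
    have h1 : ∀ t, 0 ≤ t → level V₀ (-I * exp (ϑ * I)) (s (lam + t)) = lam + t := fun t ht =>
      level_eq hR.im_pos (hs.2 _ (mem_Ici.2 (by linarith)))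
    have h2 := h1 t ht
    rw [htt, h1 t' ht'] at h2
    linarith
  · rw [← himg]
    ext q
    constructor
    · rintro ⟨t, ht, rfl⟩
      exact ⟨lam + t, by simpa using ht, (hpos t ht).symm⟩
    · rintro ⟨t, ht, rfl⟩
      have ht' : 0 ≤ t - lam := sub_nonneg.2 ht
      exact ⟨t - lam, ht', by rw [hpos _ ht', add_sub_cancel]⟩

/-- A continuous injective function on `[0, ∞)` with image `[a, ∞)` that starts at `a` tends to
infinity. -/
theorem tendsto_atTop_of_injOn {φ : ℝ → ℝ} {a : ℝ} (hc : ContinuousOn φ (Ici 0))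
    (hi : InjOn φ (Ici 0)) (h0 : φ 0 = a) (himg : φ '' Ici 0 = Ici a) :
    Filter.Tendsto φ Filter.atTop Filter.atTop := by
  refine Filter.tendsto_atTop.2 fun b => ?_
  obtain ⟨t₁, ht₁, e₁⟩ : max a b ∈ φ '' Ici 0 := himg ▸ mem_Ici.2 (le_max_left _ _)
  filter_upwards [Filter.eventually_gt_atTop t₁] with t ht
  have ht0 : 0 ≤ t := (mem_Ici.1 ht₁).trans ht.le
  by_contra! hlt
  have hta : a ≤ φ t := by
    have : φ t ∈ Ici a := himg ▸ mem_image_of_mem φ (mem_Ici.2 ht0)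
    exact this
  -- A value below `b` after time `t₁` has already been taken on `[0, t₁]`, against injectivity.
  obtain ⟨t', ht', e'⟩ := intermediate_value_Icc (mem_Ici.1 ht₁)
    (hc.mono fun t ht => mem_Ici.2 ht.1)
    (show φ t ∈ Icc (φ 0) (φ t₁) from ⟨h0.symm ▸ hta, e₁ ▸ hlt.le.trans (le_max_right _ _)⟩)
  have := hi (mem_Ici.2 ht'.1) (mem_Ici.2 ht0) e'
  linarith [ht'.2]

/-- For `t ≥ 0` any parametrisation factors as `γ = s ∘ φ` through the lift `s`, with `φ` the level.
As `φ` is injective onto `[lam, ∞)` it tends to infinity, so this end is that of the lift; the other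
end is a tail. -/
theorem IsPointContour.exists_stateCombination (h : Tilt A B θ ε) {V₀ : ℂ} {ϑ lam : ℝ}
    (hϑ : ϑ ∈ Ioo (Real.pi / 2) (3 * Real.pi / 2))
    (hθ : θ ∈ Ioo (ϑ - Real.pi / 2) (ϑ + Real.pi / 2)) (hlam : 0 < lam)
    (hR : Regular A B V₀ (-I * exp (ϑ * I))) {p : Surf A B}
    (hp : ev p = ex (V₀ + -I * exp (ϑ * I) * lam)) {τ : ℂ} (hτ : ArgCondition τ θ)
    {γ : ℝ → Surf A B} (hγ : IsPointContour V₀ ϑ lam θ ε p γ) :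
    ∃ c : ℤ × Fin A →₀ ℤ, IsStateCombination θ τ ε γ c := by
  obtain ⟨hc, htail, hinj, himg⟩ := hγ
  obtain ⟨s, hs, hsp⟩ := exists_lift h.hA h.hB h.hAB hR hlam hp
  have himg' := hs.image_eq_levelComponent h.hA h.hB hlam hR
  rw [hsp, ← himg] at himg'
  have hγ0 : γ 0 = p := by
    have := htail.apply_zero
    rwa [neg_zero] at this
  set φ : ℝ → ℝ := fun t => level V₀ (-I * exp (ϑ * I)) (γ t) with hφ
  have hsl : ∀ t, lam ≤ t → level V₀ (-I * exp (ϑ * I)) (s t) = t := fun t ht =>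
    level_eq hR.im_pos (hs.2 t ht)
  have hγs : ∀ t, 0 ≤ t → lam ≤ φ t ∧ γ t = s (φ t) := fun t ht => by
    obtain ⟨x, hx, e⟩ : γ t ∈ s '' Ici lam := himg' ▸ mem_image_of_mem γ (mem_Ici.2 ht)
    have : φ t = x := by simp only [hφ]; rw [← e, hsl x hx]
    rw [this]
    exact ⟨hx, e.symm⟩
  have htend : Filter.Tendsto φ Filter.atTop Filter.atTop := by
    refine tendsto_atTop_of_injOn (a := lam) ((continuous_level V₀ _).comp hc).continuousOn
      (fun t ht t' ht' e => hinj ht ht' ?_) ?_ ?_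
    · rw [(hγs t ht).2, (hγs t' ht').2, e]
    · simp only [hφ]
      rw [hγ0, level_eq hR.im_pos hp]
    · ext x
      constructor
      · rintro ⟨t, ht, rfl⟩
        exact (hγs t ht).1
      · intro hx
        obtain ⟨t, ht, e⟩ : s x ∈ γ '' Ici 0 := himg' ▸ mem_image_of_mem s hx
        exact ⟨t, ht, by simp only [hφ]; rw [e, hsl x hx]⟩
  obtain ⟨T, σ, m, z, hend, hz⟩ := hs.exists_end h.hA h.hB h.hAB hϑ hR.im_pos
  have g1 : GoodEnd {θ} γ := GoodEnd.comp (s := s)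
    ⟨T, σ, m, z, hend, fun θ' hθ' => hz θ' ((mem_singleton_iff.1 hθ').symm ▸ hθ)⟩ htend
    (by
      filter_upwards [Filter.eventually_ge_atTop 0] with t ht
      exact (hγs t ht).2)
  obtain ⟨c, hc'⟩ := GoodEnd.exists_stateCombination h.hA h.hB h.hAB
    (singleton_subset_iff.2 ⟨h.pos, h.lt⟩) hc g1 (htail.goodEnd h)
  exact ⟨c, hc' θ rfl τ ε hτ h.small⟩

theorem exists_isEdgeContour (h : Tilt A B θ ε) {e : Set (Surf A B)} {a b : Surf A B}
    (he : IsSegment e a b) (ha : OffReal a) (hb : OffReal b) :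
    ∃ γ : ℝ → Surf A B, IsEdgeContour θ ε e a b γ := by
  obtain ⟨η, hη, hinj, himg, h0, h1⟩ := he
  set η' : ℝ → Surf A B := fun t => η (max 0 (min t 1)) with hη'
  have hη'c : Continuous η' := hη.comp_continuous (by fun_prop) fun t => clamp_mem t
  have heq : ∀ t ∈ Icc (0 : ℝ) 1, η' t = η t := fun t ht => by
    simp only [hη']
    rw [min_eq_left ht.2, max_eq_right ht.1]
  have e0 : η' 0 = a := (heq 0 ⟨le_rfl, zero_le_one⟩).trans h0
  have e1 : η' 1 = b := (heq 1 ⟨zero_le_one, le_rfl⟩).trans h1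
  have harc : EqOn (arc (dir A B θ ε) η' 0 1) η (Icc 0 1) := fun t ht => by
    rw [arc]
    split_ifs with g1 g2
    · rw [le_antisymm g1 ht.1, sub_zero, ray_zero, e0, h0]
    · exact heq t ht
    · exact absurd ht.2 g2
  refine ⟨arc (dir A B θ ε) η' 0 1, continuous_arc h.hA h.hB h.pointing hη'c zero_le_one,
    isTail_of_eq_ray h ha fun s hs => ?_, isTail_of_eq_ray h hb fun s hs => ?_,
    hinj.congr harc.symm, harc.image_eq.trans himg⟩
  · rw [arc, if_pos (by linarith), e0, zero_sub, neg_neg]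
  · rcases hs.eq_or_lt with rfl | hs
    · rw [add_zero, ray_zero, harc ⟨zero_le_one, le_rfl⟩, h1]
    · rw [arc, if_neg (by linarith), if_neg (by linarith), e1, add_sub_cancel_left]

/-- Both ends are straight tails, which depend on `θ` themselves; hence the set of angles is `{θ}`.
-/
theorem IsEdgeContour.exists_stateCombination (h : Tilt A B θ ε) {e : Set (Surf A B)}
    {a b : Surf A B} {γ : ℝ → Surf A B} (hγ : IsEdgeContour θ ε e a b γ) {τ : ℂ}
    (hτ : ArgCondition τ θ) : ∃ c : ℤ × Fin A →₀ ℤ, IsStateCombination θ τ ε γ c := by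
  obtain ⟨hc, h1, h2, -, -⟩ := hγ
  have g2 : GoodEnd {θ} γ := (h2.goodEnd h).comp (φ := fun t => t + -1)
    (Filter.tendsto_atTop_add_const_right _ _ Filter.tendsto_id)
    (.of_forall fun t => by simp)
  obtain ⟨c, hc'⟩ := GoodEnd.exists_stateCombination h.hA h.hB h.hAB
    (singleton_subset_iff.2 ⟨h.pos, h.lt⟩) hc g2 (h1.goodEnd h)
  exact ⟨c, hc' θ rfl τ ε hτ h.small⟩

end

end StateIntegral

end

/-! ### The theorem, for the thimble and for both kinds of mixed contours -/

theorem mainTheorem6 (A B : ℕ) (hA : 0 < A) (hB : 0 < B) (hAB : A ≠ B)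
    (p₀ : StateIntegral.Surf A B) (hp₀ : StateIntegral.IsCritical p₀)
    (V₀ : ℂ) (hV₀ : StateIntegral.vol A B p₀ = StateIntegral.modZ V₀)
    (ϑ : ℝ) (hϑ : ϑ ∈ Set.Ioo (Real.pi / 2) (3 * Real.pi / 2))
    (hS : -Complex.exp (-(ϑ * Complex.I)) ∉ StateIntegral.stokes A B V₀) :
    -- the thimble
    ((∃ γ : ℝ → StateIntegral.Surf A B,
        StateIntegral.IsLineParam γ (StateIntegral.levelComponent A B V₀ ϑ 0 p₀)) ∧
      ∀ γ : ℝ → StateIntegral.Surf A B,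
        StateIntegral.IsLineParam γ (StateIntegral.levelComponent A B V₀ ϑ 0 p₀) →
        ∃ c : ℤ × Fin A →₀ ℤ, ∀ θ ∈ Set.Ioo (ϑ - Real.pi / 2) (ϑ + Real.pi / 2),
          ∀ (τ : ℂ) (ε : ℝ), StateIntegral.ArgCondition τ θ → StateIntegral.SmallTilt A B θ ε →
            StateIntegral.IsStateCombination θ τ ε γ c) ∧
    ∀ θ ∈ Set.Ioo (ϑ - Real.pi / 2) (ϑ + Real.pi / 2),
      ∀ (τ : ℂ) (ε : ℝ), StateIntegral.ArgCondition τ θ → StateIntegral.SmallTilt A B θ ε →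
        -- the contours `γ_{p,θ}`
        (∀ (lam : ℝ) (p : StateIntegral.Surf A B), 0 < lam →
          StateIntegral.vol A B p =
            StateIntegral.modZ (V₀ - Complex.I * Complex.exp (ϑ * Complex.I) * lam) →
          StateIntegral.OffReal p →
          (∃ γ : ℝ → StateIntegral.Surf A B,
            StateIntegral.IsPointContour V₀ ϑ lam θ ε p γ) ∧
          ∀ γ : ℝ → StateIntegral.Surf A B, StateIntegral.IsPointContour V₀ ϑ lam θ ε p γ →
            ∃ c : ℤ × Fin A →₀ ℤ, StateIntegral.IsStateCombination θ τ ε γ c) ∧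
        -- the contours `γ_{e,θ}`
        (∀ (e : Set (StateIntegral.Surf A B)) (a b : StateIntegral.Surf A B),
          StateIntegral.IsSegment e a b →
          (∀ p ∈ e, ∃ lam : ℝ, 0 < lam ∧ StateIntegral.vol A B p =
            StateIntegral.modZ (V₀ - Complex.I * Complex.exp (ϑ * Complex.I) * lam)) →
          StateIntegral.OffReal a → StateIntegral.OffReal b →
          (∃ γ : ℝ → StateIntegral.Surf A B, StateIntegral.IsEdgeContour θ ε e a b γ) ∧
          ∀ γ : ℝ → StateIntegral.Surf A B, StateIntegral.IsEdgeContour θ ε e a b γ →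
            ∃ c : ℤ × Fin A →₀ ℤ, StateIntegral.IsStateCombination θ τ ε γ c) := by
  have hR := StateIntegral.regular_of_notMem_stokes hϑ hS
  have hp₀' := StateIntegral.isCritical_iff.1 hp₀
  have hV₀' := StateIntegral.vol_eq_iff.1 hV₀
  obtain ⟨γ₀, hc₀, hi₀, hev, hrange⟩ := StateIntegral.exists_thimble hA hB hAB hR hp₀' hV₀'
  have hsub := StateIntegral.subset_Ioo_two_pi hϑ
  refine ⟨⟨⟨γ₀, hc₀, hi₀, hrange⟩, fun γ hγ => ?_⟩, fun θ hθ τ ε hτ hε => ?_⟩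
  · obtain ⟨h₁, h₂⟩ := StateIntegral.thimble_goodEnd hA hB hAB hϑ hR hc₀ hi₀ hev hγ.1 hγ.2.1
      (hγ.2.2.trans hrange.symm)
    exact StateIntegral.GoodEnd.exists_stateCombination hA hB hAB hsub hγ.1 h₁ h₂
  · have h : StateIntegral.Tilt A B θ ε := ⟨hA, hB, hAB, (hsub hθ).1, (hsub hθ).2, hε⟩
    refine ⟨fun lam p hlam hp hoff => ?_, fun e a b he _ ha hb =>
      ⟨StateIntegral.exists_isEdgeContour h he ha hb, fun γ hγ =>
        hγ.exists_stateCombination h hτ⟩⟩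
    have hp' : StateIntegral.ev p =
        StateIntegral.ex (V₀ + -Complex.I * Complex.exp (ϑ * Complex.I) * lam) := by
      rw [StateIntegral.vol_eq_iff.1 hp]
      congr 1
      ring
    exact ⟨StateIntegral.exists_isPointContour h hlam hR hp' hoff, fun γ hγ =>
      hγ.exists_stateCombination h hϑ hθ hlam hR hp' hτ⟩
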